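/- **Setting.** Let $\mathbb T=\mathfrak t/2\pi\Lambda$ be an $r$-dimensional torus ($\mathfrak t=\mathbb R^r$, $\Lambda=\mathbb Z^r$, basis $\xi_1,\dots,\xi_r$) acting holomorphically on a compact connected complex manifold $X$ of complex dimension $m$. For a Kähler form $\omega$ (with complex structure $J$) put $g_\omega=\omega(\cdot,J\cdot)$, $d^cf=-df\circ J$, $\omega^{[m]}=\omega^m/m!$, and let $\Delta_\omega=\delta d\ge 0$ and $\mathrm{Scal}(\omega)$ be the Laplacian and the scalar curvature of $g_\omega$. A momentum map of a $\mathbb T$-invariant $\omega$ is a $\mathbb T$-invariant smooth $\mu:X\to\mathfrak t^*$ with $\omega(\xi,\cdot)=-d\langle\mu,\xi\rangle$ for $\xi\in\mathfrak t$. For smooth functions $v,w$ on $\mathfrak t^*$ put $$\mathrm{Scal}_v(\omega)=v(\mu)\,\mathrm{Scal}(\omega)+2\Delta_\omega\big(v(\mu)\big)+\sum_{i,j}v_{,ij}(\mu)\,g_\omega(\xi_i,\xi_j);$$ $\omega$ is called $(v,w)$-cscK if $\mathrm{Scal}_v(\omega)=w(\mu)$. Let $\mathcal K_{\mathbb T}(X,\omega)$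 be the set of $\mathbb T$-invariant smooth $\varphi$ with $\omega_\varphi=\omega+dd^c\varphi>0$, and give $\omega_\varphi$ the momentum map $\mu_\varphi$, $\langle\mu_\varphi,\xi\rangle=\langle\mu,\xi\rangle+d^c\varphi(\xi)$. The weighted Mabuchi energy $\mathbf M_{v,w}=\mathbf M^X_{v,w}$ on $\mathcal K_{\mathbb T}(X,\omega)$ is the functional with $\mathbf M_{v,w}(0)=0$ and $$(d_\varphi\mathbf M_{v,w})(\dot\varphi)=-\int_X\big(\mathrm{Scal}_v(\omega_\varphi)-w(\mu_\varphi)\big)\,\dot\varphi\;\omega_\varphi^{[m]}$$ for every $\mathbb T$-invariant smooth $\dot\varphi$. Let $(B_a,\omega_a)$, $a=1,\dots,k$, be compact connected Kähler manifolds of complex dimension $n_a$ and constant scalar curvature $s_a$; let $B=\prod_aB_a$, $n=\sum_an_a$, $\omega_B=\sum_a\omega_a$. Let $\pi_B:P\to B$ be a principal $\mathbb T$-bundle with a connection 1-form $\theta\in\Omega^1(P,\mathfrak t)$ such that $d\theta=\sum_a\pi_B^*\omega_a\otimes p_a$, $p_a\in\Lambda$. Let $Y=(X\times P)/\mathbb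 T$ be the quotient by the $\mathbb T$-action generated by the fields $-\xi^X+\xi^P$, $\xi\in\mathfrak t$, with the complex structure induced by the CR structure $J_X\oplus J_B$ on $TX\oplus\ker\theta$ and with the $\mathbb T$-action induced by the action on $X$ ($Y$ is a semi-simple principal $(X,\mathbb T)$-fibration). A $\mathbb T$-invariant function on $X$ is identified with the function it induces on $Y$. **Statement.** Let $\omega$ be a $\mathbb T$-invariant Kähler form on $X$ with momentum map $\mu$, and let $c_a\in\mathbb R$ be such that $\langle p_a,\mu\rangle+c_a>0$ on $X$ for every $a$. Let $v,w$ be smooth functions on $\mathfrak t^*$ with $v>0$ on $\mu(X)$. Put $$p(y)=\prod_a(\langle p_a,y\rangle+c_a)^{n_a},\qquad q(y)=\sum_a\frac{s_a}{\langle p_a,y\rangle+c_a},\qquad\tilde w=p\,(w-vq).$$ 1. The 2-form $\omega+\sum_a(\langle p_a,\mu\rangle+c_a)\,\pi_B^*\omega_a+\langle d\mu\wedge\theta\rangle$ on $X\times P$ is the pull-back of a 2-form $\tilde\omega$ on $Y$, and $\tilde\omega$ is a $\mathbb T$-invariant Kähler form on $Y$ with momentum map $\mu$. 2. As functions on $X\times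 P$, $$\mathrm{Scal}_v(\tilde\omega)=\frac{1}{p(\mu)}\,\mathrm{Scal}_{pv}(\omega)+v(\mu)\,q(\mu).$$ 3. $\omega$ is $(pv,\tilde w)$-cscK on $X$ if and only if $\tilde\omega$ is $(v,w)$-cscK on $Y$. 4. For every $\varphi\in\mathcal K_{\mathbb T}(X,\omega)$ the induced function on $Y$ lies in $\mathcal K_{\mathbb T}(Y,\tilde\omega)$, and $\tilde\omega+dd^c\varphi$ is the form induced, as in 1, by $(\omega_\varphi,\mu_\varphi)$. The restriction of the weighted Mabuchi energy $\mathbf M^Y_{v,w}$ to $\mathcal K_{\mathbb T}(X,\omega)\subset\mathcal K_{\mathbb T}(Y,\tilde\omega)$ equals $\mathrm{Vol}(B,\omega_B)\,\mathbf M^X_{pv,\tilde w}$; the differentials of these functionals along $\mathcal K_{\mathbb T}(X,\omega)$, in the direction of $\mathbb T$-invariant smooth functions on $X$, are likewise equal up to the factor $\mathrm{Vol}(B,\omega_B)$. -/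

import Mathlib

open scoped Manifold ContDiff Topology
open MeasureTheory

noncomputable section

namespace WKahler

/-- The model space `ℝ^d` of a real `d`-dimensional manifold. -/
abbrev 𝔼 (d : ℕ) : Type := EuclideanSpace ℝ (Fin d)

/-- The Lie algebra `𝔱 = ℝ^r` of the torus `𝕋 = 𝔱 / 2πΛ`, with `Λ = ℤ^r`; the dual space `𝔱^*` is
identified with the same coordinate space through the dual basis. -/
abbrev LieT (r : ℕ) : Type := Fin r → ℝ

/-- The pairing `⟨ξ, y⟩` of `𝔱` and `𝔱^*`. -/
def pair {r : ℕ} (ξ y : LieT r) : ℝ := ∑ i, ξ i * y i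

/-- The basis vector `ξ_i` of `𝔱`. -/
def bas {r : ℕ} (i : Fin r) : LieT r := Pi.single i 1

/-! ### Tensor fields on manifolds -/

section Tensors

variable {d : ℕ} (M : Type*) [TopologicalSpace M] [ChartedSpace (𝔼 d) M]

variable (d) in
/-- Differential 1-forms with values in `V` (no regularity yet). -/
abbrev OneForm (V : Type*) [NormedAddCommGroup V] [NormedSpace ℝ V] : Type _ :=
  ∀ x : M, TangentSpace 𝓘(ℝ, 𝔼 d) x →L[ℝ] V

variable (d) in
/-- Fields of bilinear forms on the tangent spaces, with values in `V`. -/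
abbrev BilForm (V : Type*) [NormedAddCommGroup V] [NormedSpace ℝ V] : Type _ :=
  ∀ x : M, TangentSpace 𝓘(ℝ, 𝔼 d) x →L[ℝ] TangentSpace 𝓘(ℝ, 𝔼 d) x →L[ℝ] V

variable (d) in
/-- Fields of endomorphisms of the tangent spaces. -/
abbrev EndField : Type _ :=
  ∀ x : M, TangentSpace 𝓘(ℝ, 𝔼 d) x →L[ℝ] TangentSpace 𝓘(ℝ, 𝔼 d) x

variable {M}

variable (d) in
/-- The chart `M ⊇ U → ℝ^d` around `x₀`. -/
abbrev chart (x₀ : M) : PartialEquiv M (𝔼 d) := extChartAt 𝓘(ℝ, 𝔼 d) x₀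

/-- The differential at `u` of the parametrization inverse to the chart around `x₀`. -/
def frame (x₀ : M) (u : 𝔼 d) :
    𝔼 d →L[ℝ] TangentSpace 𝓘(ℝ, 𝔼 d) ((chart d x₀).symm u) :=
  mfderiv 𝓘(ℝ, 𝔼 d) 𝓘(ℝ, 𝔼 d) (chart d x₀).symm u

/-- The differential at `x` of the chart around `x₀`. -/
def coframe (x₀ x : M) : TangentSpace 𝓘(ℝ, 𝔼 d) x →L[ℝ] 𝔼 d :=
  mfderiv 𝓘(ℝ, 𝔼 d) 𝓘(ℝ, 𝔼 d) (chart d x₀) x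

variable {V : Type*} [NormedAddCommGroup V] [NormedSpace ℝ V]

/-- A 1-form in the chart around `x₀`. -/
def coord1 (α : OneForm d M V) (x₀ : M) (u : 𝔼 d) : 𝔼 d →L[ℝ] V :=
  (α ((chart d x₀).symm u)).comp (frame x₀ u)

/-- Pull-back of a bilinear form by a linear map. -/
def pull2 {A C : Type*} [NormedAddCommGroup A] [NormedSpace ℝ A] [NormedAddCommGroup C]
    [NormedSpace ℝ C] (β : A →L[ℝ] A →L[ℝ] V) (f : C →L[ℝ] A) : C →L[ℝ] C →L[ℝ] V :=
  β.bilinearComp f f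

/-- A field of bilinear forms in the chart around `x₀`. -/
def coord2 (β : BilForm d M V) (x₀ : M) (u : 𝔼 d) : 𝔼 d →L[ℝ] 𝔼 d →L[ℝ] V :=
  pull2 (A := 𝔼 d) (C := 𝔼 d) (β ((chart d x₀).symm u)) (frame x₀ u)

/-- A field of endomorphisms in the chart around `x₀`. -/
def coordEnd (J : EndField d M) (x₀ : M) (u : 𝔼 d) : 𝔼 d →L[ℝ] 𝔼 d :=
  (coframe x₀ ((chart d x₀).symm u)).comp ((J ((chart d x₀).symm u)).comp (frame x₀ u))

def Smooth1 (α : OneForm d M V) : Prop :=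
  ∀ x₀ : M, ContDiffOn ℝ ∞ (coord1 α x₀) (chart d x₀).target

def Smooth2 (β : BilForm d M V) : Prop :=
  ∀ x₀ : M, ContDiffOn ℝ ∞ (coord2 β x₀) (chart d x₀).target

def SmoothEnd (J : EndField d M) : Prop :=
  ∀ x₀ : M, ContDiffOn ℝ ∞ (coordEnd J x₀) (chart d x₀).target

/-- Exterior derivative of a 1-form: `dα(u, w) = (∂_u α)(w) - (∂_w α)(u)`, computed at `x` in the
chart around `x`. -/
def extd (α : OneForm d M V) : BilForm d M V := fun x =>
  let D : 𝔼 d →L[ℝ] 𝔼 d →L[ℝ] V := fderiv ℝ (coord1 α x) (chart d x x)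
  pull2 (A := 𝔼 d) (C := 𝔼 d) (D - D.flip) (coframe x x)

/-- A 2-form is closed: `(∂_a β)(b, c) + (∂_b β)(c, a) + (∂_c β)(a, b) = 0`, computed at `x` in the
chart around `x`. -/
def IsClosed2 (β : BilForm d M ℝ) : Prop :=
  ∀ (x : M) (a b c : 𝔼 d),
    let D : 𝔼 d →L[ℝ] 𝔼 d →L[ℝ] 𝔼 d →L[ℝ] ℝ := fderiv ℝ (coord2 β x) (chart d x x)
    D a b c + D b c a + D c a b = 0

/-- Vanishing of the Nijenhuis tensor `[Ja, Jb] - J[Ja, b] - J[a, Jb] - [a, b]`, computed at `x` in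
the chart around `x` for constant coordinate fields `a, b`. -/
def IsIntegrable (J : EndField d M) : Prop :=
  ∀ (x : M) (a b : 𝔼 d),
    let K : 𝔼 d →L[ℝ] 𝔼 d := coordEnd J x (chart d x x)
    let D : 𝔼 d →L[ℝ] 𝔼 d →L[ℝ] 𝔼 d := fderiv ℝ (coordEnd J x) (chart d x x)
    D (K a) b - D (K b) a + K (D b a) - K (D a b) = 0

/-- `d^c f = J df = - df ∘ J`. -/
def dc (J : EndField d M) (f : M → ℝ) : OneForm d M ℝ := fun x =>
  -((mfderiv 𝓘(ℝ, 𝔼 d) 𝓘(ℝ, ℝ) f x : TangentSpace 𝓘(ℝ, 𝔼 d) x →L[ℝ] ℝ).comp (J x))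

/-- `dd^c f`. -/
def ddc (J : EndField d M) (f : M → ℝ) : BilForm d M ℝ := extd (dc J f)

/-- `(J, ω)` is a Kähler structure: an integrable almost complex structure and a closed `J`-invariant
2-form with `ω(u, Ju) > 0` for `u ≠ 0`. -/
structure IsKahler (J : EndField d M) (Ω : BilForm d M ℝ) : Prop where
  smooth_J : SmoothEnd J
  sq_J : ∀ x u, J x (J x u) = -u
  integrable : IsIntegrable J
  smooth_form : Smooth2 Ω
  alternating : ∀ x u, Ω x u u = 0
  closed : IsClosed2 Ω
  invariant : ∀ x u w, Ω x (J x u) (J x w) = Ω x u w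
  positive : ∀ x u, u ≠ 0 → 0 < Ω x u (J x u)

/-- The Riemannian metric `g(u, w) = ω(u, Jw)`. -/
def metric (J : EndField d M) (Ω : BilForm d M ℝ) : BilForm d M ℝ := fun x =>
  ContinuousLinearMap.flip (E := 𝔼 d) (F := 𝔼 d)
    ((ContinuousLinearMap.flip (E := 𝔼 d) (F := 𝔼 d) (Ω x)).comp (J x))

end Tensors

/-! ### Riemannian geometry: Laplacian, scalar curvature, volume -/

section Riemannian

variable {d : ℕ}

/-- Partial derivative `∂_i f` on `ℝ^d`. -/
def pd (i : Fin d) (f : 𝔼 d → ℝ) (u : 𝔼 d) : ℝ :=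
  fderiv ℝ f u (EuclideanSpace.single i 1)

/-- Christoffel symbol `Γ^k_{ij}` of the metric with Gram matrix `G`. -/
def christoffel (G : 𝔼 d → Matrix (Fin d) (Fin d) ℝ) (k i j : Fin d) (u : 𝔼 d) : ℝ :=
  (1 / 2 : ℝ) * ∑ l, (G u)⁻¹ k l *
    (pd i (fun z => G z j l) u + pd j (fun z => G z i l) u - pd l (fun z => G z i j) u)

/-- Ricci curvature `R_{jk} = ∂_i Γ^i_{jk} - ∂_j Γ^i_{ik} + Γ^i_{il} Γ^l_{jk} - Γ^i_{jl} Γ^l_{ik}`. -/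
def ricci (G : 𝔼 d → Matrix (Fin d) (Fin d) ℝ) (j k : Fin d) (u : 𝔼 d) : ℝ :=
  ∑ i, (pd i (christoffel G i j k) u - pd j (christoffel G i i k) u +
    ∑ l, (christoffel G i i l u * christoffel G l j k u -
      christoffel G i j l u * christoffel G l i k u))

variable {M : Type*} [TopologicalSpace M] [ChartedSpace (𝔼 d) M]

/-- Gram matrix of `g` in the chart around `x₀`. -/
def gram (g : BilForm d M ℝ) (x₀ : M) (u : 𝔼 d) : Matrix (Fin d) (Fin d) ℝ :=
  Matrix.of fun i j => coord2 g x₀ u (EuclideanSpace.single i 1) (EuclideanSpace.single j 1)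

/-- The scalar curvature of `g` at `x`, computed in the chart around `x`. -/
def scal (g : BilForm d M ℝ) (x : M) : ℝ :=
  ∑ j, ∑ k, (gram g x (chart d x x))⁻¹ j k * ricci (gram g x) j k (chart d x x)

/-- The (nonnegative) Laplacian `Δf = - g^{ij} (∂_i ∂_j f - Γ^k_{ij} ∂_k f) = δdf`. -/
def laplacian (g : BilForm d M ℝ) (f : M → ℝ) (x : M) : ℝ :=
  let F : 𝔼 d → ℝ := f ∘ (chart d x).symm;
  -∑ i, ∑ j, (gram g x (chart d x x))⁻¹ i j *
    (pd i (pd j F) (chart d x x) - ∑ k, christoffel (gram g x) k i j (chart d x x) * pd k F (chart d x x))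

variable (d M) in
theorem exists_chart_cover [CompactSpace M] [Nonempty M] :
    ∃ c : ℕ → M, ⋃ j, (chartAt (𝔼 d) (c j)).source = Set.univ := by
  obtain ⟨s, hs, hcov⟩ := countable_cover_nhds (X := M)
    (U := fun x => (chartAt (𝔼 d) x).source)
    (fun x => (chartAt (𝔼 d) x).open_source.mem_nhds (mem_chart_source _ x))
  have hne : s.Nonempty := by
    by_contra h
    rw [Set.not_nonempty_iff_eq_empty] at h
    subst h
    simp only [Set.mem_empty_iff_false, Set.iUnion_of_empty, Set.iUnion_empty] at hcov
    exact Set.empty_ne_univ hcov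
  obtain ⟨c, rfl⟩ := hs.exists_eq_range hne
  exact ⟨c, by simpa using hcov⟩

variable (d M) in
/-- Centres of a sequence of charts that cover `M`. -/
def chartCentre [CompactSpace M] [Nonempty M] : ℕ → M := (exists_chart_cover d M).choose

/-- The Riemannian volume measure of `g`: in a chart it is `√(det g_{ij}) du`; the pieces are glued
along a countable measurable partition of `M` subordinate to charts. For a Kähler metric of complex
dimension `m` this is the measure `ω^{[m]} = ω^m / m!`. -/
def vol [CompactSpace M] [Nonempty M] [MeasurableSpace M] (g : BilForm d M ℝ) : Measure M :=
  Measure.sum fun j : ℕ =>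
    (Measure.map (chart d (chartCentre d M j)).symm
      ((volume.restrict (chart d (chartCentre d M j)).target).withDensity
        fun u => ENNReal.ofReal (Real.sqrt (gram g (chartCentre d M j) u).det))).restrict
      (disjointed (fun l => (chartAt (𝔼 d) (chartCentre d M l)).source) j)

end Riemannian

/-! ### Torus actions, momentum maps and the weighted theory -/

section Weighted

variable {d r : ℕ} {M : Type*} [TopologicalSpace M] [ChartedSpace (𝔼 d) M]

variable (d) in
/-- `τ` is a smooth action on `M` of the torus `𝕋 = ℝ^r / 2πℤ^r`, written as an action of `ℝ^r`. -/
structure IsTorusAction (τ : LieT r → M → M) : Prop where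
  zero_act : ∀ x, τ 0 x = x
  add_act : ∀ s t x, τ (s + t) x = τ s (τ t x)
  periodic : ∀ (l : Fin r → ℤ) x, τ (fun i => 2 * Real.pi * l i) x = x
  smooth : ContMDiff (𝓘(ℝ, LieT r).prod 𝓘(ℝ, 𝔼 d)) 𝓘(ℝ, 𝔼 d) ∞ fun z : LieT r × M => τ z.1 z.2

/-- The vector field on `M` generated by `ξ ∈ 𝔱`. -/
def gen (τ : LieT r → M → M) (ξ : LieT r) (x : M) : TangentSpace 𝓘(ℝ, 𝔼 d) x :=
  (mfderiv 𝓘(ℝ, ℝ) 𝓘(ℝ, 𝔼 d) (fun s : ℝ => τ (s • ξ) x) (0 : ℝ) : ℝ →L[ℝ] 𝔼 d) (1 : ℝ)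

/-- `ω` is a `𝕋`-invariant Kähler form, `𝕋` acts by automorphisms of the complex structure, and `μ`
is a momentum map: `ω(ξ, ·) = - d⟨μ, ξ⟩`. -/
structure IsHamKahler (J : EndField d M) (Ω : BilForm d M ℝ) (τ : LieT r → M → M)
    (μ : M → LieT r) : Prop where
  kahler : IsKahler J Ω
  action : IsTorusAction d τ
  act_J : ∀ t x u,
    mfderiv 𝓘(ℝ, 𝔼 d) 𝓘(ℝ, 𝔼 d) (τ t) x (J x u) =
      J (τ t x) (mfderiv 𝓘(ℝ, 𝔼 d) 𝓘(ℝ, 𝔼 d) (τ t) x u)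
  act_form : ∀ t x u w,
    Ω (τ t x) (mfderiv 𝓘(ℝ, 𝔼 d) 𝓘(ℝ, 𝔼 d) (τ t) x u) (mfderiv 𝓘(ℝ, 𝔼 d) 𝓘(ℝ, 𝔼 d) (τ t) x w) =
      Ω x u w
  smooth_mom : ContMDiff 𝓘(ℝ, 𝔼 d) 𝓘(ℝ, LieT r) ∞ μ
  mom_inv : ∀ t x, μ (τ t x) = μ x
  mom : ∀ ξ x u, Ω x (gen τ ξ x) u =
    -(mfderiv 𝓘(ℝ, 𝔼 d) 𝓘(ℝ, ℝ) (fun y => pair ξ (μ y)) x : TangentSpace 𝓘(ℝ, 𝔼 d) x →L[ℝ] ℝ) u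

/-- The second partial derivative `v_{,ij}` of a function on `𝔱^*`. -/
def hess (v : LieT r → ℝ) (i j : Fin r) (y : LieT r) : ℝ :=
  fderiv ℝ (fun z => fderiv ℝ v z (bas j)) y (bas i)

/-- The weighted scalar curvature
`Scal_v(ω) = v(μ) Scal(ω) + 2 Δ_ω v(μ) + ∑_{i,j} v_{,ij}(μ) g(ξ_i, ξ_j)`. -/
def wScal (v : LieT r → ℝ) (J : EndField d M) (Ω : BilForm d M ℝ) (τ : LieT r → M → M)
    (μ : M → LieT r) (x : M) : ℝ :=
  v (μ x) * scal (metric J Ω) x + 2 * laplacian (metric J Ω) (fun y => v (μ y)) x +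
    ∑ i, ∑ j, hess v i j (μ x) * metric J Ω x (gen τ (bas i) x) (gen τ (bas j) x)

/-- `ω` is a `(v, w)`-cscK metric. -/
def IsWCscK (v w : LieT r → ℝ) (J : EndField d M) (Ω : BilForm d M ℝ) (τ : LieT r → M → M)
    (μ : M → LieT r) : Prop :=
  IsHamKahler J Ω τ μ ∧ ∀ x, wScal v J Ω τ μ x = w (μ x)

variable (d) in
/-- `C^∞_𝕋(M)`. -/
def SmoothInv (τ : LieT r → M → M) : Set (M → ℝ) :=
  {f | ContMDiff 𝓘(ℝ, 𝔼 d) 𝓘(ℝ, ℝ) ∞ f ∧ ∀ t x, f (τ t x) = f x}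

/-- `ω_φ = ω + dd^c φ`. -/
def formOf (J : EndField d M) (Ω : BilForm d M ℝ) (φ : M → ℝ) : BilForm d M ℝ :=
  fun x => Ω x + ddc J φ x

/-- `μ_φ = μ + d^c φ`, where `⟨d^c φ, ξ⟩ = d^c φ(ξ)`. -/
def momOf (J : EndField d M) (τ : LieT r → M → M) (μ : M → LieT r) (φ : M → ℝ) : M → LieT r :=
  fun x i => μ x i + dc J φ x (gen τ (bas i) x)

/-- The space `𝒦_𝕋(M, ω)` of `𝕋`-invariant `ω`-relative Kähler potentials. -/
def potentials (J : EndField d M) (Ω : BilForm d M ℝ) (τ : LieT r → M → M) : Set (M → ℝ) :=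
  {φ | φ ∈ SmoothInv d τ ∧ ∀ x u, u ≠ 0 → 0 < formOf J Ω φ x u (J x u)}

variable [CompactSpace M] [Nonempty M] [MeasurableSpace M]

/-- `-∫_M (Scal_v(ω_φ) - w(μ_φ)) ψ ω_φ^{[m]}`. -/
def mabuchiDiff (v w : LieT r → ℝ) (J : EndField d M) (Ω : BilForm d M ℝ) (τ : LieT r → M → M)
    (μ : M → LieT r) (φ ψ : M → ℝ) : ℝ :=
  -∫ x, (wScal v J (formOf J Ω φ) τ (momOf J τ μ φ) x - w (momOf J τ μ φ x)) * ψ x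
    ∂(vol (metric J (formOf J Ω φ)))

/-- `E` is the weighted Mabuchi energy `𝐌_{v,w}` on `𝒦_𝕋(M, ω)` (values of `E` outside
`𝒦_𝕋(M, ω)` are irrelevant): `E(0) = 0` and
`(d_φ E)(ψ) = -∫_M (Scal_v(ω_φ) - w(μ_φ)) ψ ω_φ^{[m]}`. -/
def IsMabuchi (v w : LieT r → ℝ) (J : EndField d M) (Ω : BilForm d M ℝ) (τ : LieT r → M → M)
    (μ : M → LieT r) (E : (M → ℝ) → ℝ) : Prop :=
  E 0 = 0 ∧ ∀ φ ∈ potentials J Ω τ, ∀ ψ ∈ SmoothInv d τ,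
    HasDerivAt (fun s : ℝ => E (φ + s • ψ)) (mabuchiDiff v w J Ω τ μ φ ψ) 0

end Weighted

/-! ### Semi-simple principal fibrations -/

section Fibration

variable {r m k : ℕ} {n : Fin k → ℕ}
  {X : Type*} [TopologicalSpace X] [ChartedSpace (𝔼 (2 * m)) X]
  {B : Fin k → Type*} [∀ a, TopologicalSpace (B a)] [∀ a, ChartedSpace (𝔼 (2 * n a)) (B a)]
  {P : Type*} [TopologicalSpace P] [ChartedSpace (𝔼 (2 * (∑ a, n a) + r)) P]
  {Y : Type*} [TopologicalSpace Y] [ChartedSpace (𝔼 (2 * (m + ∑ a, n a))) Y]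

/-- The differential `T_p P → ∏_a T_{b_a} B_a` of a map `P → B = ∏_a B_a`. -/
def dprod (π : P → ∀ a, B a) (p : P) :
    𝔼 (2 * (∑ a, n a) + r) →L[ℝ] (∀ a, 𝔼 (2 * n a)) :=
  ContinuousLinearMap.pi fun a =>
    (mfderiv 𝓘(ℝ, 𝔼 (2 * (∑ a, n a) + r)) 𝓘(ℝ, 𝔼 (2 * n a)) (fun p' => π p' a) p :
      𝔼 (2 * (∑ a, n a) + r) →L[ℝ] 𝔼 (2 * n a))

variable (r m n X B P Y) in
/-- The data of a semi-simple principal `(X, 𝕋)`-fibration: a complex manifold `(X, JX)` with an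
action of `𝕋` by automorphisms; Kähler manifolds `(B a, JB a, ΩB a)` of constant scalar curvature
`s a` and complex dimension `n a`; a principal `𝕋`-bundle `projB : P → ∏_a B a` with connection
1-form `θ` whose curvature is `∑_a ΩB a ⊗ p a`; and the quotient manifold
`projY : X × P → Y = (X × P)/𝕋`, for the action of `𝕋` generated by `-ξ^X + ξ^P`. -/
structure Fibration where
  JX : EndField (2 * m) X
  actX : LieT r → X → X
  JB : ∀ a, EndField (2 * n a) (B a)
  ΩB : ∀ a, BilForm (2 * n a) (B a) ℝ
  s : Fin k → ℝ
  actP : LieT r → P → P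
  projB : P → ∀ a, B a
  p : Fin k → Fin r → ℤ
  θ : OneForm (2 * (∑ a, n a) + r) P (LieT r)
  projY : X × P → Y
  smooth_JX : SmoothEnd JX
  sq_JX : ∀ x u, JX x (JX x u) = -u
  integrable_JX : IsIntegrable JX
  torus_X : IsTorusAction (2 * m) actX
  act_JX : ∀ t x u,
    mfderiv 𝓘(ℝ, 𝔼 (2 * m)) 𝓘(ℝ, 𝔼 (2 * m)) (actX t) x (JX x u) =
      JX (actX t x) (mfderiv 𝓘(ℝ, 𝔼 (2 * m)) 𝓘(ℝ, 𝔼 (2 * m)) (actX t) x u)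
  kahler_B : ∀ a, IsKahler (JB a) (ΩB a)
  scal_B : ∀ a b, scal (metric (JB a) (ΩB a)) b = s a
  torus_P : IsTorusAction (2 * (∑ a, n a) + r) actP
  free_P : ∀ t q, actP t q = q → ∃ l : Fin r → ℤ, t = fun i => 2 * Real.pi * l i
  projB_smooth : ∀ a, ContMDiff 𝓘(ℝ, 𝔼 (2 * (∑ a, n a) + r)) 𝓘(ℝ, 𝔼 (2 * n a)) ∞
    fun q => projB q a
  projB_surj : Function.Surjective projB
  projB_subm : ∀ q, Function.Surjective (dprod (r := r) (n := n) projB q)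
  projB_fibre : ∀ q q', projB q = projB q' ↔ ∃ t, q' = actP t q
  θ_smooth : Smooth1 θ
  θ_vert : ∀ ξ q, θ q (gen actP ξ q) = ξ
  θ_inv : ∀ t q u, θ (actP t q) (mfderiv 𝓘(ℝ, 𝔼 (2 * (∑ a, n a) + r))
    𝓘(ℝ, 𝔼 (2 * (∑ a, n a) + r)) (actP t) q u) = θ q u
  θ_curv : ∀ q u w, extd θ q u w =
    ∑ a, ΩB a (projB q a) (dprod (r := r) (n := n) projB q u a) (dprod (r := r) (n := n) projB q w a) •
      fun i => (p a i : ℝ)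
  projY_smooth : ContMDiff (𝓘(ℝ, 𝔼 (2 * m)).prod 𝓘(ℝ, 𝔼 (2 * (∑ a, n a) + r)))
    𝓘(ℝ, 𝔼 (2 * (m + ∑ a, n a))) ∞ projY
  projY_surj : Function.Surjective projY
  projY_subm : ∀ z, Function.Surjective (mfderiv
    (𝓘(ℝ, 𝔼 (2 * m)).prod 𝓘(ℝ, 𝔼 (2 * (∑ a, n a) + r))) 𝓘(ℝ, 𝔼 (2 * (m + ∑ a, n a))) projY z)
  projY_fibre : ∀ x q x' q', projY (x, q) = projY (x', q') ↔
    ∃ t, x' = actX (-t) x ∧ q' = actP t q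

namespace Fibration

variable (S : Fibration r m n X B P Y)

/-- The affine function `⟨p_a, y⟩ + c_a` on `𝔱^*`. -/
def aff (c : Fin k → ℝ) (a : Fin k) (y : LieT r) : ℝ := pair (fun i => (S.p a i : ℝ)) y + c a

/-- The weight `p(y) = ∏_a (⟨p_a, y⟩ + c_a)^{n_a}`. -/
def pWeight (c : Fin k → ℝ) (y : LieT r) : ℝ := ∏ a, S.aff c a y ^ n a

/-- The weight `q(y) = ∑_a s_a / (⟨p_a, y⟩ + c_a)`. -/
def qWeight (c : Fin k → ℝ) (y : LieT r) : ℝ := ∑ a, S.s a / S.aff c a y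

/-- A point of `Z = X × P` over `y ∈ Y`. -/
def lift (y : Y) : X × P := Function.surjInv S.projY_surj y

/-- The differential `T_x X × T_q P → T_y Y` of `projY` at `z = (x, q)`. -/
def dY (z : X × P) : (𝔼 (2 * m) × 𝔼 (2 * (∑ a, n a) + r)) →L[ℝ] 𝔼 (2 * (m + ∑ a, n a)) :=
  mfderiv (𝓘(ℝ, 𝔼 (2 * m)).prod 𝓘(ℝ, 𝔼 (2 * (∑ a, n a) + r))) 𝓘(ℝ, 𝔼 (2 * (m + ∑ a, n a)))
    S.projY z

/-- The connection form at a point of `P`. -/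
def con (q : P) : 𝔼 (2 * (∑ a, n a) + r) →L[ℝ] LieT r := S.θ q

/-- The horizontal lift `T_y Y → ℋ_z = T_x X ⊕ ker θ_q`: the inverse of the isomorphism
`(projY_*, θ) : T_x X × T_q P → T_y Y × 𝔱`, restricted to `T_y Y × 0`. -/
def hlift (z : X × P) :
    𝔼 (2 * (m + ∑ a, n a)) →L[ℝ] (𝔼 (2 * m) × 𝔼 (2 * (∑ a, n a) + r)) :=
  (ContinuousLinearMap.inverse
    ((S.dY z).prod ((S.con z.2).comp (ContinuousLinearMap.snd ℝ _ _)))).comp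
      (ContinuousLinearMap.inl ℝ _ _)

/-- The lift of `J_B = ∏_a J_{B_a}` to the horizontal distribution `ker θ` of `P` (extended by zero
to the vertical directions): `N⁻¹ ∘ (J_B × 0) ∘ N` for the isomorphism
`N = (projB_*, θ) : T_q P → T_b B × 𝔱`. -/
def JD (q : P) : 𝔼 (2 * (∑ a, n a) + r) →L[ℝ] 𝔼 (2 * (∑ a, n a) + r) :=
  let N : 𝔼 (2 * (∑ a, n a) + r) →L[ℝ] (∀ a, 𝔼 (2 * n a)) × LieT r :=
    (dprod S.projB q).prod (S.con q)
  let K : (∀ a, 𝔼 (2 * n a)) →L[ℝ] (∀ a, 𝔼 (2 * n a)) :=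
    ContinuousLinearMap.pi fun a =>
      (S.JB a (S.projB q a) : 𝔼 (2 * n a) →L[ℝ] 𝔼 (2 * n a)).comp (ContinuousLinearMap.proj a)
  (ContinuousLinearMap.inverse N).comp ((K.prodMap 0).comp N)

/-- The CR structure `J_X ⊕ J_B` on `ℋ ⊂ TZ`. -/
def JZ (z : X × P) :
    (𝔼 (2 * m) × 𝔼 (2 * (∑ a, n a) + r)) →L[ℝ] (𝔼 (2 * m) × 𝔼 (2 * (∑ a, n a) + r)) :=
  (S.JX z.1 : 𝔼 (2 * m) →L[ℝ] 𝔼 (2 * m)).prodMap (S.JD z.2)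

/-- The complex structure of `Y` induced by the CR structure of `Z`. -/
def JY : EndField (2 * (m + ∑ a, n a)) Y := fun y =>
  (S.dY (S.lift y)).comp ((S.JZ (S.lift y)).comp (S.hlift (S.lift y)))

/-- The action of `𝕋` on `Y` induced by the action on the factor `X` of `Z`. -/
def actY (t : LieT r) (y : Y) : Y := S.projY (S.actX t (S.lift y).1, (S.lift y).2)

/-- The function on `Y` induced by a (`𝕋`-invariant) function on `X`. -/
def down {W : Type*} (f : X → W) (y : Y) : W := f (S.lift y).1

/-- The differential `d⟨μ, ξ_i⟩` at `z`, pulled back to `Z = X × P`. -/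
def dmu (μ : X → LieT r) (i : Fin r) (z : X × P) :
    (𝔼 (2 * m) × 𝔼 (2 * (∑ a, n a) + r)) →L[ℝ] ℝ :=
  let D : 𝔼 (2 * m) →L[ℝ] ℝ := mfderiv 𝓘(ℝ, 𝔼 (2 * m)) 𝓘(ℝ, ℝ) (fun x => μ x i) z.1
  D.comp (ContinuousLinearMap.fst ℝ (𝔼 (2 * m)) (𝔼 (2 * (∑ a, n a) + r)))

/-- The component `θ_i` of the connection form at `z`, pulled back to `Z = X × P`. -/
def thetaZ (i : Fin r) (z : X × P) : (𝔼 (2 * m) × 𝔼 (2 * (∑ a, n a) + r)) →L[ℝ] ℝ :=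
  (ContinuousLinearMap.proj (R := ℝ) (φ := fun _ : Fin r => ℝ) i).comp
    ((S.con z.2).comp (ContinuousLinearMap.snd ℝ (𝔼 (2 * m)) (𝔼 (2 * (∑ a, n a) + r))))

/-- The 2-form `ω + ∑_a (⟨p_a, μ⟩ + c_a) ω_a + ⟨dμ ∧ θ⟩` on `Z = X × P`. -/
def formZ (c : Fin k → ℝ) (Ω : BilForm (2 * m) X ℝ) (μ : X → LieT r) (z : X × P) :
    (𝔼 (2 * m) × 𝔼 (2 * (∑ a, n a) + r)) →L[ℝ] (𝔼 (2 * m) × 𝔼 (2 * (∑ a, n a) + r)) →L[ℝ] ℝ :=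
  pull2 (A := 𝔼 (2 * m)) (Ω z.1)
      (ContinuousLinearMap.fst ℝ (𝔼 (2 * m)) (𝔼 (2 * (∑ a, n a) + r))) +
    ∑ a, S.aff c a (μ z.1) •
      pull2 (A := 𝔼 (2 * n a)) (S.ΩB a (S.projB z.2 a))
        ((ContinuousLinearMap.proj (R := ℝ) (φ := fun a => 𝔼 (2 * n a)) a).comp
          ((dprod S.projB z.2).comp
            (ContinuousLinearMap.snd ℝ (𝔼 (2 * m)) (𝔼 (2 * (∑ a, n a) + r))))) +
    ∑ i, ((dmu μ i z).smulRight (S.thetaZ i z) - (S.thetaZ i z).smulRight (dmu μ i z))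

/-- The bundle-compatible form `ω̃` on `Y` induced by `ω`, i.e. the 2-form on `Y` whose pull-back
to `Z` is `formZ`. -/
def formY (c : Fin k → ℝ) (Ω : BilForm (2 * m) X ℝ) (μ : X → LieT r) :
    BilForm (2 * (m + ∑ a, n a)) Y ℝ := fun y =>
  pull2 (S.formZ c Ω μ (S.lift y)) (S.hlift (S.lift y))

/-- `Vol(B, ω_B) = ∏_a Vol(B_a, ω_a)`. -/
def volB [∀ a, CompactSpace (B a)] [∀ a, Nonempty (B a)] [∀ a, MeasurableSpace (B a)] : ℝ :=
  ∏ a, (vol (metric (S.JB a) (S.ΩB a))).real Set.univ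

end Fibration

end Fibration

end WKahler

end

open WKahler

/-!
A chart of `X` and a local section `σ` of `P` give a parametrization `Fibration.par` of `Y` by an open
subset of `E × ∏ F_a`, where `E` and `F_a` are the model spaces of `X` and `B_a`. If `A` is the
pull-back of the connection form by `σ` and `l` the coordinate expression of the generators of the
action on `X`, then the metric, the form and the complex structure of `Y` become `modelG`, `modelForm`
and `modelJ` (`Adapted.pb2_metric`, `Adapted.pb2_form`, `Adapted.md_modelJ`): the product structures,
conjugated by the shear `(v, b) ↦ (v + l (A b), b)`. By `exists_isSection_gauge`, every point lies in
such a parametrization with `A = 0`, and with antisymmetric derivative of `A`, there.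

*Kähler property.* Closedness and integrability are tensorial (`cyc_pullF`, `nij_pull`), so that they
may be tested in any parametrization (`isClosed2_of_param`, `isIntegrable_of_param`); at a point with
`A = 0` they are short computations (`cyc_modelForm`, `nij_modelJ`). In the same way `dd^c φ` is
computed on `Y` (`formOf_down`). A momentum map component of `ω_φ` has its minimum at a zero of the
generating vector field, where the momentum maps of `ω` and `ω_φ` agree
(`exists_pair_le_momOf`); hence the functions `⟨p_a, μ_φ⟩ + c_a` stay positive.

*Scalar curvature.* Scalar curvature and Laplacian at a point are expressions `scalJet`, `lapJet` in
the 2-jet of the metric and an orthonormal frame, in any parametrization (`scal_eq_scalJet`,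
`laplacian_eq_lapJet`). For a metric of Kaluza-Klein type with `A = 0` at the point they are computed
in `scalJet_kkG` and `lapJet_kkG`; with the product metric `∑ f_a h_a` on the base (`scalJet_prodG`)
this gives `IsModel.scalJet_modelG`, and `curvature_formY` for `Y`. All terms but `Scal(ω)` and `q(μ)`
are expressed by `ψ_j = p_{,j} / p`, by `χ_ij = -∂_i ψ_j`, by `Δ μ_j` and by the Gram matrix
`g(ξ_i, ξ_j)` of the generators. Expanding `Scal_v` in the same quantities (`IsHamKahler.wScal_eq`),
and using `hess_pWeight_mul` for the derivatives of `p v`, gives the identity `wScal_formY`. The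
statement about weighted cscK metrics is an immediate consequence.

*Mabuchi energy.* Since `det modelG = det g · ∏ f_a ^ (2 n_a) det h_a` (`det_modelG`), a measurable
trivialization of the bundle identifies the volume of `Y` with `p(μ)` times the product of the volumes
of `X` and `B` (`exists_vol_formY_eq_map`), and Fubini's theorem gives `integral_formY`. With
`wScal_formY` it yields the equality of the differentials (`mabuchiDiff_down`). The energies then agree
because `s ↦ s φ` stays in the convex space of potentials, and both functionals are differentiated
along this ray (`IsMabuchi.hasDerivAt_ray`, `mabuchi_down`).
-/

noncomputable section

set_option maxSynthPendingDepth 3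
set_option linter.unusedSectionVars false

namespace WKahler

/-! ### Second order calculus of bilinear form fields on normed spaces -/

section Calculus

variable {E F V : Type*} [NormedAddCommGroup E] [NormedSpace ℝ E] [NormedAddCommGroup F]
  [NormedSpace ℝ F] [NormedAddCommGroup V] [NormedSpace ℝ V]

@[simp] theorem pull2_apply (β : E →L[ℝ] E →L[ℝ] V) (f : F →L[ℝ] E) (a b : F) :
    pull2 β f a b = β (f a) (f b) := rfl

theorem contDiff_flip {n : WithTop ℕ∞} :
    ContDiff ℝ n (fun β : E →L[ℝ] F →L[ℝ] V => β.flip) :=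
  LinearIsometryEquiv.contDiff (𝕜 := ℝ) (E := E →L[ℝ] F →L[ℝ] V) (F := F →L[ℝ] E →L[ℝ] V)
    (ContinuousLinearMap.flipₗᵢ ℝ E F V)

theorem contDiffAt_pull2 {W : Type*} [NormedAddCommGroup W] [NormedSpace ℝ W] {n : WithTop ℕ∞}
    {β : W → E →L[ℝ] E →L[ℝ] V} {f : W → F →L[ℝ] E} {w : W} (hβ : ContDiffAt ℝ n β w)
    (hf : ContDiffAt ℝ n f w) : ContDiffAt ℝ n (fun z => pull2 (β z) (f z)) w := by
  have h1 : ContDiffAt ℝ n (fun z => (β z).comp (f z)) w := hβ.clm_comp hf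
  have h2 : ContDiffAt ℝ n (fun z => ((β z).comp (f z)).flip) w :=
    contDiff_flip.contDiffAt.comp w h1
  exact contDiff_flip.contDiffAt.comp w
    (h2.clm_comp hf)

theorem fderiv_apply_apply {W : Type*} [NormedAddCommGroup W] [NormedSpace ℝ W]
    {G : W → E →L[ℝ] F →L[ℝ] V} {p : W → E} {q : W → F} {z : W} (hG : DifferentiableAt ℝ G z)
    (hp : DifferentiableAt ℝ p z) (hq : DifferentiableAt ℝ q z) (d : W) :
    fderiv ℝ (fun z => G z (p z) (q z)) z d =
      fderiv ℝ G z d (p z) (q z) + G z (fderiv ℝ p z d) (q z) + G z (p z) (fderiv ℝ q z d) := by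
  rw [fderiv_clm_apply (hG.clm_apply hp) hq, fderiv_clm_apply hG hp]
  simp only [add_apply, ContinuousLinearMap.comp_apply,
    ContinuousLinearMap.flip_apply]
  abel

theorem fderiv_apply_const {W : Type*} [NormedAddCommGroup W] [NormedSpace ℝ W]
    {G : W → E →L[ℝ] V} {z : W} (hG : DifferentiableAt ℝ G z) (a : E) (d : W) :
    fderiv ℝ (fun z => G z a) z d = fderiv ℝ G z d a := by
  rw [fderiv_clm_apply hG (differentiableAt_const _)]
  simp

theorem fderiv_apply_const₂ {W : Type*} [NormedAddCommGroup W] [NormedSpace ℝ W]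
    {G : W → E →L[ℝ] F →L[ℝ] V} {z : W} (hG : DifferentiableAt ℝ G z) (a : E) (b : F) (d : W) :
    fderiv ℝ (fun z => G z a b) z d = fderiv ℝ G z d a b := by
  rw [fderiv_apply_apply hG (differentiableAt_const _) (differentiableAt_const _)]
  simp

/-- Pull-back of a field of bilinear forms by a map of normed spaces. -/
def pullF (G : E → E →L[ℝ] E →L[ℝ] V) (φ : F → E) : F → F →L[ℝ] F →L[ℝ] V :=
  fun z => pull2 (G (φ z)) (fderiv ℝ φ z)

theorem ContDiffAt.pullF {G : E → E →L[ℝ] E →L[ℝ] V} {φ : F → E} {z : F} {n k : WithTop ℕ∞}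
    (hG : ContDiffAt ℝ n G (φ z)) (hφ : ContDiffAt ℝ k φ z) (hk : n + 1 ≤ k) :
    ContDiffAt ℝ n (pullF G φ) z :=
  contDiffAt_pull2 (hG.comp z (hφ.of_le (le_self_add.trans hk))) (hφ.fderiv_right hk)

theorem fderiv_fderiv_symm {φ : F → E} {z : F} (hφ : ContDiffAt ℝ 2 φ z) (a b : F) :
    fderiv ℝ (fderiv ℝ φ) z a b = fderiv ℝ (fderiv ℝ φ) z b a :=
  (hφ.isSymmSndFDerivAt (by simp)).eq a b

/-- The product rule for a pull-back. -/
theorem fderiv_pullF {G : E → E →L[ℝ] E →L[ℝ] V} {φ : F → E} {z : F}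
    (hG : ContDiffAt ℝ 1 G (φ z)) (hφ : ContDiffAt ℝ 2 φ z) (a b c : F) :
    fderiv ℝ (pullF G φ) z a b c =
      fderiv ℝ G (φ z) (fderiv ℝ φ z a) (fderiv ℝ φ z b) (fderiv ℝ φ z c) +
        G (φ z) (fderiv ℝ (fderiv ℝ φ) z a b) (fderiv ℝ φ z c) +
        G (φ z) (fderiv ℝ φ z b) (fderiv ℝ (fderiv ℝ φ) z a c) := by
  have hd : DifferentiableAt ℝ (fderiv ℝ φ) z :=
    (hφ.fderiv_right (m := 1) (by norm_num)).differentiableAt (by simp)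
  have hφ1 : DifferentiableAt ℝ φ z := hφ.differentiableAt (by simp)
  have hGφ : DifferentiableAt ℝ (fun z => G (φ z)) z :=
    (hG.differentiableAt (by simp)).comp z hφ1
  rw [← fderiv_apply_const₂ ((ContDiffAt.pullF hG hφ (by norm_num)).differentiableAt (by simp))]
  simp only [pullF, pull2_apply]
  rw [fderiv_apply_apply hGφ (hd.clm_apply (differentiableAt_const _))
    (hd.clm_apply (differentiableAt_const _)), fderiv_apply_const hd, fderiv_apply_const hd]
  have : fderiv ℝ (fun z => G (φ z)) z = (fderiv ℝ G (φ z)).comp (fderiv ℝ φ z) :=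
    fderiv_comp z (hG.differentiableAt (by simp)) hφ1
  rw [this]; rfl

/-- The exterior derivative of a 1-form on a normed space. -/
def curl (α : E → E →L[ℝ] V) (z : E) : E →L[ℝ] E →L[ℝ] V := fderiv ℝ α z - (fderiv ℝ α z).flip

theorem curl_apply (α : E → E →L[ℝ] V) (z a b : E) :
    curl α z a b = fderiv ℝ α z a b - fderiv ℝ α z b a := rfl

/-- Exterior derivatives commute with pull-backs. -/
theorem curl_pull {α : E → E →L[ℝ] V} {φ : F → E} {z : F} (hα : DifferentiableAt ℝ α (φ z))
    (hφ : ContDiffAt ℝ 2 φ z) :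
    curl (fun z => (α (φ z)).comp (fderiv ℝ φ z)) z = pull2 (curl α (φ z)) (fderiv ℝ φ z) := by
  have hd : DifferentiableAt ℝ (fderiv ℝ φ) z :=
    (hφ.fderiv_right (m := 1) (by norm_num)).differentiableAt (by simp)
  have hφ1 : DifferentiableAt ℝ φ z := hφ.differentiableAt (by simp)
  have hαφ : DifferentiableAt ℝ (fun z => α (φ z)) z := hα.comp z hφ1
  have key : ∀ a b, fderiv ℝ (fun z => (α (φ z)).comp (fderiv ℝ φ z)) z a b =
      fderiv ℝ α (φ z) (fderiv ℝ φ z a) (fderiv ℝ φ z b) +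
        α (φ z) (fderiv ℝ (fderiv ℝ φ) z a b) := by
    intro a b
    rw [← fderiv_apply_const (hαφ.clm_comp hd)]
    simp only [ContinuousLinearMap.comp_apply]
    rw [fderiv_clm_apply hαφ (hd.clm_apply (differentiableAt_const _))]
    have : fderiv ℝ (fun z => α (φ z)) z = (fderiv ℝ α (φ z)).comp (fderiv ℝ φ z) :=
      fderiv_comp z hα hφ1
    simp only [add_apply, ContinuousLinearMap.comp_apply,
      ContinuousLinearMap.flip_apply, fderiv_apply_const hd, this]
    abel
  ext a b
  rw [curl_apply, key, key, fderiv_fderiv_symm hφ a b, pull2_apply, curl_apply]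
  abel

/-- The cyclic sum of the derivative of a field of bilinear forms; for a 2-form it is the exterior
derivative. -/
def cyc (G : E → E →L[ℝ] E →L[ℝ] V) (z a b c : E) : V :=
  fderiv ℝ G z a b c + fderiv ℝ G z b c a + fderiv ℝ G z c a b

/-- The exterior derivative of a 2-form commutes with pull-backs; the second derivatives of `φ`
cancel. -/
theorem cyc_pullF {G : E → E →L[ℝ] E →L[ℝ] V} {φ : F → E} {z : F} (hG : ContDiffAt ℝ 1 G (φ z))
    (hφ : ContDiffAt ℝ 2 φ z) (halt : ∀ a b, G (φ z) a b = -G (φ z) b a) (a b c : F) :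
    cyc (pullF G φ) z a b c =
      cyc G (φ z) (fderiv ℝ φ z a) (fderiv ℝ φ z b) (fderiv ℝ φ z c) := by
  simp only [cyc, fderiv_pullF hG hφ]
  rw [fderiv_fderiv_symm hφ b a, fderiv_fderiv_symm hφ c a, fderiv_fderiv_symm hφ c b,
    halt (fderiv ℝ φ z b) _, halt (fderiv ℝ φ z c) _, halt (fderiv ℝ φ z a) _]
  abel

theorem cyc_curl {α : E → E →L[ℝ] V} {z : E} (hα : ContDiffAt ℝ 2 α z) (a b c : E) :
    cyc (curl α) z a b c = 0 := by
  have hd : DifferentiableAt ℝ (fderiv ℝ α) z :=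
    (hα.fderiv_right (m := 1) (by norm_num)).differentiableAt (by simp)
  have hfl : DifferentiableAt ℝ (fun z => (fderiv ℝ α z).flip) z :=
    ((contDiff_flip (n := 1)).differentiable (by simp)).differentiableAt.comp z hd
  have hcurl : DifferentiableAt ℝ (curl α) z :=
    DifferentiableAt.sub (𝕜 := ℝ) (E := E) (F := E →L[ℝ] E →L[ℝ] V) hd hfl
  have key : ∀ a b c, fderiv ℝ (curl α) z a b c =
      fderiv ℝ (fderiv ℝ α) z a b c - fderiv ℝ (fderiv ℝ α) z a c b := by
    intro a b c
    rw [← fderiv_apply_const₂ hcurl]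
    simp only [curl_apply]
    rw [fderiv_fun_sub ((hd.clm_apply (differentiableAt_const _)).clm_apply
      (differentiableAt_const _)) ((hd.clm_apply (differentiableAt_const _)).clm_apply
      (differentiableAt_const _)), sub_apply, fderiv_apply_const₂ hd,
      fderiv_apply_const₂ hd]
  simp only [cyc, key]
  rw [fderiv_fderiv_symm hα b a, fderiv_fderiv_symm hα c a, fderiv_fderiv_symm hα c b]
  abel

/-- The Nijenhuis tensor of a field of endomorphisms of a normed space. -/
def nij (K : E → E →L[ℝ] E) (z a b : E) : E :=
  fderiv ℝ K z (K z a) b - fderiv ℝ K z (K z b) a + K z (fderiv ℝ K z b a) - K z (fderiv ℝ K z a b)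

/-- The Nijenhuis tensor is natural: second derivatives of `φ` enter only through the derivative of
the relation `dφ ∘ K = J ∘ dφ`, and drop out by symmetry. -/
theorem nij_pull {J : E → E →L[ℝ] E} {K : F → F →L[ℝ] F} {φ : F → E} {z : F}
    (hJ : DifferentiableAt ℝ J (φ z)) (hK : DifferentiableAt ℝ K z) (hφ : ContDiffAt ℝ 2 φ z)
    (h : ∀ᶠ y in 𝓝 z, ∀ a, fderiv ℝ φ y (K y a) = J (φ y) (fderiv ℝ φ y a)) (a b : F) :
    fderiv ℝ φ z (nij K z a b) = nij J (φ z) (fderiv ℝ φ z a) (fderiv ℝ φ z b) := by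
  have hd : DifferentiableAt ℝ (fderiv ℝ φ) z :=
    (hφ.fderiv_right (m := 1) (by norm_num)).differentiableAt (by simp)
  have hφ1 : DifferentiableAt ℝ φ z := hφ.differentiableAt (by simp)
  have hJφ : DifferentiableAt ℝ (fun z => J (φ z)) z := hJ.comp z hφ1
  have key : ∀ d a, fderiv ℝ (fderiv ℝ φ) z d (K z a) + fderiv ℝ φ z (fderiv ℝ K z d a) =
      fderiv ℝ J (φ z) (fderiv ℝ φ z d) (fderiv ℝ φ z a) +
        J (φ z) (fderiv ℝ (fderiv ℝ φ) z d a) := by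
    intro d a
    have e : fderiv ℝ (fun y => fderiv ℝ φ y (K y a)) z =
        fderiv ℝ (fun y => J (φ y) (fderiv ℝ φ y a)) z :=
      Filter.EventuallyEq.fderiv_eq (h.mono fun y hy => hy a)
    have e' := DFunLike.congr_fun e d
    rw [fderiv_clm_apply hd (hK.clm_apply (differentiableAt_const _)),
      fderiv_clm_apply hJφ (hd.clm_apply (differentiableAt_const _))] at e'
    have : fderiv ℝ (fun z => J (φ z)) z = (fderiv ℝ J (φ z)).comp (fderiv ℝ φ z) :=
      fderiv_comp z hJ hφ1
    simp only [add_apply, ContinuousLinearMap.comp_apply,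
      ContinuousLinearMap.flip_apply, fderiv_apply_const hd, fderiv_apply_const hK, this] at e'
    rw [add_comm, e', add_comm]
  have h0 := fun a => h.self_of_nhds a
  have k' : ∀ d a, fderiv ℝ φ z (fderiv ℝ K z d a) =
      fderiv ℝ J (φ z) (fderiv ℝ φ z d) (fderiv ℝ φ z a) +
        J (φ z) (fderiv ℝ (fderiv ℝ φ) z d a) - fderiv ℝ (fderiv ℝ φ) z d (K z a) := fun d a =>
    eq_sub_of_add_eq' (key d a)
  simp only [nij, map_add, map_sub, h0, k']
  rw [fderiv_fderiv_symm hφ (K z b) (K z a), fderiv_fderiv_symm hφ (K z a) b,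
    fderiv_fderiv_symm hφ (K z b) a, fderiv_fderiv_symm hφ b a]
  abel

/-- The form `-df ∘ K` has exterior derivative of type `(1, 1)` for an integrable almost complex
structure `K`. -/
theorem curl_dc_invariant {K : E → E →L[ℝ] E} {f : E → ℝ} {z : E} (hK : DifferentiableAt ℝ K z)
    (hf : ContDiffAt ℝ 2 f z) (hsq : ∀ᶠ y in 𝓝 z, ∀ a, K y (K y a) = -a)
    (hn : ∀ a b, nij K z a b = 0) (a b : E) :
    curl (fun y => -((fderiv ℝ f y).comp (K y))) z (K z a) (K z b) =
      curl (fun y => -((fderiv ℝ f y).comp (K y))) z a b := by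
  have hd : DifferentiableAt ℝ (fderiv ℝ f) z :=
    (hf.fderiv_right (m := 1) (by norm_num)).differentiableAt (by simp)
  have h0 := fun a => hsq.self_of_nhds a
  have key : ∀ d a, fderiv ℝ (fun y => -((fderiv ℝ f y).comp (K y))) z d a =
      -(fderiv ℝ (fderiv ℝ f) z d (K z a) + fderiv ℝ f z (fderiv ℝ K z d a)) := by
    intro d a
    rw [← fderiv_apply_const (hd.clm_comp hK).fun_neg]
    simp only [neg_apply, ContinuousLinearMap.comp_apply]
    rw [fderiv_fun_neg, fderiv_clm_apply hd (hK.clm_apply (differentiableAt_const _))]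
    simp only [add_apply, ContinuousLinearMap.comp_apply,
      ContinuousLinearMap.flip_apply, fderiv_apply_const hK, neg_apply]
    ring
  have kk : ∀ d a, fderiv ℝ K z d (K z a) + K z (fderiv ℝ K z d a) = 0 := by
    intro d a
    have e : fderiv ℝ (fun y => K y (K y a)) z = fderiv ℝ (fun _ => -a) z :=
      Filter.EventuallyEq.fderiv_eq (hsq.mono fun y hy => hy a)
    have e' := DFunLike.congr_fun e d
    rw [fderiv_clm_apply hK (hK.clm_apply (differentiableAt_const _))] at e'
    simp only [add_apply, ContinuousLinearMap.comp_apply,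
      ContinuousLinearMap.flip_apply, fderiv_apply_const hK, fderiv_fun_const, Pi.zero_apply,
      zero_apply] at e'
    rw [add_comm, e']
  have hn' : fderiv ℝ K z (K z a) (K z b) - fderiv ℝ K z (K z b) (K z a) =
      fderiv ℝ K z a b - fderiv ℝ K z b a := by
    have h1 := congrArg (K z) (hn a b)
    simp only [nij, map_add, map_sub, h0, map_zero] at h1
    rw [eq_neg_of_add_eq_zero_left (kk (K z a) b), eq_neg_of_add_eq_zero_left (kk (K z b) a)]
    have : K z (fderiv ℝ K z (K z a) b) - K z (fderiv ℝ K z (K z b) a) =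
      fderiv ℝ K z b a - fderiv ℝ K z a b := by
      rw [← sub_eq_zero, ← h1]; abel
    rw [neg_sub_neg, ← neg_sub, this, neg_sub]
  have hn'' := congrArg (fderiv ℝ f z) hn'
  simp only [map_sub] at hn''
  simp only [curl_apply, key, h0, map_neg]
  rw [fderiv_fderiv_symm hf (K z a) b, fderiv_fderiv_symm hf (K z b) a]
  linarith

end Calculus

/-! ### Curvature and Laplacian in terms of the 2-jet of the metric -/

section Jets

variable {E F : Type*} [NormedAddCommGroup E] [NormedSpace ℝ E] [NormedAddCommGroup F]
  [NormedSpace ℝ F] {ι : Type*} [Fintype ι]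

/-- The Christoffel symbol of the first kind `⟨∇_a b, c⟩`, for constant vector fields `a, b, c`. -/
def chr1 (G : E → E →L[ℝ] E →L[ℝ] ℝ) (z a b c : E) : ℝ :=
  (fderiv ℝ G z a b c + fderiv ℝ G z b a c - fderiv ℝ G z c a b) / 2

/-- `e` is an orthonormal frame of the symmetric form `β`. -/
structure IsFrame [DecidableEq ι] (β : E →L[ℝ] E →L[ℝ] ℝ) (e : ι → E) : Prop where
  orth : ∀ i j, β (e i) (e j) = if i = j then 1 else 0
  expand : ∀ x, x = ∑ k, β x (e k) • e k

/-- The scalar curvature of the metric `G` in terms of its 2-jet at `u`, with respect to an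
orthonormal frame `e` at `u`. -/
def scalJet (G : E → E →L[ℝ] E →L[ℝ] ℝ) (u : E) (e : ι → E) : ℝ :=
  ∑ i, ∑ j, (fderiv ℝ (fun z => fderiv ℝ G z (e j) (e i) (e j)) u (e i) -
      fderiv ℝ (fun z => fderiv ℝ G z (e i) (e j) (e j)) u (e i)) +
    ∑ i, ∑ j, ∑ k, chr1 G u (e i) (e j) (e k) ^ 2 -
    ∑ k, (∑ i, chr1 G u (e i) (e i) (e k)) ^ 2

/-- The Laplacian in terms of the 1-jet of the metric and the 2-jet of the function, with respect to
an orthonormal frame. -/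
def lapJet (G : E → E →L[ℝ] E →L[ℝ] ℝ) (f : E → ℝ) (u : E) (e : ι → E) : ℝ :=
  -∑ i, (fderiv ℝ (fun z => fderiv ℝ f z (e i)) u (e i) -
    ∑ k, chr1 G u (e i) (e i) (e k) * fderiv ℝ f u (e k))

/-- The curvature tensor of a connection `Γ`. -/
def riem (Γ : E → E →L[ℝ] E →L[ℝ] E) (z d a b : E) : E :=
  fderiv ℝ Γ z d a b - fderiv ℝ Γ z a d b + Γ z d (Γ z a b) - Γ z a (Γ z d b)

/-- `Γ` is, near `u`, the Levi-Civita connection of `G`. -/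
structure IsLevi (G : E → E →L[ℝ] E →L[ℝ] ℝ) (Γ : E → E →L[ℝ] E →L[ℝ] E) (u : E) : Prop where
  diff : DifferentiableAt ℝ Γ u
  symm : ∀ᶠ z in 𝓝 u, ∀ a b, Γ z a b = Γ z b a
  metric_symm : ∀ᶠ z in 𝓝 u, ∀ a b, G z a b = G z b a
  compat : ∀ᶠ z in 𝓝 u, ∀ a b c, fderiv ℝ G z a b c = G z (Γ z a b) c + G z b (Γ z a c)

/-- The second fundamental form of `φ` with respect to the flat connection on the source and `Γ` on
the target. -/
def sff (Γ : E → E →L[ℝ] E →L[ℝ] E) (φ : F → E) (a b : F) (z : F) : E :=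
  fderiv ℝ (fderiv ℝ φ) z a b + Γ (φ z) (fderiv ℝ φ z a) (fderiv ℝ φ z b)

variable {G : E → E →L[ℝ] E →L[ℝ] ℝ} {Γ : E → E →L[ℝ] E →L[ℝ] E} {φ : F → E} {u : F}

theorem IsFrame.parseval [DecidableEq ι] {β : E →L[ℝ] E →L[ℝ] ℝ} {e : ι → E} (h : IsFrame β e)
    (hs : ∀ a b, β a b = β b a) (x y : E) : ∑ k, β x (e k) * β y (e k) = β x y := by
  conv_rhs => rw [h.expand x]
  simp [hs y]

/-- The derivative of the pulled back metric, in terms of the second fundamental form of `φ`. -/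
theorem fderiv_pullF_levi (hL : IsLevi G Γ (φ u)) (hG : ContDiffAt ℝ 2 G (φ u))
    (hφ : ContDiffAt ℝ 3 φ u) : ∀ᶠ z in 𝓝 u, ∀ a b c, fderiv ℝ (pullF G φ) z a b c =
      G (φ z) (sff Γ φ a b z) (fderiv ℝ φ z c) + G (φ z) (fderiv ℝ φ z b) (sff Γ φ a c z) := by
  have hc : ContinuousAt φ u := hφ.continuousAt
  filter_upwards [hc.eventually hL.compat, hφ.eventually (by simp),
    hc.eventually (hG.eventually (by simp))] with z h1 h2 h3 a b c
  rw [fderiv_pullF (h3.of_le (by norm_num)) (h2.of_le (by norm_num)), h1]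
  simp only [sff, map_add, add_apply]
  ring

theorem sff_symm (hL : IsLevi G Γ (φ u)) (hφ : ContDiffAt ℝ 3 φ u) :
    ∀ᶠ z in 𝓝 u, ∀ a b, sff Γ φ a b z = sff Γ φ b a z := by
  have hc : ContinuousAt φ u := hφ.continuousAt
  filter_upwards [hc.eventually hL.symm, hφ.eventually (by simp)] with z h1 h2 a b
  rw [sff, sff, h1, fderiv_fderiv_symm (h2.of_le (by norm_num))]

theorem chr1_pullF (hL : IsLevi G Γ (φ u)) (hG : ContDiffAt ℝ 2 G (φ u))
    (hφ : ContDiffAt ℝ 3 φ u) (a b c : F) :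
    chr1 (pullF G φ) u a b c = G (φ u) (sff Γ φ a b u) (fderiv ℝ φ u c) := by
  have h1 := (fderiv_pullF_levi hL hG hφ).self_of_nhds
  have h2 := (sff_symm hL hφ).self_of_nhds
  have h3 := (hφ.continuousAt.eventually hL.metric_symm).self_of_nhds
  simp only [chr1, h1]
  rw [h2 b a, h2 c a, h2 c b, h3 (fderiv ℝ φ u b) (sff Γ φ a c u)]
  ring

/-- The scalar curvature of a metric is computed by the 2-jet of any of its pull-backs by maps whose
differential takes `e` to an orthonormal frame. -/
theorem sum_riem_eq_scalJet [DecidableEq ι] (hL : IsLevi G Γ (φ u)) (hG : ContDiffAt ℝ 2 G (φ u))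
    (hφ : ContDiffAt ℝ 3 φ u) {e : ι → F} (he : IsFrame (G (φ u)) fun i => fderiv ℝ φ u (e i)) :
    ∑ i, ∑ j, G (φ u) (riem Γ (φ u) (fderiv ℝ φ u (e i)) (fderiv ℝ φ u (e j))
      (fderiv ℝ φ u (e j))) (fderiv ℝ φ u (e i)) = scalJet (pullF G φ) u e := by
  have hd : DifferentiableAt ℝ (fderiv ℝ φ) u :=
    (hφ.fderiv_right (m := 2) (by norm_num)).differentiableAt (by simp)
  have hdd : DifferentiableAt ℝ (fderiv ℝ (fderiv ℝ φ)) u :=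
    ((hφ.fderiv_right (m := 2) (by norm_num)).fderiv_right (m := 1)
      (by norm_num)).differentiableAt (by simp)
  have hφ1 : DifferentiableAt ℝ φ u := hφ.differentiableAt (by simp)
  have hGφ : DifferentiableAt ℝ (fun z => G (φ z)) u :=
    (hG.differentiableAt (by simp)).comp u hφ1
  have hΓφ : DifferentiableAt ℝ (fun z => Γ (φ z)) u := hL.diff.comp u hφ1
  have hda : ∀ a, DifferentiableAt ℝ (fun z => fderiv ℝ φ z a) u := fun a =>
    hd.clm_apply (differentiableAt_const _)
  have hsd : ∀ a b, DifferentiableAt ℝ (sff Γ φ a b) u := fun a b =>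
    DifferentiableAt.fun_add ((hdd.clm_apply (differentiableAt_const _)).clm_apply
      (differentiableAt_const _)) ((hΓφ.clm_apply (hda a)).clm_apply (hda b))
  have hcompat := hL.compat.self_of_nhds
  have hs := hL.metric_symm.self_of_nhds
  have hsf := (sff_symm hL hφ).self_of_nhds
  have hΓs := hL.symm.self_of_nhds
  -- `M d a b` is the covariant derivative of the second fundamental form
  set M : F → F → F → E := fun d a b =>
    fderiv ℝ (sff Γ φ a b) u d + Γ (φ u) (fderiv ℝ φ u d) (sff Γ φ a b u) with hM
  have hMs : ∀ d a b, M d a b = M d b a := by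
    intro d a b
    have : fderiv ℝ (sff Γ φ a b) u = fderiv ℝ (sff Γ φ b a) u :=
      Filter.EventuallyEq.fderiv_eq ((sff_symm hL hφ).mono fun z hz => hz a b)
    simp only [hM, this, hsf a b]
  have hMR : ∀ d a b, M d a b - M a d b =
      riem Γ (φ u) (fderiv ℝ φ u d) (fderiv ℝ φ u a) (fderiv ℝ φ u b) := by
    have hval : ∀ d a b, M d a b = fderiv ℝ (fderiv ℝ (fderiv ℝ φ)) u d a b +
        (fderiv ℝ Γ (φ u) (fderiv ℝ φ u d) (fderiv ℝ φ u a) (fderiv ℝ φ u b) +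
          Γ (φ u) (fderiv ℝ (fderiv ℝ φ) u d a) (fderiv ℝ φ u b) +
          Γ (φ u) (fderiv ℝ φ u a) (fderiv ℝ (fderiv ℝ φ) u d b)) +
        Γ (φ u) (fderiv ℝ φ u d) (fderiv ℝ (fderiv ℝ φ) u a b +
          Γ (φ u) (fderiv ℝ φ u a) (fderiv ℝ φ u b)) := by
      intro d a b
      have : fderiv ℝ (fun z => Γ (φ z)) u = (fderiv ℝ Γ (φ u)).comp (fderiv ℝ φ u) :=
        fderiv_comp u hL.diff hφ1
      change fderiv ℝ (fun z => fderiv ℝ (fderiv ℝ φ) z a b +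
        Γ (φ z) (fderiv ℝ φ z a) (fderiv ℝ φ z b)) u d + _ = _
      rw [fderiv_fun_add ((hdd.clm_apply (differentiableAt_const _)).clm_apply
        (differentiableAt_const _)) ((hΓφ.clm_apply (hda a)).clm_apply (hda b)), add_apply,
        fderiv_apply_const₂ hdd, fderiv_apply_apply hΓφ (hda a) (hda b), fderiv_apply_const hd,
        fderiv_apply_const hd, this, ContinuousLinearMap.comp_apply, sff]
    intro d a b
    have h3 : fderiv ℝ (fderiv ℝ (fderiv ℝ φ)) u d a b =
        fderiv ℝ (fderiv ℝ (fderiv ℝ φ)) u a d b := by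
      rw [fderiv_fderiv_symm (hφ.fderiv_right (m := 2) (by norm_num))]
    rw [hval, hval, h3, fderiv_fderiv_symm (hφ.of_le (by norm_num)) a d, riem]
    simp only [map_add]
    abel
  -- the second derivatives of the pull-back
  have hsec : ∀ d a b c, fderiv ℝ (fun z => fderiv ℝ (pullF G φ) z a b c) u d =
      G (φ u) (M d a b) (fderiv ℝ φ u c) + G (φ u) (sff Γ φ a b u) (sff Γ φ d c u) +
      G (φ u) (sff Γ φ d b u) (sff Γ φ a c u) + G (φ u) (fderiv ℝ φ u b) (M d a c) := by
    intro d a b c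
    have e1 : fderiv ℝ (fun z => fderiv ℝ (pullF G φ) z a b c) u = fderiv ℝ (fun z =>
        G (φ z) (sff Γ φ a b z) (fderiv ℝ φ z c) + G (φ z) (fderiv ℝ φ z b) (sff Γ φ a c z)) u :=
      Filter.EventuallyEq.fderiv_eq ((fderiv_pullF_levi hL hG hφ).mono fun z hz => hz a b c)
    have : fderiv ℝ (fun z => G (φ z)) u = (fderiv ℝ G (φ u)).comp (fderiv ℝ φ u) :=
      fderiv_comp u (hG.differentiableAt (by simp)) hφ1
    rw [e1, fderiv_fun_add ((hGφ.clm_apply (hsd a b)).clm_apply (hda c))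
      ((hGφ.clm_apply (hda b)).clm_apply (hsd a c)), add_apply,
      fderiv_apply_apply hGφ (hsd a b) (hda c), fderiv_apply_apply hGφ (hda b) (hsd a c), this]
    simp only [ContinuousLinearMap.comp_apply, hcompat, fderiv_apply_const hd, hM, map_add,
      add_apply]
    have e2 : ∀ d c, sff Γ φ d c u = fderiv ℝ (fderiv ℝ φ) u d c +
      Γ (φ u) (fderiv ℝ φ u d) (fderiv ℝ φ u c) := fun _ _ => rfl
    rw [e2 d c, e2 d b]
    simp only [map_add, add_apply]
    ring
  have hp := he.parseval hs
  have hchr : ∀ i j, ∑ k, chr1 (pullF G φ) u (e i) (e j) (e k) ^ 2 =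
      G (φ u) (sff Γ φ (e i) (e j) u) (sff Γ φ (e i) (e j) u) := by
    intro i j
    rw [← hp]
    simp only [chr1_pullF hL hG hφ, sq]
  have htr : ∑ k, (∑ i, chr1 (pullF G φ) u (e i) (e i) (e k)) ^ 2 =
      ∑ i, ∑ j, G (φ u) (sff Γ φ (e i) (e i) u) (sff Γ φ (e j) (e j) u) := by
    have : ∀ k, ∑ i, chr1 (pullF G φ) u (e i) (e i) (e k) =
        G (φ u) (∑ i, sff Γ φ (e i) (e i) u) (fderiv ℝ φ u (e k)) := by
      intro k
      simp only [chr1_pullF hL hG hφ, map_sum, sum_apply]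
    simp only [this, sq, hp]
    simp only [map_sum, sum_apply]
    exact Finset.sum_comm
  -- what remains is the symmetry of `M` in its last two arguments and a relabelling of the sums
  simp only [scalJet, hchr, htr, ← hMR, hsec, map_sub, sub_apply]
  have hsw : ∑ i, ∑ j, G (φ u) (M (e i) (e j) (e i)) (fderiv ℝ φ u (e j)) =
      ∑ i, ∑ j, G (φ u) (M (e j) (e i) (e j)) (fderiv ℝ φ u (e i)) := Finset.sum_comm
  have hsw2 : ∑ i, ∑ j, G (φ u) (M (e i) (e i) (e j)) (fderiv ℝ φ u (e j)) =
      ∑ i, ∑ j, G (φ u) (M (e j) (e i) (e j)) (fderiv ℝ φ u (e i)) := by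
    rw [Finset.sum_comm]
    simp only [hMs (e _) (e _) (e _)]
  have hx : ∀ i j, G (φ u) (sff Γ φ (e j) (e i) u) (sff Γ φ (e i) (e j) u) =
      G (φ u) (sff Γ φ (e i) (e j) u) (sff Γ φ (e i) (e j) u) := fun i j => by rw [hsf]
  have hy : ∀ x y, G (φ u) (fderiv ℝ φ u x) y = G (φ u) y (fderiv ℝ φ u x) := fun x y => hs _ _
  simp only [hx, hy, Finset.sum_sub_distrib, Finset.sum_add_distrib, hsw, hsw2]
  ring

/-- The trace of the Hessian for the Levi-Civita connection, computed in the parametrization `φ`. -/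
theorem sum_hess_eq_lapJet [DecidableEq ι] (hL : IsLevi G Γ (φ u)) (hG : ContDiffAt ℝ 2 G (φ u))
    (hφ : ContDiffAt ℝ 3 φ u) {e : ι → F} (he : IsFrame (G (φ u)) fun i => fderiv ℝ φ u (e i))
    {f : E → ℝ} (hf : ContDiffAt ℝ 2 f (φ u)) :
    -∑ i, (fderiv ℝ (fderiv ℝ f) (φ u) (fderiv ℝ φ u (e i)) (fderiv ℝ φ u (e i)) -
      fderiv ℝ f (φ u) (Γ (φ u) (fderiv ℝ φ u (e i)) (fderiv ℝ φ u (e i)))) =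
    lapJet (pullF G φ) (f ∘ φ) u e := by
  have hd : DifferentiableAt ℝ (fderiv ℝ φ) u :=
    (hφ.fderiv_right (m := 2) (by norm_num)).differentiableAt (by simp)
  have hφ1 : DifferentiableAt ℝ φ u := hφ.differentiableAt (by simp)
  have hdf : DifferentiableAt ℝ (fderiv ℝ f) (φ u) :=
    (hf.fderiv_right (m := 1) (by norm_num)).differentiableAt (by simp)
  have h1 : ∀ᶠ z in 𝓝 u, fderiv ℝ (f ∘ φ) z = (fderiv ℝ f (φ z)).comp (fderiv ℝ φ z) := by
    filter_upwards [hφ.continuousAt.eventually (hf.eventually (by simp)),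
      hφ.eventually (by simp)] with z h1 h2
    exact fderiv_comp z (h1.differentiableAt (by simp)) (h2.differentiableAt (by simp))
  have h2 : ∀ a, fderiv ℝ (fun z => fderiv ℝ (f ∘ φ) z a) u a =
      fderiv ℝ (fderiv ℝ f) (φ u) (fderiv ℝ φ u a) (fderiv ℝ φ u a) +
        fderiv ℝ f (φ u) (fderiv ℝ (fderiv ℝ φ) u a a) := by
    intro a
    have e1 : fderiv ℝ (fun z => fderiv ℝ (f ∘ φ) z a) u =
        fderiv ℝ (fun z => fderiv ℝ f (φ z) (fderiv ℝ φ z a)) u :=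
      Filter.EventuallyEq.fderiv_eq (h1.mono fun z hz => by simp only [hz]; rfl)
    have e2 : fderiv ℝ (fun z => fderiv ℝ f (φ z)) u =
        (fderiv ℝ (fderiv ℝ f) (φ u)).comp (fderiv ℝ φ u) := fderiv_comp u hdf hφ1
    have hdfφ : DifferentiableAt ℝ (fun z => fderiv ℝ f (φ z)) u := hdf.comp u hφ1
    rw [e1, fderiv_clm_apply hdfφ (hd.clm_apply (differentiableAt_const _))]
    simp only [add_apply, ContinuousLinearMap.comp_apply, ContinuousLinearMap.flip_apply,
      fderiv_apply_const hd]
    rw [add_comm]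
    congr 1
    exact congrArg (fun T => T a (fderiv ℝ φ u a)) e2
  rw [lapJet]
  congr 1
  refine Finset.sum_congr rfl fun i _ => ?_
  rw [h2, h1.self_of_nhds]
  have h3 : ∑ k, chr1 (pullF G φ) u (e i) (e i) (e k) *
      ((fderiv ℝ f (φ u)).comp (fderiv ℝ φ u)) (e k) =
      fderiv ℝ f (φ u) (sff Γ φ (e i) (e i) u) := by
    conv_rhs => rw [he.expand (sff Γ φ (e i) (e i) u)]
    simp [chr1_pullF hL hG hφ]
  rw [h3, sff, map_add]
  ring

/-! ### Existence of the Levi-Civita connection -/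

/-- The Christoffel symbols of the first kind as a multilinear map. -/
def chrL (G : E → E →L[ℝ] E →L[ℝ] ℝ) (z : E) : E →L[ℝ] E →L[ℝ] E →L[ℝ] ℝ :=
  (1 / 2 : ℝ) • (fderiv ℝ G z + (fderiv ℝ G z).flip -
    ((ContinuousLinearMap.flipₗᵢ ℝ E E ℝ : (E →L[ℝ] E →L[ℝ] ℝ) →L[ℝ] (E →L[ℝ] E →L[ℝ] ℝ))).comp
      (fderiv ℝ G z).flip)

theorem chrL_apply (z a b c : E) : chrL G z a b c = chr1 G z a b c := by
  simp [chrL, chr1]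
  ring

/-- The Levi-Civita connection of `G`. -/
def levi (G : E → E →L[ℝ] E →L[ℝ] ℝ) (z : E) : E →L[ℝ] E →L[ℝ] E :=
  (ContinuousLinearMap.compL ℝ E (E →L[ℝ] ℝ) E (ContinuousLinearMap.inverse (G z))).comp (chrL G z)

theorem levi_apply (z a b : E) :
    levi G z a b = ContinuousLinearMap.inverse (G z) (chrL G z a b) := rfl

theorem eventually_levi [FiniteDimensional ℝ E] {x : E} (hG : ContDiffAt ℝ 2 G x)
    (hpos : ∀ a, a ≠ 0 → 0 < G x a a) :
    DifferentiableAt ℝ (levi G) x ∧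
      ∀ᶠ z in 𝓝 x, ∀ a b c, G z (levi G z a b) c = chr1 G z a b c ∧
        (∀ y, (∀ c, G z y c = chr1 G z a b c) → y = levi G z a b) := by
  have hinj : LinearMap.ker (G x).toLinearMap = ⊥ := by
    rw [LinearMap.ker_eq_bot']
    intro a ha
    by_contra h
    have := hpos a h
    simp only [ContinuousLinearMap.coe_coe] at ha
    simp [ha] at this
  have hfin : Module.finrank ℝ E = Module.finrank ℝ (E →L[ℝ] ℝ) := by
    rw [← (LinearMap.toContinuousLinearMap (𝕜 := ℝ) (E := E) (F' := ℝ)).finrank_eq]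
    exact (Subspace.dual_finrank_eq (K := ℝ) (V := E)).symm
  obtain ⟨T, hT⟩ : ∃ T : E ≃L[ℝ] (E →L[ℝ] ℝ), (T : E →L[ℝ] E →L[ℝ] ℝ) = G x :=
    ⟨(LinearEquiv.ofInjectiveOfFinrankEq (G x).toLinearMap
      (LinearMap.ker_eq_bot.1 hinj) hfin).toContinuousLinearEquiv, by ext; rfl⟩
  have hD : ContDiffAt ℝ 1 (fderiv ℝ G) x := hG.fderiv_right (by norm_num)
  have hC : ContDiffAt ℝ 1 (chrL G) x := by
    have hf : ContDiffAt ℝ 1 (fun z => (fderiv ℝ G z).flip) x :=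
      contDiff_flip.contDiffAt.comp x hD
    exact ((hD.add hf).sub (contDiffAt_const.clm_comp hf)).const_smul (1 / 2 : ℝ)
  have hI : ContDiffAt ℝ 1 (fun z => ContinuousLinearMap.inverse (G z)) x := by
    have : ContDiffAt ℝ 1 ContinuousLinearMap.inverse (G x) := by
      rw [← hT]; exact contDiffAt_map_inverse T
    exact this.comp x (hG.of_le (by norm_num))
  refine ⟨?_, ?_⟩
  · have h1 : ContDiffAt ℝ 1 (fun z => ContinuousLinearMap.compL ℝ E (E →L[ℝ] ℝ) E
        (ContinuousLinearMap.inverse (G z))) x :=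
      (ContinuousLinearMap.contDiff _).contDiffAt.comp x hI
    exact (h1.clm_comp hC).differentiableAt (by simp)
  · have hn : ∀ᶠ z in 𝓝 x, ∃ T : E ≃L[ℝ] (E →L[ℝ] ℝ), (T : E →L[ℝ] E →L[ℝ] ℝ) = G z := by
      have := T.nhds
      rw [hT] at this
      exact hG.continuousAt.eventually this
    filter_upwards [hn] with z hz a b c
    obtain ⟨T, hT⟩ := hz
    have h1 : G z (levi G z a b) = chrL G z a b := by
      rw [levi_apply, ← hT, ContinuousLinearMap.inverse_equiv]
      exact T.apply_symm_apply _
    refine ⟨by rw [h1, chrL_apply], fun y hy => ?_⟩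
    have : G z y = G z (levi G z a b) := by
      rw [h1]; ext c; rw [hy, chrL_apply]
    rw [← hT] at this
    exact T.injective this

theorem fderiv_symm_of_symm {x : E} (hG : ContDiffAt ℝ 2 G x)
    (hs : ∀ᶠ z in 𝓝 x, ∀ a b, G z a b = G z b a) :
    ∀ᶠ z in 𝓝 x, ∀ a b c, fderiv ℝ G z a b c = fderiv ℝ G z a c b := by
  filter_upwards [hs.eventually_nhds, hG.eventually (by simp)] with z hz h2 a b c
  have hd : DifferentiableAt ℝ G z := h2.differentiableAt (by simp)
  rw [← fderiv_apply_const₂ hd, ← fderiv_apply_const₂ hd]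
  exact DFunLike.congr_fun (Filter.EventuallyEq.fderiv_eq (hz.mono fun y hy => hy b c)) a

/-- Existence of the Levi-Civita connection, from the Koszul formula. -/
theorem isLevi_levi [FiniteDimensional ℝ E] {x : E} (hG : ContDiffAt ℝ 2 G x)
    (hs : ∀ᶠ z in 𝓝 x, ∀ a b, G z a b = G z b a) (hpos : ∀ a, a ≠ 0 → 0 < G x a a) :
    IsLevi G (levi G) x := by
  obtain ⟨h1, h2⟩ := eventually_levi hG hpos
  refine ⟨h1, ?_, hs, ?_⟩
  · filter_upwards [h2, fderiv_symm_of_symm hG hs] with z hz h3 a b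
    refine (hz b a 0).2 _ fun c => ?_
    rw [(hz a b c).1, chr1, chr1, h3 c a b]
    ring
  · filter_upwards [h2, fderiv_symm_of_symm hG hs, hs] with z hz h3 h4 a b c
    rw [(hz a b c).1, h4, (hz a c b).1, chr1, chr1]
    linarith [h3 a b c, h3 b a c, h3 c a b]

end Jets

/-! ### Comparison with the coordinate formulas -/

section Coordinates

variable {d : ℕ} {ι : Type*} [Fintype ι] [DecidableEq ι]

/-- The `i`-th standard basis vector of `ℝ^d`. -/
abbrev stdb (i : Fin d) : 𝔼 d := EuclideanSpace.single i 1

/-- The Gram matrix of a field of bilinear forms on `ℝ^d`. -/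
def gramF (G : 𝔼 d → 𝔼 d →L[ℝ] 𝔼 d →L[ℝ] ℝ) (u : 𝔼 d) : Matrix (Fin d) (Fin d) ℝ :=
  Matrix.of fun i j => G u (stdb i) (stdb j)

theorem sum_stdb (x : 𝔼 d) : x = ∑ i, x i • stdb i := by
  ext j
  simp [Finset.sum_apply, Pi.single_apply]

/-- The inverse of the Gram matrix of the standard basis, in terms of an orthonormal frame. -/
theorem IsFrame.gram_inv {β : 𝔼 d →L[ℝ] 𝔼 d →L[ℝ] ℝ} {f : ι → 𝔼 d} (h : IsFrame β f) :
    (Matrix.of fun i j => β (stdb i) (stdb j))⁻¹ = Matrix.of fun i j => ∑ a, f a i * f a j := by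
  apply Matrix.inv_eq_right_inv
  ext i l
  rw [Matrix.mul_apply]
  simp only [Matrix.of_apply]
  have h1 := congrArg (fun x : 𝔼 d => x l) (h.expand (stdb i))
  simp only [WithLp.ofLp_sum, Finset.sum_apply, PiLp.smul_apply, smul_eq_mul] at h1
  have h2 : ∀ a, β (stdb i) (f a) = ∑ j, β (stdb i) (stdb j) * f a j := by
    intro a
    conv_lhs => rw [sum_stdb (f a)]
    simp [mul_comm]
  simp only [h2] at h1
  simp only [Finset.mul_sum]
  rw [Finset.sum_comm]
  simp only [Finset.sum_mul, mul_assoc] at h1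
  rw [← h1]
  simp [Matrix.one_apply, eq_comm]

theorem IsFrame.sum_gram_inv {β : 𝔼 d →L[ℝ] 𝔼 d →L[ℝ] ℝ} {f : ι → 𝔼 d} (h : IsFrame β f)
    (B : 𝔼 d →ₗ[ℝ] 𝔼 d →ₗ[ℝ] ℝ) :
    ∑ j, ∑ k, (Matrix.of fun i j => β (stdb i) (stdb j))⁻¹ j k * B (stdb j) (stdb k) =
      ∑ a, B (f a) (f a) := by
  rw [h.gram_inv]
  have h2 : ∀ a, B (f a) (f a) = ∑ j, ∑ k, f a j * f a k * B (stdb j) (stdb k) := by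
    intro a
    conv_lhs => rw [sum_stdb (f a)]
    simp only [map_sum, map_smul, LinearMap.sum_apply, LinearMap.smul_apply, smul_eq_mul,
      Finset.mul_sum]
    rw [Finset.sum_comm]
    refine Finset.sum_congr rfl fun j _ => Finset.sum_congr rfl fun k _ => by ring
  simp only [h2, Matrix.of_apply, Finset.sum_mul]
  rw [Finset.sum_comm' (t' := Finset.univ) (s' := fun _ => Finset.univ) (by simp)]
  rw [Finset.sum_congr rfl fun j _ => Finset.sum_comm]
  rw [Finset.sum_comm]
  rw [Finset.sum_congr rfl fun j _ => Finset.sum_comm]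

theorem IsFrame.trace {β : 𝔼 d →L[ℝ] 𝔼 d →L[ℝ] ℝ} {f : ι → 𝔼 d} (h : IsFrame β f)
    (T : 𝔼 d →ₗ[ℝ] 𝔼 d) : ∑ i, T (stdb i) i = ∑ a, β (T (f a)) (f a) := by
  have h2 : ∀ a, β (T (f a)) (f a) = ∑ i, f a i * β (T (stdb i)) (f a) := by
    intro a
    have : T (f a) = ∑ i, f a i • T (stdb i) := by
      conv_lhs => rw [sum_stdb (f a)]
      simp only [map_sum, map_smul]
    rw [this]
    simp
  simp only [h2]
  rw [Finset.sum_comm]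
  refine Finset.sum_congr rfl fun i _ => ?_
  have h1 := congrArg (fun x : 𝔼 d => x i) (h.expand (T (stdb i)))
  simp only [WithLp.ofLp_sum, Finset.sum_apply, PiLp.smul_apply, smul_eq_mul] at h1
  rw [h1]
  exact Finset.sum_congr rfl fun a _ => mul_comm _ _

variable {G : 𝔼 d → 𝔼 d →L[ℝ] 𝔼 d →L[ℝ] ℝ} {x : 𝔼 d}

/-- The classical Christoffel symbols are the components of `levi`. -/
theorem christoffel_eq_levi (hG : ContDiffAt ℝ 2 G x)
    (hs : ∀ᶠ z in 𝓝 x, ∀ a b, G z a b = G z b a) (hpos : ∀ a, a ≠ 0 → 0 < G x a a) :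
    ∀ᶠ z in 𝓝 x, ∀ k i j, christoffel (gramF G) k i j z = levi G z (stdb i) (stdb j) k := by
  obtain ⟨-, h2⟩ := eventually_levi hG hpos
  have hdet : ∀ᶠ z in 𝓝 x, IsUnit (gramF G z).det := by
    have hc : ContinuousAt (fun z => (gramF G z).det) x := by
      have : ContinuousAt (gramF G) x := by
        refine continuousAt_pi.2 fun i => continuousAt_pi.2 fun j => ?_
        exact (hG.continuousAt.clm_apply continuousAt_const).clm_apply continuousAt_const
      exact (Continuous.matrix_det continuous_id).continuousAt.comp this
    have h0 : (gramF G x).det ≠ 0 := by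
      intro h
      obtain ⟨v, hv, hv'⟩ := Matrix.exists_mulVec_eq_zero_iff.2 h
      have := hpos (WithLp.toLp 2 v) (by simpa using hv)
      have e : G x (WithLp.toLp 2 v) (WithLp.toLp 2 v) = v ⬝ᵥ (gramF G x).mulVec v := by
        conv_lhs => rw [sum_stdb (WithLp.toLp 2 v)]
        simp only [map_sum, map_smul, sum_apply, smul_apply, smul_eq_mul,
          dotProduct, Matrix.mulVec, gramF, Matrix.of_apply, Finset.mul_sum]
        rw [Finset.sum_comm]
        refine Finset.sum_congr rfl fun i _ => Finset.sum_congr rfl fun j _ => by ring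
      rw [e, hv'] at this
      simp at this
    filter_upwards [hc.eventually_ne h0] with z hz using hz.isUnit
  filter_upwards [h2, hdet, hG.eventually (by simp), hs] with z h1 hu h3 h4 k i j
  have hd : DifferentiableAt ℝ G z := h3.differentiableAt (by simp)
  have hpd : ∀ i j l, pd i (fun z => gramF G z j l) z = fderiv ℝ G z (stdb i) (stdb j) (stdb l) :=
    fun i j l => fderiv_apply_const₂ hd _ _ _
  rw [christoffel]
  simp only [hpd]
  have h5 : ∀ l, (gramF G z).mulVec (levi G z (stdb i) (stdb j)) l =
      chr1 G z (stdb i) (stdb j) (stdb l) := by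
    intro l
    rw [← (h1 _ _ _).1, h4]
    conv_rhs => rw [sum_stdb (levi G z (stdb i) (stdb j))]
    simp [Matrix.mulVec, dotProduct, gramF, mul_comm]
  have h6 : (gramF G z)⁻¹.mulVec ((gramF G z).mulVec (levi G z (stdb i) (stdb j))) =
      levi G z (stdb i) (stdb j) := by
    rw [Matrix.mulVec_mulVec, Matrix.nonsing_inv_mul _ hu, Matrix.one_mulVec]
  rw [← h6]
  simp only [Matrix.mulVec, dotProduct] at h5 ⊢
  simp only [h5, Finset.mul_sum, chr1]
  refine Finset.sum_congr rfl fun l _ => by ring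

/-- The coordinate formula for the scalar curvature, in terms of any pull-back. -/
theorem sum_ricci_eq_scalJet {F : Type*} [NormedAddCommGroup F] [NormedSpace ℝ F] {φ : F → 𝔼 d}
    {u : F} (hG : ContDiffAt ℝ 2 G (φ u)) (hs : ∀ᶠ z in 𝓝 (φ u), ∀ a b, G z a b = G z b a)
    (hpos : ∀ a, a ≠ 0 → 0 < G (φ u) a a) (hφ : ContDiffAt ℝ 3 φ u) {e : ι → F}
    (he : IsFrame (G (φ u)) fun i => fderiv ℝ φ u (e i)) :
    ∑ j, ∑ k, (gramF G (φ u))⁻¹ j k * ricci (gramF G) j k (φ u) = scalJet (pullF G φ) u e := by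
  have hL := isLevi_levi hG hs hpos
  rw [← sum_riem_eq_scalJet hL hG hφ he]
  have hch := christoffel_eq_levi hG hs hpos
  have hpd : ∀ l k i j, pd l (christoffel (gramF G) k i j) (φ u) =
      fderiv ℝ (levi G) (φ u) (stdb l) (stdb i) (stdb j) k := by
    intro l k i j
    have e1 : fderiv ℝ (christoffel (gramF G) k i j) (φ u) =
        fderiv ℝ (fun z => levi G z (stdb i) (stdb j) k) (φ u) :=
      Filter.EventuallyEq.fderiv_eq (hch.mono fun z hz => hz k i j)
    rw [pd, e1, ← fderiv_apply_const₂ hL.diff]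
    exact congrArg (fun T => T (stdb l)) (fderiv_comp (φ u)
      (EuclideanSpace.proj k : 𝔼 d →L[ℝ] ℝ).differentiableAt
      ((hL.diff.clm_apply (differentiableAt_const _)).clm_apply (differentiableAt_const _)) |>.trans
      (by rw [ContinuousLinearMap.fderiv]))
  have hric : ∀ j k, ricci (gramF G) j k (φ u) =
      ∑ i, riem (levi G) (φ u) (stdb i) (stdb j) (stdb k) i := by
    intro j k
    have hexp : ∀ a b : Fin d, ∀ w : 𝔼 d, ∀ i, levi G (φ u) (stdb a) w i =
        ∑ l, levi G (φ u) (stdb a) (stdb l) i * w l := by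
      intro a b w i
      conv_lhs => rw [sum_stdb w]
      simp [mul_comm]
    rw [ricci]
    refine Finset.sum_congr rfl fun i _ => ?_
    simp only [hpd, hch.self_of_nhds, riem, PiLp.sub_apply, PiLp.add_apply, Finset.sum_sub_distrib]
    rw [hexp i i (levi G (φ u) (stdb j) (stdb k)), hexp j j (levi G (φ u) (stdb i) (stdb k))]
    ring
  let T : 𝔼 d → 𝔼 d → 𝔼 d →ₗ[ℝ] 𝔼 d := fun a b =>
    { toFun := fun z => riem (levi G) (φ u) z a b
      map_add' := fun y z => by simp only [riem, map_add, add_apply]; abel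
      map_smul' := fun c y => by
        simp only [riem, map_smul, smul_apply, RingHom.id_apply, smul_sub,
          smul_add] }
  let B : 𝔼 d →ₗ[ℝ] 𝔼 d →ₗ[ℝ] ℝ := LinearMap.mk₂ ℝ (fun a b => ∑ i, G (φ u)
      (riem (levi G) (φ u) (fderiv ℝ φ u (e i)) a b) (fderiv ℝ φ u (e i)))
    (by intro a b c; rw [← Finset.sum_add_distrib]; refine Finset.sum_congr rfl fun i _ => ?_
        simp only [riem, map_add, add_apply, map_sub, sub_apply]; ring)
    (by intro c a b; rw [Finset.smul_sum]; refine Finset.sum_congr rfl fun i _ => ?_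
        simp only [riem, map_add, add_apply, map_sub, sub_apply, map_smul,
          smul_apply, smul_eq_mul]; ring)
    (by intro a b c; rw [← Finset.sum_add_distrib]; refine Finset.sum_congr rfl fun i _ => ?_
        simp only [riem, map_add, add_apply, map_sub, sub_apply]; ring)
    (by intro c a b; rw [Finset.smul_sum]; refine Finset.sum_congr rfl fun i _ => ?_
        simp only [riem, map_add, add_apply, map_sub, sub_apply, map_smul,
          smul_apply, smul_eq_mul]; ring)
  have hB : ∀ j k, ricci (gramF G) j k (φ u) = B (stdb j) (stdb k) := fun j k => by
    rw [hric]; exact he.trace (T (stdb j) (stdb k))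
  simp only [hB]
  rw [show gramF G (φ u) = Matrix.of fun i j => G (φ u) (stdb i) (stdb j) from rfl,
    he.sum_gram_inv B, Finset.sum_comm]
  rfl

/-- The coordinate formula for the Laplacian, in terms of any pull-back. -/
theorem sum_laplacian_eq_lapJet {F : Type*} [NormedAddCommGroup F] [NormedSpace ℝ F] {φ : F → 𝔼 d}
    {u : F} (hG : ContDiffAt ℝ 2 G (φ u)) (hs : ∀ᶠ z in 𝓝 (φ u), ∀ a b, G z a b = G z b a)
    (hpos : ∀ a, a ≠ 0 → 0 < G (φ u) a a) (hφ : ContDiffAt ℝ 3 φ u) {e : ι → F}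
    (he : IsFrame (G (φ u)) fun i => fderiv ℝ φ u (e i)) {f : 𝔼 d → ℝ}
    (hf : ContDiffAt ℝ 2 f (φ u)) :
    -∑ i, ∑ j, (gramF G (φ u))⁻¹ i j * (pd i (pd j f) (φ u) -
      ∑ k, christoffel (gramF G) k i j (φ u) * pd k f (φ u)) = lapJet (pullF G φ) (f ∘ φ) u e := by
  have hL := isLevi_levi hG hs hpos
  rw [← sum_hess_eq_lapJet hL hG hφ he hf]
  have hch := (christoffel_eq_levi hG hs hpos).self_of_nhds
  have hdf : DifferentiableAt ℝ (fderiv ℝ f) (φ u) :=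
    (hf.fderiv_right (m := 1) (by norm_num)).differentiableAt (by simp)
  let B : 𝔼 d →ₗ[ℝ] 𝔼 d →ₗ[ℝ] ℝ := LinearMap.mk₂ ℝ (fun a b =>
      fderiv ℝ (fderiv ℝ f) (φ u) a b - fderiv ℝ f (φ u) (levi G (φ u) a b))
    (by intros; simp only [map_add, add_apply]; ring)
    (by intros; simp only [map_smul, smul_apply, smul_eq_mul]; ring)
    (by intros; simp only [map_add]; ring)
    (by intros; simp only [map_smul, smul_eq_mul]; ring)
  have hB : ∀ i j, pd i (pd j f) (φ u) - ∑ k, christoffel (gramF G) k i j (φ u) * pd k f (φ u) =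
      B (stdb i) (stdb j) := by
    intro i j
    have h1 : pd i (pd j f) (φ u) = fderiv ℝ (fderiv ℝ f) (φ u) (stdb i) (stdb j) :=
      fderiv_apply_const hdf _ _
    simp only [h1, hch, B, LinearMap.mk₂_apply]
    conv_rhs => rw [sum_stdb (levi G (φ u) (stdb i) (stdb j))]
    simp [pd]
  simp only [hB]
  rw [show gramF G (φ u) = Matrix.of fun i j => G (φ u) (stdb i) (stdb j) from rfl,
    he.sum_gram_inv B]
  rfl

end Coordinates

theorem two_le_infty : (2 : WithTop ℕ∞) ≤ ∞ :=
  show (((2 : ℕ∞) : WithTop ℕ∞)) ≤ (((⊤ : ℕ∞) : WithTop ℕ∞)) from WithTop.coe_le_coe.2 le_top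

theorem three_le_infty : (3 : WithTop ℕ∞) ≤ ∞ :=
  show (((3 : ℕ∞) : WithTop ℕ∞)) ≤ (((⊤ : ℕ∞) : WithTop ℕ∞)) from WithTop.coe_le_coe.2 le_top

/-! ### Pull-backs of tensor fields along smooth maps from normed spaces -/

section PullBack

variable {d : ℕ} {M : Type*} [TopologicalSpace M] [ChartedSpace (𝔼 d) M]
  {E : Type*} [NormedAddCommGroup E] [NormedSpace ℝ E]
  {V : Type*} [NormedAddCommGroup V] [NormedSpace ℝ V]

/-- The differential of a map from a normed space to a manifold. -/
def md (c : E → M) (u : E) : E →L[ℝ] 𝔼 d := mfderiv 𝓘(ℝ, E) 𝓘(ℝ, 𝔼 d) c u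

/-- The pull-back of a 1-form. -/
def pb1 (c : E → M) (α : OneForm d M V) (u : E) : E →L[ℝ] V :=
  ContinuousLinearMap.comp (α (c u) : 𝔼 d →L[ℝ] V) (md c u)

/-- The pull-back of a field of bilinear forms. -/
def pb2 (c : E → M) (β : BilForm d M V) (u : E) : E →L[ℝ] E →L[ℝ] V :=
  pull2 (A := 𝔼 d) (β (c u)) (md c u)

theorem pb2_apply (c : E → M) (β : BilForm d M V) (u a b : E) :
    pb2 c β u a b = β (c u) (md c u a) (md c u b) := rfl

theorem pb1_apply (c : E → M) (α : OneForm d M V) (u a : E) :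
    pb1 c α u a = α (c u) (md c u a) := rfl

variable (d) in
/-- The map `c` is smooth near `u`. -/
def SmAt (c : E → M) (u : E) : Prop := ∀ᶠ z in 𝓝 u, ContMDiffAt 𝓘(ℝ, E) 𝓘(ℝ, 𝔼 d) ∞ c z

theorem SmAt.contMDiffAt {c : E → M} {u : E} (h : SmAt d c u) :
    ContMDiffAt 𝓘(ℝ, E) 𝓘(ℝ, 𝔼 d) ∞ c u := h.self_of_nhds

theorem SmAt.eventually {c : E → M} {u : E} (h : SmAt d c u) : ∀ᶠ z in 𝓝 u, SmAt d c z :=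
  eventually_eventually_nhds.2 h

theorem SmAt.continuousAt {c : E → M} {u : E} (h : SmAt d c u) : ContinuousAt c u :=
  h.contMDiffAt.continuousAt

theorem SmAt.mdiff {c : E → M} {u : E} (h : SmAt d c u) :
    MDifferentiableAt 𝓘(ℝ, E) 𝓘(ℝ, 𝔼 d) c u := h.contMDiffAt.mdifferentiableAt (by simp)

variable [IsManifold 𝓘(ℝ, 𝔼 d) ∞ M]

theorem smAt_chart_symm (x₀ : M) {u : 𝔼 d} (hu : u ∈ (chart d x₀).target) :
    SmAt d (chart d x₀).symm u := by
  filter_upwards [(isOpen_extChartAt_target (I := 𝓘(ℝ, 𝔼 d)) x₀).mem_nhds hu] with z hz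
  exact (contMDiffOn_extChartAt_symm x₀).contMDiffAt
    ((isOpen_extChartAt_target (I := 𝓘(ℝ, 𝔼 d)) x₀).mem_nhds hz)

theorem pb2_chart_symm (x₀ : M) (β : BilForm d M V) : pb2 (chart d x₀).symm β = coord2 β x₀ := rfl

omit [IsManifold 𝓘(ℝ, 𝔼 d) ∞ M] in
theorem coord2_apply (β : BilForm d M V) (x₀ : M) (z a b : 𝔼 d) : coord2 β x₀ z a b =
    β ((chart d x₀).symm z) (md (d := d) (chart d x₀).symm z a) (md (d := d) (chart d x₀).symm z b) :=
  rfl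

theorem chart_source_mem_nhds {x₀ x : M} (h : x ∈ (chart d x₀).source) :
    (chart d x₀).source ∈ 𝓝 x := (isOpen_extChartAt_source (I := 𝓘(ℝ, 𝔼 d)) x₀).mem_nhds h

theorem mdiff_chart {x₀ x : M} (h : x ∈ (chart d x₀).source) :
    MDifferentiableAt 𝓘(ℝ, 𝔼 d) 𝓘(ℝ, 𝔼 d) (chart d x₀) x :=
  mdifferentiableAt_extChartAt (by simpa using h)

section Transition

variable {c : E → M} {u : E} {x₀ : M}

/-- A chart expression of a smooth map is smooth. -/
theorem SmAt.contDiffAt_chart (hc : SmAt d c u) (hx : c u ∈ (chart d x₀).source) :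
    ContDiffAt ℝ ∞ (chart d x₀ ∘ c) u := by
  have h1 : ContMDiffAt 𝓘(ℝ, 𝔼 d) 𝓘(ℝ, 𝔼 d) ∞ (chart d x₀) (c u) :=
    contMDiffAt_extChartAt' (by simpa using hx)
  exact (h1.comp u hc.contMDiffAt).contDiffAt

theorem SmAt.mem_source (hc : SmAt d c u) (hx : c u ∈ (chart d x₀).source) :
    ∀ᶠ z in 𝓝 u, c z ∈ (chart d x₀).source :=
  hc.continuousAt.eventually (chart_source_mem_nhds hx)

theorem SmAt.coframe_md (hc : SmAt d c u) (hx : c u ∈ (chart d x₀).source) (a : E) :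
    (coframe x₀ (c u) : 𝔼 d →L[ℝ] 𝔼 d) (md c u a) = fderiv ℝ (chart d x₀ ∘ c) u a := by
  rw [← mfderiv_eq_fderiv, mfderiv_comp u (mdiff_chart hx) hc.mdiff]
  rfl

theorem SmAt.md_eq (hc : SmAt d c u) (hx : c u ∈ (chart d x₀).source) :
    md c u = (frame x₀ ((chart d x₀ ∘ c) u) : 𝔼 d →L[ℝ] 𝔼 d).comp
      (fderiv ℝ (chart d x₀ ∘ c) u) := by
  have e : c =ᶠ[𝓝 u] (chart d x₀).symm ∘ (chart d x₀ ∘ c) := by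
    filter_upwards [hc.mem_source hx] with z hz
    exact ((chart d x₀).left_inv hz).symm
  have h1 : MDifferentiableAt 𝓘(ℝ, 𝔼 d) 𝓘(ℝ, 𝔼 d) (chart d x₀).symm ((chart d x₀ ∘ c) u) :=
    (smAt_chart_symm x₀ ((chart d x₀).map_source hx)).mdiff
  have h2 : MDifferentiableAt 𝓘(ℝ, E) 𝓘(ℝ, 𝔼 d) (chart d x₀ ∘ c) u :=
    (mdiff_chart hx).comp u hc.mdiff
  rw [← mfderiv_eq_fderiv, md, e.mfderiv_eq, mfderiv_comp u h1 h2]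
  rfl

theorem SmAt.pb2_eq (hc : SmAt d c u) (hx : c u ∈ (chart d x₀).source) (β : BilForm d M V) :
    pb2 c β =ᶠ[𝓝 u] pullF (coord2 β x₀) (chart d x₀ ∘ c) := by
  filter_upwards [hc.eventually, hc.mem_source hx] with z h1 h2
  have e : ∀ a, md c z a = (frame x₀ ((chart d x₀ ∘ c) z) : 𝔼 d →L[ℝ] 𝔼 d)
      (fderiv ℝ (chart d x₀ ∘ c) z a) := fun a => by rw [h1.md_eq h2]; rfl
  have e2 : ∀ (x y : M) (p q : 𝔼 d), x = y → (β x : 𝔼 d →L[ℝ] 𝔼 d →L[ℝ] V) p q =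
      (β y : 𝔼 d →L[ℝ] 𝔼 d →L[ℝ] V) p q := by rintro x _ p q rfl; rfl
  ext a b
  rw [pb2_apply, e, e]
  exact e2 _ _ _ _ ((chart d x₀).left_inv h2).symm

theorem SmAt.pb1_eq (hc : SmAt d c u) (hx : c u ∈ (chart d x₀).source) (α : OneForm d M V) :
    pb1 c α =ᶠ[𝓝 u] fun z => (coord1 α x₀ ((chart d x₀ ∘ c) z)).comp
      (fderiv ℝ (chart d x₀ ∘ c) z) := by
  filter_upwards [hc.eventually, hc.mem_source hx] with z h1 h2
  ext a
  rw [pb1_apply, h1.md_eq h2, ContinuousLinearMap.comp_apply, coord1]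
  rw [Function.comp_apply, (chart d x₀).left_inv h2]
  rfl

end Transition

theorem mem_chart_self (x : M) : x ∈ (chart d x).source := mem_extChartAt_source x

theorem target_mem_nhds {x₀ : M} {u : 𝔼 d} (hu : u ∈ (chart d x₀).target) :
    (chart d x₀).target ∈ 𝓝 u := (isOpen_extChartAt_target (I := 𝓘(ℝ, 𝔼 d)) x₀).mem_nhds hu

theorem Smooth2.contDiffAt {β : BilForm d M V} (h : Smooth2 β) {x₀ x : M}
    (hx : x ∈ (chart d x₀).source) : ContDiffAt ℝ ∞ (coord2 β x₀) (chart d x₀ x) :=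
  (h x₀).contDiffAt (target_mem_nhds ((chart d x₀).map_source hx))

theorem Smooth1.contDiffAt {α : OneForm d M V} (h : Smooth1 α) {x₀ x : M}
    (hx : x ∈ (chart d x₀).source) : ContDiffAt ℝ ∞ (coord1 α x₀) (chart d x₀ x) :=
  (h x₀).contDiffAt (target_mem_nhds ((chart d x₀).map_source hx))

theorem SmoothEnd.contDiffAt {J : EndField d M} (h : SmoothEnd J) {x₀ x : M}
    (hx : x ∈ (chart d x₀).source) : ContDiffAt ℝ ∞ (coordEnd J x₀) (chart d x₀ x) :=
  (h x₀).contDiffAt (target_mem_nhds ((chart d x₀).map_source hx))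

theorem Smooth2.pb2 {β : BilForm d M V} (h : Smooth2 β) {c : E → M} {u : E} (hc : SmAt d c u) :
    ContDiffAt ℝ ∞ (pb2 c β) u :=
  (ContDiffAt.pullF (φ := chart d (c u) ∘ c) (h.contDiffAt (mem_chart_self (c u))) (hc.contDiffAt_chart (mem_chart_self _))
    (by simp)).congr_of_eventuallyEq (hc.pb2_eq (mem_chart_self _) β)

theorem Smooth1.pb1 {α : OneForm d M V} (h : Smooth1 α) {c : E → M} {u : E} (hc : SmAt d c u) :
    ContDiffAt ℝ ∞ (pb1 c α) u := by
  refine ContDiffAt.congr_of_eventuallyEq ?_ (hc.pb1_eq (mem_chart_self _) α)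
  have h1 := hc.contDiffAt_chart (mem_chart_self (c u))
  exact ((h.contDiffAt (mem_chart_self (c u))).comp u h1).clm_comp (h1.fderiv_right (by simp))

/-- The exterior derivative, defined in charts, commutes with pull-backs along parametrizations. -/
theorem pb2_extd {α : OneForm d M V} (h : Smooth1 α) {c : E → M} {u : E} (hc : SmAt d c u) :
    pb2 c (extd α) u = curl (pb1 c α) u := by
  have hx := mem_chart_self (d := d) (c u)
  have e : curl (pb1 c α) u = curl (fun z => (coord1 α (c u) ((chart d (c u) ∘ c) z)).comp
      (fderiv ℝ (chart d (c u) ∘ c) z)) u := by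
    rw [curl, curl, (hc.pb1_eq hx α).fderiv_eq]
  rw [e, curl_pull (φ := chart d (c u) ∘ c) ((h.contDiffAt hx).differentiableAt (by simp))
    ((hc.contDiffAt_chart hx).of_le two_le_infty)]
  ext a b
  rw [pull2_apply, ← hc.coframe_md hx, ← hc.coframe_md hx]
  rfl

theorem frame_coframe {x₀ x : M} (hx : x ∈ (chart d x₀).source) (a : 𝔼 d) :
    (frame x₀ (chart d x₀ x) : 𝔼 d →L[ℝ] 𝔼 d) ((coframe x₀ x : 𝔼 d →L[ℝ] 𝔼 d) a) = a := by
  have h1 : MDifferentiableAt 𝓘(ℝ, 𝔼 d) 𝓘(ℝ, 𝔼 d) (chart d x₀).symm (chart d x₀ x) :=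
    (smAt_chart_symm x₀ ((chart d x₀).map_source hx)).mdiff
  have e : (chart d x₀).symm ∘ chart d x₀ =ᶠ[𝓝 x] id := by
    filter_upwards [chart_source_mem_nhds hx] with z hz using (chart d x₀).left_inv hz
  have h := mfderiv_comp x h1 (mdiff_chart hx)
  rw [e.mfderiv_eq, mfderiv_id] at h
  exact (DFunLike.congr_fun h a).symm

theorem coframe_frame {x₀ : M} {u : 𝔼 d} (hu : u ∈ (chart d x₀).target) (a : 𝔼 d) :
    (coframe x₀ ((chart d x₀).symm u) : 𝔼 d →L[ℝ] 𝔼 d) ((frame x₀ u : 𝔼 d →L[ℝ] 𝔼 d) a) = a := by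
  have h := (smAt_chart_symm x₀ hu).coframe_md ((chart d x₀).map_target hu) a
  have e : chart d x₀ ∘ (chart d x₀).symm =ᶠ[𝓝 u] id := by
    filter_upwards [target_mem_nhds hu] with z hz using (chart d x₀).right_inv hz
  rw [e.fderiv_eq, fderiv_id] at h
  exact h

/-- `K` is the expression of the endomorphism field `J` in the parametrization `c`, near `u`. -/
def Represents (c : E → M) (J : EndField d M) (K : E → E →L[ℝ] E) (u : E) : Prop :=
  ∀ᶠ z in 𝓝 u, ∀ a, md c z (K z a) = (J (c z) : 𝔼 d →L[ℝ] 𝔼 d) (md c z a)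

theorem represents_coordEnd (J : EndField d M) (x₀ : M) {u : 𝔼 d} (hu : u ∈ (chart d x₀).target) :
    Represents (chart d x₀).symm J (coordEnd J x₀) u := by
  filter_upwards [target_mem_nhds hu] with z hz a
  have h := frame_coframe ((chart d x₀).map_target hz)
    ((J ((chart d x₀).symm z) : 𝔼 d →L[ℝ] 𝔼 d) (md (chart d x₀).symm z a))
  rw [(chart d x₀).right_inv hz] at h
  exact h

/-- In a chart, a representation of an endomorphism field is related to the coordinate expression by
the transition map. -/
theorem Represents.transition {c : E → M} {J : EndField d M} {K : E → E →L[ℝ] E} {u : E}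
    (h : Represents c J K u) (hc : SmAt d c u) {x₀ : M} (hx : c u ∈ (chart d x₀).source) :
    ∀ᶠ z in 𝓝 u, ∀ a, fderiv ℝ (chart d x₀ ∘ c) z (K z a) =
      coordEnd J x₀ ((chart d x₀ ∘ c) z) (fderiv ℝ (chart d x₀ ∘ c) z a) := by
  filter_upwards [h, hc.eventually, hc.mem_source hx] with z h1 h2 h3 a
  rw [← h2.coframe_md h3, h1, coordEnd, ContinuousLinearMap.comp_apply,
    ContinuousLinearMap.comp_apply, Function.comp_apply, (chart d x₀).left_inv h3]
  have : md c z a = (frame x₀ ((chart d x₀ ∘ c) z) : 𝔼 d →L[ℝ] 𝔼 d)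
    (fderiv ℝ (chart d x₀ ∘ c) z a) := by rw [h2.md_eq h3]; rfl
  rw [this]
  rfl

theorem SmAt.bijective_fderiv {c : E → M} {u : E} (hc : SmAt d c u)
    (hb : Function.Bijective (md (d := d) c u)) {x₀ : M} (hx : c u ∈ (chart d x₀).source) :
    Function.Bijective (fderiv ℝ (chart d x₀ ∘ c) u) := by
  have h1 : ⇑(fderiv ℝ (chart d x₀ ∘ c) u) =
      ⇑(coframe x₀ (c u) : 𝔼 d →L[ℝ] 𝔼 d) ∘ md (d := d) c u := by
    ext1 a; exact (hc.coframe_md hx a).symm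
  rw [h1]
  refine Function.Bijective.comp ⟨?_, ?_⟩ hb
  · exact Function.LeftInverse.injective (frame_coframe hx)
  · intro y
    refine ⟨(frame x₀ (chart d x₀ (c u)) : 𝔼 d →L[ℝ] 𝔼 d) y, ?_⟩
    have := coframe_frame ((chart d x₀).map_source hx) y
    rwa [(chart d x₀).left_inv hx] at this

theorem bijective_frame {x₀ : M} {u : 𝔼 d} (hu : u ∈ (chart d x₀).target) :
    Function.Bijective (md (d := d) (chart d x₀).symm u) := by
  refine ⟨Function.LeftInverse.injective (coframe_frame hu), fun y => ?_⟩
  refine ⟨(coframe x₀ ((chart d x₀).symm u) : 𝔼 d →L[ℝ] 𝔼 d) y, ?_⟩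
  have := frame_coframe ((chart d x₀).map_target hu) y
  rwa [(chart d x₀).right_inv hu] at this

omit [IsManifold 𝓘(ℝ, 𝔼 d) ∞ M] in
theorem IsIntegrable.nij_eq {J : EndField d M} (h : IsIntegrable J) (x : M) (a b : 𝔼 d) :
    nij (coordEnd J x) (chart d x x) a b = 0 := h x a b

theorem IsIntegrable.nij_eq_zero {J : EndField d M} (h : IsIntegrable J) (hJ : SmoothEnd J)
    {c : E → M} {u : E} (hc : SmAt d c u) (hb : Function.Bijective (md (d := d) c u))
    {K : E → E →L[ℝ] E} (hr : Represents c J K u) (hK : DifferentiableAt ℝ K u) (a b : E) :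
    nij K u a b = 0 := by
  have hx := mem_chart_self (d := d) (c u)
  refine (hc.bijective_fderiv hb hx).1 ?_
  rw [nij_pull (φ := chart d (c u) ∘ c) ((hJ.contDiffAt hx).differentiableAt (by simp)) hK
    ((hc.contDiffAt_chart hx).of_le two_le_infty) (hr.transition hc hx), map_zero]
  exact h.nij_eq (c u) _ _

/-- Integrability is tensorial, so that it may be tested in any parametrization. -/
theorem isIntegrable_of_param {J : EndField d M} (hJ : SmoothEnd J)
    (h : ∀ x : M, ∃ (c : E → M) (u : E) (K : E → E →L[ℝ] E), c u = x ∧ SmAt d c u ∧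
      Function.Bijective (md (d := d) c u) ∧ Represents c J K u ∧ DifferentiableAt ℝ K u ∧
      ∀ a b, nij K u a b = 0) : IsIntegrable J := by
  intro x a b
  obtain ⟨c, u, K, rfl, hc, hb, hr, hK, hn⟩ := h x
  have hx := mem_chart_self (d := d) (c u)
  obtain ⟨a, rfl⟩ := (hc.bijective_fderiv hb hx).2 a
  obtain ⟨b, rfl⟩ := (hc.bijective_fderiv hb hx).2 b
  have := nij_pull (φ := chart d (c u) ∘ c) ((hJ.contDiffAt hx).differentiableAt (by simp)) hK
    ((hc.contDiffAt_chart hx).of_le two_le_infty) (hr.transition hc hx) a b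
  rw [hn, map_zero] at this
  exact this.symm

omit [IsManifold 𝓘(ℝ, 𝔼 d) ∞ M] in
theorem IsClosed2.cyc_eq {β : BilForm d M ℝ} (h : IsClosed2 β) (x : M) (a b c : 𝔼 d) :
    cyc (coord2 β x) (chart d x x) a b c = 0 := h x a b c

omit [IsManifold 𝓘(ℝ, 𝔼 d) ∞ M] in
theorem coord2_alt {β : BilForm d M ℝ} (halt : ∀ x u, β x u u = 0) (x₀ : M) (z a b : 𝔼 d) :
    coord2 β x₀ z a b = -coord2 β x₀ z b a := by
  have h : ∀ a, coord2 β x₀ z a a = 0 := fun a => (coord2_apply β x₀ z a a).trans (halt _ _)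
  have := h (a + b)
  simp only [map_add, add_apply, h] at this
  linarith

theorem IsClosed2.cyc_pb2 {β : BilForm d M ℝ} (h : IsClosed2 β) (hβ : Smooth2 β)
    (halt : ∀ x u, β x u u = 0) {c : E → M} {u : E} (hc : SmAt d c u) (a₁ a₂ a₃ : E) :
    cyc (WKahler.pb2 c β) u a₁ a₂ a₃ = 0 := by
  have hx := mem_chart_self (d := d) (c u)
  rw [cyc, (hc.pb2_eq hx β).fderiv_eq, ← cyc, cyc_pullF (φ := chart d (c u) ∘ c)
    ((hβ.contDiffAt hx).of_le (by simp))
    ((hc.contDiffAt_chart hx).of_le two_le_infty) (coord2_alt halt _ _)]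
  exact h.cyc_eq (c u) _ _ _

/-- Closedness is tensorial, so that it may be tested in any parametrization. -/
theorem isClosed2_of_param {β : BilForm d M ℝ} (hβ : Smooth2 β) (halt : ∀ x u, β x u u = 0)
    (h : ∀ x : M, ∃ (c : E → M) (u : E), c u = x ∧ SmAt d c u ∧
      Function.Bijective (md (d := d) c u) ∧ ∀ a₁ a₂ a₃, cyc (pb2 c β) u a₁ a₂ a₃ = 0) :
    IsClosed2 β := by
  intro x a₁ a₂ a₃
  obtain ⟨c, u, rfl, hc, hb, hn⟩ := h x
  have hx := mem_chart_self (d := d) (c u)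
  obtain ⟨a₁, rfl⟩ := (hc.bijective_fderiv hb hx).2 a₁
  obtain ⟨a₂, rfl⟩ := (hc.bijective_fderiv hb hx).2 a₂
  obtain ⟨a₃, rfl⟩ := (hc.bijective_fderiv hb hx).2 a₃
  have := hn a₁ a₂ a₃
  rw [cyc, (hc.pb2_eq hx β).fderiv_eq, ← cyc, cyc_pullF (φ := chart d (c u) ∘ c)
    ((hβ.contDiffAt hx).of_le (by simp))
    ((hc.contDiffAt_chart hx).of_le two_le_infty) (coord2_alt halt _ _)] at this
  exact this

/-- A smooth map with invertible differential has a smooth local inverse. -/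
theorem exists_local_inverse {F : Type*} [NormedAddCommGroup F] [NormedSpace ℝ F]
    [FiniteDimensional ℝ E] [FiniteDimensional ℝ F] {φ : E → F} {u : E}
    (hφ : ContDiffAt ℝ ∞ φ u) (hb : Function.Bijective (fderiv ℝ φ u)) :
    ∃ ρ : F → E, ρ (φ u) = u ∧ ContDiffAt ℝ ∞ ρ (φ u) ∧ (∀ᶠ w in 𝓝 (φ u), φ (ρ w) = w) ∧
      ∀ᶠ z in 𝓝 u, ρ (φ z) = z := by
  let T : E ≃L[ℝ] F := (LinearEquiv.ofBijective (fderiv ℝ φ u).toLinearMap hb).toContinuousLinearEquiv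
  have hT : HasFDerivAt φ (T : E →L[ℝ] F) u := (hφ.differentiableAt (by simp)).hasFDerivAt
  have hs := hφ.hasStrictFDerivAt' hT (by simp)
  exact ⟨hφ.localInverse hT (by simp), hφ.localInverse_apply_image hT (by simp),
    hφ.to_localInverse hT (by simp), hs.eventually_right_inverse, hs.eventually_left_inverse⟩

omit [IsManifold 𝓘(ℝ, 𝔼 d) ∞ M] in
theorem pullF_pullF {F : Type*} [NormedAddCommGroup F] [NormedSpace ℝ F]
    {W : Type*} [NormedAddCommGroup W] [NormedSpace ℝ W]
    {G : F → F →L[ℝ] F →L[ℝ] V} {φ : E → F} {ρ : W → E} {w : W}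
    (hφ : DifferentiableAt ℝ φ (ρ w)) (hρ : DifferentiableAt ℝ ρ w) :
    pullF (pullF G φ) ρ w = pullF G (φ ∘ ρ) w := by
  ext a b
  simp only [pullF, pull2_apply, fderiv_comp w hφ hρ]
  rfl

/-- Chart and parametrization: the local inverse of the transition map. -/
theorem SmAt.exists_inverse [FiniteDimensional ℝ E] {c : E → M} {u : E} (hc : SmAt d c u)
    (hb : Function.Bijective (md (d := d) c u)) {x₀ : M} (hx : c u ∈ (chart d x₀).source) :
    ∃ ρ : 𝔼 d → E, ρ (chart d x₀ (c u)) = u ∧ (∀ᶠ w in 𝓝 (chart d x₀ (c u)), ContDiffAt ℝ ∞ ρ w ∧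
      (chart d x₀ ∘ c) (ρ w) = w ∧ SmAt d c (ρ w) ∧ c (ρ w) = (chart d x₀).symm w ∧
      c (ρ w) ∈ (chart d x₀).source) := by
  obtain ⟨ρ, h1, h2, h3, h4⟩ := exists_local_inverse (hc.contDiffAt_chart hx)
    (hc.bijective_fderiv hb hx)
  refine ⟨ρ, h1, ?_⟩
  have hρc : ContinuousAt ρ (chart d x₀ (c u)) := h2.continuousAt
  have hev : ∀ᶠ z in 𝓝 u, SmAt d c z ∧ c z ∈ (chart d x₀).source ∧
      Function.Bijective (fderiv ℝ (chart d x₀ ∘ c) z) ∧ ρ (chart d x₀ (c z)) = z := by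
    have hbe : ∀ᶠ z in 𝓝 u, Function.Bijective (fderiv ℝ (chart d x₀ ∘ c) z) := by
      have hcont : ContinuousAt (fderiv ℝ (chart d x₀ ∘ c)) u :=
        ((hc.contDiffAt_chart hx).fderiv_right (m := 0) (by simp)).continuousAt
      let T : E ≃L[ℝ] 𝔼 d := (LinearEquiv.ofBijective
        (fderiv ℝ (chart d x₀ ∘ c) u).toLinearMap
        (hc.bijective_fderiv hb hx)).toContinuousLinearEquiv
      have hT : (T : E →L[ℝ] 𝔼 d) = fderiv ℝ (chart d x₀ ∘ c) u := by ext; rfl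
      have := T.nhds
      rw [hT] at this
      filter_upwards [hcont.eventually this] with z hz
      obtain ⟨S, hS⟩ := hz
      rw [← hS]
      exact S.bijective
    filter_upwards [hc.eventually, hc.mem_source hx, hbe, h4] with z a1 a2 a3 a4
    exact ⟨a1, a2, a3, a4⟩
  have h5 : ∀ᶠ w in 𝓝 (chart d x₀ (c u)), ∀ᶠ w' in 𝓝 w, (chart d x₀ ∘ c) (ρ w') = w' :=
    h3.eventually_nhds
  have hev' := hρc.eventually ((congrArg 𝓝 h1).symm ▸ hev)
  -- smoothness of the inverse at nearby points comes from the inverse function theorem there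
  have h6 : ∀ᶠ w in 𝓝 (chart d x₀ (c u)), ContinuousAt ρ w :=
    ((h2.of_le (m := 1) (by simp)).eventually (by simp)).mono
      fun w hw => hw.continuousAt
  filter_upwards [hev', h5, h6] with w ⟨b1, b2, b3, b4⟩ hw hcw
  have hw0 : (chart d x₀ ∘ c) (ρ w) = w := hw.self_of_nhds
  refine ⟨?_, hw0, b1, ?_, b2⟩
  · obtain ⟨ρ', r1, r2, r3, r4⟩ := exists_local_inverse (b1.contDiffAt_chart b2) b3
    rw [hw0] at r1 r2 r3
    refine r2.congr_of_eventuallyEq ?_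
    filter_upwards [hcw.eventually r4, hw] with w' s1 s2
    rw [← s1, s2]
  · have h7 : (chart d x₀) (c (ρ w)) = w := hw0
    conv_rhs => rw [← h7]
    exact ((chart d x₀).left_inv b2).symm

/-- Smoothness of a bilinear form field may be tested in local parametrizations. -/
theorem smooth2_of_param [FiniteDimensional ℝ E] {β : BilForm d M V}
    (h : ∀ x : M, ∃ (c : E → M) (u : E), c u = x ∧ SmAt d c u ∧
      Function.Bijective (md (d := d) c u) ∧ ContDiffAt ℝ ∞ (pb2 c β) u) : Smooth2 β := by
  intro x₀ u' hu'
  refine ContDiffAt.contDiffWithinAt ?_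
  obtain ⟨c, u, hcu, hc, hb, hs⟩ := h ((chart d x₀).symm u')
  have hx : c u ∈ (chart d x₀).source := by rw [hcu]; exact (chart d x₀).map_target hu'
  have hu : chart d x₀ (c u) = u' := by rw [hcu]; exact (chart d x₀).right_inv hu'
  obtain ⟨ρ, h1, h2⟩ := hc.exists_inverse hb hx
  rw [hu] at h1 h2
  have e : coord2 β x₀ =ᶠ[𝓝 u'] pullF (pb2 c β) ρ := by
    have h3 : ∀ᶠ w in 𝓝 u', pb2 c β (ρ w) = pullF (coord2 β x₀) (chart d x₀ ∘ c) (ρ w) :=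
      h2.self_of_nhds.1.continuousAt.eventually (by rw [h1]; exact hc.pb2_eq hx β)
    filter_upwards [h2, h3, h2.eventually_nhds] with w h4 h5 h6
    have h7 := pullF_pullF (G := coord2 β x₀)
      ((h4.2.2.1.contDiffAt_chart h4.2.2.2.2).differentiableAt (by simp))
      (h4.1.differentiableAt (by simp))
    have h8 : (chart d x₀ ∘ c) ∘ ρ =ᶠ[𝓝 w] id := h6.mono fun w' hw' => hw'.2.1
    rw [pullF, h5]
    rw [pullF] at h7
    rw [h7, pullF, h8.fderiv_eq, fderiv_id]
    have h9 : ((chart d x₀ ∘ c) ∘ ρ) w = w := h4.2.1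
    rw [h9]
    ext; rfl
  refine ContDiffAt.congr_of_eventuallyEq ?_ e
  exact ContDiffAt.pullF (by rw [h1]; exact hs) h2.self_of_nhds.1 (by simp)

/-- Smoothness of an endomorphism field may be tested in local parametrizations. -/
theorem smoothEnd_of_param [FiniteDimensional ℝ E] {J : EndField d M}
    (h : ∀ x : M, ∃ (c : E → M) (u : E) (K : E → E →L[ℝ] E), c u = x ∧ SmAt d c u ∧
      Function.Bijective (md (d := d) c u) ∧ Represents c J K u ∧ ContDiffAt ℝ ∞ K u) :
    SmoothEnd J := by
  intro x₀ u' hu'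
  refine ContDiffAt.contDiffWithinAt ?_
  obtain ⟨c, u, K, hcu, hc, hb, hr, hs⟩ := h ((chart d x₀).symm u')
  have hx : c u ∈ (chart d x₀).source := by rw [hcu]; exact (chart d x₀).map_target hu'
  have hu : chart d x₀ (c u) = u' := by rw [hcu]; exact (chart d x₀).right_inv hu'
  obtain ⟨ρ, h1, h2⟩ := hc.exists_inverse hb hx
  rw [hu] at h1 h2
  have e : coordEnd J x₀ =ᶠ[𝓝 u'] fun w => ((fderiv ℝ (chart d x₀ ∘ c) (ρ w)).comp (K (ρ w))).comp
      (fderiv ℝ ρ w) := by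
    have h3 := h2.self_of_nhds.1.continuousAt.eventually (by rw [h1]; exact hr.transition hc hx)
    filter_upwards [h2, h3, h2.eventually_nhds] with w h4 h5 h6
    ext1 a
    rw [ContinuousLinearMap.comp_apply, ContinuousLinearMap.comp_apply, h5, h4.2.1]
    congr 1
    have h8 : (chart d x₀ ∘ c) ∘ ρ =ᶠ[𝓝 w] id := h6.mono fun w' hw' => hw'.2.1
    have h9 := fderiv_comp w ((h4.2.2.1.contDiffAt_chart h4.2.2.2.2).differentiableAt (by simp))
      (h4.1.differentiableAt (by simp))
    rw [h8.fderiv_eq, fderiv_id] at h9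
    exact DFunLike.congr_fun h9 a
  refine ContDiffAt.congr_of_eventuallyEq ?_ e
  have hρ := h2.self_of_nhds.1
  have h3 : ContDiffAt ℝ ∞ (fderiv ℝ (chart d x₀ ∘ c)) (ρ u') := by
    rw [h1]; exact (hc.contDiffAt_chart hx).fderiv_right (by simp)
  have h4 : ContDiffAt ℝ ∞ K (ρ u') := by rw [h1]; exact hs
  exact ((h3.comp u' hρ).clm_comp (h4.comp u' hρ)).clm_comp (hρ.fderiv_right (by simp))

/-- A Riemannian metric. -/
structure IsRiem (g : BilForm d M ℝ) : Prop where
  smooth : Smooth2 g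
  symm : ∀ x u w, g x u w = g x w u
  pos : ∀ x u, u ≠ 0 → 0 < g x u u

theorem coord2_pos {g : BilForm d M ℝ} (hg : IsRiem g) {x₀ x : M} (hx : x ∈ (chart d x₀).source)
    (a : 𝔼 d) (ha : a ≠ 0) : 0 < coord2 g x₀ (chart d x₀ x) a a := by
  rw [coord2_apply]
  refine hg.pos _ _ fun h => ha ?_
  have h2 := (bijective_frame (d := d) ((chart d x₀).map_source hx)).1
  exact h2 (h.trans (map_zero _).symm)

section Frames

variable {ι : Type*} [Fintype ι] [DecidableEq ι]

/-- An orthonormal frame for the pull-back of `g` by `c` is mapped to one for `g` in the chart. -/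
theorem SmAt.isFrame {g : BilForm d M ℝ} {c : E → M} {u : E} (hc : SmAt d c u)
    (hb : Function.Surjective (md (d := d) c u)) {e : ι → E} (he : IsFrame (pb2 c g u) e) :
    IsFrame (coord2 g (c u) ((chart d (c u) ∘ c) u))
      fun i => fderiv ℝ (chart d (c u) ∘ c) u (e i) := by
  have hx := mem_chart_self (d := d) (c u)
  have h1 : ∀ a b, coord2 g (c u) ((chart d (c u) ∘ c) u) (fderiv ℝ (chart d (c u) ∘ c) u a)
      (fderiv ℝ (chart d (c u) ∘ c) u b) = pb2 c g u a b := by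
    intro a b
    rw [(hc.pb2_eq hx g).self_of_nhds]; rfl
  refine ⟨fun i j => by rw [h1, he.orth], fun x => ?_⟩
  obtain ⟨y, hy⟩ := hb ((frame (c u) ((chart d (c u) ∘ c) u) : 𝔼 d →L[ℝ] 𝔼 d) x)
  have : fderiv ℝ (chart d (c u) ∘ c) u y = x := by
    rw [← hc.coframe_md hx, hy]
    have := coframe_frame ((chart d (c u)).map_source hx) x
    rwa [(chart d (c u)).left_inv hx] at this
  rw [← this]
  simp only [h1]
  conv_lhs => rw [he.expand y]
  simp only [map_sum, map_smul]

theorem IsRiem.coord2_symm {g : BilForm d M ℝ} (hg : IsRiem g) (x₀ : M) (z a b : 𝔼 d) :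
    coord2 g x₀ z a b = coord2 g x₀ z b a := by
  rw [coord2_apply, coord2_apply]
  exact hg.symm _ _ _

/-- The scalar curvature in an arbitrary parametrization. -/
theorem scal_eq_scalJet {g : BilForm d M ℝ} (hg : IsRiem g) {c : E → M} {u : E} (hc : SmAt d c u)
    (hb : Function.Surjective (md (d := d) c u)) {e : ι → E} (he : IsFrame (pb2 c g u) e) :
    scal g (c u) = scalJet (pb2 c g) u e := by
  have hx := mem_chart_self (d := d) (c u)
  have h := sum_ricci_eq_scalJet (φ := chart d (c u) ∘ c)
    ((hg.smooth.contDiffAt hx).of_le two_le_infty)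
    (Filter.Eventually.of_forall (hg.coord2_symm (c u))) (coord2_pos hg hx)
    ((hc.contDiffAt_chart hx).of_le three_le_infty) (hc.isFrame hb he)
  have e1 := hc.pb2_eq hx g
  have e2 : fderiv ℝ (pb2 c g) =ᶠ[𝓝 u] fderiv ℝ (pullF (coord2 g (c u)) (chart d (c u) ∘ c)) :=
    e1.eventually_nhds.mono fun z hz => Filter.EventuallyEq.fderiv_eq hz
  have e3 : ∀ a b c', fderiv ℝ (fun z => fderiv ℝ (pb2 c g) z a b c') u =
      fderiv ℝ (fun z => fderiv ℝ (pullF (coord2 g (c u)) (chart d (c u) ∘ c)) z a b c') u :=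
    fun a b c' => Filter.EventuallyEq.fderiv_eq (e2.mono fun z hz => by simp only [hz])
  refine (show scal g (c u) = _ from h).trans ?_
  simp only [scalJet, e3, chr1, e1.fderiv_eq]

/-- The Laplacian in an arbitrary parametrization. -/
theorem laplacian_eq_lapJet {g : BilForm d M ℝ} (hg : IsRiem g) {c : E → M} {u : E}
    (hc : SmAt d c u) (hb : Function.Surjective (md (d := d) c u)) {e : ι → E}
    (he : IsFrame (pb2 c g u) e) {f : M → ℝ} (hf : ContMDiff 𝓘(ℝ, 𝔼 d) 𝓘(ℝ, ℝ) ∞ f) :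
    laplacian g f (c u) = lapJet (pb2 c g) (f ∘ c) u e := by
  have hx := mem_chart_self (d := d) (c u)
  have hfs : ContDiffAt ℝ 2 (f ∘ (chart d (c u)).symm) ((chart d (c u) ∘ c) u) := by
    have : ContMDiffAt 𝓘(ℝ, 𝔼 d) 𝓘(ℝ, ℝ) ∞ (f ∘ (chart d (c u)).symm) ((chart d (c u) ∘ c) u) :=
      hf.contMDiffAt.comp _ (smAt_chart_symm (c u) ((chart d (c u)).map_source hx)).contMDiffAt
    exact this.contDiffAt.of_le two_le_infty
  have h := sum_laplacian_eq_lapJet (φ := chart d (c u) ∘ c)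
    ((hg.smooth.contDiffAt hx).of_le two_le_infty)
    (Filter.Eventually.of_forall (hg.coord2_symm (c u))) (coord2_pos hg hx)
    ((hc.contDiffAt_chart hx).of_le three_le_infty) (hc.isFrame hb he) hfs
  have e1 := hc.pb2_eq hx g
  have e2 : (f ∘ (chart d (c u)).symm) ∘ (chart d (c u) ∘ c) =ᶠ[𝓝 u] f ∘ c := by
    filter_upwards [hc.mem_source hx] with z hz
    simp only [Function.comp_apply, (chart d (c u)).left_inv hz]
  have e3 : ∀ a, fderiv ℝ (fun z => fderiv ℝ ((f ∘ (chart d (c u)).symm) ∘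
      (chart d (c u) ∘ c)) z a) u = fderiv ℝ (fun z => fderiv ℝ (f ∘ c) z a) u := fun a =>
    Filter.EventuallyEq.fderiv_eq (e2.eventually_nhds.mono fun z hz => by
      simp only [Filter.EventuallyEq.fderiv_eq hz])
  refine (show laplacian g f (c u) = _ from h).trans ?_
  simp only [lapJet, chr1, e1.fderiv_eq, e2.fderiv_eq, e3]

end Frames

/-- A positive definite symmetric form has an orthonormal frame. -/
theorem exists_frame [FiniteDimensional ℝ E] (β : E →L[ℝ] E →L[ℝ] ℝ)
    (hs : ∀ a b, β a b = β b a) (hpos : ∀ a, a ≠ 0 → 0 < β a a) :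
    ∃ e : Fin (Module.finrank ℝ E) → E, IsFrame β e := by
  obtain ⟨b, hb⟩ := LinearMap.BilinForm.exists_orthogonal_basis (K := ℝ) (V := E)
    (B := ContinuousLinearMap.toBilinForm β) ⟨fun a b => by simpa using hs a b⟩
  have hne : ∀ i, 0 < β (b i) (b i) := fun i => hpos _ (b.ne_zero i)
  have horth : ∀ i j, i ≠ j → β (b i) (b j) = 0 := fun i j hij => hb hij
  have h1 : ∀ i j, β ((Real.sqrt (β (b i) (b i)))⁻¹ • b i)
      ((Real.sqrt (β (b j) (b j)))⁻¹ • b j) = if i = j then 1 else 0 := by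
    intro i j
    simp only [map_smul, smul_apply, smul_eq_mul]
    split_ifs with h
    · subst h
      have := Real.mul_self_sqrt (hne i).le
      have h0 : Real.sqrt (β (b i) (b i)) ≠ 0 := (Real.sqrt_pos.2 (hne i)).ne'
      field_simp
      rw [sq, this]
    · rw [horth i j h]; simp
  refine ⟨fun i => (Real.sqrt (β (b i) (b i)))⁻¹ • b i, h1, fun x => ?_⟩
  have h2 : ∀ k, β x ((Real.sqrt (β (b k) (b k)))⁻¹ • b k) = (Real.sqrt (β (b k) (b k)))⁻¹ *
      (b.repr x k * β (b k) (b k)) := by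
    intro k
    rw [map_smul, smul_eq_mul]
    congr 1
    conv_lhs => rw [← b.sum_repr x]
    simp only [map_sum, map_smul, sum_apply, smul_apply, smul_eq_mul]
    rw [Finset.sum_eq_single k (fun j _ hj => by rw [horth j k hj, mul_zero]) (by simp)]
  conv_lhs => rw [← b.sum_repr x]
  refine Finset.sum_congr rfl fun k _ => ?_
  rw [h2, smul_smul]
  congr 1
  have := Real.mul_self_sqrt (hne k).le
  have h0 : Real.sqrt (β (b k) (b k)) ≠ 0 := (Real.sqrt_pos.2 (hne k)).ne'
  field_simp
  rw [sq, this]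

end PullBack

/-! ### Torus actions -/

section Action

variable {d r : ℕ} {M : Type*} [TopologicalSpace M] [ChartedSpace (𝔼 d) M]
  {E : Type*} [NormedAddCommGroup E] [NormedSpace ℝ E]

/-- The differential of a map between manifolds. -/
def dmap {d' : ℕ} {N : Type*} [TopologicalSpace N] [ChartedSpace (𝔼 d') N] (f : M → N) (x : M) :
    𝔼 d →L[ℝ] 𝔼 d' := mfderiv 𝓘(ℝ, 𝔼 d) 𝓘(ℝ, 𝔼 d') f x

/-- The differential of a function on a manifold. -/
def dfun {V : Type*} [NormedAddCommGroup V] [NormedSpace ℝ V] (f : M → V) (x : M) :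
    𝔼 d →L[ℝ] V := mfderiv 𝓘(ℝ, 𝔼 d) 𝓘(ℝ, V) f x

variable (d) in
/-- The generator of an action as a vector of the model space. -/
def genV (τ : LieT r → M → M) (ξ : LieT r) (x : M) : 𝔼 d := gen τ ξ x

theorem SmAt.md_comp {d' : ℕ} {N : Type*} [TopologicalSpace N] [ChartedSpace (𝔼 d') N] {f : M → N}
    {c : E → M} {u : E} (hc : SmAt d c u) (hf : MDifferentiableAt 𝓘(ℝ, 𝔼 d) 𝓘(ℝ, 𝔼 d') f (c u))
    (a : E) : md (d := d') (f ∘ c) u a = dmap (d := d) f (c u) (md c u a) := by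
  rw [md, mfderiv_comp u hf hc.mdiff]
  rfl

theorem SmAt.comp {d' : ℕ} {N : Type*} [TopologicalSpace N] [ChartedSpace (𝔼 d') N] {f : M → N}
    {c : E → M} {u : E} (hc : SmAt d c u) (hf : ContMDiff 𝓘(ℝ, 𝔼 d) 𝓘(ℝ, 𝔼 d') ∞ f) :
    SmAt d' (f ∘ c) u :=
  hc.mono fun _ hz => hf.contMDiffAt.comp _ hz

theorem SmAt.comp_left {F : Type*} [NormedAddCommGroup F] [NormedSpace ℝ F] {c : E → M} {φ : F → E}
    {w : F} (hc : SmAt d c (φ w)) (hφ : ∀ᶠ z in 𝓝 w, ContDiffAt ℝ ∞ φ z) : SmAt d (c ∘ φ) w := by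
  filter_upwards [hφ.self_of_nhds.continuousAt.eventually hc, hφ] with z h1 h2
  exact ContMDiffAt.comp z h1 h2.contMDiffAt

theorem SmAt.md_comp_left {F : Type*} [NormedAddCommGroup F] [NormedSpace ℝ F] {c : E → M}
    {φ : F → E} {w : F} (hc : SmAt d c (φ w)) (hφ : DifferentiableAt ℝ φ w) (a : F) :
    md (d := d) (c ∘ φ) w a = md c (φ w) (fderiv ℝ φ w a) := by
  rw [md, mfderiv_comp w hc.mdiff hφ.mdifferentiableAt, mfderiv_eq_fderiv]
  rfl

theorem SmAt.md_comp_left_const {F : Type*} [NormedAddCommGroup F] [NormedSpace ℝ F] {c : E → M}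
    {φ : F → E} {w : F} {u : E} (hc : SmAt d c u) (hu : φ w = u) (hφ : DifferentiableAt ℝ φ w)
    (a : F) : md (d := d) (c ∘ φ) w a = md c u (fderiv ℝ φ w a) := by
  subst hu; exact hc.md_comp_left hφ a

theorem SmAt.fderiv_fun {V : Type*} [NormedAddCommGroup V] [NormedSpace ℝ V] {c : E → M} {u : E}
    (hc : SmAt d c u) {f : M → V} (hf : MDifferentiableAt 𝓘(ℝ, 𝔼 d) 𝓘(ℝ, V) f (c u)) (a : E) :
    fderiv ℝ (f ∘ c) u a = dfun (d := d) f (c u) (md c u a) := by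
  rw [← mfderiv_eq_fderiv, mfderiv_comp u hf hc.mdiff]
  rfl

theorem SmAt.contDiffAt_fun {V : Type*} [NormedAddCommGroup V] [NormedSpace ℝ V] {c : E → M} {u : E}
    (hc : SmAt d c u) {f : M → V} (hf : ContMDiff 𝓘(ℝ, 𝔼 d) 𝓘(ℝ, V) ∞ f) :
    ContDiffAt ℝ ∞ (f ∘ c) u :=
  (hf.contMDiffAt.comp u hc.contMDiffAt).contDiffAt

theorem contMDiff_of_chart [IsManifold 𝓘(ℝ, 𝔼 d) ∞ M] {V : Type*} [NormedAddCommGroup V]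
    [NormedSpace ℝ V] {f : M → V}
    (h : ∀ x, ContDiffAt ℝ ∞ (f ∘ (chart d x).symm) (chart d x x)) :
    ContMDiff 𝓘(ℝ, 𝔼 d) 𝓘(ℝ, V) ∞ f := by
  intro x
  have h1 : ContMDiffAt 𝓘(ℝ, 𝔼 d) 𝓘(ℝ, 𝔼 d) ∞ (chart d x) x := contMDiffAt_extChartAt
  refine ((h x).contMDiffAt.comp x h1).congr_of_eventuallyEq ?_
  filter_upwards [chart_source_mem_nhds (mem_chart_self (d := d) x)] with z hz
  simp only [Function.comp_apply, (chart d x).left_inv hz]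

theorem dmap_comp {d₁ d₂ : ℕ} {N₁ N₂ : Type*} [TopologicalSpace N₁] [ChartedSpace (𝔼 d₁) N₁]
    [TopologicalSpace N₂] [ChartedSpace (𝔼 d₂) N₂] {f : N₁ → N₂} {g : M → N₁} {x : M}
    (hf : MDifferentiableAt 𝓘(ℝ, 𝔼 d₁) 𝓘(ℝ, 𝔼 d₂) f (g x))
    (hg : MDifferentiableAt 𝓘(ℝ, 𝔼 d) 𝓘(ℝ, 𝔼 d₁) g x) (u : 𝔼 d) :
    dmap (d := d) (d' := d₂) (f ∘ g) x u = dmap (d := d₁) f (g x) (dmap g x u) := by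
  rw [dmap, mfderiv_comp x hf hg]
  rfl

theorem dfun_comp {d₁ : ℕ} {N₁ V : Type*} [TopologicalSpace N₁] [ChartedSpace (𝔼 d₁) N₁]
    [NormedAddCommGroup V] [NormedSpace ℝ V] {f : N₁ → V} {g : M → N₁} {x : M}
    (hf : MDifferentiableAt 𝓘(ℝ, 𝔼 d₁) 𝓘(ℝ, V) f (g x))
    (hg : MDifferentiableAt 𝓘(ℝ, 𝔼 d) 𝓘(ℝ, 𝔼 d₁) g x) (u : 𝔼 d) :
    dfun (d := d) (f ∘ g) x u = dfun (d := d₁) f (g x) (dmap g x u) := by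
  rw [dfun, mfderiv_comp x hf hg]
  rfl

namespace IsTorusAction

variable {τ : LieT r → M → M} (hτ : IsTorusAction d τ)
include hτ

theorem contMDiff (t : LieT r) : ContMDiff 𝓘(ℝ, 𝔼 d) 𝓘(ℝ, 𝔼 d) ∞ (τ t) :=
  hτ.smooth.comp (contMDiff_const.prodMk contMDiff_id)

theorem mdiff (t : LieT r) (x : M) : MDifferentiableAt 𝓘(ℝ, 𝔼 d) 𝓘(ℝ, 𝔼 d) (τ t) x :=
  (hτ.contMDiff t).mdifferentiableAt (by simp)

/-- The map `(t, z) ↦ t · c(z)`. -/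
theorem smAt_act {W : Type*} [NormedAddCommGroup W] [NormedSpace ℝ W] {t : W → LieT r} {c : W → M}
    {w : W} (ht : ∀ᶠ z in 𝓝 w, ContDiffAt ℝ ∞ t z) (hc : SmAt d c w) :
    SmAt d (fun z => τ (t z) (c z)) w := by
  filter_upwards [ht, hc] with z h1 h2
  exact hτ.smooth.contMDiffAt.comp z (h1.contMDiffAt.prodMk h2)

theorem smAt_prod {c : E → M} {u : E} (hc : SmAt d c u) (s : LieT r) :
    SmAt d (fun z : LieT r × E => τ z.1 (c z.2)) (s, u) := by
  refine hτ.smAt_act (Filter.Eventually.of_forall fun z => contDiffAt_fst) ?_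
  exact SmAt.comp_left (φ := Prod.snd) hc (Filter.Eventually.of_forall fun z => contDiffAt_snd)

theorem smAt_orbit (x : M) (s : LieT r) : SmAt d (fun t => τ t x) s :=
  hτ.smAt_act (Filter.Eventually.of_forall fun _ => contDiffAt_id)
    (Filter.Eventually.of_forall fun _ => contMDiffAt_const)

theorem gen_eq (ξ : LieT r) (x : M) : genV d τ ξ x = md (d := d) (fun t => τ t x) 0 ξ := by
  have h := SmAt.md_comp_left_const (φ := fun s : ℝ => s • ξ) (w := 0) (u := (0 : LieT r))
    (hτ.smAt_orbit x 0) (zero_smul ℝ ξ) (by fun_prop) (1 : ℝ)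
  have h2 : fderiv ℝ (fun s : ℝ => s • ξ) 0 1 = ξ := by
    rw [fderiv_smul_const differentiableAt_fun_id]
    simp
  rw [h2] at h
  exact h

theorem gen_sum (ξ : LieT r) (x : M) :
    genV d τ ξ x = ∑ i, ξ i • genV d τ (bas i) x := by
  simp only [hτ.gen_eq, ← map_smul, ← map_sum]
  congr 1
  ext j
  simp [bas, Finset.sum_apply, Pi.single_apply]

theorem md_orbit (t ξ : LieT r) (x : M) :
    md (d := d) (fun s => τ s x) t ξ = genV d τ ξ (τ t x) := by
  rw [hτ.gen_eq]
  have h := SmAt.md_comp_left_const (φ := fun s : LieT r => s - t) (w := t) (u := (0 : LieT r))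
    (hτ.smAt_orbit (τ t x) 0) (sub_self t) (by fun_prop) ξ
  have h2 : fderiv ℝ (fun s : LieT r => s - t) t ξ = ξ := by
    rw [fderiv_sub_const, fderiv_fun_id]; rfl
  rw [h2] at h
  rw [← h]
  congr 2
  ext s
  simp only [Function.comp_apply, ← hτ.add_act, sub_add_cancel]

theorem dmap_gen (t ξ : LieT r) (x : M) :
    dmap (τ t) x (genV d τ ξ x) = genV d τ ξ (τ t x) := by
  have h := (hτ.smAt_orbit x 0).md_comp (f := τ t) (hτ.mdiff t _) ξ
  rw [← hτ.gen_eq, hτ.zero_act] at h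
  rw [← h, hτ.gen_eq]
  congr 2
  ext s
  simp only [Function.comp_apply, ← hτ.add_act, add_comm]

/-- The derivative of `(t, u) ↦ τ_t (c u)`: the torus direction contributes the generator. -/
theorem md_prod {c : E → M} {u : E} (hc : SmAt d c u) (s ξ : LieT r) (a : E) :
    md (d := d) (fun z : LieT r × E => τ z.1 (c z.2)) (s, u) (ξ, a) =
      genV d τ ξ (τ s (c u)) + dmap (d := d) (τ s) (c u) (md (d := d) c u a) := by
  have hs := hτ.smAt_prod hc s
  have h1 := SmAt.md_comp_left_const (φ := fun t : LieT r => (t, u)) (w := s) hs rfl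
    (by fun_prop) ξ
  have h2 := SmAt.md_comp_left_const (φ := fun z : E => (s, z)) (w := u) hs rfl (by fun_prop) a
  have e1 : fderiv ℝ (fun t : LieT r => (t, u)) s ξ = (ξ, 0) := by
    rw [(hasFDerivAt_prodMk_left s u).fderiv]; rfl
  have e2 : fderiv ℝ (fun z : E => (s, z)) u a = (0, a) := by
    rw [(hasFDerivAt_prodMk_right s u).fderiv]; rfl
  rw [e1] at h1
  rw [e2] at h2
  have e3 : ((ξ, a) : LieT r × E) = (ξ, 0) + (0, a) := by simp
  rw [e3, map_add, ← h1, ← h2]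
  congr 1
  · exact hτ.md_orbit s ξ (c u)
  · exact hc.md_comp (f := τ s) (hτ.mdiff s _) a

/-- More generally, the differential of `z ↦ t(z) · c(z)`. -/
theorem md_act {t : E → LieT r} {c : E → M} {u : E} (ht : DifferentiableAt ℝ t u)
    (hc : SmAt d c u) (a : E) :
    md (d := d) (fun z => τ (t z) (c z)) u a =
      genV d τ (fderiv ℝ t u a) (τ (t u) (c u)) + dmap (d := d) (τ (t u)) (c u) (md (d := d) c u a) := by
  have h := SmAt.md_comp_left_const (φ := fun z : E => (t z, z)) (w := u) (hτ.smAt_prod hc (t u))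
    rfl (ht.prodMk differentiableAt_fun_id) a
  rw [DifferentiableAt.fderiv_prodMk ht differentiableAt_fun_id] at h
  simp only [fderiv_fun_id, ContinuousLinearMap.prod_apply, ContinuousLinearMap.id_apply] at h
  rw [hτ.md_prod hc] at h
  exact h

/-- The generators in a parametrization. -/
theorem exists_gen_param [IsManifold 𝓘(ℝ, 𝔼 d) ∞ M] (x₀ : M) :
    ∃ G : 𝔼 d → LieT r →L[ℝ] 𝔼 d, ∀ z ∈ (chart d x₀).target, ContDiffAt ℝ ∞ G z ∧
      ∀ ξ, md (chart d x₀).symm z (G z ξ) = genV d τ ξ ((chart d x₀).symm z) := by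
  let F : LieT r × 𝔼 d → 𝔼 d := chart d x₀ ∘ fun z : LieT r × 𝔼 d => τ z.1 ((chart d x₀).symm z.2)
  refine ⟨fun z => (fderiv ℝ F (0, z)).comp (ContinuousLinearMap.inl ℝ _ _), fun z hz => ?_⟩
  have hs := hτ.smAt_prod (smAt_chart_symm x₀ hz) 0
  have hx : τ 0 ((chart d x₀).symm z) ∈ (chart d x₀).source := by
    rw [hτ.zero_act]; exact (chart d x₀).map_target hz
  have hF : ContDiffAt ℝ ∞ F (0, z) := hs.contDiffAt_chart hx
  refine ⟨?_, fun ξ => ?_⟩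
  · have h1 : ContDiffAt ℝ ∞ (fun z => fderiv ℝ F (0, z)) z :=
      ContDiffAt.comp (f := fun z => ((0 : LieT r), z)) z (hF.fderiv_right (by simp))
        (contDiffAt_const.prodMk contDiffAt_id)
    exact h1.clm_comp contDiffAt_const
  · have h1 := hs.coframe_md hx (ξ, 0)
    rw [hτ.md_prod (smAt_chart_symm x₀ hz), map_zero, map_zero, add_zero] at h1
    have h2 : (fderiv ℝ F (0, z)).comp (ContinuousLinearMap.inl ℝ _ _) ξ = fderiv ℝ F (0, z) (ξ, 0) :=
      rfl
    rw [h2, show fderiv ℝ F (0, z) (ξ, 0) = _ from h1.symm]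
    have h3 := frame_coframe ((chart d x₀).map_target hz)
      (genV d τ ξ ((chart d x₀).symm z))
    rw [(chart d x₀).right_inv hz] at h3
    rw [hτ.zero_act]
    exact h3

/-- Invariant functions are constant along the orbits. -/
theorem dfun_gen {f : M → ℝ} (hf : ContMDiff 𝓘(ℝ, 𝔼 d) 𝓘(ℝ, ℝ) ∞ f) (hi : ∀ t x, f (τ t x) = f x)
    (ξ : LieT r) (x : M) : dfun f x (genV d τ ξ x) = 0 := by
  have h := (hτ.smAt_orbit x 0).fderiv_fun (f := f) (hf.mdifferentiableAt (by simp)) ξ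
  rw [← hτ.gen_eq, hτ.zero_act] at h
  rw [← h]
  have : f ∘ (fun t => τ t x) = fun _ => f x := by ext t; exact hi t x
  rw [this]
  simp

theorem dfun_dmap {V : Type*} [NormedAddCommGroup V] [NormedSpace ℝ V] {f : M → V}
    (hf : ContMDiff 𝓘(ℝ, 𝔼 d) 𝓘(ℝ, V) ∞ f) (hi : ∀ t x, f (τ t x) = f x)
    (t : LieT r) (x : M) (u : 𝔼 d) : dfun (d := d) f (τ t x) (dmap (τ t) x u) = dfun f x u := by
  rw [← dfun_comp (hf.mdifferentiableAt (by simp)) (hτ.mdiff t x)]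
  have : f ∘ τ t = f := by ext x; exact hi t x
  rw [this]

end IsTorusAction
end Action

/-! ### Kähler structures and the twisted differential -/

section Kahler

variable {d r : ℕ} {M : Type*} [TopologicalSpace M] [ChartedSpace (𝔼 d) M]
  {E : Type*} [NormedAddCommGroup E] [NormedSpace ℝ E]

theorem dc_apply (J : EndField d M) (f : M → ℝ) (x : M) (u : 𝔼 d) :
    (dc J f x : 𝔼 d →L[ℝ] ℝ) u = -dfun f x (J x u) := rfl

theorem pb2_metric {J : EndField d M} {Ω : BilForm d M ℝ} {c : E → M} {u : E} {K : E → E →L[ℝ] E}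
    (hr : Represents c J K u) :
    pb2 c (metric J Ω) =ᶠ[𝓝 u] fun z => (((pb2 c Ω z).flip).comp (K z)).flip := by
  filter_upwards [hr] with z hz
  ext a b
  exact congrArg ((Ω (c z) : 𝔼 d →L[ℝ] 𝔼 d →L[ℝ] ℝ) (md c z a)) (hz b).symm

theorem antisymm_of_alternating {β : E →L[ℝ] E →L[ℝ] ℝ} (h : ∀ a, β a a = 0) (a b : E) :
    β a b = -β b a := by
  have h1 := h (a + b)
  simp only [map_add, add_apply, h] at h1
  linarith

theorem IsKahler.antisymm {J : EndField d M} {Ω : BilForm d M ℝ} (h : IsKahler J Ω) (x : M)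
    (u w : 𝔼 d) : (Ω x : 𝔼 d →L[ℝ] 𝔼 d →L[ℝ] ℝ) u w = -(Ω x : 𝔼 d →L[ℝ] 𝔼 d →L[ℝ] ℝ) w u :=
  antisymm_of_alternating (E := 𝔼 d) (h.alternating x) u w

variable [IsManifold 𝓘(ℝ, 𝔼 d) ∞ M]

theorem IsKahler.isRiem {J : EndField d M} {Ω : BilForm d M ℝ} (h : IsKahler J Ω) :
    IsRiem (metric J Ω) := by
  refine ⟨?_, ?_, fun x u hu => h.positive x u hu⟩
  · refine smooth2_of_param (E := 𝔼 d) fun x => ?_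
    have hx := mem_chart_self (d := d) x
    have hu := (chart d x).map_source hx
    refine ⟨(chart d x).symm, chart d x x, (chart d x).left_inv hx, smAt_chart_symm x hu,
      bijective_frame hu, ?_⟩
    refine ContDiffAt.congr_of_eventuallyEq ?_ (pb2_metric (represents_coordEnd J x hu))
    exact contDiff_flip.contDiffAt.comp _ ((contDiff_flip.contDiffAt.comp _
      (h.smooth_form.pb2 (smAt_chart_symm x hu))).clm_comp (h.smooth_J.contDiffAt hx))
  · intro x u w
    have h1 := h.invariant x u (J x w)
    rw [h.sq_J] at h1
    have h2 := h.antisymm x (J x u) w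
    have h3 : (Ω x : 𝔼 d →L[ℝ] 𝔼 d →L[ℝ] ℝ) (J x u) (-w) = -Ω x (J x u) w := map_neg _ _
    have h4 : Ω x (J x u) (-w) = -Ω x (J x u) w := h3
    change Ω x u (J x w) = Ω x w (J x u)
    rw [← h1, h4]
    have h5 : Ω x (J x u) w = -Ω x w (J x u) := h2
    rw [h5, neg_neg]

section Dc

variable {J : EndField d M} {f : M → ℝ}

theorem pb1_dc (hf : ContMDiff 𝓘(ℝ, 𝔼 d) 𝓘(ℝ, ℝ) ∞ f) {c : E → M} {u : E} (hc : SmAt d c u)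
    {K : E → E →L[ℝ] E} (hr : Represents c J K u) :
    pb1 c (dc J f) =ᶠ[𝓝 u] fun z => -((fderiv ℝ (f ∘ c) z).comp (K z)) := by
  filter_upwards [hr, hc.eventually] with z h1 h2
  ext a
  rw [neg_apply, ContinuousLinearMap.comp_apply, h2.fderiv_fun (hf.mdifferentiableAt (by simp)), h1]
  rfl

theorem smooth1_dc (hf : ContMDiff 𝓘(ℝ, 𝔼 d) 𝓘(ℝ, ℝ) ∞ f) (hJ : SmoothEnd J) :
    Smooth1 (dc J f) := by
  intro x₀ u hu
  refine ContDiffAt.contDiffWithinAt ?_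
  have hs := smAt_chart_symm (d := d) x₀ hu
  refine ContDiffAt.congr_of_eventuallyEq ?_ (pb1_dc hf hs (represents_coordEnd J x₀ hu))
  exact (((hs.contDiffAt_fun hf).fderiv_right (by simp)).clm_comp
    ((hJ x₀).contDiffAt (target_mem_nhds hu))).neg

theorem extd_alternating (α : OneForm d M ℝ) (x : M) (u : 𝔼 d) :
    (extd α x : 𝔼 d →L[ℝ] 𝔼 d →L[ℝ] ℝ) u u = 0 := sub_self _

theorem pb2_extd_eventually {α : OneForm d M ℝ} (h : Smooth1 α) {c : E → M} {u : E}
    (hc : SmAt d c u) : pb2 c (extd α) =ᶠ[𝓝 u] curl (pb1 c α) :=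
  hc.eventually.mono fun _ hz => pb2_extd h hz

theorem contDiffAt_curl {α : E → E →L[ℝ] ℝ} {u : E} (h : ContDiffAt ℝ ∞ α u) :
    ContDiffAt ℝ ∞ (curl α) u := by
  have h1 : ContDiffAt ℝ ∞ (fderiv ℝ α) u := h.fderiv_right (by simp)
  exact ContDiffAt.sub (F := E →L[ℝ] E →L[ℝ] ℝ) h1 (contDiff_flip.contDiffAt.comp u h1)

theorem smooth2_extd {α : OneForm d M ℝ} (h : Smooth1 α) : Smooth2 (extd α) := by
  intro x₀ u hu
  refine ContDiffAt.contDiffWithinAt ?_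
  have hs := smAt_chart_symm (d := d) x₀ hu
  exact (contDiffAt_curl (h.pb1 hs)).congr_of_eventuallyEq (pb2_extd_eventually h hs)

theorem cyc_pb2_extd {α : OneForm d M ℝ} (h : Smooth1 α) {c : E → M} {u : E} (hc : SmAt d c u)
    (a₁ a₂ a₃ : E) : cyc (pb2 c (extd α)) u a₁ a₂ a₃ = 0 := by
  rw [cyc, (pb2_extd_eventually h hc).fderiv_eq, ← cyc]
  exact cyc_curl ((h.pb1 hc).of_le two_le_infty) _ _ _

/-- On a complex manifold `dd^c f` is of type `(1, 1)`. -/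
theorem ddc_invariant (hf : ContMDiff 𝓘(ℝ, 𝔼 d) 𝓘(ℝ, ℝ) ∞ f) (hJ : SmoothEnd J)
    (hsq : ∀ x u, J x (J x u) = -u) (hi : IsIntegrable J) (x : M) (u w : 𝔼 d) :
    (ddc J f x : 𝔼 d →L[ℝ] 𝔼 d →L[ℝ] ℝ) (J x u) (J x w) =
      (ddc J f x : 𝔼 d →L[ℝ] 𝔼 d →L[ℝ] ℝ) u w := by
  have hx := mem_chart_self (d := d) x
  obtain ⟨c, z, hcz, hc, hb, hr, hK⟩ : ∃ (c : 𝔼 d → M) (z : 𝔼 d), c z = x ∧ SmAt d c z ∧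
      Function.Bijective (md (d := d) c z) ∧ Represents c J (coordEnd J x) z ∧
      ContDiffAt ℝ ∞ (coordEnd J x) z :=
    have hu := (chart d x).map_source hx
    ⟨(chart d x).symm, chart d x x, (chart d x).left_inv hx, smAt_chart_symm x hu,
      bijective_frame hu, represents_coordEnd J x hu, hJ.contDiffAt hx⟩
  set K := coordEnd J x
  subst hcz
  obtain ⟨a, rfl⟩ := hb.2 u
  obtain ⟨b, rfl⟩ := hb.2 w
  have hr0 := hr.self_of_nhds
  have e : pb2 c (ddc J f) z = curl (fun y => -((fderiv ℝ (f ∘ c) y).comp (K y))) z := by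
    rw [ddc, pb2_extd (smooth1_dc hf hJ) hc, curl, curl, (pb1_dc hf hc hr).fderiv_eq]
  -- near `z` the representation `K` squares to `-1`
  have hsqK : ∀ᶠ y in 𝓝 z, ∀ a, K y (K y a) = -a := by
    have hbe : ∀ᶠ y in 𝓝 z, Function.Injective (md (d := d) c y) := by
      obtain ⟨ρ, h1, h2⟩ := hc.exists_inverse hb (mem_chart_self (d := d) (c z))
      have hφ := hc.contDiffAt_chart (mem_chart_self (d := d) (c z))
      have hinj := hc.bijective_fderiv hb (mem_chart_self (d := d) (c z))
      let T : 𝔼 d ≃L[ℝ] 𝔼 d := (LinearEquiv.ofBijective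
        (fderiv ℝ (chart d (c z) ∘ c) z).toLinearMap hinj).toContinuousLinearEquiv
      have hT : (T : 𝔼 d →L[ℝ] 𝔼 d) = fderiv ℝ (chart d (c z) ∘ c) z := by ext1; rfl
      have hn := T.nhds
      rw [hT] at hn
      have hcont : ContinuousAt (fderiv ℝ (chart d (c z) ∘ c)) z :=
        (hφ.fderiv_right (m := 0) (by simp)).continuousAt
      filter_upwards [hcont.eventually hn, hc.eventually,
        hc.mem_source (mem_chart_self (d := d) (c z))] with y hy h3 h4 a b hab
      obtain ⟨S, hS⟩ := hy
      refine S.injective ?_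
      have hS' : ∀ v, S v = fderiv ℝ (chart d (c z) ∘ c) y v := fun v => DFunLike.congr_fun hS v
      rw [hS', hS', ← h3.coframe_md h4, ← h3.coframe_md h4, hab]
    filter_upwards [hr, hbe] with y h1 h2 a
    refine h2 ?_
    rw [h1, h1, map_neg]
    exact hsq _ _
  have h1 := curl_dc_invariant (hK.differentiableAt (by simp))
    ((hc.contDiffAt_fun hf).of_le two_le_infty) hsqK
    (hi.nij_eq_zero hJ hc hb hr (hK.differentiableAt (by simp))) a b
  rw [← e, pb2_apply, pb2_apply, hr0, hr0] at h1
  exact h1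

end Dc

section Potential

variable {J : EndField d M} {Ω : BilForm d M ℝ} {τ : LieT r → M → M} {μ : M → LieT r} {φ : M → ℝ}

theorem dc_dmap (h : IsHamKahler J Ω τ μ) (hφ : φ ∈ SmoothInv d τ) (t : LieT r) (x : M) (u : 𝔼 d) :
    (dc J φ (τ t x) : 𝔼 d →L[ℝ] ℝ) (dmap (τ t) x u) = (dc J φ x : 𝔼 d →L[ℝ] ℝ) u := by
  rw [dc_apply, dc_apply]
  congr 1
  have h1 : dmap (τ t) x (J x u) = J (τ t x) (dmap (τ t) x u) := h.act_J t x u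
  exact (congrArg (dfun φ (τ t x)) h1.symm).trans (h.action.dfun_dmap hφ.1 hφ.2 t x (J x u))

/-- A positive form `ω + dd^c φ` is Kähler. -/
theorem IsKahler.formOf (h : IsKahler J Ω) (hφ : ContMDiff 𝓘(ℝ, 𝔼 d) 𝓘(ℝ, ℝ) ∞ φ)
    (hpos : ∀ x u, u ≠ 0 → 0 < formOf J Ω φ x u (J x u)) : IsKahler J (formOf J Ω φ) := by
  have hs := smooth1_dc hφ h.smooth_J
  have hadd : ∀ (c : 𝔼 d → M) (z : 𝔼 d), pb2 c (WKahler.formOf J Ω φ) z =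
      pb2 c Ω z + pb2 c (ddc J φ) z := fun c z => rfl
  have hsm : Smooth2 (WKahler.formOf J Ω φ) := by
    intro x₀ u hu
    refine ContDiffAt.contDiffWithinAt ?_
    have hsu := smAt_chart_symm (d := d) x₀ hu
    exact (h.smooth_form.pb2 hsu).add ((smooth2_extd hs).pb2 hsu)
  have halt : ∀ x u, WKahler.formOf J Ω φ x u u = 0 := by
    intro x u
    have h1 : (ddc J φ x : 𝔼 d →L[ℝ] 𝔼 d →L[ℝ] ℝ) u u = 0 := extd_alternating _ _ _
    have h2 : (Ω x : 𝔼 d →L[ℝ] 𝔼 d →L[ℝ] ℝ) u u = 0 := h.alternating x u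
    exact (congrArg₂ (· + ·) h2 h1).trans (add_zero 0)
  refine ⟨h.smooth_J, h.sq_J, h.integrable, hsm, halt, ?_, ?_, hpos⟩
  · refine isClosed2_of_param (E := 𝔼 d) hsm halt fun x => ?_
    have hx := mem_chart_self (d := d) x
    have hu := (chart d x).map_source hx
    have hsu := smAt_chart_symm (d := d) x hu
    refine ⟨(chart d x).symm, chart d x x, (chart d x).left_inv hx, hsu,
      bijective_frame hu, fun a₁ a₂ a₃ => ?_⟩
    have e : fderiv ℝ (pb2 (chart d x).symm (WKahler.formOf J Ω φ)) (chart d x x) =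
        fderiv ℝ (pb2 (chart d x).symm Ω) (chart d x x) +
          fderiv ℝ (pb2 (chart d x).symm (ddc J φ)) (chart d x x) :=
      fderiv_add ((h.smooth_form.pb2 hsu).differentiableAt (by simp))
        (((smooth2_extd hs).pb2 hsu).differentiableAt (by simp))
    have h1 := h.closed.cyc_pb2 h.smooth_form h.alternating hsu a₁ a₂ a₃
    have h2 := cyc_pb2_extd hs hsu a₁ a₂ a₃
    rw [← ddc] at h2
    simp only [cyc, e, add_apply] at h1 h2 ⊢
    linarith
  · intro x u w
    have h1 := ddc_invariant hφ h.smooth_J h.sq_J h.integrable x u w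
    have h2 : (Ω x : 𝔼 d →L[ℝ] 𝔼 d →L[ℝ] ℝ) (J x u) (J x w) = Ω x u w := h.invariant x u w
    exact congrArg₂ (· + ·) h2 h1

/-- `dd^cφ` is invariant for an invariant function. -/
theorem ddc_dmap (h : IsHamKahler J Ω τ μ) (hφ : φ ∈ SmoothInv d τ) (t : LieT r) (x : M)
    (u w : 𝔼 d) : (ddc J φ (τ t x) : 𝔼 d →L[ℝ] 𝔼 d →L[ℝ] ℝ) (dmap (τ t) x u) (dmap (τ t) x w) =
      (ddc J φ x : 𝔼 d →L[ℝ] 𝔼 d →L[ℝ] ℝ) u w := by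
  have hs := smooth1_dc hφ.1 h.kahler.smooth_J
  have hx := mem_chart_self (d := d) x
  have hu := (chart d x).map_source hx
  obtain ⟨c, z, hcz, hc, hb⟩ : ∃ (c : 𝔼 d → M) (z : 𝔼 d), c z = x ∧ SmAt d c z ∧
      Function.Bijective (md (d := d) c z) :=
    ⟨(chart d x).symm, chart d x x, (chart d x).left_inv hx, smAt_chart_symm (d := d) x hu,
      bijective_frame hu⟩
  subst hcz
  obtain ⟨a, rfl⟩ := hb.2 u
  obtain ⟨b, rfl⟩ := hb.2 w
  have hc' := hc.comp (h.action.contMDiff t)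
  have e : pb1 (τ t ∘ c) (dc J φ) =ᶠ[𝓝 z] pb1 c (dc J φ) := by
    filter_upwards [hc.eventually] with y hy
    ext a
    rw [pb1_apply, hy.md_comp (h.action.mdiff t _)]
    exact dc_dmap h hφ t (c y) _
  have h1 : pb2 (τ t ∘ c) (ddc J φ) z = pb2 c (ddc J φ) z := by
    rw [ddc, pb2_extd hs hc, pb2_extd hs hc', curl, curl, e.fderiv_eq]
  have h2 := congrArg (fun T => T a b) h1
  simp only [pb2_apply, hc.md_comp (h.action.mdiff t _)] at h2
  exact h2

/-- The function `d^cφ(ξ)`. -/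
def dcGen (J : EndField d M) (τ : LieT r → M → M) (φ : M → ℝ) (ξ : LieT r) (x : M) : ℝ :=
  (dc J φ x : 𝔼 d →L[ℝ] ℝ) (gen τ ξ x)

theorem pb1_prod_dc (h : IsHamKahler J Ω τ μ) (hφ : φ ∈ SmoothInv d τ) {c : E → M} {u : E}
    (hc : SmAt d c u) (s ξ : LieT r) (a : E) :
    pb1 (fun z : LieT r × E => τ z.1 (c z.2)) (dc J φ) (s, u) (ξ, a) =
      dcGen J τ φ ξ (c u) + pb1 c (dc J φ) u a := by
  refine (congrArg (dc J φ (τ s (c u)) : 𝔼 d →L[ℝ] ℝ) (h.action.md_prod hc s ξ a)).trans ?_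
  refine (map_add (dc J φ (τ s (c u)) : 𝔼 d →L[ℝ] ℝ) _ _).trans ?_
  exact congrArg₂ (· + ·) ((congrArg (dc J φ (τ s (c u)) : 𝔼 d →L[ℝ] ℝ)
    (h.action.dmap_gen s ξ (c u)).symm).trans (dc_dmap h hφ s (c u) _)) (dc_dmap h hφ s (c u) _)

theorem contMDiff_dcGen (h : IsHamKahler J Ω τ μ) (hφ : φ ∈ SmoothInv d τ) (ξ : LieT r) :
    ContMDiff 𝓘(ℝ, 𝔼 d) 𝓘(ℝ, ℝ) ∞ (dcGen J τ φ ξ) := by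
  refine contMDiff_of_chart fun x => ?_
  have hx := mem_chart_self (d := d) x
  have hu := (chart d x).map_source hx
  have hc := smAt_chart_symm (d := d) x hu
  have h1 := (smooth1_dc hφ.1 h.kahler.smooth_J).pb1 (h.action.smAt_prod hc 0)
  have h2 : ContDiffAt ℝ ∞ (fun z => pb1 (fun z : LieT r × 𝔼 d => τ z.1 ((chart d x).symm z.2))
      (dc J φ) (0, z) (ξ, 0)) (chart d x x) :=
    (ContDiffAt.comp (f := fun z => ((0 : LieT r), z)) _ h1
      (contDiffAt_const.prodMk contDiffAt_id)).clm_apply contDiffAt_const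
  refine h2.congr_of_eventuallyEq ?_
  filter_upwards [hc.eventually] with z hz
  rw [pb1_prod_dc h hφ hz, map_zero, add_zero]
  rfl

/-- Cartan's formula: `dd^cφ(ξ, ·) = -d(d^cφ(ξ))`. -/
theorem ddc_gen (h : IsHamKahler J Ω τ μ) (hφ : φ ∈ SmoothInv d τ) (ξ : LieT r) (x : M) (u : 𝔼 d) :
    (ddc J φ x : 𝔼 d →L[ℝ] 𝔼 d →L[ℝ] ℝ) (gen τ ξ x) u = -dfun (dcGen J τ φ ξ) x u := by
  have hs := smooth1_dc hφ.1 h.kahler.smooth_J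
  have hx := mem_chart_self (d := d) x
  have hu := (chart d x).map_source hx
  obtain ⟨c, z, hcz, hc, hb⟩ : ∃ (c : 𝔼 d → M) (z : 𝔼 d), c z = x ∧ SmAt d c z ∧
      Function.Bijective (md (d := d) c z) :=
    ⟨(chart d x).symm, chart d x x, (chart d x).left_inv hx, smAt_chart_symm (d := d) x hu,
      bijective_frame hu⟩
  subst hcz
  obtain ⟨a, rfl⟩ := hb.2 u
  set C : LieT r × 𝔼 d → M := fun z : LieT r × 𝔼 d => τ z.1 (c z.2) with hC
  have hc' : SmAt d C (0, z) := h.action.smAt_prod hc 0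
  have h1 := congrArg (fun T => T (ξ, 0) (0, a)) (pb2_extd hs hc')
  have hd : DifferentiableAt ℝ (pb1 C (dc J φ)) (0, z) := (hs.pb1 hc').differentiableAt (by simp)
  have hg0 : genV d τ (0 : LieT r) (c z) = 0 := by rw [h.action.gen_eq, map_zero]
  have hd0 : ∀ v : 𝔼 d, dmap (τ 0) (c z) v = v := by
    intro v
    have : τ 0 = id := by ext x; exact h.action.zero_act x
    rw [dmap, this, mfderiv_id]; rfl
  simp only [curl_apply, pb2_apply, hC] at h1
  rw [h.action.md_prod hc, h.action.md_prod hc, map_zero, hd0, hd0, h.action.zero_act, hg0, zero_add,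
    add_zero, ← hC, ← fderiv_apply_const hd, ← fderiv_apply_const hd] at h1
  have hsnd : ∀ᶠ y in 𝓝 ((0 : LieT r), z), SmAt d c y.2 := continuousAt_snd.eventually hc.eventually
  have e1 : (fun y => pb1 C (dc J φ) y (0, a)) =ᶠ[𝓝 ((0 : LieT r), z)]
      (fun y => pb1 c (dc J φ) y a) ∘ Prod.snd := by
    filter_upwards [hsnd] with y hy
    obtain ⟨y1, y2⟩ := y
    rw [pb1_prod_dc h hφ hy]
    have : dcGen J τ φ (0 : LieT r) (c y2) = 0 := by
      rw [dcGen]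
      have : genV d τ (0 : LieT r) (c y2) = 0 := by rw [h.action.gen_eq, map_zero]
      exact (congrArg _ this).trans (map_zero _)
    rw [this, zero_add]
    rfl
  have e2 : (fun y => pb1 C (dc J φ) y (ξ, 0)) =ᶠ[𝓝 ((0 : LieT r), z)]
      (dcGen J τ φ ξ ∘ c) ∘ Prod.snd := by
    filter_upwards [hsnd] with y hy
    obtain ⟨y1, y2⟩ := y
    rw [pb1_prod_dc h hφ hy, map_zero, add_zero]
    rfl
  have hd1 : DifferentiableAt ℝ (fun y => pb1 c (dc J φ) y a) z :=
    ((hs.pb1 hc).differentiableAt (by simp)).clm_apply (differentiableAt_const _)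
  have hd2 : DifferentiableAt ℝ (dcGen J τ φ ξ ∘ c) z :=
    (hc.contDiffAt_fun (contMDiff_dcGen h hφ ξ)).differentiableAt (by simp)
  rw [e1.fderiv_eq, e2.fderiv_eq, fderiv_comp _ hd1 differentiableAt_snd,
    fderiv_comp _ hd2 differentiableAt_snd, fderiv_snd] at h1
  simp only [ContinuousLinearMap.comp_apply, ContinuousLinearMap.coe_snd', map_zero, zero_sub] at h1
  rw [hc.fderiv_fun ((contMDiff_dcGen h hφ ξ).mdifferentiableAt (by simp))] at h1
  exact h1

theorem pair_momOf (h : IsHamKahler J Ω τ μ) (ξ : LieT r) (x : M) :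
    pair ξ (momOf J τ μ φ x) = pair ξ (μ x) + dcGen J τ φ ξ x := by
  have key : ∀ A : 𝔼 d →L[ℝ] ℝ, A (genV d τ ξ x) = ∑ i, ξ i * A (genV d τ (bas i) x) := by
    intro A
    rw [h.action.gen_sum, map_sum]
    simp
  have : (dc J φ x : 𝔼 d →L[ℝ] ℝ) (gen τ ξ x) =
      ∑ i, ξ i * (dc J φ x : 𝔼 d →L[ℝ] ℝ) (gen τ (bas i) x) := key _
  rw [dcGen, this]
  simp only [pair, momOf, mul_add, Finset.sum_add_distrib]

theorem IsHamKahler.contMDiff_pair (h : IsHamKahler J Ω τ μ) (ξ : LieT r) :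
    ContMDiff 𝓘(ℝ, 𝔼 d) 𝓘(ℝ, ℝ) ∞ fun x => pair ξ (μ x) := by
  have : ContDiff ℝ ∞ (pair ξ) := by unfold pair; fun_prop
  exact this.contMDiff.comp h.smooth_mom

/-- The metrics in a Kähler class are Hamiltonian. -/
theorem IsHamKahler.formOf (h : IsHamKahler J Ω τ μ) (hφ : φ ∈ potentials J Ω τ) :
    IsHamKahler J (formOf J Ω φ) τ (momOf J τ μ φ) := by
  refine ⟨h.kahler.formOf hφ.1.1 hφ.2, h.action, h.act_J, ?_, ?_, ?_, ?_⟩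
  · intro t x u w
    exact congrArg₂ (· + ·) (h.act_form t x u w) (ddc_dmap h hφ.1 t x u w)
  · refine contMDiff_pi_space.2 fun i => ?_
    have h1 : ContMDiff 𝓘(ℝ, 𝔼 d) 𝓘(ℝ, ℝ) ∞ fun x => μ x i := contMDiff_pi_space.1 h.smooth_mom i
    exact h1.add (contMDiff_dcGen h hφ.1 (bas i))
  · intro t x
    ext i
    have h1 := (congrArg (dc J φ (τ t x) : 𝔼 d →L[ℝ] ℝ)
      (h.action.dmap_gen t (bas i) x).symm).trans (dc_dmap h hφ.1 t x (genV d τ (bas i) x))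
    exact congrArg₂ (· + ·) (congrFun (h.mom_inv t x) i) h1
  · intro ξ x u
    have h1 : (Ω x : 𝔼 d →L[ℝ] 𝔼 d →L[ℝ] ℝ) (gen τ ξ x) u = -dfun (fun y => pair ξ (μ y)) x u :=
      h.mom ξ x u
    have h2 := ddc_gen h hφ.1 ξ x u
    have h3 : (fun y => pair ξ (momOf J τ μ φ y)) =
        (fun y => pair ξ (μ y)) + dcGen J τ φ ξ := by
      ext y; exact pair_momOf h ξ y
    have h4 : dfun (d := d) (fun y => pair ξ (momOf J τ μ φ y)) x =
        dfun (d := d) (fun y => pair ξ (μ y)) x + dfun (d := d) (dcGen J τ φ ξ) x := by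
      rw [h3]
      exact mfderiv_add ((h.contMDiff_pair ξ).mdifferentiableAt (by simp))
        ((contMDiff_dcGen h hφ.1 ξ).mdifferentiableAt (by simp))
    change (Ω x : 𝔼 d →L[ℝ] 𝔼 d →L[ℝ] ℝ) (gen τ ξ x) u +
      (ddc J φ x : 𝔼 d →L[ℝ] 𝔼 d →L[ℝ] ℝ) (gen τ ξ x) u =
      -dfun (fun y => pair ξ (momOf J τ μ φ y)) x u
    rw [h1, h2, h4]
    exact (neg_add _ _).symm

/-- A lower bound for a component of the momentum map persists in the whole Kähler class: where
`⟨μ_φ, ξ⟩` is minimal the field `ξ` vanishes, and there `⟨μ_φ, ξ⟩ = ⟨μ, ξ⟩`. -/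
theorem exists_pair_le_momOf [CompactSpace M] (h : IsHamKahler J Ω τ μ)
    (hφ : φ ∈ potentials J Ω τ) (ξ : LieT r) (x : M) :
    ∃ y, pair ξ (μ y) ≤ pair ξ (momOf J τ μ φ x) := by
  have h' := h.formOf hφ
  have hcont : Continuous fun x => pair ξ (momOf J τ μ φ x) := (h'.contMDiff_pair ξ).continuous
  -- at a minimum `y` of the component of `μ_φ` the generator vanishes, so that `d^c φ (ξ)` does
  obtain ⟨y, -, hy⟩ := isCompact_univ.exists_isMinOn ⟨x, Set.mem_univ x⟩ hcont.continuousOn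
  refine ⟨y, le_trans (le_of_eq ?_) (hy (Set.mem_univ x))⟩
  have hx := mem_chart_self (d := d) y
  have hu := (chart d y).map_source hx
  have hc := smAt_chart_symm (d := d) y hu
  have hd : ∀ u : 𝔼 d, dfun (fun x => pair ξ (momOf J τ μ φ x)) y u = 0 := by
    intro u
    obtain ⟨a, rfl⟩ := (bijective_frame hu).2 u
    have hmin : IsLocalMin ((fun x => pair ξ (momOf J τ μ φ x)) ∘ (chart d y).symm)
        (chart d y y) := by
      refine Filter.Eventually.of_forall fun z => ?_
      have h0 := hy (Set.mem_univ ((chart d y).symm z))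
      simp only [Set.mem_ofPred_eq, Function.comp_apply, (chart d y).left_inv hx] at h0 ⊢
      exact h0
    have h1 := hc.fderiv_fun (f := fun x => pair ξ (momOf J τ μ φ x))
      ((h'.contMDiff_pair ξ).mdifferentiableAt (by simp)) a
    rw [hmin.fderiv_eq_zero, zero_apply] at h1
    have e : ∀ z, z = y → (dfun (fun x => pair ξ (momOf J τ μ φ x)) z : 𝔼 d →L[ℝ] ℝ) =
      dfun (fun x => pair ξ (momOf J τ μ φ x)) y := by rintro _ rfl; rfl
    rw [e _ ((chart d y).left_inv hx)] at h1
    exact h1.symm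
  have hgen : genV d τ ξ y = 0 := by
    by_contra hne
    have h1 := h'.kahler.positive y (gen τ ξ y) hne
    have h2 := h'.mom ξ y (J y (gen τ ξ y))
    have h3 := hd (J y (gen τ ξ y))
    rw [h2] at h1
    have h4 : (mfderiv 𝓘(ℝ, 𝔼 d) 𝓘(ℝ, ℝ) (fun y => pair ξ (momOf J τ μ φ y)) y :
      TangentSpace 𝓘(ℝ, 𝔼 d) y →L[ℝ] ℝ) (J y (gen τ ξ y)) = 0 := h3
    rw [h4, neg_zero] at h1
    exact lt_irrefl _ h1
  change pair ξ (μ y) = pair ξ (momOf J τ μ φ y)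
  rw [pair_momOf h, dcGen]
  have : (dc J φ y : 𝔼 d →L[ℝ] ℝ) (gen τ ξ y) = 0 := (congrArg _ hgen).trans (map_zero _)
  rw [this, add_zero]

end Potential
end Kahler

/-! ### The weighted scalar curvature in terms of the momentum map -/

section Weighted

variable {E : Type*} [NormedAddCommGroup E] [NormedSpace ℝ E] {ι : Type*} [Fintype ι] {r : ℕ}

theorem sum_smul_bas (y : LieT r) : ∑ i, y i • bas i = y := by
  ext j
  simp [bas, Finset.sum_apply, Pi.single_apply]

theorem pair_bas (i : Fin r) (y : LieT r) : pair (bas i) y = y i := by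
  simp [pair, bas, Pi.single_apply]

theorem hess_eq {v : LieT r → ℝ} (hv : ContDiff ℝ ∞ v) (i j : Fin r) (y : LieT r) :
    hess v i j y = fderiv ℝ (fderiv ℝ v) y (bas i) (bas j) := by
  have h : Differentiable ℝ (fderiv ℝ v) :=
    (hv.fderiv_right (m := ∞) (by simp)).differentiable (by simp)
  rw [hess, fderiv_apply_const (h y)]

/-- The chain rule for the Laplacian of a function of several functions. -/
theorem lapJet_comp (G : E → E →L[ℝ] E →L[ℝ] ℝ) {v : LieT r → ℝ} (hv : ContDiff ℝ ∞ v)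
    {m : E → LieT r} {u : E} (hm : ContDiffAt ℝ 2 m u) (e : ι → E) :
    lapJet G (v ∘ m) u e = ∑ i, fderiv ℝ v (m u) (bas i) * lapJet G (fun z => m z i) u e -
      ∑ i, ∑ j, hess v i j (m u) *
        ∑ k, fderiv ℝ (fun z => m z i) u (e k) * fderiv ℝ (fun z => m z j) u (e k) := by
  have hmi : ∀ i, ContDiffAt ℝ 2 (fun z => m z i) u := fun i => contDiffAt_pi.1 hm i
  have hD : Differentiable ℝ (fderiv ℝ v) :=
    (hv.fderiv_right (m := ∞) (by simp)).differentiable (by simp)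
  have hvd : Differentiable ℝ v := hv.differentiable (by simp)
  have hev : ∀ᶠ z in 𝓝 u, DifferentiableAt ℝ m z :=
    (hm.eventually (by simp)).mono fun z hz => hz.differentiableAt (by simp)
  have h1 : ∀ z, DifferentiableAt ℝ m z → ∀ a, fderiv ℝ m z a =
      ∑ i, fderiv ℝ (fun z => m z i) z a • bas i := by
    intro z hz a
    conv_lhs => rw [← sum_smul_bas (fderiv ℝ m z a)]
    refine Finset.sum_congr rfl fun i _ => ?_
    rw [fderiv_apply hz i]
    rfl
  have h2 : ∀ z, DifferentiableAt ℝ m z → ∀ a, fderiv ℝ (v ∘ m) z a =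
      ∑ i, fderiv ℝ v (m z) (bas i) * fderiv ℝ (fun z => m z i) z a := by
    intro z hz a
    rw [fderiv_comp z (hvd _) hz, ContinuousLinearMap.comp_apply, h1 z hz, map_sum]
    refine Finset.sum_congr rfl fun i _ => ?_
    rw [map_smul, smul_eq_mul, mul_comm]
  have h3 : ∀ i, HasFDerivAt (fun z => fderiv ℝ v (m z) (bas i))
      (((ContinuousLinearMap.apply ℝ ℝ (bas i)).comp (fderiv ℝ (fderiv ℝ v) (m u))).comp
        (fderiv ℝ m u)) u := fun i =>
    ((ContinuousLinearMap.apply ℝ ℝ (bas i)).hasFDerivAt.comp _ (hD (m u)).hasFDerivAt).comp u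
      hev.self_of_nhds.hasFDerivAt
  have hDi : ∀ i, DifferentiableAt ℝ (fderiv ℝ (fun z => m z i)) u := fun i =>
    ((hmi i).fderiv_right (m := 1) (by norm_num)).differentiableAt (by simp)
  have h4 : ∀ a, fderiv ℝ (fun z => fderiv ℝ (v ∘ m) z a) u a =
      ∑ i, (fderiv ℝ v (m u) (bas i) * fderiv ℝ (fun z => fderiv ℝ (fun z => m z i) z a) u a +
        fderiv ℝ (fun z => m z i) u a *
          ∑ j, hess v j i (m u) * fderiv ℝ (fun z => m z j) u a) := by
    intro a
    have e : (fun z => fderiv ℝ (v ∘ m) z a) =ᶠ[𝓝 u]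
        fun z => ∑ i, fderiv ℝ v (m z) (bas i) * fderiv ℝ (fun z => m z i) z a :=
      hev.mono fun z hz => h2 z hz a
    have h5 : ∀ i, HasFDerivAt (fun z => fderiv ℝ v (m z) (bas i) * fderiv ℝ (fun z => m z i) z a) _ u :=
      fun i => (h3 i).mul ((hDi i).clm_apply (differentiableAt_const a)).hasFDerivAt
    rw [e.fderiv_eq, (HasFDerivAt.fun_sum fun i _ => h5 i).fderiv, sum_apply]
    refine Finset.sum_congr rfl fun i _ => ?_
    simp only [add_apply, smul_apply, smul_eq_mul, ContinuousLinearMap.comp_apply,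
      ContinuousLinearMap.apply_apply]
    congr 2
    rw [h1 u hev.self_of_nhds, map_sum, sum_apply]
    refine Finset.sum_congr rfl fun j _ => ?_
    rw [map_smul, smul_apply, smul_eq_mul, hess_eq hv, mul_comm]
  simp only [lapJet, h4, h2 u hev.self_of_nhds, Finset.mul_sum, Finset.sum_sub_distrib, 
    Finset.sum_add_distrib, mul_neg, mul_sub, Finset.sum_neg_distrib]
  have c1 : ∑ k, ∑ i, fderiv ℝ v (m u) (bas i) * fderiv ℝ (fun z => fderiv ℝ (fun z => m z i) z (e k)) u (e k)
      = ∑ i, ∑ k, fderiv ℝ v (m u) (bas i) * fderiv ℝ (fun z => fderiv ℝ (fun z => m z i) z (e k)) u (e k) :=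
    Finset.sum_comm
  have c2 : ∑ k, ∑ i, ∑ j, fderiv ℝ (fun z => m z i) u (e k) *
      (hess v j i (m u) * fderiv ℝ (fun z => m z j) u (e k)) =
      ∑ i, ∑ j, ∑ k, hess v i j (m u) *
        (fderiv ℝ (fun z => m z i) u (e k) * fderiv ℝ (fun z => m z j) u (e k)) := by
    rw [Finset.sum_comm]
    conv_rhs => rw [Finset.sum_comm]
    refine Finset.sum_congr rfl fun i _ => ?_
    rw [Finset.sum_comm]
    exact Finset.sum_congr rfl fun j _ => Finset.sum_congr rfl fun k _ => by ring
  have c3 : ∑ k, ∑ l, ∑ i, chr1 G u (e k) (e k) (e l) *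
      (fderiv ℝ v (m u) (bas i) * fderiv ℝ (fun z => m z i) u (e l)) =
      ∑ i, ∑ k, ∑ l, fderiv ℝ v (m u) (bas i) * (chr1 G u (e k) (e k) (e l) *
        fderiv ℝ (fun z => m z i) u (e l)) := by
    conv_rhs => rw [Finset.sum_comm]
    refine Finset.sum_congr rfl fun k _ => ?_
    rw [Finset.sum_comm]
    exact Finset.sum_congr rfl fun j _ => Finset.sum_congr rfl fun k _ => by ring
  rw [c1, c2, c3]
  ring

end Weighted

section Momentum

variable {d r : ℕ} {M : Type*} [TopologicalSpace M] [ChartedSpace (𝔼 d) M]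
  [IsManifold 𝓘(ℝ, 𝔼 d) ∞ M]
  {J : EndField d M} {Ω : BilForm d M ℝ} {τ : LieT r → M → M} {μ : M → LieT r}

/-- The inner products `g(ξ_i, ξ_j)`. -/
def genGram (J : EndField d M) (Ω : BilForm d M ℝ) (τ : LieT r → M → M) (i j : Fin r) (x : M) : ℝ :=
  (metric J Ω x : 𝔼 d →L[ℝ] 𝔼 d →L[ℝ] ℝ) (gen τ (bas i) x) (gen τ (bas j) x)

/-- The gradient of `⟨μ, ξ⟩` is `-Jξ`. -/
theorem IsHamKahler.dfun_mu (h : IsHamKahler J Ω τ μ) (i : Fin r) (x : M) (u : 𝔼 d) :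
    dfun (fun y => μ y i) x u =
      -(metric J Ω x : 𝔼 d →L[ℝ] 𝔼 d →L[ℝ] ℝ) (J x (gen τ (bas i) x)) u := by
  have h1 : (Ω x : 𝔼 d →L[ℝ] 𝔼 d →L[ℝ] ℝ) (gen τ (bas i) x) u =
      -dfun (fun y => pair (bas i) (μ y)) x u := h.mom (bas i) x u
  rw [show (fun y => pair (bas i) (μ y)) = fun y => μ y i from funext fun y => pair_bas i _] at h1
  have h2 : (metric J Ω x : 𝔼 d →L[ℝ] 𝔼 d →L[ℝ] ℝ) (J x (gen τ (bas i) x)) u =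
    (Ω x : 𝔼 d →L[ℝ] 𝔼 d →L[ℝ] ℝ) (gen τ (bas i) x) u := h.kahler.invariant x _ u
  rw [h2, h1, neg_neg]

theorem IsHamKahler.form_gen (h : IsHamKahler J Ω τ μ) (i : Fin r) (x : M) (u : 𝔼 d) :
    (Ω x : 𝔼 d →L[ℝ] 𝔼 d →L[ℝ] ℝ) (genV d τ (bas i) x) u = -dfun (fun y => μ y i) x u := by
  have h1 : (Ω x : 𝔼 d →L[ℝ] 𝔼 d →L[ℝ] ℝ) (gen τ (bas i) x) u =
      -dfun (fun y => pair (bas i) (μ y)) x u := h.mom (bas i) x u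
  rw [show (fun y => pair (bas i) (μ y)) = fun y => μ y i from funext fun y => pair_bas i _] at h1
  exact h1

theorem IsHamKahler.dfun_pair (h : IsHamKahler J Ω τ μ) (ξ : LieT r) (x : M) (u : 𝔼 d) :
    dfun (fun y => pair ξ (μ y)) x u = ∑ i, ξ i * dfun (fun y => μ y i) x u := by
  have key : ∀ A : 𝔼 d →L[ℝ] 𝔼 d →L[ℝ] ℝ, A (genV d τ ξ x) u =
      ∑ i, ξ i * A (genV d τ (bas i) x) u := by
    intro A
    rw [h.action.gen_sum, map_sum]
    simp
  have h1 : (Ω x : 𝔼 d →L[ℝ] 𝔼 d →L[ℝ] ℝ) (genV d τ ξ x) u =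
      -dfun (fun y => pair ξ (μ y)) x u := h.mom ξ x u
  have h2 := (key (Ω x)).symm.trans h1
  rw [← neg_eq_iff_eq_neg, ← Finset.sum_neg_distrib] at h2
  rw [← h2]
  refine Finset.sum_congr rfl fun i _ => ?_
  rw [← neg_neg (dfun (fun y => μ y i) x u), ← h.form_gen i x u, mul_neg]
  rfl

theorem IsHamKahler.contMDiff_mu (h : IsHamKahler J Ω τ μ) (i : Fin r) :
    ContMDiff 𝓘(ℝ, 𝔼 d) 𝓘(ℝ, ℝ) ∞ fun x => μ x i := contMDiff_pi_space.1 h.smooth_mom i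

/-- As `dμ_i` is dual to `-J ξ_i`, the inner products of the `dμ_i` are those of the `ξ_i`. -/
theorem IsHamKahler.sum_dmu_mul_dmu (h : IsHamKahler J Ω τ μ) {E : Type*} [NormedAddCommGroup E]
    [NormedSpace ℝ E] {ι : Type*} [Fintype ι] [DecidableEq ι] {c : E → M} {u : E} (hc : SmAt d c u)
    (hb : Function.Surjective (md (d := d) c u)) {e : ι → E}
    (he : IsFrame (pb2 c (metric J Ω) u) e) (i j : Fin r) :
    ∑ k, fderiv ℝ (fun z => μ (c z) i) u (e k) * fderiv ℝ (fun z => μ (c z) j) u (e k) =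
      genGram J Ω τ i j (c u) := by
  obtain ⟨a, ha⟩ := hb (J (c u) (gen τ (bas i) (c u)))
  obtain ⟨b, hb⟩ := hb (J (c u) (gen τ (bas j) (c u)))
  have hsymm := h.kahler.isRiem.symm (c u)
  have key : ∀ i (a : E), md (d := d) c u a = J (c u) (gen τ (bas i) (c u)) → ∀ k,
      fderiv ℝ (fun z => μ (c z) i) u (e k) = -pb2 c (metric J Ω) u a (e k) := by
    intro i a ha k
    have h1 := hc.fderiv_fun (f := fun x => μ x i)
      ((h.contMDiff_mu i).mdifferentiableAt (by simp)) (e k)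
    refine h1.trans ((h.dfun_mu i (c u) _).trans ?_)
    rw [pb2_apply, ha]
  simp only [key i a ha, key j b hb, neg_mul_neg]
  rw [he.parseval (fun a b => hsymm _ _), pb2_apply, ha, hb]
  have h3 := h.kahler.invariant (c u) (gen τ (bas i) (c u)) (J (c u) (gen τ (bas j) (c u)))
  exact h3

theorem exists_param (x : M) : ∃ (c : 𝔼 d → M) (z : 𝔼 d), c z = x ∧ SmAt d c z ∧
    Function.Bijective (md (d := d) c z) :=
  have hx := mem_chart_self (d := d) x
  have hu := (chart d x).map_source hx
  ⟨(chart d x).symm, chart d x x, (chart d x).left_inv hx, smAt_chart_symm (d := d) x hu,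
    bijective_frame hu⟩

theorem IsRiem.exists_frame {g : BilForm d M ℝ} (hg : IsRiem g) {E : Type*} [NormedAddCommGroup E]
    [NormedSpace ℝ E] [FiniteDimensional ℝ E] {c : E → M} {u : E}
    (hb : Function.Injective (md (d := d) c u)) :
    ∃ e : Fin (Module.finrank ℝ E) → E, IsFrame (pb2 c g u) e := by
  refine WKahler.exists_frame (pb2 c g u) (fun a b => ?_) (fun a ha => ?_)
  · rw [pb2_apply, pb2_apply]
    exact hg.symm (c u) _ _
  · rw [pb2_apply]
    exact hg.pos (c u) _ fun h0 => ha (hb (h0.trans (map_zero (md (d := d) c u)).symm))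

/-- The Laplacian of `v(μ)`, by the chain rule and `sum_dmu_mul_dmu`. -/
theorem IsHamKahler.laplacian_comp (h : IsHamKahler J Ω τ μ) {v : LieT r → ℝ}
    (hv : ContDiff ℝ ∞ v) (x : M) : laplacian (metric J Ω) (fun y => v (μ y)) x =
      ∑ i, fderiv ℝ v (μ x) (bas i) * laplacian (metric J Ω) (fun y => μ y i) x -
      ∑ i, ∑ j, hess v i j (μ x) * genGram J Ω τ i j x := by
  obtain ⟨c, z, hcz, hc, hb⟩ := exists_param (d := d) x
  subst hcz
  have hg := h.kahler.isRiem
  obtain ⟨e, he⟩ := hg.exists_frame hb.1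
  have h1 := laplacian_eq_lapJet hg hc hb.2 he (hv.contMDiff.comp h.smooth_mom)
  have h2 : ContDiffAt ℝ 2 (μ ∘ c) z := (hc.contDiffAt_fun h.smooth_mom).of_le two_le_infty
  have h3 := lapJet_comp (pb2 c (metric J Ω)) hv h2 e
  refine (h1.trans h3).trans (congrArg₂ _ ?_ ?_)
  · exact Finset.sum_congr rfl fun i _ => congrArg _
      (laplacian_eq_lapJet hg hc hb.2 he (h.contMDiff_mu i)).symm
  · exact Finset.sum_congr rfl fun i _ => Finset.sum_congr rfl fun j _ =>
      congrArg _ (h.sum_dmu_mul_dmu hc hb.2 he i j)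

/-- The weighted scalar curvature through the Laplacians of the components of the momentum map:
the Hessian terms combine because `⟨dμ_i, dμ_j⟩ = g(ξ_i, ξ_j)`. -/
theorem IsHamKahler.wScal_eq (h : IsHamKahler J Ω τ μ) {v : LieT r → ℝ} (hv : ContDiff ℝ ∞ v)
    (x : M) : wScal v J Ω τ μ x = v (μ x) * scal (metric J Ω) x +
      2 * ∑ i, fderiv ℝ v (μ x) (bas i) * laplacian (metric J Ω) (fun y => μ y i) x -
      ∑ i, ∑ j, hess v i j (μ x) * genGram J Ω τ i j x := by
  rw [wScal, h.laplacian_comp hv]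
  change _ + _ + (∑ i, ∑ j, hess v i j (μ x) * genGram J Ω τ i j x) = _
  ring

end Momentum

/-! ### Linear algebra and local inverses -/

section Lin

variable {V W L : Type*} [NormedAddCommGroup V] [NormedSpace ℝ V] [FiniteDimensional ℝ V]
  [NormedAddCommGroup W] [NormedSpace ℝ W] [FiniteDimensional ℝ W]
  [NormedAddCommGroup L] [NormedSpace ℝ L] [FiniteDimensional ℝ L]

theorem exists_equiv_of_bijective {f : V →L[ℝ] W} (h : Function.Bijective f) :
    ∃ e : V ≃L[ℝ] W, (e : V →L[ℝ] W) = f :=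
  ⟨(LinearEquiv.ofBijective f.toLinearMap h).toContinuousLinearEquiv, by ext1; rfl⟩

theorem apply_inverse_self {f : V →L[ℝ] W} (h : Function.Bijective f) (w : W) :
    f (f.inverse w) = w := by
  obtain ⟨e, rfl⟩ := exists_equiv_of_bijective h
  simp

/-- If `f` is onto, and `s` is a right inverse of `g` with values in the kernel of `f`, then
`(f, g)` is onto, hence bijective for reasons of dimension. -/
theorem bijective_prod {f : V →L[ℝ] W} (hf : Function.Surjective f) {g : V →L[ℝ] L} {s : L → V}
    (hs : ∀ l, f (s l) = 0) (hg : ∀ l, g (s l) = l)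
    (hd : Module.finrank ℝ V = Module.finrank ℝ W + Module.finrank ℝ L) :
    Function.Bijective (f.prod g) := by
  have hsurj : Function.Surjective (f.prod g) := by
    rintro ⟨w, l⟩
    obtain ⟨v, rfl⟩ := hf w
    refine ⟨v + s (l - g v), ?_⟩
    simp [hs, hg]
  refine ⟨?_, hsurj⟩
  exact (LinearMap.injective_iff_surjective_of_finrank_eq_finrank (f := (f.prod g).toLinearMap)
    (by rw [Module.finrank_prod]; exact hd)).2 hsurj

end Lin

section Inverse

variable {E F : Type*} [NormedAddCommGroup E] [NormedSpace ℝ E] [NormedAddCommGroup F]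
  [NormedSpace ℝ F] [FiniteDimensional ℝ E] [FiniteDimensional ℝ F]

/-- The local inverse of a map that is smooth near `u` is smooth near `φ(u)`. -/
theorem exists_local_inverse_eventually {φ : E → F} {u : E}
    (hφ : ∀ᶠ z in 𝓝 u, ContDiffAt ℝ ∞ φ z) (hb : Function.Bijective (fderiv ℝ φ u)) :
    ∃ ρ : F → E, ρ (φ u) = u ∧ (∀ᶠ w in 𝓝 (φ u), ContDiffAt ℝ ∞ ρ w) ∧
      (∀ᶠ w in 𝓝 (φ u), φ (ρ w) = w) ∧ ∀ᶠ z in 𝓝 u, ρ (φ z) = z := by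
  obtain ⟨ρ, h1, h2, h3, h4⟩ := exists_local_inverse hφ.self_of_nhds hb
  refine ⟨ρ, h1, ?_, h3, h4⟩
  have hρc : ContinuousAt ρ (φ u) := h2.continuousAt
  have hbe : ∀ᶠ z in 𝓝 u, Function.Bijective (fderiv ℝ φ z) := by
    have hcont : ContinuousAt (fderiv ℝ φ) u :=
      (hφ.self_of_nhds.fderiv_right (m := 0) (by simp)).continuousAt
    obtain ⟨T, hT⟩ := exists_equiv_of_bijective hb
    have := T.nhds
    rw [hT] at this
    filter_upwards [hcont.eventually this] with z hz
    obtain ⟨S, hS⟩ := hz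
    rw [← hS]
    exact S.bijective
  have hev' := hρc.eventually ((congrArg 𝓝 h1).symm ▸ (hφ.and hbe))
  have h5 : ∀ᶠ w in 𝓝 (φ u), ContinuousAt ρ w :=
    ((h2.of_le (m := 1) (by simp)).eventually (by simp)).mono fun w hw => hw.continuousAt
  filter_upwards [hev', h3.eventually_nhds, h5] with w ⟨b1, b2⟩ hw hcw
  obtain ⟨ρ', r1, r2, r3, r4⟩ := exists_local_inverse b1 b2
  rw [hw.self_of_nhds] at r1 r2 r3
  refine r2.congr_of_eventuallyEq ?_
  filter_upwards [hcw.eventually r4, hw] with w' s1 s2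
  rw [← s1, s2]

end Inverse

/-! ### The local model of a fibration -/

section Model

variable {E : Type*} [NormedAddCommGroup E] [NormedSpace ℝ E] {k r : ℕ} {F : Fin k → Type*}
  [∀ a, NormedAddCommGroup (F a)] [∀ a, NormedSpace ℝ (F a)]

/-- The map `(u, b) ↦ u + λ(A b)`: in an adapted parametrization of `Y` it is the component in `TX`
of the horizontal part of a vector. -/
def shear (l : E → LieT r →L[ℝ] E) (A : (∀ a, F a) → (∀ a, F a) →L[ℝ] LieT r) (z : E × ∀ a, F a) :
    (E × ∀ a, F a) →L[ℝ] E :=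
  ContinuousLinearMap.fst ℝ E (∀ a, F a) +
    (l z.1).comp ((A z.2).comp (ContinuousLinearMap.snd ℝ E (∀ a, F a)))

/-- The projection to the factor `F a`. -/
def prF (E : Type*) [NormedAddCommGroup E] [NormedSpace ℝ E] (F : Fin k → Type*)
    [∀ a, NormedAddCommGroup (F a)] [∀ a, NormedSpace ℝ (F a)] (a : Fin k) :
    (E × ∀ a, F a) →L[ℝ] F a :=
  (ContinuousLinearMap.proj (R := ℝ) (φ := F) a).comp (ContinuousLinearMap.snd ℝ E (∀ a, F a))

/-- The product of endomorphisms of the factors. -/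
def prodEnd (K : ∀ a, F a → F a →L[ℝ] F a) (y : ∀ a, F a) : (∀ a, F a) →L[ℝ] (∀ a, F a) :=
  ContinuousLinearMap.pi fun a => (K a (y a)).comp (ContinuousLinearMap.proj (R := ℝ) (φ := F) a)

/-- The metric of `Y` in an adapted parametrization. -/
def modelG (g : E → E →L[ℝ] E →L[ℝ] ℝ) (l : E → LieT r →L[ℝ] E)
    (A : (∀ a, F a) → (∀ a, F a) →L[ℝ] LieT r) (f : Fin k → E → ℝ)
    (h : ∀ a, F a → F a →L[ℝ] F a →L[ℝ] ℝ) (z : E × ∀ a, F a) :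
    (E × ∀ a, F a) →L[ℝ] (E × ∀ a, F a) →L[ℝ] ℝ :=
  pull2 (g z.1) (shear l A z) + ∑ a, f a z.1 • pull2 (h a (z.2 a)) (prF E F a)

/-- The component `A_i` of the connection form. -/
def compA (A : (∀ a, F a) → (∀ a, F a) →L[ℝ] LieT r) (i : Fin r) (z : E × ∀ a, F a) :
    (E × ∀ a, F a) →L[ℝ] ℝ :=
  (ContinuousLinearMap.proj (R := ℝ) (φ := fun _ : Fin r => ℝ) i).comp
    ((A z.2).comp (ContinuousLinearMap.snd ℝ E (∀ a, F a)))

/-- The 2-form of `Y` in an adapted parametrization. -/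
def modelForm (Ω : E → E →L[ℝ] E →L[ℝ] ℝ) (μ : E → LieT r)
    (A : (∀ a, F a) → (∀ a, F a) →L[ℝ] LieT r) (f : Fin k → E → ℝ)
    (κ : ∀ a, F a → F a →L[ℝ] F a →L[ℝ] ℝ) (z : E × ∀ a, F a) :
    (E × ∀ a, F a) →L[ℝ] (E × ∀ a, F a) →L[ℝ] ℝ :=
  pull2 (Ω z.1) (ContinuousLinearMap.fst ℝ E (∀ a, F a)) +
    ∑ a, f a z.1 • pull2 (κ a (z.2 a)) (prF E F a) +
    ∑ i, (((fderiv ℝ (fun u => μ u i) z.1).comp (ContinuousLinearMap.fst ℝ E (∀ a, F a))).smulRight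
        (compA A i z) - (compA A i z).smulRight
        ((fderiv ℝ (fun u => μ u i) z.1).comp (ContinuousLinearMap.fst ℝ E (∀ a, F a))))

/-- The complex structure of `Y` in an adapted parametrization. -/
def modelJ (J : E → E →L[ℝ] E) (l : E → LieT r →L[ℝ] E)
    (A : (∀ a, F a) → (∀ a, F a) →L[ℝ] LieT r) (K : ∀ a, F a → F a →L[ℝ] F a) (z : E × ∀ a, F a) :
    (E × ∀ a, F a) →L[ℝ] (E × ∀ a, F a) :=
  ((J z.1).comp (shear l A z) - (l z.1).comp ((A z.2).comp ((prodEnd K z.2).comp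
    (ContinuousLinearMap.snd ℝ E (∀ a, F a))))).prod
      ((prodEnd K z.2).comp (ContinuousLinearMap.snd ℝ E (∀ a, F a)))

variable {g Ω : E → E →L[ℝ] E →L[ℝ] ℝ} {l : E → LieT r →L[ℝ] E}
  {A : (∀ a, F a) → (∀ a, F a) →L[ℝ] LieT r} {f : Fin k → E → ℝ}
  {h κ : ∀ a, F a → F a →L[ℝ] F a →L[ℝ] ℝ} {J : E → E →L[ℝ] E} {K : ∀ a, F a → F a →L[ℝ] F a}
  {μ : E → LieT r}

theorem modelG_apply (z v w : E × ∀ a, F a) : modelG g l A f h z v w =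
    g z.1 (v.1 + l z.1 (A z.2 v.2)) (w.1 + l z.1 (A z.2 w.2)) +
      ∑ a, f a z.1 * h a (z.2 a) (v.2 a) (w.2 a) := by
  simp only [modelG, add_apply, sum_apply, smul_apply, smul_eq_mul]
  rfl

theorem modelForm_apply (z v w : E × ∀ a, F a) : modelForm Ω μ A f κ z v w =
    Ω z.1 v.1 w.1 + ∑ a, f a z.1 * κ a (z.2 a) (v.2 a) (w.2 a) +
      ∑ i, (fderiv ℝ (fun u => μ u i) z.1 v.1 * A z.2 w.2 i -
        A z.2 v.2 i * fderiv ℝ (fun u => μ u i) z.1 w.1) := by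
  simp only [modelForm, add_apply, sum_apply, smul_apply, sub_apply, smul_eq_mul,
    ContinuousLinearMap.smulRight_apply]
  rfl

theorem modelJ_apply (z v : E × ∀ a, F a) : modelJ J l A K z v =
    (J z.1 (v.1 + l z.1 (A z.2 v.2)) - l z.1 (A z.2 (prodEnd K z.2 v.2)), prodEnd K z.2 v.2) := rfl

theorem prodEnd_apply (y b : ∀ a, F a) (a : Fin k) : prodEnd K y b a = K a (y a) (b a) := rfl

section Smooth

variable {z : E × ∀ a, F a}

theorem contDiffAt_prodEnd {y : ∀ a, F a} (hK : ∀ a, ContDiffAt ℝ ∞ (K a) (y a)) :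
    ContDiffAt ℝ ∞ (prodEnd K) y := by
  have e : prodEnd K = fun y => ∑ a, (ContinuousLinearMap.single ℝ F a).comp
      ((K a (y a)).comp (ContinuousLinearMap.proj (R := ℝ) (φ := F) a)) := by
    ext y b a
    simp [prodEnd_apply, sum_apply, Finset.sum_apply]
  rw [e]
  refine ContDiffAt.sum fun a _ => ?_
  have h1 : ContDiffAt ℝ ∞ (fun y : ∀ a, F a => K a (y a)) y :=
    ContDiffAt.comp (f := fun y : ∀ a, F a => y a) y (hK a) (ContinuousLinearMap.proj (R := ℝ) (φ := F) a).contDiff.contDiffAt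
  exact contDiffAt_const.clm_comp (h1.clm_comp contDiffAt_const)

theorem contDiffAt_comp_fst {V : Type*} [NormedAddCommGroup V] [NormedSpace ℝ V] {s : E → V}
    (hs : ContDiffAt ℝ ∞ s z.1) : ContDiffAt ℝ ∞ (fun z : E × ∀ a, F a => s z.1) z :=
  ContDiffAt.comp z hs contDiffAt_fst

theorem contDiffAt_comp_snd {V : Type*} [NormedAddCommGroup V] [NormedSpace ℝ V]
    {s : (∀ a, F a) → V} (hs : ContDiffAt ℝ ∞ s z.2) :
    ContDiffAt ℝ ∞ (fun z : E × ∀ a, F a => s z.2) z :=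
  ContDiffAt.comp z hs contDiffAt_snd

theorem contDiffAt_comp_snd_apply {V : Type*} [NormedAddCommGroup V] [NormedSpace ℝ V] {a : Fin k}
    {s : F a → V} (hs : ContDiffAt ℝ ∞ s (z.2 a)) :
    ContDiffAt ℝ ∞ (fun z : E × ∀ a, F a => s (z.2 a)) z :=
  ContDiffAt.comp (f := fun z : E × ∀ a, F a => z.2 a) z hs
    ((prF E F a).contDiff.contDiffAt)

theorem contDiffAt_shear (hl : ContDiffAt ℝ ∞ l z.1) (hA : ContDiffAt ℝ ∞ A z.2) :
    ContDiffAt ℝ ∞ (shear l A) z :=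
  contDiffAt_const.add ((contDiffAt_comp_fst hl).clm_comp
    ((contDiffAt_comp_snd hA).clm_comp contDiffAt_const))

theorem contDiffAt_modelJ (hJ : ContDiffAt ℝ ∞ J z.1) (hl : ContDiffAt ℝ ∞ l z.1)
    (hA : ContDiffAt ℝ ∞ A z.2) (hK : ∀ a, ContDiffAt ℝ ∞ (K a) (z.2 a)) :
    ContDiffAt ℝ ∞ (modelJ J l A K) z := by
  have h1 : ContDiffAt ℝ ∞ (fun z : E × ∀ a, F a => (prodEnd K z.2).comp
      (ContinuousLinearMap.snd ℝ E (∀ a, F a))) z :=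
    (contDiffAt_comp_snd (contDiffAt_prodEnd hK)).clm_comp contDiffAt_const
  have h2 : ContDiffAt ℝ ∞ (fun z : E × ∀ a, F a => (J z.1).comp (shear l A z) -
      (l z.1).comp ((A z.2).comp ((prodEnd K z.2).comp
        (ContinuousLinearMap.snd ℝ E (∀ a, F a))))) z :=
    ((contDiffAt_comp_fst hJ).clm_comp (contDiffAt_shear hl hA)).sub
      ((contDiffAt_comp_fst hl).clm_comp ((contDiffAt_comp_snd hA).clm_comp h1))
  have e : modelJ J l A K = fun z => (ContinuousLinearMap.inl ℝ E (∀ a, F a)).comp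
      ((J z.1).comp (shear l A z) - (l z.1).comp ((A z.2).comp ((prodEnd K z.2).comp
        (ContinuousLinearMap.snd ℝ E (∀ a, F a))))) +
      (ContinuousLinearMap.inr ℝ E (∀ a, F a)).comp ((prodEnd K z.2).comp
        (ContinuousLinearMap.snd ℝ E (∀ a, F a))) := by
    ext1 z
    refine ContinuousLinearMap.ext fun v => ?_
    simp [modelJ]
  rw [e]
  exact (contDiffAt_const.clm_comp h2).add (contDiffAt_const.clm_comp h1)

theorem contDiffAt_modelForm (hΩ : ContDiffAt ℝ ∞ Ω z.1) (hμ : ContDiffAt ℝ ∞ μ z.1)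
    (hA : ContDiffAt ℝ ∞ A z.2) (hf : ∀ a, ContDiffAt ℝ ∞ (f a) z.1)
    (hκ : ∀ a, ContDiffAt ℝ ∞ (κ a) (z.2 a)) : ContDiffAt ℝ ∞ (modelForm Ω μ A f κ) z := by
  have h1 : ∀ i, ContDiffAt ℝ ∞ (compA (E := E) A i) z := fun i =>
    contDiffAt_const.clm_comp ((contDiffAt_comp_snd hA).clm_comp contDiffAt_const)
  have h2 : ∀ i, ContDiffAt ℝ ∞ (fun z : E × ∀ a, F a => (fderiv ℝ (fun u => μ u i) z.1).comp
      (ContinuousLinearMap.fst ℝ E (∀ a, F a))) z := fun i =>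
    (contDiffAt_comp_fst ((contDiffAt_pi.1 hμ i).fderiv_right (by simp))).clm_comp contDiffAt_const
  refine ContDiffAt.add (ContDiffAt.add (contDiffAt_pull2 (contDiffAt_comp_fst hΩ)
    contDiffAt_const) ?_) ?_
  · exact ContDiffAt.sum fun a _ => (contDiffAt_comp_fst (hf a)).smul
      (contDiffAt_pull2 (contDiffAt_comp_snd_apply (hκ a)) contDiffAt_const)
  · exact ContDiffAt.sum fun i _ => ((h2 i).smulRight (h1 i)).sub ((h1 i).smulRight (h2 i))

end Smooth

/-! ### First derivatives of the local model where the connection form vanishes -/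

section Jet

variable {u : E} {y : ∀ a, F a}

/-- If `s` vanishes at the point, the derivative of `T` does not enter that of `T s`. -/
theorem hasFDerivAt_clm_apply_of_zero {W V V' : Type*} [NormedAddCommGroup W] [NormedSpace ℝ W]
    [NormedAddCommGroup V] [NormedSpace ℝ V] [NormedAddCommGroup V'] [NormedSpace ℝ V']
    {T : W → V →L[ℝ] V'} {s : W → V} {w : W} {s' : W →L[ℝ] V} (hT : DifferentiableAt ℝ T w)
    (hs : HasFDerivAt s s' w) (h0 : s w = 0) :
    HasFDerivAt (fun z => T z (s z)) ((T w).comp s') w := by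
  have h1 := hT.hasFDerivAt.clm_apply hs
  rw [h0] at h1
  convert h1 using 1
  ext v
  simp

theorem _root_.HasFDerivAt.comp_fstF {V : Type*} [NormedAddCommGroup V] [NormedSpace ℝ V] {s : E → V}
    {s' : E →L[ℝ] V} (hs : HasFDerivAt s s' u) : HasFDerivAt (fun z : E × ∀ a, F a => s z.1)
      (s'.comp (ContinuousLinearMap.fst ℝ E (∀ a, F a))) (u, y) :=
  HasFDerivAt.comp (f := Prod.fst) (u, y) hs hasFDerivAt_fst

theorem _root_.HasFDerivAt.comp_sndF {V : Type*} [NormedAddCommGroup V] [NormedSpace ℝ V]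
    {s : (∀ a, F a) → V} {s' : (∀ a, F a) →L[ℝ] V} (hs : HasFDerivAt s s' y) :
    HasFDerivAt (fun z : E × ∀ a, F a => s z.2)
      (s'.comp (ContinuousLinearMap.snd ℝ E (∀ a, F a))) (u, y) :=
  HasFDerivAt.comp (f := Prod.snd) (u, y) hs hasFDerivAt_snd

theorem _root_.HasFDerivAt.comp_prF {V : Type*} [NormedAddCommGroup V] [NormedSpace ℝ V] {a : Fin k}
    {s : F a → V} {s' : F a →L[ℝ] V} (hs : HasFDerivAt s s' (y a)) :
    HasFDerivAt (fun z : E × ∀ a, F a => s (z.2 a)) (s'.comp (prF E F a)) (u, y) :=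
  HasFDerivAt.comp (f := prF E F a) (u, y) hs (prF E F a).hasFDerivAt

theorem hasFDerivAt_apply_const {W V V' : Type*} [NormedAddCommGroup W] [NormedSpace ℝ W]
    [NormedAddCommGroup V] [NormedSpace ℝ V] [NormedAddCommGroup V'] [NormedSpace ℝ V']
    {T : W → V →L[ℝ] V'} {w : W} (hT : DifferentiableAt ℝ T w) (b : V) :
    HasFDerivAt (fun z => T z b) ((fderiv ℝ T w).flip b) w := by
  have h1 := hT.hasFDerivAt.clm_apply (hasFDerivAt_const b w)
  have e : (fderiv ℝ T w).flip b = (T w).comp (0 : W →L[ℝ] V) + (fderiv ℝ T w).flip b := by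
    refine ContinuousLinearMap.ext fun v => ?_
    simp
  rw [e]
  exact h1

theorem fderiv_prodEnd (hK : ∀ a, DifferentiableAt ℝ (K a) (y a)) (hP : DifferentiableAt ℝ (prodEnd K) y)
    (v b : ∀ a, F a) : fderiv ℝ (prodEnd K) y v b = fun a => fderiv ℝ (K a) (y a) (v a) (b a) := by
  ext1 a
  have h1 : fderiv ℝ (fun y => prodEnd K y b a) y v = fderiv ℝ (prodEnd K) y v b a := by
    have h2 : DifferentiableAt ℝ (fun y => prodEnd K y b) y := hP.clm_apply (differentiableAt_const _)
    have h3 := fderiv_apply h2 a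
    rw [h3, ContinuousLinearMap.comp_apply, fderiv_apply_const hP]
    rfl
  rw [← h1]
  have h4 : HasFDerivAt (fun y : ∀ a, F a => K a (y a)) _ y :=
    (hK a).hasFDerivAt.comp y ((ContinuousLinearMap.proj (R := ℝ) (φ := F) a).hasFDerivAt (x := y))
  have h5 : (fun y => prodEnd K y b a) = fun y => K a (y a) (b a) := rfl
  rw [h5, fderiv_apply_const h4.differentiableAt, h4.fderiv]
  rfl

/-- The derivative of `modelJ` where `A` vanishes: only terms linear in `dA` survive from the
shear. -/
theorem fderiv_modelJ (hJ : ContDiffAt ℝ ∞ J u) (hl : ContDiffAt ℝ ∞ l u)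
    (hA : ContDiffAt ℝ ∞ A y) (hK : ∀ a, ContDiffAt ℝ ∞ (K a) (y a)) (hA0 : A y = 0)
    (v w : E × ∀ a, F a) : fderiv ℝ (modelJ J l A K) (u, y) v w =
      (fderiv ℝ J u v.1 w.1 + J u (l u (fderiv ℝ A y v.2 w.2)) -
        l u (fderiv ℝ A y v.2 (prodEnd K y w.2)), fun a => fderiv ℝ (K a) (y a) (v.2 a) (w.2 a)) := by
  have hm : DifferentiableAt ℝ (modelJ J l A K) (u, y) :=
    (contDiffAt_modelJ hJ hl hA hK).differentiableAt (by simp)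
  have hJd : DifferentiableAt ℝ J u := hJ.differentiableAt (by simp)
  have hAd : DifferentiableAt ℝ A y := hA.differentiableAt (by simp)
  have hPd : DifferentiableAt ℝ (prodEnd K) y := (contDiffAt_prodEnd hK).differentiableAt (by simp)
  have hl1 : DifferentiableAt ℝ (fun z : E × ∀ a, F a => l z.1) (u, y) :=
    (contDiffAt_comp_fst hl).differentiableAt (by simp)
  have hJ1 : DifferentiableAt ℝ (fun z : E × ∀ a, F a => J z.1) (u, y) :=
    (contDiffAt_comp_fst hJ).differentiableAt (by simp)
  have hA1 : HasFDerivAt (fun z : E × ∀ a, F a => A z.2) _ (u, y) :=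
    hAd.hasFDerivAt.comp_sndF
  rw [← fderiv_apply_const hm]
  have e1 : (fun z => modelJ J l A K z w) = fun z => (J z.1 w.1 + (J z.1 (l z.1 (A z.2 w.2)) -
      l z.1 (A z.2 (prodEnd K z.2 w.2))), prodEnd K z.2 w.2) := by
    ext1 z; rw [modelJ_apply, map_add, add_sub_assoc]
  have d1 := (hasFDerivAt_apply_const hJd w.1).comp_fstF (y := y)
  have d2 := hasFDerivAt_clm_apply_of_zero hl1 ((hasFDerivAt_apply_const hAd w.2).comp_sndF (u := u))
    (by simp [hA0])
  have d3 := hasFDerivAt_clm_apply_of_zero hJ1 d2 (by simp [hA0])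
  have d4 := (hasFDerivAt_apply_const hPd w.2).comp_sndF (u := u)
  have d5 := hA1.clm_apply d4
  have d6 := hasFDerivAt_clm_apply_of_zero hl1 d5 (by simp [hA0])
  rw [e1]
  refine (DFunLike.congr_fun ((d1.fun_add (d3.fun_sub d6)).prodMk d4).fderiv v).trans ?_
  refine Prod.ext ?_ ?_
  · simp [hA0, add_sub_assoc]
  · exact fderiv_prodEnd (fun a => (hK a).differentiableAt (by simp)) hPd v.2 w.2

/-- The model complex structure is integrable where the curvature of `A` is of type `(1, 1)`. -/
theorem nij_modelJ (hJ : ContDiffAt ℝ ∞ J u) (hl : ContDiffAt ℝ ∞ l u)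
    (hA : ContDiffAt ℝ ∞ A y) (hK : ∀ a, ContDiffAt ℝ ∞ (K a) (y a)) (hA0 : A y = 0)
    (hJsq : ∀ v, J u (J u v) = -v) (hKsq : ∀ a v, K a (y a) (K a (y a) v) = -v)
    (hnJ : ∀ v w, nij J u v w = 0) (hnK : ∀ a v w, nij (K a) (y a) v w = 0)
    (hanti : ∀ b b', fderiv ℝ A y b b' = -fderiv ℝ A y b' b)
    (hinv : ∀ b b', fderiv ℝ A y (prodEnd K y b) (prodEnd K y b') = fderiv ℝ A y b b')
    (v w : E × ∀ a, F a) : nij (modelJ J l A K) (u, y) v w = 0 := by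
  have h0 : ∀ v, modelJ J l A K (u, y) v = (J u v.1, prodEnd K y v.2) := by
    intro v; rw [modelJ_apply]; simp [hA0]
  have hPsq : ∀ b, prodEnd K y (prodEnd K y b) = -b := by
    intro b; ext1 a; exact hKsq a (b a)
  have hinv' : ∀ b b', fderiv ℝ A y (prodEnd K y b) b' = -fderiv ℝ A y b (prodEnd K y b') := by
    intro b b'
    rw [← hinv b, hPsq, map_neg, neg_neg]
  have h1 := hnJ v.1 w.1
  rw [nij] at h1 ⊢
  simp only [h0, fderiv_modelJ hJ hl hA hK hA0]
  refine Prod.ext ?_ ?_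
  · simp only [Prod.fst_add, Prod.fst_sub, Prod.fst_zero, map_add, map_sub, hJsq, hinv, hinv']
    rw [hanti w.2 v.2, hanti w.2 (prodEnd K y v.2), hinv' v.2 w.2]
    simp only [map_neg, neg_neg]
    rw [← h1]
    abel
  · ext1 a
    exact hnK a (v.2 a) (w.2 a)

/-- The derivative of `modelForm` where `A` vanishes. -/
theorem fderiv_modelForm (hΩ : ContDiffAt ℝ ∞ Ω u) (hμ : ContDiffAt ℝ ∞ μ u)
    (hA : ContDiffAt ℝ ∞ A y) (hf : ∀ a, ContDiffAt ℝ ∞ (f a) u)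
    (hκ : ∀ a, ContDiffAt ℝ ∞ (κ a) (y a)) (hA0 : A y = 0) (x v w : E × ∀ a, F a) :
    fderiv ℝ (modelForm Ω μ A f κ) (u, y) x v w = fderiv ℝ Ω u x.1 v.1 w.1 +
      ∑ a, (fderiv ℝ (f a) u x.1 * κ a (y a) (v.2 a) (w.2 a) +
        f a u * fderiv ℝ (κ a) (y a) (x.2 a) (v.2 a) (w.2 a)) +
      ∑ i, (fderiv ℝ (fun u => μ u i) u v.1 * fderiv ℝ A y x.2 w.2 i -
        fderiv ℝ A y x.2 v.2 i * fderiv ℝ (fun u => μ u i) u w.1) := by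
  have hm : DifferentiableAt ℝ (modelForm Ω μ A f κ) (u, y) :=
    (contDiffAt_modelForm hΩ hμ hA hf hκ).differentiableAt (by simp)
  have hAd : DifferentiableAt ℝ A y := hA.differentiableAt (by simp)
  rw [← fderiv_apply_const₂ hm]
  simp only [modelForm_apply]
  have d1 : HasFDerivAt (fun z : E × ∀ a, F a => Ω z.1 v.1 w.1) _ (u, y) :=
    (((hΩ.differentiableAt (by simp)).clm_apply (differentiableAt_const v.1)).clm_apply
      (differentiableAt_const w.1)).hasFDerivAt.comp_fstF
  have d2 : ∀ a, HasFDerivAt (fun z : E × ∀ a, F a => f a z.1 * κ a (z.2 a) (v.2 a) (w.2 a)) _ (u, y) :=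
    fun a => (((hf a).differentiableAt (by simp)).hasFDerivAt.comp_fstF).mul
      (((((hκ a).differentiableAt (by simp)).clm_apply (differentiableAt_const (v.2 a))).clm_apply
        (differentiableAt_const (w.2 a))).hasFDerivAt.comp_prF)
  have d3 : ∀ i (b : ∀ a, F a), HasFDerivAt (fun z : E × ∀ a, F a => A z.2 b i) _ (u, y) :=
    fun i b => (((ContinuousLinearMap.proj (R := ℝ) (φ := fun _ : Fin r => ℝ) i).hasFDerivAt).comp
      y (hasFDerivAt_apply_const hAd b)).comp_sndF
  have d4 : ∀ i (a : E), DifferentiableAt ℝ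
      (fun z : E × ∀ a, F a => fderiv ℝ (fun u => μ u i) z.1 a) (u, y) := fun i a =>
    (contDiffAt_comp_fst (z := (u, y)) (((contDiffAt_pi.1 hμ i).fderiv_right (m := ∞)
      (by simp)).clm_apply contDiffAt_const)).differentiableAt (by simp)
  refine (DFunLike.congr_fun ((d1.fun_add (HasFDerivAt.fun_sum fun a _ => d2 a)).fun_add
    (HasFDerivAt.fun_sum fun i _ => ((d4 i v.1).hasFDerivAt.fun_mul (d3 i w.2)).fun_sub
      ((d3 i v.2).fun_mul (d4 i w.1).hasFDerivAt))).fderiv x).trans ?_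
  simp only [add_apply, sum_apply, sub_apply, smul_apply, smul_eq_mul,
    ContinuousLinearMap.comp_apply, hA0, zero_apply, Pi.zero_apply, zero_mul, add_zero, zero_add]
  rw [fderiv_apply_const₂ (hΩ.differentiableAt (by simp))]
  congr 1
  · congr 1
    refine Finset.sum_congr rfl fun a _ => ?_
    have h1 := fderiv_apply_const₂ ((hκ a).differentiableAt (by simp)) (v.2 a) (w.2 a) (prF E F a x)
    rw [h1, add_comm, mul_comm (κ a (y a) (v.2 a) (w.2 a))]
    rfl
  · refine Finset.sum_congr rfl fun i _ => ?_
    simp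
    ring

/-- The model 2-form is closed if the derivatives of the functions `f_a` and of the connection form
are related through the curvature. -/
theorem cyc_modelForm (hΩ : ContDiffAt ℝ ∞ Ω u) (hμ : ContDiffAt ℝ ∞ μ u)
    (hA : ContDiffAt ℝ ∞ A y) (hf : ∀ a, ContDiffAt ℝ ∞ (f a) u)
    (hκ : ∀ a, ContDiffAt ℝ ∞ (κ a) (y a)) (hA0 : A y = 0)
    (hcΩ : ∀ v₁ v₂ v₃, cyc Ω u v₁ v₂ v₃ = 0) (hcκ : ∀ a v₁ v₂ v₃, cyc (κ a) (y a) v₁ v₂ v₃ = 0)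
    (hκa : ∀ a v w, κ a (y a) v w = -κ a (y a) w v) {p : Fin k → Fin r → ℝ}
    (hp : ∀ a v, fderiv ℝ (f a) u v = ∑ i, p a i * fderiv ℝ (fun u => μ u i) u v)
    (hAp : ∀ b b' i, fderiv ℝ A y b b' i = (1 / 2 : ℝ) * ∑ a, κ a (y a) (b a) (b' a) * p a i)
    (v₁ v₂ v₃ : E × ∀ a, F a) : cyc (modelForm Ω μ A f κ) (u, y) v₁ v₂ v₃ = 0 := by
  have key : ∀ (s : E) (b b' : ∀ a, F a), ∑ a, fderiv ℝ (f a) u s * κ a (y a) (b a) (b' a) =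
      ∑ i, fderiv ℝ (fun u => μ u i) u s * (2 * fderiv ℝ A y b b' i) := by
    intro s b b'
    simp only [hp, hAp, Finset.sum_mul, Finset.mul_sum]
    rw [Finset.sum_comm]
    exact Finset.sum_congr rfl fun i _ => Finset.sum_congr rfl fun a _ => by ring
  have hanti : ∀ b b' i, fderiv ℝ A y b b' i = -fderiv ℝ A y b' b i := by
    intro b b' i
    rw [hAp, hAp, ← mul_neg, ← Finset.sum_neg_distrib]
    congr 1
    exact Finset.sum_congr rfl fun a _ => by rw [hκa]; ring
  have h1 := hcΩ v₁.1 v₂.1 v₃.1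
  have h2 : ∑ a, f a u * cyc (κ a) (y a) (v₁.2 a) (v₂.2 a) (v₃.2 a) = 0 :=
    Finset.sum_eq_zero fun a _ => by rw [hcκ, mul_zero]
  simp only [cyc, fderiv_modelForm hΩ hμ hA hf hκ hA0, Finset.sum_add_distrib, key] at h1 h2 ⊢
  have h3 : ∑ i, (fderiv ℝ (fun u => μ u i) u v₁.1 * (2 * fderiv ℝ A y v₂.2 v₃.2 i) +
      fderiv ℝ (fun u => μ u i) u v₂.1 * (2 * fderiv ℝ A y v₃.2 v₁.2 i) +
      fderiv ℝ (fun u => μ u i) u v₃.1 * (2 * fderiv ℝ A y v₁.2 v₂.2 i) +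
      (fderiv ℝ (fun u => μ u i) u v₂.1 * fderiv ℝ A y v₁.2 v₃.2 i -
        fderiv ℝ A y v₁.2 v₂.2 i * fderiv ℝ (fun u => μ u i) u v₃.1) +
      (fderiv ℝ (fun u => μ u i) u v₃.1 * fderiv ℝ A y v₂.2 v₁.2 i -
        fderiv ℝ A y v₂.2 v₃.2 i * fderiv ℝ (fun u => μ u i) u v₁.1) +
      (fderiv ℝ (fun u => μ u i) u v₁.1 * fderiv ℝ A y v₃.2 v₂.2 i -
        fderiv ℝ A y v₃.2 v₁.2 i * fderiv ℝ (fun u => μ u i) u v₂.1)) = 0 := by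
    refine Finset.sum_eq_zero fun i _ => ?_
    rw [hanti v₁.2 v₃.2, hanti v₂.2 v₁.2, hanti v₃.2 v₂.2]
    ring
  simp only [Finset.sum_add_distrib, mul_add] at h2 h3
  linarith

end Jet
end Model

section ModelForms

variable {E : Type*} [NormedAddCommGroup E] [NormedSpace ℝ E] {k r : ℕ} {F : Fin k → Type*}
  [∀ a, NormedAddCommGroup (F a)] [∀ a, NormedSpace ℝ (F a)] {l : E → LieT r →L[ℝ] E}
  {A : (∀ a, F a) → (∀ a, F a) →L[ℝ] LieT r} {u : E} {y : ∀ a, F a}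

/-- The exterior derivative of a 1-form of `E` composed with the shear: the curvature `dA`
appears. -/
theorem curl_comp_shear {β : E → E →L[ℝ] ℝ} (hβ : ContDiffAt ℝ ∞ β u) (hl : ContDiffAt ℝ ∞ l u)
    (hA : ContDiffAt ℝ ∞ A y) (hA0 : A y = 0) (v w : E × ∀ a, F a) :
    curl (fun z : E × ∀ a, F a => (β z.1).comp (shear l A z)) (u, y) v w = curl β u v.1 w.1 +
      β u (l u (fderiv ℝ A y v.2 w.2 - fderiv ℝ A y w.2 v.2)) := by
  have hd : DifferentiableAt ℝ (fun z : E × ∀ a, F a => (β z.1).comp (shear l A z)) (u, y) :=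
    ContDiffAt.differentiableAt (n := ∞) ((contDiffAt_comp_fst (F := F) (z := (u, y)) hβ).clm_comp
      (contDiffAt_shear hl hA)) (by simp)
  have hAd : DifferentiableAt ℝ A y := hA.differentiableAt (by simp)
  have hl1 : DifferentiableAt ℝ (fun z : E × ∀ a, F a => l z.1) (u, y) :=
    (contDiffAt_comp_fst hl).differentiableAt (by simp)
  have hβ1 : DifferentiableAt ℝ (fun z : E × ∀ a, F a => β z.1) (u, y) :=
    (contDiffAt_comp_fst hβ).differentiableAt (by simp)
  have key : ∀ v w, fderiv ℝ (fun z : E × ∀ a, F a => (β z.1).comp (shear l A z)) (u, y) v w =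
      fderiv ℝ β u v.1 w.1 + β u (l u (fderiv ℝ A y v.2 w.2)) := by
    intro v w
    rw [← fderiv_apply_const hd]
    have e1 : (fun z : E × ∀ a, F a => (β z.1).comp (shear l A z) w) =
        fun z => β z.1 w.1 + β z.1 (l z.1 (A z.2 w.2)) := by
      ext1 z; exact map_add (β z.1) _ _
    have d1 := (hasFDerivAt_apply_const (hβ.differentiableAt (by simp)) w.1).comp_fstF (y := y)
    have d2 := hasFDerivAt_clm_apply_of_zero hl1 ((hasFDerivAt_apply_const hAd w.2).comp_sndF (u := u))
      (by simp [hA0])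
    have d3 := hasFDerivAt_clm_apply_of_zero hβ1 d2 (by simp [hA0])
    rw [e1]
    refine (DFunLike.congr_fun (d1.fun_add d3).fderiv v).trans ?_
    simp
  rw [curl_apply, curl_apply, key, key]
  simp only [map_sub]
  ring

end ModelForms

/-! ### Curvature of a metric of Kaluza-Klein type -/

section KaluzaKlein

/-- The second derivative `∂_b ∂_a s` of a function. -/
def d2 {E : Type*} [NormedAddCommGroup E] [NormedSpace ℝ E] (s : E → ℝ) (z a b : E) : ℝ :=
  fderiv ℝ (fun z' => fderiv ℝ s z' a) z b

section D2

variable {E : Type*} [NormedAddCommGroup E] [NormedSpace ℝ E] {W : Type*} [NormedAddCommGroup W]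
  [NormedSpace ℝ W]

theorem fderiv_fderiv_apply {G : E → E →L[ℝ] E →L[ℝ] ℝ} {z : E} (hG : ContDiffAt ℝ 2 G z)
    (a b v w : E) : fderiv ℝ (fun z' => fderiv ℝ G z' a v w) z b = d2 (fun z' => G z' v w) z a b := by
  refine DFunLike.congr_fun (Filter.EventuallyEq.fderiv_eq ?_) b
  filter_upwards [hG.eventually (by simp)] with z' h
  rw [fderiv_apply_const₂ (h.differentiableAt (by simp))]

theorem d2_congr {s t : E → ℝ} {z : E} (h : s =ᶠ[𝓝 z] t) (a b : E) : d2 s z a b = d2 t z a b :=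
  DFunLike.congr_fun (Filter.EventuallyEq.fderiv_eq (h.eventuallyEq_nhds.mono fun _ hy =>
    DFunLike.congr_fun hy.fderiv_eq a)) b

theorem d2_symm {s : E → ℝ} {z : E} (hs : ContDiffAt ℝ 2 s z) (a b : E) : d2 s z a b = d2 s z b a := by
  have hd : DifferentiableAt ℝ (fderiv ℝ s) z :=
    (hs.fderiv_right (m := 1) (by norm_num)).differentiableAt (by simp)
  rw [d2, d2, fderiv_apply_const hd, fderiv_apply_const hd, fderiv_fderiv_symm hs]

theorem d2_zero (z a b : E) : d2 (fun _ : E => (0 : ℝ)) z a b = 0 := by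
  simp [d2]

theorem d2_smul {s : E → ℝ} {z : E} (c : ℝ) (hs : ContDiffAt ℝ 2 s z) (a b : E) :
    d2 (fun z => c * s z) z a b = c * d2 s z a b := by
  have hd : DifferentiableAt ℝ (fderiv ℝ s) z :=
    (hs.fderiv_right (m := 1) (by norm_num)).differentiableAt (by simp)
  have h1 : (fun z' => fderiv ℝ (fun z => c * s z) z' a) =ᶠ[𝓝 z] fun z' => c * fderiv ℝ s z' a := by
    filter_upwards [hs.eventually (by simp)] with z' h
    rw [fderiv_const_mul (h.differentiableAt (by simp))]
    rfl
  rw [d2, h1.fderiv_eq, fderiv_const_mul (hd.clm_apply (differentiableAt_const _))]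
  rfl

theorem d2_add {s t : E → ℝ} {z : E} (hs : ContDiffAt ℝ 2 s z) (ht : ContDiffAt ℝ 2 t z) (a b : E) :
    d2 (fun z => s z + t z) z a b = d2 s z a b + d2 t z a b := by
  have hd : ∀ {s : E → ℝ}, ContDiffAt ℝ 2 s z → DifferentiableAt ℝ (fun z => fderiv ℝ s z a) z :=
    fun hs => ((hs.fderiv_right (m := 1) (by norm_num)).differentiableAt (by simp)).clm_apply
      (differentiableAt_const _)
  have h1 : (fun z' => fderiv ℝ (fun z => s z + t z) z' a) =ᶠ[𝓝 z]
      fun z' => fderiv ℝ s z' a + fderiv ℝ t z' a := by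
    filter_upwards [hs.eventually (by simp), ht.eventually (by simp)] with z' h h'
    rw [fderiv_fun_add (h.differentiableAt (by simp)) (h'.differentiableAt (by simp))]
    rfl
  rw [d2, h1.fderiv_eq, fderiv_fun_add (hd hs) (hd ht)]
  rfl

/-- Second derivatives along an affine subspace. -/
theorem d2_comp_affine {s : E → ℝ} {φ : W → E} {L : W →L[ℝ] E} (hφ : ∀ w, HasFDerivAt φ L w) {w : W}
    (hs : ContDiffAt ℝ 2 s (φ w)) (a b : W) : d2 (fun w => s (φ w)) w a b = d2 s (φ w) (L a) (L b) := by
  have h1 : (fun w' => fderiv ℝ (fun w => s (φ w)) w' a) =ᶠ[𝓝 w]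
      fun w' => fderiv ℝ s (φ w') (L a) := by
    filter_upwards [(hφ w).continuousAt.eventually (hs.eventually (by simp))] with w' h
    exact DFunLike.congr_fun ((h.differentiableAt (by simp)).hasFDerivAt.comp w' (hφ w')).fderiv a
  have hd : DifferentiableAt ℝ (fun z => fderiv ℝ s z (L a)) (φ w) :=
    ((hs.fderiv_right (m := 1) (by norm_num)).differentiableAt (by simp)).clm_apply
      (differentiableAt_const _)
  rw [d2, h1.fderiv_eq]
  exact DFunLike.congr_fun (hd.hasFDerivAt.comp w (hφ w)).fderiv b

/-- The second derivative of `γ(p, q)` where `p` and `q` vanish. -/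
theorem d2_bilin {V : Type*} [NormedAddCommGroup V] [NormedSpace ℝ V] (γ : V →L[ℝ] V →L[ℝ] ℝ)
    {p q : W → V} {w : W} (hp : ContDiffAt ℝ 2 p w) (hq : ContDiffAt ℝ 2 q w) (hp0 : p w = 0)
    (hq0 : q w = 0) (a b : W) : d2 (fun w => γ (p w) (q w)) w a b =
      γ (fderiv ℝ p w a) (fderiv ℝ q w b) + γ (fderiv ℝ p w b) (fderiv ℝ q w a) := by
  have h1 : (fun w' => fderiv ℝ (fun w => γ (p w) (q w)) w' a) =ᶠ[𝓝 w]
      fun w' => γ (fderiv ℝ p w' a) (q w') + γ (p w') (fderiv ℝ q w' a) := by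
    filter_upwards [hp.eventually (by simp), hq.eventually (by simp)] with w' h h'
    have d1 := (γ.hasFDerivAt.comp w' (h.differentiableAt (by simp)).hasFDerivAt).clm_apply
      (h'.differentiableAt (by simp)).hasFDerivAt
    refine (DFunLike.congr_fun d1.fderiv a).trans ?_
    simp [add_comm]
  have dp : ∀ {p : W → V}, ContDiffAt ℝ 2 p w → DifferentiableAt ℝ (fun w' => fderiv ℝ p w' a) w :=
    fun hp => ((hp.fderiv_right (m := 1) (by norm_num)).differentiableAt (by simp)).clm_apply
      (differentiableAt_const _)
  have d1 := (γ.hasFDerivAt.comp w (dp hp).hasFDerivAt).clm_apply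
    (hq.differentiableAt (by simp)).hasFDerivAt
  have d2 := (γ.hasFDerivAt.comp w (hp.differentiableAt (by simp)).hasFDerivAt).clm_apply
    (dp hq).hasFDerivAt
  rw [WKahler.d2, h1.fderiv_eq]
  refine (DFunLike.congr_fun (d1.fun_add d2).fderiv b).trans ?_
  simp [hp0, hq0]

end D2

variable {E F : Type*} [NormedAddCommGroup E] [NormedSpace ℝ E] [NormedAddCommGroup F]
  [NormedSpace ℝ F]

/-- A metric `g(u + T b, u + T b) + H(b, b)` on a product. -/
def kkG (g : E → E →L[ℝ] E →L[ℝ] ℝ) (T : E × F → F →L[ℝ] E) (H : E × F → F →L[ℝ] F →L[ℝ] ℝ)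
    (z : E × F) : (E × F) →L[ℝ] (E × F) →L[ℝ] ℝ :=
  pull2 (g z.1) (ContinuousLinearMap.fst ℝ E F + (T z).comp (ContinuousLinearMap.snd ℝ E F)) +
    pull2 (H z) (ContinuousLinearMap.snd ℝ E F)

variable {g : E → E →L[ℝ] E →L[ℝ] ℝ} {T : E × F → F →L[ℝ] E} {H : E × F → F →L[ℝ] F →L[ℝ] ℝ}
  {u : E} {y : F}

theorem kkG_apply (z v w : E × F) :
    kkG g T H z v w = g z.1 (v.1 + T z v.2) (w.1 + T z w.2) + H z v.2 w.2 := rfl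

/-- The conditions on `g`, `T`, `H` at the point `(u, y)`: the connection `T` vanishes on the slice
`E × {y}`, and its derivative there is antisymmetric. -/
structure IsKK (g : E → E →L[ℝ] E →L[ℝ] ℝ) (T : E × F → F →L[ℝ] E)
    (H : E × F → F →L[ℝ] F →L[ℝ] ℝ) (u : E) (y : F) : Prop where
  smooth_g : ContDiffAt ℝ 2 g u
  smooth_T : ContDiffAt ℝ 2 T (u, y)
  smooth_H : ContDiffAt ℝ 2 H (u, y)
  symm_g : ∀ v w, g u v w = g u w v
  T_zero : ∀ u', T (u', y) = 0
  antisymm : ∀ᶠ u' in 𝓝 u, ∀ b, fderiv ℝ T (u', y) (0, b) b = 0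

namespace IsKK

variable (h : IsKK g T H u y)
include h

theorem contDiffAt : ContDiffAt ℝ 2 (kkG g T H) (u, y) :=
  ContDiffAt.add (contDiffAt_pull2 (ContDiffAt.comp (u, y) h.smooth_g contDiffAt_fst)
    (contDiffAt_const.add (h.smooth_T.clm_comp contDiffAt_const)))
      (contDiffAt_pull2 h.smooth_H contDiffAt_const)

theorem diff_T : DifferentiableAt ℝ T (u, y) := h.smooth_T.differentiableAt (by simp)

theorem diff_H : DifferentiableAt ℝ H (u, y) := h.smooth_H.differentiableAt (by simp)

/-- `T` vanishes along `E × {y}`, so that only the derivative in the direction of `F` matters. -/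
theorem fderiv_T (d : E × F) : fderiv ℝ T (u, y) d = fderiv ℝ T (u, y) (0, d.2) := by
  have h1 : HasFDerivAt (fun u' : E => ((u', y) : E × F)) (ContinuousLinearMap.inl ℝ E F) u :=
    hasFDerivAt_prodMk_left u y
  have h2 := (h.diff_T.hasFDerivAt.comp u h1).fderiv
  have h3 : (T ∘ fun u' : E => ((u', y) : E × F)) = fun _ => 0 := funext h.T_zero
  rw [h3, fderiv_fun_const] at h2
  have h4 : fderiv ℝ T (u, y) (d.1, 0) = 0 := (DFunLike.congr_fun h2 d.1).symm
  have h5 : d = (d.1, 0) + (0, d.2) := by simp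
  conv_lhs => rw [h5, map_add, h4, zero_add]

theorem anti (b b' : F) : fderiv ℝ T (u, y) (0, b) b' = -fderiv ℝ T (u, y) (0, b') b := by
  have h1 := h.antisymm.self_of_nhds
  have h2 := h1 (b + b')
  have h3 : ((0, b + b') : E × F) = (0, b) + (0, b') := by simp
  rw [h3] at h2
  simp only [map_add, add_apply, h1, zero_add, add_zero] at h2
  exact eq_neg_of_add_eq_zero_right h2

/-- All first derivatives of the metric; as `T (u, y) = 0`, `T` enters only through its
derivative. -/
theorem fderiv_kkG (d v w : E × F) : fderiv ℝ (kkG g T H) (u, y) d v w =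
    fderiv ℝ g u d.1 v.1 w.1 + g u v.1 (fderiv ℝ T (u, y) (0, d.2) w.2) +
      g u (fderiv ℝ T (u, y) (0, d.2) v.2) w.1 + fderiv ℝ H (u, y) d v.2 w.2 := by
  rw [← fderiv_apply_const₂ (h.contDiffAt.differentiableAt (by simp))]
  have e1 : (fun z => kkG g T H z v w) = fun z => g z.1 (v.1 + T z v.2) (w.1 + T z w.2) +
    H z v.2 w.2 := rfl
  have dg : HasFDerivAt (fun z : E × F => g z.1) ((fderiv ℝ g u).comp (ContinuousLinearMap.fst ℝ E F))
      (u, y) :=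
    HasFDerivAt.comp (f := Prod.fst) (u, y) (h.smooth_g.differentiableAt (by simp)).hasFDerivAt
      hasFDerivAt_fst
  have dT : ∀ b : F, HasFDerivAt (fun z => T z b) ((fderiv ℝ T (u, y)).flip b) (u, y) :=
    fun b => hasFDerivAt_apply_const h.diff_T b
  have d1 := (dg.clm_apply ((dT v.2).const_add v.1)).clm_apply ((dT w.2).const_add w.1)
  have d2 := (hasFDerivAt_apply_const h.diff_H v.2).clm_apply (hasFDerivAt_const w.2 (u, y))
  rw [e1]
  refine (DFunLike.congr_fun (d1.fun_add d2).fderiv d).trans ?_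
  simp only [add_apply, ContinuousLinearMap.comp_apply, ContinuousLinearMap.flip_apply, h.T_zero,
    zero_apply, add_zero, ContinuousLinearMap.coe_fst', map_zero]
  rw [h.fderiv_T d]
  ring

theorem fderiv_T_zero : fderiv ℝ T (u, y) ((0 : E), (0 : F)) = 0 := map_zero _

/-- The Christoffel symbols of the first kind; `X` stands for a direction in `E`, `B` for one in
`F`. -/
theorem chr1_XXX (x x' x'' : E) :
    chr1 (kkG g T H) (u, y) (x, 0) (x', 0) (x'', 0) = chr1 g u x x' x'' := by
  simp [chr1, h.fderiv_kkG]

theorem chr1_XXB (x x' : E) (b : F) : chr1 (kkG g T H) (u, y) (x, 0) (x', 0) (0, b) = 0 := by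
  simp [chr1, h.fderiv_kkG, h.fderiv_T_zero]

theorem chr1_XBX (x x' : E) (b : F) : chr1 (kkG g T H) (u, y) (x, 0) (0, b) (x', 0) = 0 := by
  simp [chr1, h.fderiv_kkG, h.fderiv_T_zero]

theorem chr1_BXX (x x' : E) (b : F) : chr1 (kkG g T H) (u, y) (0, b) (x, 0) (x', 0) = 0 := by
  simp [chr1, h.fderiv_kkG, h.fderiv_T_zero]

theorem chr1_XBB (x : E) (b b' : F) : chr1 (kkG g T H) (u, y) (x, 0) (0, b) (0, b') =
    fderiv ℝ H (u, y) (x, 0) b b' / 2 + g u x (fderiv ℝ T (u, y) (0, b) b') := by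
  simp [chr1, h.fderiv_kkG]
  rw [h.anti b' b, map_neg]
  ring

theorem chr1_BXB (x : E) (b b' : F) : chr1 (kkG g T H) (u, y) (0, b) (x, 0) (0, b') =
    fderiv ℝ H (u, y) (x, 0) b b' / 2 + g u x (fderiv ℝ T (u, y) (0, b) b') := by
  simp [chr1, h.fderiv_kkG]
  rw [h.anti b' b, map_neg, neg_apply, h.symm_g _ x]
  ring

theorem chr1_BBX (x : E) (b b' : F) : chr1 (kkG g T H) (u, y) (0, b) (0, b') (x, 0) =
    -(fderiv ℝ H (u, y) (x, 0) b b' / 2) := by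
  simp [chr1, h.fderiv_kkG]
  rw [h.anti b' b, map_neg, neg_apply]
  ring

theorem fderiv_H_snd (b : F) : fderiv ℝ (fun y' => H (u, y')) y b = fderiv ℝ H (u, y) (0, b) :=
  DFunLike.congr_fun (h.diff_H.hasFDerivAt.comp y (hasFDerivAt_prodMk_right u y)).fderiv b

theorem fderiv_H_fst (x : E) : fderiv ℝ (fun u' => H (u', y)) u x = fderiv ℝ H (u, y) (x, 0) :=
  DFunLike.congr_fun (HasFDerivAt.comp (g := H) (f := fun u' : E => ((u', y) : E × F)) u
    h.diff_H.hasFDerivAt (hasFDerivAt_prodMk_left u y)).fderiv x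

theorem chr1_BBB (b b' b'' : F) : chr1 (kkG g T H) (u, y) (0, b) (0, b') (0, b'') =
    chr1 (fun y' => H (u, y')) y b b' b'' := by
  simp [chr1, h.fderiv_kkG, h.fderiv_H_snd]

theorem contDiffAt_apply (v w : E × F) : ContDiffAt ℝ 2 (fun z => kkG g T H z v w) (u, y) :=
  (h.contDiffAt.clm_apply contDiffAt_const).clm_apply contDiffAt_const

theorem d2_fst (v w : E × F) (a b : E) : d2 (fun z => kkG g T H z v w) (u, y) (a, 0) (b, 0) =
    d2 (fun u' => kkG g T H (u', y) v w) u a b :=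
  (d2_comp_affine (φ := fun u' : E => ((u', y) : E × F)) (fun w => hasFDerivAt_prodMk_left w y)
    (h.contDiffAt_apply v w) a b).symm

theorem d2_snd (v w : E × F) (a b : F) : d2 (fun z => kkG g T H z v w) (u, y) (0, a) (0, b) =
    d2 (fun y' => kkG g T H (u, y') v w) y a b :=
  (d2_comp_affine (φ := fun y' : F => ((u, y') : E × F)) (fun w => hasFDerivAt_prodMk_right u w)
    (h.contDiffAt_apply v w) a b).symm

/-- The second derivatives of the metric coefficients, with the same convention for `X` and `B`. -/
theorem d2_XX (x x' a b : E) :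
    d2 (fun z => kkG g T H z (x, 0) (x', 0)) (u, y) (a, 0) (b, 0) = d2 (fun u' => g u' x x') u a b := by
  rw [h.d2_fst]
  simp [kkG_apply]

theorem d2_XX_snd (x x' : E) (a b : F) :
    d2 (fun z => kkG g T H z (x, 0) (x', 0)) (u, y) (0, a) (0, b) = 0 := by
  rw [h.d2_snd]
  simp [kkG_apply, d2]

theorem d2_BB_fst (b b' : F) (a a' : E) :
    d2 (fun z => kkG g T H z (0, b) (0, b')) (u, y) (a, 0) (a', 0) =
      d2 (fun u' => H (u', y) b b') u a a' := by
  rw [h.d2_fst]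
  simp [kkG_apply, h.T_zero]

theorem d2_BB_snd (b b' c c' : F) :
    d2 (fun z => kkG g T H z (0, b) (0, b')) (u, y) (0, c) (0, c') =
      g u (fderiv ℝ T (u, y) (0, c) b) (fderiv ℝ T (u, y) (0, c') b') +
      g u (fderiv ℝ T (u, y) (0, c') b) (fderiv ℝ T (u, y) (0, c) b') +
      d2 (fun y' => H (u, y') b b') y c c' := by
  rw [h.d2_snd]
  have hT : ∀ b, ContDiffAt ℝ 2 (fun y' => T (u, y') b) y := fun b =>
    (ContDiffAt.comp y h.smooth_T (contDiffAt_const.prodMk contDiffAt_id)).clm_apply contDiffAt_const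
  have hH : ContDiffAt ℝ 2 (fun y' => H (u, y') b b') y :=
    ((ContDiffAt.comp y h.smooth_H (contDiffAt_const.prodMk contDiffAt_id)).clm_apply
      contDiffAt_const).clm_apply contDiffAt_const
  have hD : ∀ b c, fderiv ℝ (fun y' => T (u, y') b) y c = fderiv ℝ T (u, y) (0, c) b := fun b c =>
    DFunLike.congr_fun ((hasFDerivAt_apply_const h.diff_T b).comp y
      (hasFDerivAt_prodMk_right u y)).fderiv c
  have e : (fun y' => kkG g T H (u, y') (0, b) (0, b')) =
      fun y' => g u (T (u, y') b) (T (u, y') b') + H (u, y') b b' := by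
    ext1 y'; simp [kkG_apply]
  have hs : ContDiffAt ℝ 2 (fun y' => g u (T (u, y') b) (T (u, y') b')) y :=
    (contDiffAt_const.clm_apply (hT b)).clm_apply (hT b')
  rw [e, d2_add hs hH, d2_bilin (g u) (hT b) (hT b') (by simp [h.T_zero]) (by simp [h.T_zero])]
  simp only [hD]

theorem eventually : ∀ᶠ u' in 𝓝 u, ContDiffAt ℝ 2 g u' ∧ ContDiffAt ℝ 2 T (u', y) ∧
    ContDiffAt ℝ 2 H (u', y) := by
  have hc : ContinuousAt (fun u' : E => ((u', y) : E × F)) u := by fun_prop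
  exact (h.smooth_g.eventually (by simp)).and ((hc.eventually (h.smooth_T.eventually (by simp))).and
    (hc.eventually (h.smooth_H.eventually (by simp))))

/-- The mixed second derivatives vanish, since the curvature is antisymmetric along the slice. -/
theorem d2_XB (x : E) (b : F) : d2 (fun z => kkG g T H z (x, 0) (0, b)) (u, y) (0, b) (x, 0) = 0 := by
  have hs := h.contDiffAt_apply (x, 0) (0, b)
  have hd : DifferentiableAt ℝ (fun z => fderiv ℝ (fun z => kkG g T H z (x, 0) (0, b)) z (0, b)) (u, y) :=
    ((hs.fderiv_right (m := 1) (by norm_num)).differentiableAt (by simp)).clm_apply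
      (differentiableAt_const _)
  have h1 := DFunLike.congr_fun (HasFDerivAt.comp (f := fun u' : E => ((u', y) : E × F)) u
    hd.hasFDerivAt (hasFDerivAt_prodMk_left u y)).fderiv x
  refine h1.symm.trans ?_
  have h2 : ((fun z => fderiv ℝ (fun z => kkG g T H z (x, 0) (0, b)) z (0, b)) ∘
      fun u' : E => ((u', y) : E × F)) =ᶠ[𝓝 u] fun _ => 0 := by
    filter_upwards [h.eventually, h.antisymm] with u' h3 h4
    have dT := hasFDerivAt_apply_const (h3.2.1.differentiableAt (by simp)) b
    have dg : HasFDerivAt (fun z : E × F => g z.1)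
        ((fderiv ℝ g u').comp (ContinuousLinearMap.fst ℝ E F)) (u', y) :=
      HasFDerivAt.comp (f := Prod.fst) (u', y) (h3.1.differentiableAt (by simp)).hasFDerivAt
        hasFDerivAt_fst
    have d1 := (dg.clm_apply (hasFDerivAt_const x (u', y))).clm_apply dT
    have e : (fun z => kkG g T H z (x, 0) (0, b)) = fun z => g z.1 x (T z b) := by
      ext1 z; simp [kkG_apply]
    rw [Function.comp_apply, e, d1.fderiv]
    simp [h4, h.T_zero]
  rw [h2.fderiv_eq]
  simp

theorem d2_BX (hs : ∀ᶠ z in 𝓝 u, ∀ a b, g z a b = g z b a) (x : E) (b : F) :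
    d2 (fun z => kkG g T H z (0, b) (x, 0)) (u, y) (x, 0) (0, b) = 0 := by
  rw [d2_symm (h.contDiffAt_apply _ _), ← h.d2_XB x b]
  refine d2_congr ?_ _ _
  filter_upwards [(continuousAt_fst (p := (u, y))).eventually hs] with z hz
  simp [kkG_apply, hz x]

section Frame

variable {ι κ : Type*} [Fintype ι] [Fintype κ] {e : ι → E} {ε : κ → F}

theorem isFrame [DecidableEq ι] [DecidableEq κ] (he : IsFrame (g u) e) (hε : IsFrame (H (u, y)) ε) :
    IsFrame (kkG g T H (u, y)) (Sum.elim (fun i => (e i, (0 : F))) fun j => ((0 : E), ε j)) := by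
  refine ⟨?_, fun v => ?_⟩
  · rintro (i | i) (j | j)
    · simp [kkG_apply, h.T_zero, he.orth]
    · simp [kkG_apply, h.T_zero]
    · simp [kkG_apply, h.T_zero]
    · simp [kkG_apply, h.T_zero, hε.orth]
  · rw [Fintype.sum_sum_type]
    simp only [Sum.elim_inl, Sum.elim_inr, kkG_apply, h.T_zero, zero_apply, add_zero, map_zero,
      zero_add]
    refine Prod.ext ?_ ?_
    · simp only [Prod.fst_add, Prod.fst_sum, Prod.smul_fst, smul_zero, Finset.sum_const_zero, add_zero]
      exact he.expand v.1
    · simp only [Prod.snd_add, Prod.snd_sum, Prod.smul_snd, smul_zero, Finset.sum_const_zero, zero_add]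
      exact hε.expand v.2

omit h in
theorem _root_.WKahler.sum_sq_symm_antisymm {p q : κ → κ → ℝ} (hp : ∀ j j', p j j' = p j' j)
    (hq : ∀ j j', q j j' = -q j' j) : ∑ j, ∑ j', (p j j' / 2 + q j j') ^ 2 =
      1 / 4 * ∑ j, ∑ j', p j j' ^ 2 + ∑ j, ∑ j', q j j' ^ 2 := by
  have h1 : ∑ j, ∑ j', p j j' * q j j' = 0 := by
    have h2 : ∑ j, ∑ j', p j j' * q j j' = -∑ j, ∑ j', p j j' * q j j' := by
      conv_lhs => rw [Finset.sum_comm]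
      simp only [← Finset.sum_neg_distrib]
      refine Finset.sum_congr rfl fun j _ => Finset.sum_congr rfl fun j' _ => ?_
      rw [hp, hq]; ring
    linarith
  have h3 : ∀ j j', (p j j' / 2 + q j j') ^ 2 = 1 / 4 * p j j' ^ 2 + q j j' ^ 2 + p j j' * q j j' := by
    intro j j'; ring
  simp only [h3, Finset.sum_add_distrib, h1, Finset.mul_sum, add_zero]

/-- The scalar curvature of a Kaluza-Klein metric. -/
theorem scalJet_kkG [DecidableEq ι] (he : IsFrame (g u) e)
    (hs : ∀ᶠ z in 𝓝 u, ∀ a b, g z a b = g z b a)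
    (hH : ∀ d b b', fderiv ℝ H (u, y) d b b' = fderiv ℝ H (u, y) d b' b) :
    scalJet (kkG g T H) (u, y) (Sum.elim (fun i => (e i, (0 : F))) fun j => ((0 : E), ε j)) =
      scalJet g u e + scalJet (fun y' => H (u, y')) y ε -
      ∑ i, ∑ j, d2 (fun u' => H (u', y) (ε j) (ε j)) u (e i) (e i) +
      3 / 4 * ∑ i, ∑ j, ∑ j', fderiv ℝ H (u, y) (e i, 0) (ε j) (ε j') ^ 2 -
      ∑ j, ∑ j', g u (fderiv ℝ T (u, y) (0, ε j) (ε j')) (fderiv ℝ T (u, y) (0, ε j) (ε j')) +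
      ∑ i, (∑ i', chr1 g u (e i') (e i') (e i)) * ∑ j, fderiv ℝ H (u, y) (e i, 0) (ε j) (ε j) -
      1 / 4 * ∑ i, (∑ j, fderiv ℝ H (u, y) (e i, 0) (ε j) (ε j)) ^ 2 := by
  have hG := h.contDiffAt
  have hHs : ContDiffAt ℝ 2 (fun y' => H (u, y')) y :=
    ContDiffAt.comp y h.smooth_H (contDiffAt_const.prodMk contDiffAt_id)
  have key : ∀ (p : ι → ℝ) (q : ι → κ → ℝ), ∑ i, (p i + ∑ j, -(q i j / 2)) ^ 2 =
      ∑ i, p i ^ 2 - ∑ i, p i * ∑ j, q i j + 1 / 4 * ∑ i, (∑ j, q i j) ^ 2 := by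
    intro p q
    rw [Finset.mul_sum, ← Finset.sum_sub_distrib, ← Finset.sum_add_distrib]
    refine Finset.sum_congr rfl fun i _ => ?_
    rw [Finset.sum_neg_distrib, ← Finset.sum_div]
    ring
  have hTT : ∀ j j', g u (fderiv ℝ T (u, y) (0, ε j') (ε j)) (fderiv ℝ T (u, y) (0, ε j) (ε j')) =
      -g u (fderiv ℝ T (u, y) (0, ε j) (ε j')) (fderiv ℝ T (u, y) (0, ε j) (ε j')) := by
    intro j j'
    rw [h.anti (ε j') (ε j), map_neg, neg_apply]
  have hT0 : ∀ j, fderiv ℝ T (u, y) (0, ε j) (ε j) = 0 := fun j => h.antisymm.self_of_nhds (ε j)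
  have hsq : ∀ i, ∑ j, ∑ j', (fderiv ℝ H (u, y) (e i, 0) (ε j) (ε j') / 2 +
      g u (e i) (fderiv ℝ T (u, y) (0, ε j) (ε j'))) ^ 2 =
      1 / 4 * ∑ j, ∑ j', fderiv ℝ H (u, y) (e i, 0) (ε j) (ε j') ^ 2 +
        ∑ j, ∑ j', g u (e i) (fderiv ℝ T (u, y) (0, ε j) (ε j')) ^ 2 := fun i =>
    sum_sq_symm_antisymm (fun j j' => hH _ _ _) fun j j' => by rw [h.anti, map_neg]
  have hQ : ∑ i, ∑ j, ∑ j', g u (e i) (fderiv ℝ T (u, y) (0, ε j) (ε j')) ^ 2 =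
      ∑ j, ∑ j', g u (fderiv ℝ T (u, y) (0, ε j) (ε j')) (fderiv ℝ T (u, y) (0, ε j) (ε j')) := by
    rw [Finset.sum_comm]
    refine Finset.sum_congr rfl fun j _ => ?_
    rw [Finset.sum_comm]
    refine Finset.sum_congr rfl fun j' _ => ?_
    rw [← he.parseval h.symm_g]
    refine Finset.sum_congr rfl fun i _ => ?_
    rw [h.symm_g (e i), sq]
  simp only [scalJet, fderiv_fderiv_apply hG, fderiv_fderiv_apply h.smooth_g,
    fderiv_fderiv_apply hHs, Fintype.sum_sum_type, Sum.elim_inl, Sum.elim_inr, h.chr1_XXX, h.chr1_XXB,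
    h.chr1_XBX, h.chr1_BXX, h.chr1_XBB, h.chr1_BXB, h.chr1_BBX, h.chr1_BBB, h.d2_XX, h.d2_XX_snd,
    h.d2_BB_fst, h.d2_BB_snd, h.d2_XB, h.d2_BX hs, key, hT0, map_zero, add_zero, hTT]
  simp only [Finset.sum_add_distrib, Finset.sum_sub_distrib, Finset.sum_neg_distrib, neg_sq, div_pow,
    ← Finset.sum_div, ne_eq, OfNat.ofNat_ne_zero, not_false_eq_true, zero_pow, Finset.sum_const_zero,
    add_zero, zero_add, hsq, hQ, ← Finset.mul_sum, zero_sub, sub_zero]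
  have c1 : ∑ j, ∑ j', ∑ i, fderiv ℝ H (u, y) (e i, 0) (ε j) (ε j') ^ 2 =
      ∑ i, ∑ j, ∑ j', fderiv ℝ H (u, y) (e i, 0) (ε j) (ε j') ^ 2 := by
    rw [Finset.sum_congr rfl fun j _ => Finset.sum_comm, Finset.sum_comm]
  have c2 : ∑ j, ∑ i, ∑ j', (fderiv ℝ H (u, y) (e i, 0) (ε j) (ε j') / 2 +
      g u (e i) (fderiv ℝ T (u, y) (0, ε j) (ε j'))) ^ 2 =
      1 / 4 * ∑ i, ∑ j, ∑ j', fderiv ℝ H (u, y) (e i, 0) (ε j) (ε j') ^ 2 +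
        ∑ j, ∑ j', g u (fderiv ℝ T (u, y) (0, ε j) (ε j')) (fderiv ℝ T (u, y) (0, ε j) (ε j')) := by
    rw [Finset.sum_comm]
    simp only [Finset.sum_add_distrib, hsq, hQ, ← Finset.mul_sum]
  rw [c1, c2]
  ring

/-- The Laplacian of a function on the base of a Kaluza-Klein metric. -/
theorem lapJet_kkG {f : E → ℝ} (hf : ContDiffAt ℝ 2 f u) :
    lapJet (kkG g T H) (fun z => f z.1) (u, y)
        (Sum.elim (fun i => (e i, (0 : F))) fun j => ((0 : E), ε j)) = lapJet g f u e -
      1 / 2 * ∑ i, (∑ j, fderiv ℝ H (u, y) (e i, 0) (ε j) (ε j)) * fderiv ℝ f u (e i) := by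
  have hfd : HasFDerivAt f (fderiv ℝ f u) u := (hf.differentiableAt (by simp)).hasFDerivAt
  have hfst : ContDiffAt ℝ 2 (fun z : E × F => f z.1) (u, y) :=
    ContDiffAt.comp (u, y) hf contDiffAt_fst
  have h1 : ∀ d, fderiv ℝ (fun z : E × F => f z.1) (u, y) d = fderiv ℝ f u d.1 := fun d =>
    DFunLike.congr_fun (HasFDerivAt.comp (f := Prod.fst) (u, y) hfd hasFDerivAt_fst).fderiv d
  have h2 : ∀ a b : E, d2 (fun z : E × F => f z.1) (u, y) (a, 0) (b, 0) = d2 f u a b := fun a b =>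
    (d2_comp_affine (φ := fun u' : E => ((u', y) : E × F)) (fun w => hasFDerivAt_prodMk_left w y)
      hfst a b).symm
  have h3 : ∀ a b : F, d2 (fun z : E × F => f z.1) (u, y) (0, a) (0, b) = 0 := fun a b => by
    refine (d2_comp_affine (φ := fun y' : F => ((u, y') : E × F))
      (fun w => hasFDerivAt_prodMk_right u w) hfst a b).symm.trans ?_
    simp [d2]
  have h4 : ∀ (s : E × F → ℝ) z a b, fderiv ℝ (fun z => fderiv ℝ s z a) z b = d2 s z a b :=
    fun _ _ _ _ => rfl
  simp only [lapJet, h4, h1, Fintype.sum_sum_type, Sum.elim_inl, Sum.elim_inr, h2, h3, h.chr1_XXX,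
    h.chr1_BBX, map_zero, mul_zero, Finset.sum_const_zero, add_zero, zero_sub]
  have c1 : ∑ j, -∑ i, -(fderiv ℝ H (u, y) (e i, 0) (ε j) (ε j) / 2) * fderiv ℝ f u (e i) =
      1 / 2 * ∑ i, (∑ j, fderiv ℝ H (u, y) (e i, 0) (ε j) (ε j)) * fderiv ℝ f u (e i) := by
    simp only [← Finset.sum_neg_distrib]
    rw [Finset.sum_comm, Finset.mul_sum]
    refine Finset.sum_congr rfl fun i _ => ?_
    rw [Finset.sum_mul, Finset.mul_sum]
    exact Finset.sum_congr rfl fun j _ => by ring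
  rw [c1]
  simp only [d2]
  ring

end Frame

end IsKK
end KaluzaKlein

/-! ### Scalar curvature and Laplacian of the local model -/

section ModelCurvature

theorem d2_eq {E : Type*} [NormedAddCommGroup E] [NormedSpace ℝ E] {s : E → ℝ} {z : E}
    (hs : ContDiffAt ℝ 2 s z) (a b : E) : d2 s z a b = fderiv ℝ (fderiv ℝ s) z b a := by
  have hd : DifferentiableAt ℝ (fderiv ℝ s) z :=
    (hs.fderiv_right (m := 1) (by norm_num)).differentiableAt (by simp)
  rw [d2, fderiv_apply_const hd]

theorem d2_sum {E ι : Type*} [NormedAddCommGroup E] [NormedSpace ℝ E] (t : Finset ι) {s : ι → E → ℝ}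
    {z : E} (hs : ∀ i, ContDiffAt ℝ 2 (s i) z) (a b : E) :
    d2 (fun z => ∑ i ∈ t, s i z) z a b = ∑ i ∈ t, d2 (s i) z a b := by
  induction t using Finset.cons_induction with
  | empty => simp [d2_zero]
  | cons i t hi ih =>
    simp only [Finset.sum_cons]
    rw [d2_add (hs i) (ContDiffAt.sum fun i _ => hs i), ih]

theorem d2_frame_smul {E : Type*} [NormedAddCommGroup E] [NormedSpace ℝ E]
    {h : E → E →L[ℝ] E →L[ℝ] ℝ} {z : E} (hh : ContDiffAt ℝ 2 h z) (c : ℝ) (v w a b : E) :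
    d2 (fun z => h z (c • v) (c • w)) z (c • a) (c • b) = c ^ 4 * d2 (fun z => h z v w) z a b := by
  have hs : ContDiffAt ℝ 2 (fun z => h z v w) z :=
    (hh.clm_apply contDiffAt_const).clm_apply contDiffAt_const
  have e : (fun z => h z (c • v) (c • w)) = fun z => (c * c) * h z v w := by
    ext1 z
    simp [mul_assoc]
  rw [e, d2_smul _ hs, d2_eq hs, d2_eq hs]
  simp only [map_smul, smul_apply, smul_eq_mul]
  ring

theorem chr1_smul {E : Type*} [NormedAddCommGroup E] [NormedSpace ℝ E]
    (h : E → E →L[ℝ] E →L[ℝ] ℝ) (z : E) (c : ℝ) (a b d : E) :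
    chr1 h z (c • a) (c • b) (c • d) = c ^ 3 * chr1 h z a b d := by
  simp only [chr1, map_smul, smul_apply, smul_eq_mul]
  ring

variable {k : ℕ} {F : Fin k → Type*} [∀ a, NormedAddCommGroup (F a)] [∀ a, NormedSpace ℝ (F a)]
  {κ : Fin k → Type*}

/-- The frame of a product metric `∑_a f_a h_a` obtained from frames `ε a` of the `h_a` by rescaling
with factors `c a`. -/
def prodFrame (c : Fin k → ℝ) (ε : ∀ a, κ a → F a) (x : Σ a, κ a) : ∀ a, F a :=
  Pi.single x.1 (c x.1 • ε x.1 x.2)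

variable (c : Fin k → ℝ) (ε : ∀ a, κ a → F a)

theorem prodFrame_same (a : Fin k) (j : κ a) : prodFrame c ε ⟨a, j⟩ a = c a • ε a j :=
  Pi.single_eq_same _ _

theorem prodFrame_ne (x : Σ a, κ a) {b : Fin k} (hb : b ≠ x.1) : prodFrame c ε x b = 0 :=
  Pi.single_eq_of_ne hb _

theorem sum_prodFrame [∀ a, Fintype (κ a)] {N : Type*} [AddCommMonoid N] (b : Fin k) (ψ : F b → N)
    (hψ : ψ 0 = 0) : ∑ x, ψ (prodFrame c ε x b) = ∑ j, ψ (c b • ε b j) := by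
  rw [Fintype.sum_sigma, Finset.sum_eq_single b]
  · exact Finset.sum_congr rfl fun j _ => by rw [prodFrame_same]
  · intro a _ ha
    refine Finset.sum_eq_zero fun j _ => ?_
    rw [prodFrame_ne c ε ⟨a, j⟩ (Ne.symm ha), hψ]
  · simp

theorem sq_sum_prodFrame (x : Σ a, κ a) (ψ : ∀ b, F b → ℝ) (hψ : ∀ b, ψ b 0 = 0) :
    (∑ b, ψ b (prodFrame c ε x b)) ^ 2 = ∑ b, ψ b (prodFrame c ε x b) ^ 2 := by
  have h0 : ∀ b, b ≠ x.1 → ψ b (prodFrame c ε x b) = 0 := fun b hb => by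
    rw [prodFrame_ne c ε x hb, hψ]
  rw [Finset.sum_eq_single x.1 (fun b _ hb => h0 b hb) (by simp),
    Finset.sum_eq_single x.1 (fun b _ hb => by rw [h0 b hb]; simp) (by simp)]

/-- The metric `∑_a f_a h_a` of a product. -/
def prodG (f : Fin k → ℝ) (h : ∀ a, F a → F a →L[ℝ] F a →L[ℝ] ℝ) (y : ∀ a, F a) :
    (∀ a, F a) →L[ℝ] (∀ a, F a) →L[ℝ] ℝ :=
  ∑ a, f a • pull2 (h a (y a)) (ContinuousLinearMap.proj (R := ℝ) (φ := F) a)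

variable {f : Fin k → ℝ} {h : ∀ a, F a → F a →L[ℝ] F a →L[ℝ] ℝ} {y : ∀ a, F a}

theorem prodG_apply (y v w : ∀ a, F a) : prodG f h y v w = ∑ a, f a * h a (y a) (v a) (w a) := by
  simp only [prodG, sum_apply, smul_apply, smul_eq_mul]
  rfl

theorem contDiffAt_prodG (hh : ∀ a, ContDiffAt ℝ 2 (h a) (y a)) : ContDiffAt ℝ 2 (prodG f h) y := by
  refine ContDiffAt.sum fun a _ => ContDiffAt.const_smul (f a) (contDiffAt_pull2 ?_ contDiffAt_const)
  exact ContDiffAt.comp (f := fun y : ∀ a, F a => y a) y (hh a)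
    (ContinuousLinearMap.proj (R := ℝ) (φ := F) a).contDiff.contDiffAt

/-- The vectors `c_a ε_a` are orthonormal for `∑ f_a h_a` when `c_a = f_a ^ (-1/2)`. -/
theorem isFrame_prodFrame [∀ a, Fintype (κ a)] [∀ a, DecidableEq (κ a)]
    (hε : ∀ a, IsFrame (h a (y a)) (ε a)) (hc : ∀ a, c a ^ 2 * f a = 1) :
    IsFrame (prodG f h y) (prodFrame c ε) := by
  refine ⟨?_, fun v => ?_⟩
  · rintro ⟨a, i⟩ ⟨b, j⟩
    rw [prodG_apply, Finset.sum_eq_single a]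
    · rw [prodFrame_same]
      by_cases hab : a = b
      · subst hab
        rw [prodFrame_same]
        simp only [map_smul, smul_apply, smul_eq_mul, (hε a).orth, Sigma.mk.injEq, heq_eq_eq, true_and]
        split_ifs
        · linear_combination hc a
        · ring
      · rw [prodFrame_ne c ε ⟨b, j⟩ hab]
        simp [hab]
    · intro b' _ hb'
      rw [prodFrame_ne c ε ⟨a, i⟩ hb']
      simp
    · simp
  · ext1 b
    rw [Finset.sum_apply]
    have h1 : ∀ x, (prodG f h y v (prodFrame c ε x) • prodFrame c ε x) b =
        (f b * h b (y b) (v b) (prodFrame c ε x b)) • prodFrame c ε x b := by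
      intro x
      rw [Pi.smul_apply]
      by_cases hb : b = x.1
      · rw [prodG_apply, Finset.sum_eq_single b]
        · intro b' _ hb'
          rw [prodFrame_ne c ε x (hb ▸ hb')]
          simp
        · simp
      · rw [prodFrame_ne c ε x hb, smul_zero, smul_zero]
    simp only [h1]
    rw [sum_prodFrame c ε b (fun w => (f b * h b (y b) (v b) w) • w) (by simp)]
    conv_lhs => rw [(hε b).expand (v b)]
    refine Finset.sum_congr rfl fun j _ => ?_
    simp only [map_smul, smul_eq_mul, smul_smul]
    congr 1
    linear_combination (-(h b (y b) (v b) (ε b j))) * hc b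

theorem d2_prodG (hh : ∀ a, ContDiffAt ℝ 2 (h a) (y a)) (v w a b : ∀ a, F a) :
    d2 (fun y' => prodG f h y' v w) y a b =
      ∑ i, f i * d2 (fun z => h i z (v i) (w i)) (y i) (a i) (b i) := by
  have hs : ∀ i, ContDiffAt ℝ 2 (fun z => h i z (v i) (w i)) (y i) := fun i =>
    ((hh i).clm_apply contDiffAt_const).clm_apply contDiffAt_const
  have hs' : ∀ i, ContDiffAt ℝ 2 (fun y' : ∀ a, F a => h i (y' i) (v i) (w i)) y := fun i =>
    ContDiffAt.comp (f := fun y : ∀ a, F a => y i) y (hs i)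
      (ContinuousLinearMap.proj (R := ℝ) (φ := F) i).contDiff.contDiffAt
  simp only [prodG_apply]
  rw [d2_sum _ fun i => contDiffAt_const.mul (hs' i)]
  refine Finset.sum_congr rfl fun i _ => ?_
  rw [d2_smul _ (hs' i)]
  congr 1
  exact d2_comp_affine (φ := fun y : ∀ a, F a => y i)
    (fun w => (ContinuousLinearMap.proj (R := ℝ) (φ := F) i).hasFDerivAt) (hs i) a b

theorem chr1_prodG (hh : ∀ a, ContDiffAt ℝ 2 (h a) (y a)) (v w x : ∀ a, F a) :
    chr1 (prodG f h) y v w x = ∑ i, f i * chr1 (h i) (y i) (v i) (w i) (x i) := by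
  have key : ∀ v w x, fderiv ℝ (prodG f h) y v w x =
      ∑ i, f i * fderiv ℝ (h i) (y i) (v i) (w i) (x i) := by
    intro v w x
    rw [← fderiv_apply_const₂ ((contDiffAt_prodG hh).differentiableAt (by simp))]
    simp only [prodG_apply]
    have d : ∀ i, HasFDerivAt (fun y' : ∀ a, F a => f i * h i (y' i) (w i) (x i)) _ y := fun i =>
      ((((hh i).differentiableAt (by simp)).hasFDerivAt.comp y
        ((ContinuousLinearMap.proj (R := ℝ) (φ := F) i).hasFDerivAt (x := y))).clm_apply
          (hasFDerivAt_const (w i) y)).clm_apply (hasFDerivAt_const (x i) y) |>.const_mul (f i)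
    refine (DFunLike.congr_fun (HasFDerivAt.fun_sum fun i _ => d i).fderiv v).trans ?_
    simp [sum_apply]
  simp only [chr1, key]
  rw [← Finset.sum_add_distrib, ← Finset.sum_sub_distrib, Finset.sum_div]
  exact Finset.sum_congr rfl fun i _ => by ring

/-- The scalar curvature of a product is the sum of those of the factors. -/
theorem scalJet_prodG [∀ a, Fintype (κ a)] (hh : ∀ a, ContDiffAt ℝ 2 (h a) (y a))
    (hc : ∀ a, c a ^ 2 * f a = 1) : scalJet (prodG f h) y (prodFrame c ε) =
      ∑ a, scalJet (h a) (y a) (ε a) / f a := by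
  have e1 : ∑ i, ∑ j, (d2 (fun y' => prodG f h y' (prodFrame c ε i) (prodFrame c ε j)) y
        (prodFrame c ε j) (prodFrame c ε i) -
      d2 (fun y' => prodG f h y' (prodFrame c ε j) (prodFrame c ε j)) y (prodFrame c ε i)
        (prodFrame c ε i)) = ∑ a, f a * ∑ i, ∑ j,
      (c a ^ 4 * d2 (fun z => h a z (ε a i) (ε a j)) (y a) (ε a j) (ε a i) -
        c a ^ 4 * d2 (fun z => h a z (ε a j) (ε a j)) (y a) (ε a i) (ε a i)) := by
    simp only [d2_prodG hh, ← Finset.sum_sub_distrib, ← mul_sub]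
    rw [Finset.sum_congr rfl fun i _ => Finset.sum_comm, Finset.sum_comm]
    refine Finset.sum_congr rfl fun a _ => ?_
    have hs : ∀ v w, ContDiffAt ℝ 2 (fun z => h a z v w) (y a) := fun v w =>
      ((hh a).clm_apply contDiffAt_const).clm_apply contDiffAt_const
    have z0 : ∀ v w : F a, d2 (fun z => h a z v w) (y a) 0 0 = 0 := fun v w => by
      rw [d2_eq (hs v w)]; simp
    simp only [← Finset.mul_sum]
    congr 1
    have s1 : ∀ v : F a, ∑ j, (d2 (fun z => h a z v (prodFrame c ε j a)) (y a) (prodFrame c ε j a) v -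
        d2 (fun z => h a z (prodFrame c ε j a) (prodFrame c ε j a)) (y a) v v) =
        ∑ j, (d2 (fun z => h a z v (c a • ε a j)) (y a) (c a • ε a j) v -
          d2 (fun z => h a z (c a • ε a j) (c a • ε a j)) (y a) v v) := fun v =>
      sum_prodFrame c ε a (fun w => d2 (fun z => h a z v w) (y a) w v -
        d2 (fun z => h a z w w) (y a) v v) (by rw [d2_eq (hs v 0)]; simp [d2_zero])
    simp only [s1]
    rw [sum_prodFrame c ε a (fun v => ∑ j, (d2 (fun z => h a z v (c a • ε a j)) (y a) (c a • ε a j) v -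
          d2 (fun z => h a z (c a • ε a j) (c a • ε a j)) (y a) v v)) ?_]
    · simp only [d2_frame_smul (hh a), Finset.mul_sum, mul_sub]
    · refine Finset.sum_eq_zero fun j _ => ?_
      rw [z0]
      simp [d2_zero]
  have c0 : ∀ a (v w x : F a), v = 0 ∨ w = 0 ∨ x = 0 → chr1 (h a) (y a) v w x = 0 := by
    rintro a v w x (rfl | rfl | rfl) <;> simp [chr1]
  have e2 : ∑ i, ∑ j, ∑ l, chr1 (prodG f h) y (prodFrame c ε i) (prodFrame c ε j)
      (prodFrame c ε l) ^ 2 = ∑ a, ∑ i, ∑ j, ∑ l,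
        (f a * (c a ^ 3 * chr1 (h a) (y a) (ε a i) (ε a j) (ε a l))) ^ 2 := by
    have s0 : ∀ i j l, chr1 (prodG f h) y (prodFrame c ε i) (prodFrame c ε j) (prodFrame c ε l) ^ 2 =
        ∑ a, (f a * chr1 (h a) (y a) (prodFrame c ε i a) (prodFrame c ε j a)
          (prodFrame c ε l a)) ^ 2 := fun i j l => by
      rw [chr1_prodG hh]
      exact sq_sum_prodFrame c ε i (fun a v => f a * chr1 (h a) (y a) v (prodFrame c ε j a)
          (prodFrame c ε l a)) fun a => by simp [c0 a 0]
    simp only [s0]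
    rw [Finset.sum_congr rfl fun i _ => Finset.sum_congr rfl fun j _ => Finset.sum_comm,
      Finset.sum_congr rfl fun i _ => Finset.sum_comm, Finset.sum_comm]
    refine Finset.sum_congr rfl fun a _ => ?_
    have s1 : ∀ v w : F a, ∑ l, (f a * chr1 (h a) (y a) v w (prodFrame c ε l a)) ^ 2 =
        ∑ l, (f a * chr1 (h a) (y a) v w (c a • ε a l)) ^ 2 := fun v w =>
      sum_prodFrame c ε a (fun x => (f a * chr1 (h a) (y a) v w x) ^ 2) (by simp [c0 a v w 0])
    simp only [s1]
    have s2 : ∀ v : F a, ∑ j, ∑ l, (f a * chr1 (h a) (y a) v (prodFrame c ε j a) (c a • ε a l)) ^ 2 =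
        ∑ j, ∑ l, (f a * chr1 (h a) (y a) v (c a • ε a j) (c a • ε a l)) ^ 2 := fun v =>
      sum_prodFrame c ε a (fun w => ∑ l, (f a * chr1 (h a) (y a) v w (c a • ε a l)) ^ 2)
        (by simp [c0 a v 0])
    simp only [s2]
    rw [sum_prodFrame c ε a (fun v => ∑ j, ∑ l, (f a * chr1 (h a) (y a) v (c a • ε a j)
      (c a • ε a l)) ^ 2) (by simp [c0 a 0])]
    simp only [chr1_smul]
  have e3 : ∑ l, (∑ i, chr1 (prodG f h) y (prodFrame c ε i) (prodFrame c ε i)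
      (prodFrame c ε l)) ^ 2 = ∑ a, ∑ l, (f a * (c a ^ 3 * ∑ i, chr1 (h a) (y a) (ε a i) (ε a i)
        (ε a l))) ^ 2 := by
    have s0 : ∀ l, (∑ i, chr1 (prodG f h) y (prodFrame c ε i) (prodFrame c ε i)
        (prodFrame c ε l)) ^ 2 = ∑ a, (f a * ∑ i, chr1 (h a) (y a) (c a • ε a i) (c a • ε a i)
          (prodFrame c ε l a)) ^ 2 := fun l => by
      rw [← sq_sum_prodFrame c ε l (fun a v => f a * ∑ i, chr1 (h a) (y a) (c a • ε a i)
        (c a • ε a i) v) fun a => by simp [c0 a _ _ 0]]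
      simp only [chr1_prodG hh]
      rw [Finset.sum_comm]
      congr 1
      refine Finset.sum_congr rfl fun a _ => ?_
      rw [← Finset.mul_sum]
      congr 1
      exact sum_prodFrame c ε a (fun v => chr1 (h a) (y a) v v (prodFrame c ε l a)) (c0 a _ _ _ (.inl rfl))
    simp only [s0]
    rw [Finset.sum_comm]
    refine Finset.sum_congr rfl fun a _ => ?_
    rw [sum_prodFrame c ε a (fun v => (f a * ∑ i, chr1 (h a) (y a) (c a • ε a i) (c a • ε a i) v) ^ 2)
      (by simp [c0 a _ _ 0])]
    simp only [chr1_smul, Finset.mul_sum]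
  simp only [scalJet, fderiv_fderiv_apply (contDiffAt_prodG hh)]
  rw [e1, e2, e3, ← Finset.sum_add_distrib, ← Finset.sum_sub_distrib]
  refine Finset.sum_congr rfl fun a _ => ?_
  simp only [fderiv_fderiv_apply (hh a), ← mul_sub, mul_pow, ← Finset.mul_sum]
  have hf : f a ≠ 0 := fun h0 => by simpa [h0] using hc a
  rw [eq_div_iff hf]
  have h2 : c a ^ 4 * f a ^ 2 = 1 := by linear_combination (c a ^ 2 * f a + 1) * hc a
  have h3 : c a ^ 6 * f a ^ 3 = 1 := by
    linear_combination (c a ^ 4 * f a ^ 2 + c a ^ 2 * f a + 1) * hc a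
  linear_combination (∑ i, ∑ j, (d2 (fun z => h a z (ε a i) (ε a j)) (y a) (ε a j) (ε a i) -
    d2 (fun z => h a z (ε a j) (ε a j)) (y a) (ε a i) (ε a i))) * h2 +
    (∑ i, ∑ j, ∑ l, chr1 (h a) (y a) (ε a i) (ε a j) (ε a l) ^ 2 -
      ∑ l, (∑ i, chr1 (h a) (y a) (ε a i) (ε a i) (ε a l)) ^ 2) * h3

end ModelCurvature

section ModelCurvature

variable {E : Type*} [NormedAddCommGroup E] [NormedSpace ℝ E] {k r : ℕ} {F : Fin k → Type*}
  [∀ a, NormedAddCommGroup (F a)] [∀ a, NormedSpace ℝ (F a)]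
  {g : E → E →L[ℝ] E →L[ℝ] ℝ} {l : E → LieT r →L[ℝ] E}
  {A : (∀ a, F a) → (∀ a, F a) →L[ℝ] LieT r} {f : Fin k → E → ℝ}
  {h : ∀ a, F a → F a →L[ℝ] F a →L[ℝ] ℝ} {u : E} {y : ∀ a, F a}

/-- The local model is a metric of Kaluza-Klein type over the base. -/
theorem modelG_eq_kkG : modelG g l A f h = kkG g (fun z => (l z.1).comp (A z.2))
    (fun z => prodG (fun a => f a z.1) h z.2) := by
  funext z
  refine ContinuousLinearMap.ext fun v => ContinuousLinearMap.ext fun w => ?_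
  rw [modelG_apply, kkG_apply, prodG_apply]
  rfl

/-- The hypotheses under which the curvature of the local model is computed: `A` is a connection form
in a gauge adapted to `y`. -/
structure IsModel (g : E → E →L[ℝ] E →L[ℝ] ℝ) (l : E → LieT r →L[ℝ] E)
    (A : (∀ a, F a) → (∀ a, F a) →L[ℝ] LieT r) (f : Fin k → E → ℝ)
    (h : ∀ a, F a → F a →L[ℝ] F a →L[ℝ] ℝ) (u : E) (y : ∀ a, F a) : Prop where
  smooth_g : ContDiffAt ℝ ∞ g u
  smooth_l : ContDiffAt ℝ ∞ l u
  smooth_A : ContDiffAt ℝ ∞ A y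
  smooth_f : ∀ a, ContDiffAt ℝ ∞ (f a) u
  smooth_h : ∀ a, ContDiffAt ℝ ∞ (h a) (y a)
  symm_g : ∀ z v w, g z v w = g z w v
  symm_h : ∀ a z v w, h a z v w = h a z w v
  A_zero : A y = 0
  antisymm : ∀ b b', fderiv ℝ A y b b' = -fderiv ℝ A y b' b

namespace IsModel

variable (hm : IsModel g l A f h u y)
include hm

theorem fderiv_T {u' : E} (hl : DifferentiableAt ℝ l u') (b b' : ∀ a, F a) :
    fderiv ℝ (fun z : E × ∀ a, F a => (l z.1).comp (A z.2)) (u', y) (0, b) b' =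
      l u' (fderiv ℝ A y b b') := by
  have hA : DifferentiableAt ℝ A y := hm.smooth_A.differentiableAt (by simp)
  have d := (hl.hasFDerivAt.comp_fstF (y := y)).clm_comp (hA.hasFDerivAt.comp_sndF (u := u'))
  rw [d.fderiv]
  simp [hm.A_zero]

theorem contDiffAt_H : ContDiffAt ℝ ∞ (fun z : E × ∀ a, F a => prodG (fun a => f a z.1) h z.2)
    (u, y) :=
  ContDiffAt.sum fun a _ => (contDiffAt_comp_fst (z := (u, y)) (hm.smooth_f a)).smul
    (contDiffAt_pull2 (contDiffAt_comp_snd_apply (z := (u, y)) (hm.smooth_h a)) contDiffAt_const)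

theorem isKK : IsKK g (fun z : E × ∀ a, F a => (l z.1).comp (A z.2))
    (fun z => prodG (fun a => f a z.1) h z.2) u y := by
  refine ⟨hm.smooth_g.of_le two_le_infty, ?_, hm.contDiffAt_H.of_le two_le_infty, hm.symm_g u, ?_, ?_⟩
  · exact ((contDiffAt_comp_fst hm.smooth_l).clm_comp (contDiffAt_comp_snd hm.smooth_A)).of_le
      two_le_infty
  · intro u'
    rw [hm.A_zero, ContinuousLinearMap.comp_zero]
  · filter_upwards [(hm.smooth_l.of_le two_le_infty).eventually (by simp)] with u' hu' b
    rw [hm.fderiv_T (hu'.differentiableAt (by simp))]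
    have h0 : fderiv ℝ A y b b = 0 := self_eq_neg.1 (hm.antisymm b b)
    rw [h0, map_zero]

theorem fderiv_H_fst (x : E) (v w : ∀ a, F a) :
    fderiv ℝ (fun z : E × ∀ a, F a => prodG (fun a => f a z.1) h z.2) (u, y) (x, 0) v w =
      ∑ a, fderiv ℝ (f a) u x * h a (y a) (v a) (w a) := by
  rw [← hm.isKK.fderiv_H_fst, ← fderiv_apply_const₂]
  · simp only [prodG_apply]
    have d : ∀ a, HasFDerivAt (fun u' => f a u' * h a (y a) (v a) (w a)) _ u := fun a =>
      ((hm.smooth_f a).differentiableAt (by simp)).hasFDerivAt.mul_const _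
    refine (DFunLike.congr_fun (HasFDerivAt.fun_sum fun a _ => d a).fderiv x).trans ?_
    simp [sum_apply, mul_comm]
  · exact (ContDiffAt.comp u (g := fun z : E × ∀ a, F a => prodG (fun a => f a z.1) h z.2)
      hm.contDiffAt_H (contDiffAt_id.prodMk contDiffAt_const)).differentiableAt (by simp)

theorem symm_fderiv_H (d : E × ∀ a, F a) (v w : ∀ a, F a) :
    fderiv ℝ (fun z : E × ∀ a, F a => prodG (fun a => f a z.1) h z.2) (u, y) d v w =
      fderiv ℝ (fun z : E × ∀ a, F a => prodG (fun a => f a z.1) h z.2) (u, y) d w v := by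
  refine (fderiv_apply_const₂ hm.isKK.diff_H v w d).symm.trans (Eq.trans ?_
    (fderiv_apply_const₂ hm.isKK.diff_H w v d))
  congr 2
  ext1 z
  rw [prodG_apply, prodG_apply]
  exact Finset.sum_congr rfl fun a _ => by rw [hm.symm_h]

section Frame

variable {ι : Type*} [Fintype ι] [DecidableEq ι] {κ : Fin k → Type*} [∀ a, Fintype (κ a)]
  [∀ a, DecidableEq (κ a)] {e : ι → E} {ε : ∀ a, κ a → F a} {c : Fin k → ℝ}
  (he : IsFrame (g u) e) (hε : ∀ a, IsFrame (h a (y a)) (ε a)) (hc : ∀ a, c a ^ 2 * f a u = 1)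
include he hε hc

theorem isFrame : IsFrame (modelG g l A f h (u, y)) (Sum.elim (fun i => (e i, (0 : ∀ a, F a)))
    fun j => ((0 : E), prodFrame c ε j)) := by
  rw [modelG_eq_kkG]
  exact hm.isKK.isFrame he (isFrame_prodFrame c ε hε hc)

theorem fderiv_H_frame (x : E) (i j : Σ a, κ a) :
    fderiv ℝ (fun z : E × ∀ a, F a => prodG (fun a => f a z.1) h z.2) (u, y) (x, 0)
      (prodFrame c ε i) (prodFrame c ε j) = if i = j then fderiv ℝ (f i.1) u x / f i.1 u else 0 := by
  obtain ⟨a, i⟩ := i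
  obtain ⟨b, j⟩ := j
  rw [hm.fderiv_H_fst, Finset.sum_eq_single a]
  · rw [prodFrame_same]
    by_cases hab : a = b
    · subst hab
      have hf : f a u ≠ 0 := fun h0 => by simpa [h0] using hc a
      rw [prodFrame_same]
      simp only [map_smul, smul_apply, smul_eq_mul, (hε a).orth, Sigma.mk.injEq, heq_eq_eq, true_and]
      split_ifs
      · rw [eq_div_iff hf]
        linear_combination fderiv ℝ (f a) u x * hc a
      · ring
    · rw [prodFrame_ne c ε ⟨b, j⟩ hab]
      simp [hab]
  · intro b' _ hb'
    rw [prodFrame_ne c ε ⟨a, i⟩ hb']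
    simp
  · simp

/-- The trace of the derivative of the base metric: the logarithmic derivative of `∏ f_a ^ dim`. -/
theorem sum_fderiv_H (x : E) : ∑ j, fderiv ℝ (fun z : E × ∀ a, F a => prodG (fun a => f a z.1) h z.2)
    (u, y) (x, 0) (prodFrame c ε j) (prodFrame c ε j) =
      ∑ a, (Fintype.card (κ a) : ℝ) / f a u * fderiv ℝ (f a) u x := by
  simp only [hm.fderiv_H_frame he hε hc, if_true, Fintype.sum_sigma, Finset.sum_const,
    Finset.card_univ, nsmul_eq_mul]
  exact Finset.sum_congr rfl fun a _ => by ring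

theorem sum_sq_fderiv_H (x : E) : ∑ i, ∑ j, fderiv ℝ (fun z : E × ∀ a, F a =>
    prodG (fun a => f a z.1) h z.2) (u, y) (x, 0) (prodFrame c ε i) (prodFrame c ε j) ^ 2 =
      ∑ a, (Fintype.card (κ a) : ℝ) / f a u ^ 2 * fderiv ℝ (f a) u x ^ 2 := by
  simp only [hm.fderiv_H_frame he hε hc, ite_pow, ne_eq, OfNat.ofNat_ne_zero, not_false_eq_true,
    zero_pow, Finset.sum_ite_eq, Finset.mem_univ, if_true, Fintype.sum_sigma, Finset.sum_const,
    Finset.card_univ, nsmul_eq_mul]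
  exact Finset.sum_congr rfl fun a _ => by ring

theorem sum_d2_H (x : E) : ∑ j, d2 (fun u' => prodG (fun a => f a u') h y (prodFrame c ε j)
    (prodFrame c ε j)) u x x = ∑ a, (Fintype.card (κ a) : ℝ) / f a u * d2 (f a) u x x := by
  have key : ∀ j : Σ a, κ a, d2 (fun u' => prodG (fun a => f a u') h y (prodFrame c ε j)
      (prodFrame c ε j)) u x x = d2 (f j.1) u x x / f j.1 u := by
    rintro ⟨a, i⟩
    have hf : f a u ≠ 0 := fun h0 => by simpa [h0] using hc a
    have e1 : (fun u' => prodG (fun a => f a u') h y (prodFrame c ε ⟨a, i⟩) (prodFrame c ε ⟨a, i⟩)) =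
        fun u' => c a ^ 2 * f a u' := by
      ext1 u'
      rw [prodG_apply, Finset.sum_eq_single a]
      · rw [prodFrame_same]
        simp only [map_smul, smul_apply, smul_eq_mul, (hε a).orth, if_true]
        ring
      · intro b' _ hb'
        rw [prodFrame_ne c ε ⟨a, i⟩ hb']
        simp
      · simp
    rw [e1, d2_smul _ ((hm.smooth_f a).of_le two_le_infty), eq_div_iff hf]
    linear_combination d2 (f a) u x x * hc a
  simp only [key, Fintype.sum_sigma, Finset.sum_const, Finset.card_univ, nsmul_eq_mul]
  exact Finset.sum_congr rfl fun a _ => by ring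

theorem lapJet_modelG {φ : E → ℝ} (hφ : ContDiffAt ℝ 2 φ u) :
    lapJet (modelG g l A f h) (fun z => φ z.1) (u, y)
        (Sum.elim (fun i => (e i, (0 : ∀ a, F a))) fun j => ((0 : E), prodFrame c ε j)) =
      lapJet g φ u e - 1 / 2 * ∑ i, (∑ a, (Fintype.card (κ a) : ℝ) / f a u *
        fderiv ℝ (f a) u (e i)) * fderiv ℝ φ u (e i) := by
  rw [modelG_eq_kkG]
  refine (hm.isKK.lapJet_kkG hφ).trans ?_
  simp only [hm.sum_fderiv_H he hε hc]

/-- The square norm of the curvature of the connection. The hypothesis `hp`, which on `Y` holds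
because `f_a` is a component of the momentum map, turns it into a sum of `|df_a|²`. -/
theorem sum_curvature {β : ∀ a, F a →L[ℝ] F a →L[ℝ] ℝ} {p : Fin k → LieT r}
    (hA : ∀ b b', fderiv ℝ A y b b' = (1 / 2 : ℝ) • ∑ a, β a (b a) (b' a) • p a)
    (hβ : ∀ a, ∑ i, ∑ j, β a (ε a i) (ε a j) ^ 2 = Fintype.card (κ a))
    (hp : ∀ a, g u (l u (p a)) (l u (p a)) = ∑ i, fderiv ℝ (f a) u (e i) ^ 2) :
    ∑ i, ∑ j, g u (l u (fderiv ℝ A y (prodFrame c ε i) (prodFrame c ε j)))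
      (l u (fderiv ℝ A y (prodFrame c ε i) (prodFrame c ε j))) =
      1 / 4 * ∑ i, ∑ a, (Fintype.card (κ a) : ℝ) / f a u ^ 2 * fderiv ℝ (f a) u (e i) ^ 2 := by
  have s0 : ∀ i j, g u (l u (fderiv ℝ A y (prodFrame c ε i) (prodFrame c ε j)))
      (l u (fderiv ℝ A y (prodFrame c ε i) (prodFrame c ε j))) =
      ∑ a, 1 / 4 * β a (prodFrame c ε i a) (prodFrame c ε j a) ^ 2 *
        ∑ i, fderiv ℝ (f a) u (e i) ^ 2 := by
    intro i j
    have z0 : ∀ a, a ≠ i.1 → β a (prodFrame c ε i a) (prodFrame c ε j a) = 0 := fun a ha => by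
      rw [prodFrame_ne c ε i ha]; simp
    rw [hA, Finset.sum_eq_single i.1 (fun a _ ha => by rw [z0 a ha, zero_smul]) (by simp),
      Finset.sum_eq_single i.1 (fun a _ ha => by rw [z0 a ha]; simp) (by simp)]
    simp only [map_smul, smul_apply, smul_eq_mul, hp]
    ring
  simp only [s0]
  rw [Finset.sum_congr rfl fun i _ => Finset.sum_comm, Finset.sum_comm,
    Finset.sum_comm (f := fun i a => (Fintype.card (κ a) : ℝ) / f a u ^ 2 *
      fderiv ℝ (f a) u (e i) ^ 2), Finset.mul_sum]
  refine Finset.sum_congr rfl fun a _ => ?_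
  simp only [← Finset.sum_mul, ← Finset.mul_sum]
  have s1 : ∀ v : F a, ∑ j, β a v (prodFrame c ε j a) ^ 2 = ∑ j, β a v (c a • ε a j) ^ 2 := fun v =>
    sum_prodFrame c ε a (fun w => β a v w ^ 2) (by simp)
  simp only [s1]
  rw [sum_prodFrame c ε a (fun v => ∑ j, β a v (c a • ε a j) ^ 2) (by simp)]
  simp only [map_smul, smul_apply, smul_eq_mul, mul_pow, ← Finset.mul_sum, hβ]
  have hf : f a u ≠ 0 := fun h0 => by simpa [h0] using hc a
  have hc2 : c a ^ 2 = (f a u)⁻¹ := eq_inv_of_mul_eq_one_left (hc a)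
  rw [hc2]
  field_simp

omit hm he hε hc [DecidableEq ι] [∀ a, DecidableEq (κ a)] in
theorem sum_lapJet :
    ∑ a, (Fintype.card (κ a) : ℝ) / f a u * lapJet g (f a) u e =
      ∑ i, (∑ i', chr1 g u (e i') (e i') (e i)) * ∑ a, (Fintype.card (κ a) : ℝ) / f a u *
        fderiv ℝ (f a) u (e i) -
      ∑ i, ∑ a, (Fintype.card (κ a) : ℝ) / f a u * d2 (f a) u (e i) (e i) := by
  have s1 : ∀ a, lapJet g (f a) u e = ∑ i, (∑ i', chr1 g u (e i') (e i') (e i)) *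
      fderiv ℝ (f a) u (e i) - ∑ i, d2 (f a) u (e i) (e i) := by
    intro a
    rw [lapJet, Finset.sum_sub_distrib, neg_sub]
    congr 1
    rw [Finset.sum_comm]
    exact Finset.sum_congr rfl fun i _ => by rw [Finset.sum_mul]
  simp only [s1, mul_sub, Finset.sum_sub_distrib, Finset.mul_sum]
  rw [Finset.sum_comm, Finset.sum_comm (f := fun a i => (Fintype.card (κ a) : ℝ) / f a u *
    d2 (f a) u (e i) (e i))]
  congr 1
  exact Finset.sum_congr rfl fun i _ => Finset.sum_congr rfl fun a _ => by ring

/-- The scalar curvature of the local model. The second derivatives of the `f_a` combine to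
Laplacians. -/
theorem scalJet_modelG {β : ∀ a, F a →L[ℝ] F a →L[ℝ] ℝ} {p : Fin k → LieT r}
    (hA : ∀ b b', fderiv ℝ A y b b' = (1 / 2 : ℝ) • ∑ a, β a (b a) (b' a) • p a)
    (hβ : ∀ a, ∑ i, ∑ j, β a (ε a i) (ε a j) ^ 2 = Fintype.card (κ a))
    (hp : ∀ a, g u (l u (p a)) (l u (p a)) = ∑ i, fderiv ℝ (f a) u (e i) ^ 2) :
    scalJet (modelG g l A f h) (u, y)
        (Sum.elim (fun i => (e i, (0 : ∀ a, F a))) fun j => ((0 : E), prodFrame c ε j)) =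
      scalJet g u e + ∑ a, scalJet (h a) (y a) (ε a) / f a u +
      ∑ a, (Fintype.card (κ a) : ℝ) / f a u * lapJet g (f a) u e +
      1 / 2 * ∑ i, ∑ a, (Fintype.card (κ a) : ℝ) / f a u ^ 2 * fderiv ℝ (f a) u (e i) ^ 2 -
      1 / 4 * ∑ i, (∑ a, (Fintype.card (κ a) : ℝ) / f a u * fderiv ℝ (f a) u (e i)) ^ 2 := by
  have hld : DifferentiableAt ℝ l u := hm.smooth_l.differentiableAt (by simp)
  have hQ := hm.sum_curvature he hε hc hA hβ hp
  have hS := hm.isKK.scalJet_kkG (ε := prodFrame c ε) he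
    (Filter.Eventually.of_forall hm.symm_g) hm.symm_fderiv_H
  rw [modelG_eq_kkG]
  refine hS.trans ?_
  have hP : scalJet (prodG (fun a => f a u) h) y (prodFrame c ε) =
      ∑ a, scalJet (h a) (y a) (ε a) / f a u :=
    scalJet_prodG c ε (fun a => (hm.smooth_h a).of_le two_le_infty) hc
  have hP' : (fun y' : ∀ a, F a => prodG (fun a => f a (u, y').1) h (u, y').2) =
      prodG (fun a => f a u) h := rfl
  rw [hP', hP]
  simp only [hm.sum_fderiv_H he hε hc, hm.sum_sq_fderiv_H he hε hc, hm.sum_d2_H he hε hc,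
    hm.fderiv_T hld, hQ]
  rw [sum_lapJet]
  ring

end Frame
end IsModel
end ModelCurvature

section JetCongr

variable {E : Type*} [NormedAddCommGroup E] [NormedSpace ℝ E] {ι : Type*} [Fintype ι]
  {G G' : E → E →L[ℝ] E →L[ℝ] ℝ} {u : E}

theorem scalJet_congr (h : G =ᶠ[𝓝 u] G') (e : ι → E) : scalJet G u e = scalJet G' u e := by
  have e3 : ∀ a b c', fderiv ℝ (fun z => fderiv ℝ G z a b c') u =
      fderiv ℝ (fun z => fderiv ℝ G' z a b c') u :=
    fun a b c' => Filter.EventuallyEq.fderiv_eq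
      (h.eventually_nhds.mono fun z hz => by simp only [Filter.EventuallyEq.fderiv_eq hz])
  simp only [scalJet, e3, chr1, h.fderiv_eq]

theorem lapJet_congr (h : G =ᶠ[𝓝 u] G') {f f' : E → ℝ} (hf : f =ᶠ[𝓝 u] f') (e : ι → E) :
    lapJet G f u e = lapJet G' f' u e := by
  have e3 : ∀ a, fderiv ℝ (fun z => fderiv ℝ f z a) u = fderiv ℝ (fun z => fderiv ℝ f' z a) u :=
    fun a => Filter.EventuallyEq.fderiv_eq
      (hf.eventually_nhds.mono fun z hz => by simp only [Filter.EventuallyEq.fderiv_eq hz])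
  simp only [lapJet, e3, chr1, h.fderiv_eq, hf.fderiv_eq]

theorem sum_mul_sum_lin {r : ℕ} (a b : Fin r → ℝ) (D : Fin r → ι → ℝ) :
    ∑ i, (∑ j, a j * D j i) * (∑ j, b j * D j i) =
      ∑ j, ∑ l, a j * b l * ∑ i, D j i * D l i := by
  simp_rw [Finset.sum_mul_sum, Finset.mul_sum]
  rw [Finset.sum_comm]
  refine Finset.sum_congr rfl fun j _ => ?_
  rw [Finset.sum_comm]
  exact Finset.sum_congr rfl fun l _ => Finset.sum_congr rfl fun i _ => by ring

end JetCongr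

/-- `∑_i ω(a, e_i)² = |a|²` for an orthonormal frame `e`. -/
theorem IsKahler.sum_form_sq {d : ℕ} {M : Type*} [TopologicalSpace M] [ChartedSpace (𝔼 d) M]
    [IsManifold 𝓘(ℝ, 𝔼 d) ∞ M] {J : EndField d M} {Ω : BilForm d M ℝ} (h : IsKahler J Ω)
    {E : Type*} [NormedAddCommGroup E] [NormedSpace ℝ E] {ι : Type*} [Fintype ι] [DecidableEq ι]
    {c : E → M} {u : E} (hb : Function.Surjective (md (d := d) c u)) {e : ι → E}
    (he : IsFrame (pb2 c (metric J Ω) u) e) (a : E) :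
    ∑ i, pb2 c Ω u a (e i) ^ 2 = pb2 c (metric J Ω) u a a := by
  obtain ⟨a', ha'⟩ := hb (J (c u) (md (d := d) c u a))
  have h1 : ∀ b, pb2 c Ω u a b = pb2 c (metric J Ω) u a' b := by
    intro b
    rw [pb2_apply, pb2_apply, ha']
    exact (h.invariant (c u) (md (d := d) c u a) (md (d := d) c u b)).symm
  simp only [h1, sq]
  rw [he.parseval fun a b => h.isRiem.symm (c u) _ _, pb2_apply, pb2_apply, ha']
  exact h.invariant (c u) (md (d := d) c u a) (J (c u) (md (d := d) c u a))

theorem IsHamKahler.genGram_symm {d r : ℕ} {M : Type*} [TopologicalSpace M] [ChartedSpace (𝔼 d) M]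
    [IsManifold 𝓘(ℝ, 𝔼 d) ∞ M] {J : EndField d M} {Ω : BilForm d M ℝ} {τ : LieT r → M → M}
    {μ : M → LieT r} (h : IsHamKahler J Ω τ μ) (i j : Fin r) (x : M) :
    genGram J Ω τ i j x = genGram J Ω τ j i x := h.kahler.isRiem.symm x _ _

/-! ### The Riemannian volume in parametrizations -/

theorem ContinuousOn.measurableSet_inter_preimage {α β : Type*} [TopologicalSpace α]
    [MeasurableSpace α] [OpensMeasurableSpace α] [TopologicalSpace β] [MeasurableSpace β]
    [BorelSpace β] {f : α → β} {s : Set α} (hf : ContinuousOn f s) (hs : MeasurableSet s)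
    {t : Set β} (ht : MeasurableSet t) : MeasurableSet (s ∩ f ⁻¹' t) := by
  have h1 : Measurable (s.domRestrict f) := (continuousOn_iff_continuous_domRestrict.1 hf).measurable
  have h2 := (MeasurableEmbedding.subtype_coe hs).measurableSet_image.2 (h1 ht)
  convert h2 using 1
  ext x
  simp [and_comm]

section Volume

variable {d : ℕ} {M : Type*} [TopologicalSpace M] [ChartedSpace (𝔼 d) M]
  [IsManifold 𝓘(ℝ, 𝔼 d) ∞ M]

/-- The density of the Riemannian volume in a parametrization. -/
def dens (β : 𝔼 d → 𝔼 d →L[ℝ] 𝔼 d →L[ℝ] ℝ) (u : 𝔼 d) : ENNReal :=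
  ENNReal.ofReal (Real.sqrt (gramF β u).det)

theorem gramF_pullF (G : 𝔼 d → 𝔼 d →L[ℝ] 𝔼 d →L[ℝ] ℝ) (φ : 𝔼 d → 𝔼 d) (u : 𝔼 d) :
    (gramF (pullF G φ) u).det = (fderiv ℝ φ u).det ^ 2 * (gramF G (φ u)).det := by
  let A : Matrix (Fin d) (Fin d) ℝ := Matrix.of fun i j => fderiv ℝ φ u (stdb j) i
  have hA : A.det = (fderiv ℝ φ u).det := by
    have h1 : (fderiv ℝ φ u).det =
      LinearMap.det (fderiv ℝ φ u : 𝔼 d →ₗ[ℝ] 𝔼 d) := rfl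
    rw [h1, ← LinearMap.det_toMatrix (EuclideanSpace.basisFun (Fin d) ℝ).toBasis]
    congr 1
  have h : gramF (pullF G φ) u = A.transpose * gramF G (φ u) * A := by
    ext i j
    have h2 : ∀ j, fderiv ℝ φ u (stdb j) = ∑ k, A k j • stdb k := fun j =>
      sum_stdb (fderiv ℝ φ u (stdb j))
    change G (φ u) (fderiv ℝ φ u (stdb i)) (fderiv ℝ φ u (stdb j)) = _
    rw [h2 i, h2 j]
    simp only [map_sum, map_smul, sum_apply, smul_apply, smul_eq_mul, Matrix.mul_apply, gramF,
      Matrix.transpose_apply, Matrix.of_apply, Finset.sum_mul, Finset.mul_sum]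
    exact Finset.sum_congr rfl fun a _ => Finset.sum_congr rfl fun b _ => by ring
  rw [h, Matrix.det_mul, Matrix.det_mul, Matrix.det_transpose, hA]
  ring

theorem dens_pullF (G : 𝔼 d → 𝔼 d →L[ℝ] 𝔼 d →L[ℝ] ℝ) (φ : 𝔼 d → 𝔼 d) (u : 𝔼 d) :
    dens (pullF G φ) u = ENNReal.ofReal |(fderiv ℝ φ u).det| * dens G (φ u) := by
  rw [dens, gramF_pullF, Real.sqrt_mul (sq_nonneg _), Real.sqrt_sq_eq_abs,
    ENNReal.ofReal_mul (abs_nonneg _), dens]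

variable [T2Space M] [CompactSpace M] [Nonempty M] [MeasurableSpace M] [BorelSpace M]

/-- The volume of the image of an injective parametrization. -/
theorem vol_image (g : BilForm d M ℝ) {c : 𝔼 d → M} {S : Set (𝔼 d)}
    (hc : ∀ u ∈ S, SmAt d c u) (hinj : Set.InjOn c S) (hS : MeasurableSet S) :
    vol g (c '' S) = ∫⁻ u in S, dens (pb2 c g) u := by
  have hcont : ContinuousOn c S := fun u hu => (hc u hu).continuousAt.continuousWithinAt
  have hA : MeasurableSet (c '' S) := hS.image_of_continuousOn_injOn hcont hinj
  set D : ℕ → Set M := disjointed fun l => (chartAt (𝔼 d) (chartCentre d M l)).source with hDdef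
  have hD : ∀ j, MeasurableSet (D j) := fun j =>
    MeasurableSet.disjointed (fun l => (chartAt (𝔼 d) _).open_source.measurableSet) j
  have hDs : ∀ j, D j ⊆ (chart d (chartCentre d M j)).source := fun j => by
    rw [extChartAt_source]; exact disjointed_subset _ j
  have hDu : ⋃ j, D j = Set.univ := by
    rw [hDdef, iUnion_disjointed]; exact (exists_chart_cover d M).choose_spec
  have hSj : ∀ j, MeasurableSet (S ∩ c ⁻¹' D j) := fun j =>
    ContinuousOn.measurableSet_inter_preimage hcont hS (hD j)
  have key : ∀ j, (Measure.map (chart d (chartCentre d M j)).symm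
      ((volume.restrict (chart d (chartCentre d M j)).target).withDensity
        fun u => ENNReal.ofReal (Real.sqrt (gram g (chartCentre d M j) u).det))) (c '' S ∩ D j) =
      ∫⁻ u in S ∩ c ⁻¹' D j, dens (pb2 c g) u := by
    intro j
    set φ := chart d (chartCentre d M j)
    have hφt : MeasurableSet φ.target := (isOpen_extChartAt_target _).measurableSet
    have hφs : AEMeasurable φ.symm ((volume.restrict φ.target).withDensity
        fun u => ENNReal.ofReal (Real.sqrt (gram g (chartCentre d M j) u).det)) :=
      ((continuousOn_extChartAt_symm _).aemeasurable hφt).mono_ac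
        (withDensity_absolutelyContinuous _ _)
    rw [Measure.map_apply_of_aemeasurable hφs (hA.inter (hD j)), withDensity_apply',
      Measure.restrict_restrict' hφt]
    have e : φ.symm ⁻¹' (c '' S ∩ D j) ∩ φ.target = (φ ∘ c) '' (S ∩ c ⁻¹' D j) := by
      ext z
      constructor
      · rintro ⟨⟨⟨u, hu, hu'⟩, hz⟩, hz'⟩
        refine ⟨u, ⟨hu, ?_⟩, ?_⟩
        · rw [Set.mem_preimage, hu']; exact hz
        · rw [Function.comp_apply, hu', φ.right_inv hz']
      · rintro ⟨u, ⟨hu, hu'⟩, rfl⟩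
        have h1 : φ.symm ((φ ∘ c) u) = c u := φ.left_inv (hDs j hu')
        refine ⟨?_, φ.map_source (hDs j hu')⟩
        rw [Set.mem_preimage, h1]
        exact ⟨⟨u, hu, rfl⟩, hu'⟩
    have hinj' : Set.InjOn (φ ∘ c) (S ∩ c ⁻¹' D j) := fun u hu u' hu' h =>
      hinj hu.1 hu'.1 (φ.injOn (hDs j hu.2) (hDs j hu'.2) h)
    rw [e, lintegral_image_eq_lintegral_abs_det_fderiv_mul volume (hSj j) (f' := fderiv ℝ (φ ∘ c))
      (fun u hu => (((hc u hu.1).contDiffAt_chart (hDs j hu.2)).differentiableAt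
        (by simp)).hasFDerivAt.hasFDerivWithinAt) hinj']
    refine setLIntegral_congr_fun (hSj j) fun u hu => ?_
    have h1 := ((hc u hu.1).pb2_eq (hDs j hu.2) g).self_of_nhds
    have h2 : dens (pb2 c g) u = dens (pullF (coord2 g (chartCentre d M j)) (φ ∘ c)) u := by
      rw [dens, gramF, h1]; rfl
    rw [h2, dens_pullF]
    rfl
  rw [vol, Measure.sum_apply _ hA]
  simp only [Measure.restrict_apply hA]
  rw [tsum_congr key, ← lintegral_iUnion hSj]
  · rw [← Set.inter_iUnion, ← Set.preimage_iUnion, hDu, Set.preimage_univ, Set.inter_univ]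
  · intro i j hij
    exact ((disjoint_disjointed _ hij).preimage c).mono Set.inter_subset_right Set.inter_subset_right

open Classical in
/-- The inverse of the chart around `x₀`, extended by a constant outside the target. -/
def vchart (x₀ : M) : 𝔼 d → M := (chart d x₀).target.piecewise (chart d x₀).symm fun _ => x₀

open Classical in
/-- The density of the volume in the chart around `x₀`, extended by zero outside the target. -/
def vdens (g : BilForm d M ℝ) (x₀ : M) : 𝔼 d → ENNReal :=
  (chart d x₀).target.indicator (dens (coord2 g x₀))

theorem measurable_vchart (x₀ : M) : Measurable (vchart (d := d) x₀) := by
  classical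
  exact (continuousOn_extChartAt_symm x₀).measurable_piecewise continuousOn_const
    (isOpen_extChartAt_target x₀).measurableSet

theorem vchart_apply {x₀ : M} {u : 𝔼 d} (hu : u ∈ (chart d x₀).target) :
    vchart x₀ u = (chart d x₀).symm u := by
  classical exact Set.piecewise_eq_of_mem _ _ _ hu

theorem vdens_apply (g : BilForm d M ℝ) {x₀ : M} {u : 𝔼 d} (hu : u ∈ (chart d x₀).target) :
    vdens g x₀ u = dens (coord2 g x₀) u := Set.indicator_of_mem hu _

theorem vdens_apply_of_notMem (g : BilForm d M ℝ) {x₀ : M} {u : 𝔼 d} (hu : u ∉ (chart d x₀).target) :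
    vdens g x₀ u = 0 := Set.indicator_of_notMem hu _

theorem continuousOn_det_coord2 {g : BilForm d M ℝ} (hg : Smooth2 g) (x₀ : M) :
    ContinuousOn (fun u => (gramF (coord2 g x₀) u).det) (chart d x₀).target := by
  have h : ContinuousOn (fun u => gramF (coord2 g x₀) u) (chart d x₀).target :=
    continuousOn_pi.2 fun i => continuousOn_pi.2 fun j =>
      ((hg x₀).continuousOn.clm_apply continuousOn_const).clm_apply continuousOn_const
  exact (continuous_id.matrix_det (A := fun A : Matrix (Fin d) (Fin d) ℝ => A)).comp_continuousOn h

theorem measurable_vdens {g : BilForm d M ℝ} (hg : Smooth2 g) (x₀ : M) :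
    Measurable (vdens g x₀) := by
  classical
  have h : ContinuousOn (dens (coord2 g x₀)) (chart d x₀).target :=
    ENNReal.continuous_ofReal.comp_continuousOn
      (Real.continuous_sqrt.comp_continuousOn (continuousOn_det_coord2 hg x₀))
  have := h.measurable_piecewise (g := 0) continuousOn_const
    (isOpen_extChartAt_target x₀).measurableSet
  rwa [Set.piecewise_eq_indicator] at this

/-- The volume in a chart. -/
theorem vol_restrict_source (g : BilForm d M ℝ) (x₀ : M) :
    (vol g).restrict (chart d x₀).source = Measure.map (vchart x₀) (volume.withDensity (vdens g x₀)) := by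
  have ht : MeasurableSet (chart d x₀).target := (isOpen_extChartAt_target x₀).measurableSet
  ext A hA
  rw [Measure.restrict_apply hA, Measure.map_apply (measurable_vchart x₀) hA, withDensity_apply',
    vdens, ← lintegral_indicator (measurable_vchart x₀ hA), Set.indicator_indicator,
    lintegral_indicator ((measurable_vchart x₀ hA).inter ht)]
  have e1 : vchart x₀ ⁻¹' A ∩ (chart d x₀).target = (chart d x₀).target ∩ (chart d x₀).symm ⁻¹' A := by
    ext u
    constructor
    · rintro ⟨h1, h2⟩
      exact ⟨h2, by rwa [Set.mem_preimage, vchart_apply h2] at h1⟩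
    · rintro ⟨h2, h1⟩
      exact ⟨by rwa [Set.mem_preimage, vchart_apply h2], h2⟩
  have e2 : (chart d x₀).symm '' ((chart d x₀).target ∩ (chart d x₀).symm ⁻¹' A) =
      A ∩ (chart d x₀).source := by
    ext x
    constructor
    · rintro ⟨u, ⟨h1, h2⟩, rfl⟩
      exact ⟨h2, (chart d x₀).map_target h1⟩
    · rintro ⟨h1, h2⟩
      refine ⟨chart d x₀ x, ⟨(chart d x₀).map_source h2, ?_⟩, (chart d x₀).left_inv h2⟩
      rwa [Set.mem_preimage, (chart d x₀).left_inv h2]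
  have hinj : Set.InjOn (chart d x₀).symm ((chart d x₀).target ∩ (chart d x₀).symm ⁻¹' A) :=
    (chart d x₀).symm.injOn.mono Set.inter_subset_left
  rw [e1, ← e2, vol_image g (fun u hu => smAt_chart_symm x₀ hu.1) hinj
    (ContinuousOn.measurableSet_inter_preimage (continuousOn_extChartAt_symm x₀) ht hA)]
  rfl

theorem isFiniteMeasure_vol {g : BilForm d M ℝ} (hg : Smooth2 g) : IsFiniteMeasure (vol g) := by
  have : IsLocallyFiniteMeasure (vol g) := ⟨fun x => by
    have hx := target_mem_nhds ((chart d x).map_source (mem_chart_self (d := d) x))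
    have hd := ((continuousOn_det_coord2 hg x).continuousAt hx).eventually
      (gt_mem_nhds (lt_add_one _))
    obtain ⟨ε, hε, hb⟩ := Metric.nhds_basis_ball.mem_iff.1 (Filter.inter_mem hx hd)
    refine ⟨(chart d x).source ∩ chart d x ⁻¹' Metric.ball (chart d x x) ε, ?_, ?_⟩
    · exact Filter.inter_mem (chart_source_mem_nhds (mem_chart_self x))
        ((continuousAt_extChartAt x).preimage_mem_nhds (Metric.ball_mem_nhds _ hε))
    · have e : (chart d x).source ∩ chart d x ⁻¹' Metric.ball (chart d x x) ε =
          (chart d x).symm '' Metric.ball (chart d x x) ε :=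
        ((chart d x).symm_image_eq_source_inter_preimage fun u hu => (hb hu).1).symm
      rw [e, vol_image g (fun u hu => smAt_chart_symm x (hb hu).1)
        ((chart d x).symm.injOn.mono fun u hu => (hb hu).1) measurableSet_ball]
      refine (setLIntegral_mono measurable_const fun u hu =>
        ENNReal.ofReal_le_ofReal (Real.sqrt_le_sqrt (hb hu).2.le)).trans_lt ?_
      rw [setLIntegral_const]
      exact ENNReal.mul_lt_top ENNReal.ofReal_lt_top measure_ball_lt_top⟩
  infer_instance

end Volume

/-! ### Volumes of products -/

/-- Tonelli's theorem for a product of functions of one variable each. -/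
theorem lintegral_pi_prod {k : ℕ} {α : Fin k → Type*} [∀ a, MeasurableSpace (α a)]
    (ν : ∀ a, Measure (α a)) [∀ a, SigmaFinite (ν a)] {f : ∀ a, α a → ENNReal}
    (hf : ∀ a, Measurable (f a)) :
    ∫⁻ y, ∏ a, f a (y a) ∂(Measure.pi ν) = ∏ a, ∫⁻ x, f a x ∂(ν a) := by
  induction k with
  | zero => simp
  | succ k ih =>
    have hm : Measurable fun y : ∀ a : Fin k, α a.succ => ∏ a, f a.succ (y a) :=
      Finset.measurable_prod _ fun a _ => (hf a.succ).comp (measurable_pi_apply a)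
    rw [Fin.prod_univ_succ, ← ih (fun a => ν a.succ) fun a => hf a.succ,
      ← lintegral_prod_mul (hf 0).aemeasurable hm.aemeasurable]
    have h := ((measurePreserving_piFinSuccAbove ν 0).symm).lintegral_comp_emb
      (MeasurableEquiv.measurableEmbedding _) fun y => ∏ a, f a (y a)
    refine h.symm.trans (lintegral_congr fun z => ?_)
    rw [Fin.prod_univ_succ]
    rfl

theorem pi_withDensity {k : ℕ} {α : Fin k → Type*} [∀ a, MeasurableSpace (α a)]
    (ν : ∀ a, Measure (α a)) [∀ a, SigmaFinite (ν a)] {f : ∀ a, α a → ENNReal}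
    (hf : ∀ a, Measurable (f a)) [∀ a, SigmaFinite ((ν a).withDensity (f a))] :
    Measure.pi (fun a => (ν a).withDensity (f a)) =
      (Measure.pi ν).withDensity fun y => ∏ a, f a (y a) := by
  refine Measure.pi_eq fun s hs => ?_
  have hi : ∀ y : ∀ a, α a, (Set.univ.pi s).indicator (fun y => ∏ a, f a (y a)) y =
      ∏ a, (s a).indicator (f a) (y a) := by
    intro y
    by_cases hy : y ∈ Set.univ.pi s
    · rw [Set.indicator_of_mem hy]
      exact Finset.prod_congr rfl fun a _ => (Set.indicator_of_mem (hy a trivial) _).symm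
    · rw [Set.indicator_of_notMem hy]
      obtain ⟨a, ha⟩ : ∃ a, y a ∉ s a := by simpa [Set.mem_pi] using hy
      exact (Finset.prod_eq_zero (Finset.mem_univ a) (Set.indicator_of_notMem ha _)).symm
  rw [withDensity_apply _ (MeasurableSet.univ_pi hs), ← lintegral_indicator (MeasurableSet.univ_pi hs)]
  simp only [hi]
  rw [lintegral_pi_prod ν fun a => (hf a).indicator (hs a)]
  exact Finset.prod_congr rfl fun a _ => by
    rw [lintegral_indicator (hs a), withDensity_apply _ (hs a)]

theorem addHaar_piBasis {k : ℕ} {n : Fin k → ℕ} :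
    (Pi.basis fun a => (EuclideanSpace.basisFun (Fin (n a)) ℝ).toBasis).addHaar =
      (volume : Measure (∀ a, 𝔼 (n a))) := by
  rw [Module.Basis.addHaar_eq_iff]
  have e : ((Pi.basis fun a => (EuclideanSpace.basisFun (Fin (n a)) ℝ).toBasis).parallelepiped :
      Set (∀ a, 𝔼 (n a))) = Set.univ.pi fun a =>
        parallelepiped (EuclideanSpace.basisFun (Fin (n a)) ℝ).toBasis := by
    ext x
    rw [Module.Basis.coe_parallelepiped, parallelepiped_basis_eq]
    simp only [Set.mem_pi, parallelepiped_basis_eq, Sigma.forall, Set.mem_univ, forall_const,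
      Set.mem_ofPred_eq, Pi.basis_repr]
  rw [e, volume_pi_pi]
  refine Finset.prod_eq_one fun a _ => ?_
  rw [← OrthonormalBasis.addHaar_eq_volume (EuclideanSpace.basisFun (Fin (n a)) ℝ),
    Module.Basis.addHaar_self]

/-- The determinant of a block diagonal matrix. -/
theorem det_sigma_block {k : ℕ} {κ : Fin k → Type*} [∀ a, Fintype (κ a)] [∀ a, DecidableEq (κ a)]
    (N : ∀ a, Matrix (κ a) (κ a) ℝ) (M : Matrix (Σ a, κ a) (Σ a, κ a) ℝ)
    (h0 : ∀ i j, i.1 ≠ j.1 → M i j = 0) (h1 : ∀ a i j, M ⟨a, i⟩ ⟨a, j⟩ = N a i j) :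
    M.det = ∏ a, (N a).det := by
  have hb : M.BlockTriangular Sigma.fst := fun i j hij => h0 i j hij.ne'
  rw [hb.det_fintype]
  refine Finset.prod_congr rfl fun a _ => ?_
  rw [← Matrix.det_submatrix_equiv_self (Equiv.sigmaSubtype a).symm]
  congr 1
  ext i j
  exact h1 a i j

/-- The Gram determinant of the local model of the metric is the product of the Gram determinants. -/
theorem det_modelG {E : Type*} [NormedAddCommGroup E] [NormedSpace ℝ E] {k r : ℕ} {F : Fin k → Type*}
    [∀ a, NormedAddCommGroup (F a)] [∀ a, NormedSpace ℝ (F a)]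
    (g : E → E →L[ℝ] E →L[ℝ] ℝ) (l : E → LieT r →L[ℝ] E)
    (A : (∀ a, F a) → (∀ a, F a) →L[ℝ] LieT r) (f : Fin k → E → ℝ)
    (h : ∀ a, F a → F a →L[ℝ] F a →L[ℝ] ℝ) (z : E × ∀ a, F a) {ι : Type*} [Fintype ι]
    [DecidableEq ι] {κ : Fin k → Type*} [∀ a, Fintype (κ a)] [∀ a, DecidableEq (κ a)]
    (b : Module.Basis ι ℝ E) (b' : ∀ a, Module.Basis (κ a) ℝ (F a)) :
    (Matrix.of fun i j => modelG g l A f h z (b.prod (Pi.basis b') i) (b.prod (Pi.basis b') j)).det =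
      (Matrix.of fun i j => g z.1 (b i) (b j)).det *
        ∏ a, (f a z.1 ^ Fintype.card (κ a) * (Matrix.of fun i j => h a (z.2 a) (b' a i) (b' a j)).det) := by
  let G : Matrix ι ι ℝ := Matrix.of fun i j => g z.1 (b i) (b j)
  let H : Matrix (Σ a, κ a) (Σ a, κ a) ℝ := Matrix.of fun i j =>
    ∑ a, f a z.1 * h a (z.2 a) (Pi.basis b' i a) (Pi.basis b' j a)
  let C : Matrix ι (Σ a, κ a) ℝ := Matrix.of fun i j => b.repr (l z.1 (A z.2 (Pi.basis b' j))) i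
  -- the matrix of the shear; it is unipotent and makes the metric block diagonal
  let U : Matrix (ι ⊕ Σ a, κ a) (ι ⊕ Σ a, κ a) ℝ := Matrix.fromBlocks 1 C 0 1
  have hC : ∀ j, l z.1 (A z.2 (Pi.basis b' j)) = ∑ i, C i j • b i := fun j => (b.sum_repr _).symm
  have hU : U.det = 1 := by
    rw [Matrix.det_fromBlocks_zero₂₁, Matrix.det_one, Matrix.det_one, mul_one]
  have hM : (Matrix.of fun i j => modelG g l A f h z (b.prod (Pi.basis b') i)
      (b.prod (Pi.basis b') j)) = U.transpose * Matrix.fromBlocks G 0 0 H * U := by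
    have hGC : ∀ v j, g z.1 v (l z.1 (A z.2 (Pi.basis b' j))) = ∑ i, g z.1 v (b i) * C i j := by
      intro v j
      rw [hC, map_sum]
      exact Finset.sum_congr rfl fun i _ => by rw [map_smul, smul_eq_mul, mul_comm]
    have hCG : ∀ v j, g z.1 (l z.1 (A z.2 (Pi.basis b' j))) v = ∑ i, C i j * g z.1 (b i) v := by
      intro v j
      rw [hC, map_sum, sum_apply]
      exact Finset.sum_congr rfl fun i _ => by rw [map_smul, smul_apply, smul_eq_mul]
    rw [Matrix.fromBlocks_transpose, Matrix.fromBlocks_multiply, Matrix.fromBlocks_multiply]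
    ext (i | i) (j | j)
    · simp [modelG_apply, G]
    · simp [modelG_apply, G, hGC, Matrix.mul_apply, -Pi.basis_apply]
    · simp [modelG_apply, G, hCG, Matrix.mul_apply, -Pi.basis_apply]
    · simp only [modelG_apply, Matrix.of_apply, Module.Basis.prod_apply_inr_fst,
        Module.Basis.prod_apply_inr_snd, zero_add, Matrix.fromBlocks_apply₂₂, Matrix.transpose_one,
        Matrix.one_mul, Matrix.mul_one, Matrix.mul_zero, Matrix.zero_mul, Matrix.add_apply, add_zero,
        Matrix.transpose_zero]
      rw [hGC]
      simp only [hCG, Matrix.mul_apply, Matrix.transpose_apply, H, G, Matrix.of_apply]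
  have hH : H.det = ∏ a, (f a z.1 ^ Fintype.card (κ a) *
      (Matrix.of fun i j => h a (z.2 a) (b' a i) (b' a j)).det) := by
    rw [det_sigma_block (fun a => f a z.1 • Matrix.of fun i j => h a (z.2 a) (b' a i) (b' a j)) H]
    · exact Finset.prod_congr rfl fun a _ => Matrix.det_smul _ _
    · rintro ⟨a, i⟩ ⟨b, j⟩ hij
      change ∑ a', f a' z.1 * h a' (z.2 a') (Pi.basis b' ⟨a, i⟩ a') (Pi.basis b' ⟨b, j⟩ a') = 0
      refine Finset.sum_eq_zero fun a' _ => ?_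
      by_cases ha : a' = a
      · subst ha
        have h1 : (Pi.single b (b' b j) : ∀ a, F a) a' = 0 := Pi.single_eq_of_ne hij _
        simp [Pi.basis_apply, h1]
      · simp [Pi.basis_apply, Pi.single_eq_of_ne ha]
    · intro a i j
      refine (Finset.sum_eq_single a (fun a' _ ha => ?_)
        (fun h => absurd (Finset.mem_univ a) h)).trans ?_
      · simp [Pi.basis_apply, Pi.single_eq_of_ne ha]
      · simp [Pi.basis_apply]
  rw [hM, Matrix.det_mul, Matrix.det_mul, Matrix.det_transpose, hU, one_mul, mul_one,
    Matrix.det_fromBlocks_zero₂₁, hH]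

section Volume

variable {d : ℕ} {M : Type*} [TopologicalSpace M] [ChartedSpace (𝔼 d) M]
  [IsManifold 𝓘(ℝ, 𝔼 d) ∞ M]

theorem det_coord2_nonneg {g : BilForm d M ℝ} (hg : IsRiem g) {x₀ : M} {u : 𝔼 d}
    (hu : u ∈ (chart d x₀).target) : 0 ≤ (gramF (coord2 g x₀) u).det := by
  obtain ⟨e, he⟩ := hg.exists_frame (c := (chart d x₀).symm) (bijective_frame hu).1
  let C : Matrix (Fin d) (Fin (Module.finrank ℝ (𝔼 d))) ℝ :=
    Matrix.of fun i k => coord2 g x₀ u (stdb i) (e k)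
  have h : gramF (coord2 g x₀) u = C * C.conjTranspose := by
    ext i j
    rw [Matrix.mul_apply]
    exact (he.parseval (hg.coord2_symm x₀ u) (stdb i) (stdb j)).symm
  rw [h]
  exact (Matrix.posSemidef_self_mul_conjTranspose C).det_nonneg

variable [T2Space M] [CompactSpace M] [Nonempty M] [MeasurableSpace M] [BorelSpace M]

/-- The volume of the image of an injective parametrization by a space with a given basis. -/
theorem vol_image_basis (g : BilForm d M ℝ) {E : Type*} [NormedAddCommGroup E] [NormedSpace ℝ E]
    [FiniteDimensional ℝ E] [MeasurableSpace E] [BorelSpace E] {ν : Measure E} {ι : Type*}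
    [Fintype ι] [DecidableEq ι] (b : Module.Basis ι ℝ E) (hb : b.addHaar = ν)
    (hι : Fintype.card ι = d) {c : E → M} {S : Set E} (hc : ∀ u ∈ S, SmAt d c u)
    (hinj : Set.InjOn c S) (hS : MeasurableSet S) :
    vol g (c '' S) = ∫⁻ z in S,
      ENNReal.ofReal (Real.sqrt (Matrix.of fun i j => pb2 c g z (b i) (b j)).det) ∂ν := by
  let e : ι ≃ Fin d := Fintype.equivFinOfCardEq hι
  let B := (EuclideanSpace.basisFun (Fin d) ℝ).toBasis
  let L : 𝔼 d ≃L[ℝ] E := (B.equiv (b.reindex e) (Equiv.refl _)).toContinuousLinearEquiv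
  have hL : ∀ i, L (stdb i) = b (e.symm i) := by
    intro i
    have h1 : stdb i = B i := by simp [B]
    have h2 : L (B i) = B.equiv (b.reindex e) (Equiv.refl _) (B i) := rfl
    rw [h1, h2, Module.Basis.equiv_apply, Equiv.refl_apply, Module.Basis.reindex_apply]
  have hmap : Measure.map L volume = ν := by
    rw [← OrthonormalBasis.addHaar_eq_volume (EuclideanSpace.basisFun (Fin d) ℝ),
      Module.Basis.map_addHaar, ← hb, ← b.addHaar_reindex e]
    congr 1
    exact Module.Basis.eq_of_apply_eq fun i => B.equiv_apply i (b.reindex e) (Equiv.refl _)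
  have hmp : MeasurePreserving L volume ν := ⟨L.continuous.measurable, hmap⟩
  have hLm : MeasurableEmbedding L := L.toHomeomorph.measurableEmbedding
  have himg : c '' S = (c ∘ L) '' (L ⁻¹' S) := by
    rw [Set.image_comp, Set.image_preimage_eq _ L.surjective]
  have hc' : ∀ u ∈ L ⁻¹' S, SmAt d (c ∘ L) u := fun u hu =>
    (hc (L u) hu).comp_left (φ := L) (Filter.Eventually.of_forall fun _ => L.contDiff.contDiffAt)
  rw [himg, vol_image g hc' (fun u hu u' hu' h => L.injective (hinj hu hu' h))
    (L.continuous.measurable hS), ← hmp.setLIntegral_comp_preimage_emb hLm]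
  refine setLIntegral_congr_fun (L.continuous.measurable hS) fun u hu => ?_
  have h1 : ∀ a, md (d := d) (c ∘ L) u a = md (d := d) c (L u) (L a) := by
    intro a
    have := (hc (L u) hu).md_comp_left (φ := L) (w := u) L.differentiableAt a
    rwa [L.fderiv] at this
  have h2 : gramF (pb2 (c ∘ L) g) u =
      (Matrix.of fun i j => pb2 c g (L u) (b i) (b j)).submatrix e.symm e.symm := by
    ext i j
    change (g (c (L u)) : 𝔼 d →L[ℝ] 𝔼 d →L[ℝ] ℝ) (md (d := d) (c ∘ L) u (stdb i))
      (md (d := d) (c ∘ L) u (stdb j)) = _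
    rw [h1, h1, hL, hL]
    rfl
  rw [dens, h2, Matrix.det_submatrix_equiv_self]

end Volume

section Product

variable {e k : ℕ} {n : Fin k → ℕ}
  {X : Type*} [TopologicalSpace X] [ChartedSpace (𝔼 e) X] [IsManifold 𝓘(ℝ, 𝔼 e) ∞ X]
  [T2Space X] [CompactSpace X] [Nonempty X] [MeasurableSpace X] [BorelSpace X]
  {B : Fin k → Type*} [∀ a, TopologicalSpace (B a)] [∀ a, ChartedSpace (𝔼 (n a)) (B a)]
  [∀ a, IsManifold 𝓘(ℝ, 𝔼 (n a)) ∞ (B a)] [∀ a, T2Space (B a)] [∀ a, CompactSpace (B a)]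
  [∀ a, Nonempty (B a)] [∀ a, MeasurableSpace (B a)] [∀ a, BorelSpace (B a)]

/-- The product of the inverses of charts. -/
def prodChart (x₀ : X) (b₀ : ∀ a, B a) (z : 𝔼 e × ∀ a, 𝔼 (n a)) : X × ∀ a, B a :=
  (vchart x₀ z.1, fun a => vchart (b₀ a) (z.2 a))

theorem measurable_prodChart (x₀ : X) (b₀ : ∀ a, B a) :
    Measurable (prodChart (e := e) (n := n) x₀ b₀) :=
  ((measurable_vchart x₀).comp measurable_fst).prodMk
    (measurable_pi_lambda _ fun a =>
      (measurable_vchart (b₀ a)).comp ((measurable_pi_apply a).comp measurable_snd))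

/-- The density of a product of volumes in a product of charts. -/
def prodDens (g : BilForm e X ℝ) (h : ∀ a, BilForm (n a) (B a) ℝ) (x₀ : X) (b₀ : ∀ a, B a)
    (z : 𝔼 e × ∀ a, 𝔼 (n a)) : ENNReal :=
  vdens g x₀ z.1 * ∏ a, vdens (h a) (b₀ a) (z.2 a)

variable {g : BilForm e X ℝ} {h : ∀ a, BilForm (n a) (B a) ℝ}

theorem measurable_prodDens (hg : Smooth2 g) (hh : ∀ a, Smooth2 (h a)) (x₀ : X) (b₀ : ∀ a, B a) :
    Measurable (prodDens g h x₀ b₀) :=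
  ((measurable_vdens hg x₀).comp measurable_fst).mul
    (Finset.measurable_prod _ fun a _ =>
      (measurable_vdens (hh a) (b₀ a)).comp ((measurable_pi_apply a).comp measurable_snd))

/-- In a product of charts the product of the Riemannian measures has density `prodDens`. -/
theorem restrict_prod_vol (hg : Smooth2 g) (hh : ∀ a, Smooth2 (h a)) (x₀ : X) (b₀ : ∀ a, B a) :
    ((vol g).prod (Measure.pi fun a => vol (h a))).restrict
      ((chart e x₀).source ×ˢ Set.univ.pi fun a => (chart (n a) (b₀ a)).source) =
    Measure.map (prodChart x₀ b₀) (volume.withDensity (prodDens g h x₀ b₀)) := by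
  have := isFiniteMeasure_vol hg
  have := fun a => isFiniteMeasure_vol (hh a)
  have hs : ∀ a, SigmaFinite ((volume : Measure (𝔼 (n a))).withDensity (vdens (h a) (b₀ a))) :=
    fun a => SigmaFinite.of_map _ (measurable_vchart (b₀ a)).aemeasurable (by
      rw [← vol_restrict_source]; infer_instance)
  have hs' : SigmaFinite ((volume : Measure (𝔼 e)).withDensity (vdens g x₀)) :=
    SigmaFinite.of_map _ (measurable_vchart x₀).aemeasurable (by
      rw [← vol_restrict_source]; infer_instance)
  have hs2 : ∀ a, SigmaFinite (Measure.map (vchart (b₀ a))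
      ((volume : Measure (𝔼 (n a))).withDensity (vdens (h a) (b₀ a)))) := fun a => by
    rw [← vol_restrict_source]; infer_instance
  rw [← Measure.prod_restrict, Measure.restrict_pi_pi]
  simp only [vol_restrict_source]
  rw [← Measure.pi_map_pi fun a => (measurable_vchart (b₀ a)).aemeasurable,
    Measure.map_prod_map _ _ (measurable_vchart x₀) (g := fun (y : ∀ a, 𝔼 (n a)) a => vchart (b₀ a) (y a))
      (measurable_pi_lambda _ fun a => (measurable_vchart (b₀ a)).comp (measurable_pi_apply a)),
    pi_withDensity _ fun a => measurable_vdens (hh a) (b₀ a),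
    prod_withDensity (measurable_vdens hg x₀)
      (g := fun y : ∀ a, 𝔼 (n a) => ∏ a, vdens (h a) (b₀ a) (y a)) (Finset.measurable_prod _ fun a _ =>
      (measurable_vdens (hh a) (b₀ a)).comp (measurable_pi_apply a))]
  rfl

/-- A product integral in a product of charts. -/
theorem setLIntegral_prod_vol (hg : Smooth2 g) (hh : ∀ a, Smooth2 (h a)) (x₀ : X) (b₀ : ∀ a, B a)
    {Q : Set (X × ∀ a, B a)} (hQ : MeasurableSet Q)
    (hQs : Q ⊆ (chart e x₀).source ×ˢ Set.univ.pi fun a => (chart (n a) (b₀ a)).source)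
    {f : X × (∀ a, B a) → ENNReal} (hf : Measurable f) :
    ∫⁻ z in Q, f z ∂((vol g).prod (Measure.pi fun a => vol (h a))) =
      ∫⁻ z in ((chart e x₀).target ×ˢ Set.univ.pi fun a => (chart (n a) (b₀ a)).target) ∩
        prodChart x₀ b₀ ⁻¹' Q, prodDens g h x₀ b₀ z * f (prodChart x₀ b₀ z) := by
  have hm := measurable_prodChart (e := e) (n := n) x₀ b₀
  have ht : MeasurableSet ((chart e x₀).target ×ˢ Set.univ.pi fun a => (chart (n a) (b₀ a)).target) :=
    (isOpen_extChartAt_target x₀).measurableSet.prod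
      (MeasurableSet.univ_pi fun a => (isOpen_extChartAt_target (b₀ a)).measurableSet)
  rw [← Measure.restrict_restrict_of_subset hQs, restrict_prod_vol hg hh,
    setLIntegral_map hQ hf hm, setLIntegral_withDensity_eq_setLIntegral_mul _
      (measurable_prodDens hg hh x₀ b₀) (g := fun z => f (prodChart x₀ b₀ z)) (hf.comp hm) (hm hQ),
    ← lintegral_indicator (hm hQ), ← lintegral_indicator (ht.inter (hm hQ))]
  classical
  refine lintegral_congr fun z => ?_
  rw [← Set.indicator_indicator, Set.indicator_apply (_ ×ˢ _)]
  split_ifs with hz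
  · rfl
  · have h0 : prodDens g h x₀ b₀ z = 0 := by
      by_cases h1 : z.1 ∈ (chart e x₀).target
      · obtain ⟨a, ha⟩ : ∃ a, z.2 a ∉ (chart (n a) (b₀ a)).target := by
          by_contra! h2
          exact hz ⟨h1, fun a _ => h2 a⟩
        rw [prodDens, Finset.prod_eq_zero (Finset.mem_univ a) (vdens_apply_of_notMem _ ha), mul_zero]
      · rw [prodDens, vdens_apply_of_notMem _ h1, zero_mul]
    refine Set.indicator_apply_eq_zero.2 fun _ => ?_
    rw [Pi.mul_apply, h0, zero_mul]

end Product

theorem ContinuousOn.measurable_of_cover {α β : Type*} [TopologicalSpace α] [MeasurableSpace α]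
    [OpensMeasurableSpace α] [TopologicalSpace β] [MeasurableSpace β] [BorelSpace β] {f : α → β}
    {s : ℕ → Set α} (hs : ∀ i, MeasurableSet (s i)) (hcov : ⋃ i, s i = Set.univ)
    (hf : ∀ i, ContinuousOn f (s i)) : Measurable f := by
  intro A hA
  rw [← Set.univ_inter (f ⁻¹' A), ← hcov, Set.iUnion_inter]
  exact MeasurableSet.iUnion fun i => ContinuousOn.measurableSet_inter_preimage (hf i) (hs i) hA

/-- A measure is an image measure if this holds on the pieces of a countable partition. -/
theorem eq_map_of_partition {Z Y ι : Type*} [MeasurableSpace Z] [MeasurableSpace Y] [Countable ι]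
    {ρ : Measure Z} {ν : Measure Y} {T : Z → Y} (hT : MeasurableEmbedding T)
    (hsurj : Function.Surjective T) {D : ι → Set Z} (hD : ∀ i, MeasurableSet (D i))
    (hdisj : Pairwise (Function.onFun Disjoint D)) (hcov : ⋃ i, D i = Set.univ)
    (h : ∀ i (Q : Set Z), MeasurableSet Q → Q ⊆ D i → ν (T '' Q) = ρ Q) : ν = Measure.map T ρ := by
  ext A hA
  rw [Measure.map_apply hT.measurable hA]
  have h1 : T ⁻¹' A = ⋃ i, T ⁻¹' A ∩ D i := by rw [← Set.inter_iUnion, hcov, Set.inter_univ]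
  have hm : ∀ i, MeasurableSet (T ⁻¹' A ∩ D i) := fun i => (hT.measurable hA).inter (hD i)
  have hd : Pairwise (Function.onFun Disjoint fun i => T ⁻¹' A ∩ D i) := fun i j hij =>
    (hdisj hij).mono Set.inter_subset_right Set.inter_subset_right
  have h2 : ν A = ∑' i, ν (T '' (T ⁻¹' A ∩ D i)) := by
    rw [← measure_iUnion (fun i j hij => (Set.disjoint_image_iff hT.injective).2 (hd hij))
      fun i => hT.measurableSet_image.2 (hm i), ← Set.image_iUnion, ← h1,
      Set.image_preimage_eq A hsurj]
  refine h2.trans (Eq.trans ?_ (congrArg ρ h1).symm)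
  rw [measure_iUnion hd hm]
  exact tsum_congr fun i => h i _ (hm i) Set.inter_subset_right

/-! ### The weighted Mabuchi energy along rays -/

section Potentials

variable {d r : ℕ} {M : Type*} [TopologicalSpace M] [ChartedSpace (𝔼 d) M]
  [IsManifold 𝓘(ℝ, 𝔼 d) ∞ M] {J : EndField d M} {Ω : BilForm d M ℝ} {τ : LieT r → M → M}
  {μ : M → LieT r} {φ : M → ℝ}

theorem dc_smul (hφ : ContMDiff 𝓘(ℝ, 𝔼 d) 𝓘(ℝ, ℝ) ∞ φ) (s : ℝ) (x : M) :
    (dc J (s • φ) x : 𝔼 d →L[ℝ] ℝ) = s • (dc J φ x : 𝔼 d →L[ℝ] ℝ) := by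
  refine ContinuousLinearMap.ext fun u => ?_
  have h := const_smul_mfderiv (hφ.mdifferentiable (by simp) x) s
  have h' := DFunLike.congr_fun h (J x u)
  exact (congrArg (fun t : ℝ => -t) h').trans (mul_neg s (mfderiv 𝓘(ℝ, 𝔼 d) 𝓘(ℝ, ℝ) φ x (J x u))).symm

theorem ddc_smul (hφ : ContMDiff 𝓘(ℝ, 𝔼 d) 𝓘(ℝ, ℝ) ∞ φ) (hJ : SmoothEnd J) (s : ℝ) (x : M)
    (u v : 𝔼 d) : (ddc J (s • φ) x : 𝔼 d →L[ℝ] 𝔼 d →L[ℝ] ℝ) u v =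
      s * (ddc J φ x : 𝔼 d →L[ℝ] 𝔼 d →L[ℝ] ℝ) u v := by
  have h1 : coord1 (dc J (s • φ)) x = s • coord1 (dc J φ) x := by
    funext z
    exact congrArg (fun L : 𝔼 d →L[ℝ] ℝ => L.comp (frame x z : 𝔼 d →L[ℝ] 𝔼 d)) (dc_smul hφ s _)
  have h2 : DifferentiableAt ℝ (coord1 (dc J φ) x) (chart d x x) :=
    ((smooth1_dc hφ hJ x).contDiffAt
      (target_mem_nhds ((chart d x).map_source (mem_chart_self x)))).differentiableAt (by simp)
  have h3 : ∀ (D D' : 𝔼 d →L[ℝ] 𝔼 d →L[ℝ] ℝ) (L : 𝔼 d →L[ℝ] 𝔼 d), D = s • D' →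
      pull2 (D - D.flip) L u v = s * pull2 (D' - D'.flip) L u v := by
    rintro _ D' L rfl
    exact (mul_sub _ _ _).symm
  exact h3 _ _ _ (by rw [h1, fderiv_const_smul h2])

/-- The space of Kähler potentials is star-shaped around zero. -/
theorem IsHamKahler.smul_mem_potentials (h : IsHamKahler J Ω τ μ) (hφ : φ ∈ potentials J Ω τ)
    {s : ℝ} (hs : s ∈ Set.Icc (0 : ℝ) 1) : s • φ ∈ potentials J Ω τ := by
  refine ⟨⟨(contMDiff_const (I := 𝓘(ℝ, 𝔼 d)) (I' := 𝓘(ℝ, ℝ)) (c := s)).smul hφ.1.1, fun t x => congrArg (s * ·) (hφ.1.2 t x)⟩, fun x u hu => ?_⟩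
  have h1 : WKahler.formOf J Ω (s • φ) x u (J x u) = (1 - s) * Ω x u (J x u) +
      s * WKahler.formOf J Ω φ x u (J x u) := by
    have h2 := ddc_smul hφ.1.1 h.kahler.smooth_J s x u (J x u)
    have h3 : WKahler.formOf J Ω (s • φ) x u (J x u) = Ω x u (J x u) + ddc J (s • φ) x u (J x u) := rfl
    have h4 : WKahler.formOf J Ω φ x u (J x u) = Ω x u (J x u) + ddc J φ x u (J x u) := rfl
    rw [h3, h4]
    refine (congrArg (Ω x u (J x u) + ·) h2).trans ?_
    ring
  rw [h1]
  have h5 := h.kahler.positive x u hu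
  have h6 := hφ.2 x u hu
  rcases hs.1.eq_or_lt with rfl | h0
  · simpa using h5
  · exact add_pos_of_nonneg_of_pos (mul_nonneg (sub_nonneg.2 hs.2) h5.le) (mul_pos h0 h6)

/-- The derivative of the Mabuchi energy along the ray `s φ`, which stays in the space of
potentials. -/
theorem IsMabuchi.hasDerivAt_ray [CompactSpace M] [Nonempty M] [MeasurableSpace M]
    {v w : LieT r → ℝ} {E : (M → ℝ) → ℝ} (hE : IsMabuchi v w J Ω τ μ E)
    (h : IsHamKahler J Ω τ μ) (hφ : φ ∈ potentials J Ω τ) {s : ℝ} (hs : s ∈ Set.Icc (0 : ℝ) 1) :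
    HasDerivAt (fun s : ℝ => E (s • φ)) (mabuchiDiff v w J Ω τ μ (s • φ) φ) s := by
  have h1 := hE.2 _ (h.smul_mem_potentials hφ hs) φ hφ.1
  have h2 : HasDerivAt (fun t : ℝ => t - s) 1 s := (hasDerivAt_id s).sub_const s
  have h3 := HasDerivAt.scomp (h := fun t : ℝ => t - s) s (by simpa using h1) h2
  rw [one_smul] at h3
  refine h3.congr_of_eventuallyEq (Filter.Eventually.of_forall fun t => ?_)
  simp [← add_smul]

end Potentials

/-! ### The connection and the tensor fields of the fibration -/

namespace Fibration

variable {r m k : ℕ} {n : Fin k → ℕ}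
  {X : Type*} [TopologicalSpace X] [ChartedSpace (𝔼 (2 * m)) X]
  {B : Fin k → Type*} [∀ a, TopologicalSpace (B a)] [∀ a, ChartedSpace (𝔼 (2 * n a)) (B a)]
  {P : Type*} [TopologicalSpace P] [ChartedSpace (𝔼 (2 * (∑ a, n a) + r)) P]
  {Y : Type*} [TopologicalSpace Y] [ChartedSpace (𝔼 (2 * (m + ∑ a, n a))) Y]
  (S : Fibration r m n X B P Y)
  {E : Type*} [NormedAddCommGroup E] [NormedSpace ℝ E]

/-- The generator of the action on `X`, as a vector of the model space. -/
def genX (ξ : LieT r) (x : X) : 𝔼 (2 * m) := genV (2 * m) S.actX ξ x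

/-- The generator of the action on `P`, as a vector of the model space. -/
def genP (ξ : LieT r) (q : P) : 𝔼 (2 * (∑ a, n a) + r) := genV _ S.actP ξ q

/-- The differential of `projB` at a point of `P`. -/
abbrev dB (q : P) : 𝔼 (2 * (∑ a, n a) + r) →L[ℝ] (∀ a, 𝔼 (2 * n a)) :=
  dprod (r := r) (n := n) S.projB q

theorem md_projY {cX : E → X} {cP : E → P} {u : E} (hX : SmAt (2 * m) cX u)
    (hP : SmAt (2 * (∑ a, n a) + r) cP u) (a : E) :
    md (d := 2 * (m + ∑ a, n a)) (fun z => S.projY (cX z, cP z)) u a =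
      S.dY (cX u, cP u) (md cX u a, md cP u a) := by
  have h1 : MDifferentiableAt (𝓘(ℝ, 𝔼 (2 * m)).prod 𝓘(ℝ, 𝔼 (2 * (∑ a, n a) + r)))
      𝓘(ℝ, 𝔼 (2 * (m + ∑ a, n a))) S.projY (cX u, cP u) :=
    S.projY_smooth.mdifferentiableAt (by simp)
  have h2 := mfderiv_comp u h1 (hX.mdiff.prodMk hP.mdiff)
  have h3 := mfderiv_prodMk hX.mdiff hP.mdiff
  rw [md]
  refine (DFunLike.congr_fun h2 a).trans ?_
  exact congrArg (fun T => S.dY (cX u, cP u) (T a)) h3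

theorem smAt_projY {cX : E → X} {cP : E → P} {u : E} (hX : SmAt (2 * m) cX u)
    (hP : SmAt (2 * (∑ a, n a) + r) cP u) :
    SmAt (2 * (m + ∑ a, n a)) (fun z => S.projY (cX z, cP z)) u := by
  filter_upwards [hX, hP] with z h1 h2
  exact S.projY_smooth.contMDiffAt.comp z (h1.prodMk h2)

theorem projY_act (t : LieT r) (x : X) (q : P) :
    S.projY (S.actX (-t) x, S.actP t q) = S.projY (x, q) :=
  ((S.projY_fibre _ _ _ _).2 ⟨t, rfl, rfl⟩).symm

theorem projB_act (t : LieT r) (q : P) : S.projB (S.actP t q) = S.projB q :=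
  ((S.projB_fibre _ _).2 ⟨t, rfl⟩).symm

theorem con_genP (ξ : LieT r) (q : P) : S.con q (S.genP ξ q) = ξ := S.θ_vert ξ q

theorem con_dmap (t : LieT r) (q : P) (h : 𝔼 (2 * (∑ a, n a) + r)) :
    S.con (S.actP t q) (dmap (S.actP t) q h) = S.con q h := S.θ_inv t q h

variable [IsManifold 𝓘(ℝ, 𝔼 (2 * m)) ∞ X]
  [∀ a, IsManifold 𝓘(ℝ, 𝔼 (2 * n a)) ∞ (B a)]
  [IsManifold 𝓘(ℝ, 𝔼 (2 * (∑ a, n a) + r)) ∞ P]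
  [IsManifold 𝓘(ℝ, 𝔼 (2 * (m + ∑ a, n a))) ∞ Y]

/-- The fields `-ξ^X + ξ^P` are tangent to the fibres of `X × P → Y`. -/
theorem dY_vert (ξ : LieT r) (z : X × P) : S.dY z (-S.genX ξ z.1, S.genP ξ z.2) = 0 := by
  obtain ⟨x, q⟩ := z
  have hX : SmAt (2 * m) (fun t : LieT r => S.actX (-t) x) 0 :=
    S.torus_X.smAt_act (Filter.Eventually.of_forall fun _ => contDiffAt_id.neg)
      (Filter.Eventually.of_forall fun _ => contMDiffAt_const)
  have hP := S.torus_P.smAt_orbit q 0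
  have h := S.md_projY hX hP ξ
  have h1 : (fun t => S.projY (S.actX (-t) x, S.actP t q)) = fun _ => S.projY (x, q) := by
    ext t; exact S.projY_act t x q
  have h2 : md (d := 2 * m) (fun t : LieT r => S.actX (-t) x) 0 ξ = -S.genX ξ x := by
    have h3 := SmAt.md_comp_left_const (φ := fun t : LieT r => -t) (w := 0) (u := (0 : LieT r))
      (S.torus_X.smAt_orbit x 0) neg_zero (by fun_prop) ξ
    rw [fderiv_fun_neg, fderiv_fun_id] at h3
    refine h3.trans ?_
    rw [neg_apply, map_neg, genX, S.torus_X.gen_eq]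
    rfl
  rw [h1, h2, ← S.torus_P.gen_eq] at h
  have h3 : md (d := 2 * (m + ∑ a, n a)) (fun _ : LieT r => S.projY (x, q)) 0 ξ = 0 := by
    rw [md, mfderiv_const]; rfl
  rw [h3] at h
  have e : ∀ z : X × P, z = (x, q) → S.dY z (-S.genX ξ x, genV _ S.actP ξ q) = 0 →
      S.dY (x, q) (-S.genX ξ x, S.genP ξ q) = 0 := by
    rintro _ rfl h; exact h
  refine e _ ?_ h.symm
  rw [neg_zero, S.torus_X.zero_act, S.torus_P.zero_act]

theorem dprod_md {cP : E → P} {u : E} (hP : SmAt (2 * (∑ a, n a) + r) cP u) (a : Fin k) (b : E) :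
    S.dB (cP u) (md cP u b) a = md (d := 2 * n a) (fun z => S.projB (cP z) a) u b :=
  (hP.md_comp (f := fun q => S.projB q a) ((S.projB_smooth a).mdifferentiableAt (by simp)) b).symm

theorem dprod_genP (ξ : LieT r) (q : P) : S.dB q (S.genP ξ q) = 0 := by
  ext1 a
  have h := S.dprod_md (S.torus_P.smAt_orbit q 0) a ξ
  have h1 : (fun t => S.projB (S.actP t q) a) = fun _ => S.projB q a := by
    ext t; rw [S.projB_act]
  rw [h1, ← S.torus_P.gen_eq, S.torus_P.zero_act] at h
  refine h.trans ?_
  rw [md, mfderiv_const]; rfl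

theorem dprod_dmap (t : LieT r) (q : P) (h : 𝔼 (2 * (∑ a, n a) + r)) :
    S.dB (S.actP t q) (dmap (S.actP t) q h) = S.dB q h := by
  ext1 a
  have h1 := dmap_comp (f := fun q => S.projB q a) (g := S.actP t) (x := q)
    ((S.projB_smooth a).mdifferentiableAt (by simp)) (S.torus_P.mdiff t q) h
  have h2 : (fun q => S.projB q a) ∘ S.actP t = fun q => S.projB q a := by
    ext q; simp only [Function.comp_apply, S.projB_act]
  rw [h2] at h1
  exact h1.symm

/-- `T P` is the sum of the horizontal space, isomorphic to `T B`, and the vertical one. -/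
theorem bijective_dprod_con (q : P) :
    Function.Bijective ((S.dB q).prod (S.con q)) := by
  refine bijective_prod (S.projB_subm q) (s := fun ξ => S.genP ξ q) (fun ξ => S.dprod_genP ξ q)
    (fun ξ => S.con_genP ξ q) ?_
  rw [Module.finrank_pi_fintype]
  simp [Finset.mul_sum]

/-- The horizontal vectors of `X × P` are mapped isomorphically to the tangent spaces of `Y`. -/
theorem bijective_dY_con (z : X × P) :
    Function.Bijective ((S.dY z).prod ((S.con z.2).comp (ContinuousLinearMap.snd ℝ
      (𝔼 (2 * m)) (𝔼 (2 * (∑ a, n a) + r))))) := by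
  refine bijective_prod (S.projY_subm z) (s := fun ξ => (-S.genX ξ z.1, S.genP ξ z.2))
    (fun ξ => S.dY_vert ξ z) (fun ξ => S.con_genP ξ z.2) ?_
  rw [Module.finrank_prod]
  simp
  ring

theorem ext_P {q : P} {h h' : 𝔼 (2 * (∑ a, n a) + r)} (h1 : S.dB q h = S.dB q h')
    (h2 : S.con q h = S.con q h') : h = h' :=
  (S.bijective_dprod_con q).1 (Prod.ext h1 h2)

theorem ext_Z {z : X × P} {h h' : 𝔼 (2 * m) × 𝔼 (2 * (∑ a, n a) + r)} (h1 : S.dY z h = S.dY z h')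
    (h2 : S.con z.2 h.2 = S.con z.2 h'.2) : h = h' :=
  (S.bijective_dY_con z).1 (Prod.ext h1 h2)

theorem dY_hlift (z : X × P) (w : 𝔼 (2 * (m + ∑ a, n a))) : S.dY z (S.hlift z w) = w :=
  congrArg Prod.fst (apply_inverse_self (S.bijective_dY_con z) (w, 0))

theorem con_hlift (z : X × P) (w : 𝔼 (2 * (m + ∑ a, n a))) : S.con z.2 (S.hlift z w).2 = 0 :=
  congrArg Prod.snd (apply_inverse_self (S.bijective_dY_con z) (w, 0))

/-- `J_B` on `∏_a T_{b_a} B_a`. -/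
def JBv (b : ∀ a, B a) : (∀ a, 𝔼 (2 * n a)) →L[ℝ] (∀ a, 𝔼 (2 * n a)) :=
  ContinuousLinearMap.pi fun a =>
    (S.JB a (b a) : 𝔼 (2 * n a) →L[ℝ] 𝔼 (2 * n a)).comp (ContinuousLinearMap.proj a)

theorem dprod_JD (q : P) (h : 𝔼 (2 * (∑ a, n a) + r)) :
    S.dB q (S.JD q h) = S.JBv (S.projB q) (S.dB q h) :=
  congrArg Prod.fst (apply_inverse_self (S.bijective_dprod_con q)
    (S.JBv (S.projB q) (S.dB q h), 0))

theorem con_JD (q : P) (h : 𝔼 (2 * (∑ a, n a) + r)) : S.con q (S.JD q h) = 0 :=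
  congrArg Prod.snd (apply_inverse_self (S.bijective_dprod_con q)
    (S.JBv (S.projB q) (S.dB q h), 0))

theorem JD_dmap (t : LieT r) (q : P) (h : 𝔼 (2 * (∑ a, n a) + r)) :
    S.JD (S.actP t q) (dmap (S.actP t) q h) = dmap (S.actP t) q (S.JD q h) := by
  refine S.ext_P (q := S.actP t q) ?_ ?_
  · rw [S.dprod_JD, S.dprod_dmap, S.dprod_dmap, S.dprod_JD, S.projB_act]
  · rw [S.con_JD, S.con_dmap, S.con_JD]

/-- The differential at `z` of the action `(x, q) ↦ (-t · x, t · q)` on `X × P`. -/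
def dR (t : LieT r) (z : X × P) (h : 𝔼 (2 * m) × 𝔼 (2 * (∑ a, n a) + r)) :
    𝔼 (2 * m) × 𝔼 (2 * (∑ a, n a) + r) :=
  (dmap (S.actX (-t)) z.1 h.1, dmap (S.actP t) z.2 h.2)

/-- The action of `𝕋` on `X × P` generated by `-ξ^X + ξ^P`. -/
def actZ (t : LieT r) (z : X × P) : X × P := (S.actX (-t) z.1, S.actP t z.2)

/-- Every tangent vector of `X × P` is the velocity of a parametrization. -/
theorem exists_velocity (z : X × P) (h : 𝔼 (2 * m) × 𝔼 (2 * (∑ a, n a) + r)) :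
    ∃ (cX : 𝔼 (2 * m) × 𝔼 (2 * (∑ a, n a) + r) → X) (cP : 𝔼 (2 * m) × 𝔼 (2 * (∑ a, n a) + r) → P)
      (u w : 𝔼 (2 * m) × 𝔼 (2 * (∑ a, n a) + r)), SmAt (2 * m) cX u ∧
      SmAt (2 * (∑ a, n a) + r) cP u ∧ z = (cX u, cP u) ∧ h = (md cX u w, md cP u w) := by
  obtain ⟨x, q⟩ := z
  obtain ⟨h1, h2⟩ := h
  obtain ⟨cX, uX, rfl, hcX, hbX⟩ := exists_param (d := 2 * m) x
  obtain ⟨cP, uP, rfl, hcP, hbP⟩ := exists_param (d := 2 * (∑ a, n a) + r) q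
  obtain ⟨a, rfl⟩ := hbX.2 h1
  obtain ⟨b, rfl⟩ := hbP.2 h2
  refine ⟨cX ∘ Prod.fst, cP ∘ Prod.snd, (uX, uP), (a, b),
    hcX.comp_left (F := 𝔼 (2 * m) × 𝔼 (2 * (∑ a, n a) + r)) (w := (uX, uP))
      (Filter.Eventually.of_forall fun z => contDiffAt_fst),
    hcP.comp_left (F := 𝔼 (2 * m) × 𝔼 (2 * (∑ a, n a) + r)) (w := (uX, uP))
      (Filter.Eventually.of_forall fun z => contDiffAt_snd), rfl, Prod.ext ?_ ?_⟩
  · change md cX uX a = md (d := 2 * m) (cX ∘ Prod.fst) (uX, uP) (a, b)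
    rw [hcX.md_comp_left (φ := Prod.fst) (w := (uX, uP)) differentiableAt_fst, fderiv_fst]; rfl
  · change md cP uP b = md (d := 2 * (∑ a, n a) + r) (cP ∘ Prod.snd) (uX, uP) (a, b)
    rw [hcP.md_comp_left (φ := Prod.snd) (w := (uX, uP)) differentiableAt_snd, fderiv_snd]; rfl

theorem dY_dR (t : LieT r) (z : X × P) (h : 𝔼 (2 * m) × 𝔼 (2 * (∑ a, n a) + r)) :
    S.dY (S.actZ t z) (S.dR t z h) = S.dY z h := by
  obtain ⟨cX, cP, u, w, hX, hP, rfl, rfl⟩ := exists_velocity z h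
  have h4 := S.md_projY (hX.comp (S.torus_X.contMDiff (-t))) (hP.comp (S.torus_P.contMDiff t)) w
  rw [hX.md_comp (S.torus_X.mdiff _ _), hP.md_comp (S.torus_P.mdiff _ _)] at h4
  have h5 : (fun z => S.projY ((S.actX (-t) ∘ cX) z, (S.actP t ∘ cP) z)) =
      fun z => S.projY (cX z, cP z) := by
    ext z; exact S.projY_act t _ _
  rw [h5] at h4
  exact h4.symm.trans (S.md_projY hX hP w)

theorem lift_projY (z : X × P) : ∃ t, S.lift (S.projY z) = S.actZ t z := by
  have h : S.projY (S.lift (S.projY z)) = S.projY z := Function.surjInv_eq _ _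
  obtain ⟨t, h1, h2⟩ := (S.projY_fibre z.1 z.2 (S.lift (S.projY z)).1 (S.lift (S.projY z)).2).1 h.symm
  exact ⟨t, Prod.ext h1 h2⟩

theorem projY_lift (y : Y) : S.projY (S.lift y) = y := Function.surjInv_eq _ _

/-- Horizontal lifts at different points of a fibre correspond under the action. -/
theorem hlift_dR (t : LieT r) (z : X × P) {h : 𝔼 (2 * m) × 𝔼 (2 * (∑ a, n a) + r)}
    (hh : S.con z.2 h.2 = 0) : S.hlift (S.actZ t z) (S.dY z h) = S.dR t z h := by
  refine S.ext_Z (z := S.actZ t z) ?_ ?_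
  · rw [S.dY_hlift, S.dY_dR]
  · rw [S.con_hlift]
    exact ((S.con_dmap t z.2 h.2).trans hh).symm

theorem JZ_dR (t : LieT r) (z : X × P) (h : 𝔼 (2 * m) × 𝔼 (2 * (∑ a, n a) + r)) :
    S.JZ (S.actZ t z) (S.dR t z h) = S.dR t z (S.JZ z h) :=
  Prod.ext (S.act_JX (-t) z.1 h.1).symm (S.JD_dmap t z.2 h.2)

/-- `J_Y` is induced by the CR structure of `X × P`. -/
theorem JY_dY (z : X × P) (h : 𝔼 (2 * m) × 𝔼 (2 * (∑ a, n a) + r)) (hh : S.con z.2 h.2 = 0) :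
    (S.JY (S.projY z) : 𝔼 (2 * (m + ∑ a, n a)) →L[ℝ] 𝔼 (2 * (m + ∑ a, n a))) (S.dY z h) =
      S.dY z (S.JZ z h) := by
  obtain ⟨t, ht⟩ := S.lift_projY z
  have h1 : (S.JY (S.projY z) : 𝔼 (2 * (m + ∑ a, n a)) →L[ℝ] 𝔼 (2 * (m + ∑ a, n a))) (S.dY z h) =
      S.dY (S.lift (S.projY z)) (S.JZ (S.lift (S.projY z)) (S.hlift (S.lift (S.projY z)) (S.dY z h))) :=
    rfl
  rw [h1, ht, S.hlift_dR t z hh, S.JZ_dR, S.dY_dR]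

theorem actY_projY (t : LieT r) (x : X) (q : P) :
    S.actY t (S.projY (x, q)) = S.projY (S.actX t x, q) := by
  obtain ⟨s, hs⟩ := S.lift_projY (x, q)
  rw [actY, hs, ← S.projY_act s (S.actX t x) q]
  simp only [actZ, ← S.torus_X.add_act, add_comm]

theorem down_projY {V : Type*} {f : X → V} (hf : ∀ t x, f (S.actX t x) = f x) (x : X) (q : P) :
    S.down f (S.projY (x, q)) = f x := by
  obtain ⟨s, hs⟩ := S.lift_projY (x, q)
  rw [down, hs]
  exact hf _ _

/-- The horizontal part of a tangent vector of `X × P`. -/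
def hor (z : X × P) (h : 𝔼 (2 * m) × 𝔼 (2 * (∑ a, n a) + r)) :
    𝔼 (2 * m) × 𝔼 (2 * (∑ a, n a) + r) :=
  h - (-S.genX (S.con z.2 h.2) z.1, S.genP (S.con z.2 h.2) z.2)

theorem con_hor (z : X × P) (h : 𝔼 (2 * m) × 𝔼 (2 * (∑ a, n a) + r)) :
    S.con z.2 (S.hor z h).2 = 0 := by
  rw [hor, Prod.snd_sub, map_sub, S.con_genP, sub_self]

theorem dY_hor (z : X × P) (h : 𝔼 (2 * m) × 𝔼 (2 * (∑ a, n a) + r)) :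
    S.dY z (S.hor z h) = S.dY z h := by
  rw [hor, map_sub, S.dY_vert, sub_zero]

section Form

variable {c : Fin k → ℝ} {Ω : BilForm (2 * m) X ℝ} {μ : X → LieT r}

theorem formZ_apply (z : X × P) (h h' : 𝔼 (2 * m) × 𝔼 (2 * (∑ a, n a) + r)) :
    S.formZ c Ω μ z h h' = (Ω z.1 : 𝔼 (2 * m) →L[ℝ] 𝔼 (2 * m) →L[ℝ] ℝ) h.1 h'.1 +
      ∑ a, S.aff c a (μ z.1) *
        (S.ΩB a (S.projB z.2 a) : 𝔼 (2 * n a) →L[ℝ] 𝔼 (2 * n a) →L[ℝ] ℝ)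
          (S.dB z.2 h.2 a) (S.dB z.2 h'.2 a) +
      ∑ i, (dfun (fun x => μ x i) z.1 h.1 * S.con z.2 h'.2 i -
        S.con z.2 h.2 i * dfun (fun x => μ x i) z.1 h'.1) := by
  simp only [formZ, add_apply, sum_apply, sub_apply, smul_apply, ContinuousLinearMap.smulRight_apply,
    smul_eq_mul]
  rfl

theorem formZ_self (hΩ : ∀ x u, Ω x u u = 0) (z : X × P)
    (h : 𝔼 (2 * m) × 𝔼 (2 * (∑ a, n a) + r)) : S.formZ c Ω μ z h h = 0 := by
  rw [formZ_apply]
  have h1 : (Ω z.1 : 𝔼 (2 * m) →L[ℝ] 𝔼 (2 * m) →L[ℝ] ℝ) h.1 h.1 = 0 := hΩ z.1 h.1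
  have h2 : ∀ a, (S.ΩB a (S.projB z.2 a) : 𝔼 (2 * n a) →L[ℝ] 𝔼 (2 * n a) →L[ℝ] ℝ)
      (S.dB z.2 h.2 a) (S.dB z.2 h.2 a) = 0 := fun a =>
    (S.kahler_B a).alternating _ _
  simp [h1, h2, mul_comm]

variable (hΩ : IsHamKahler S.JX Ω S.actX μ)
include hΩ

/-- The form on `X × P` is annihilated by the fields `-ξ^X + ξ^P`: the momentum map equation cancels
the term `⟨dμ ∧ θ⟩`. -/
theorem formZ_vert (ξ : LieT r) (z : X × P) (h : 𝔼 (2 * m) × 𝔼 (2 * (∑ a, n a) + r)) :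
    S.formZ c Ω μ z (-S.genX ξ z.1, S.genP ξ z.2) h = 0 := by
  rw [formZ_apply]
  have h1 : (Ω z.1 : 𝔼 (2 * m) →L[ℝ] 𝔼 (2 * m) →L[ℝ] ℝ) (S.genX ξ z.1) h.1 =
      -dfun (fun y => pair ξ (μ y)) z.1 h.1 := hΩ.mom ξ z.1 h.1
  have h2 := hΩ.dfun_pair ξ z.1 h.1
  have h3 : ∀ i, dfun (fun x => μ x i) z.1 (-S.genX ξ z.1) = 0 := by
    intro i
    rw [map_neg, genX, S.torus_X.dfun_gen (hΩ.contMDiff_mu i) (fun t x => by rw [hΩ.mom_inv]),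
      neg_zero]
  have h4 : (Ω z.1 : 𝔼 (2 * m) →L[ℝ] 𝔼 (2 * m) →L[ℝ] ℝ) (-S.genX ξ z.1) h.1 =
      dfun (fun y => pair ξ (μ y)) z.1 h.1 := by
    have h5 : (Ω z.1 : 𝔼 (2 * m) →L[ℝ] 𝔼 (2 * m) →L[ℝ] ℝ) (-S.genX ξ z.1) h.1 =
      -(Ω z.1 : 𝔼 (2 * m) →L[ℝ] 𝔼 (2 * m) →L[ℝ] ℝ) (S.genX ξ z.1) h.1 := by
      have := map_neg (Ω z.1 : 𝔼 (2 * m) →L[ℝ] 𝔼 (2 * m) →L[ℝ] ℝ) (S.genX ξ z.1)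
      exact DFunLike.congr_fun this h.1
    rw [h5, h1, neg_neg]
  have h5 : ∀ a (v : 𝔼 (2 * n a)), (S.ΩB a (S.projB z.2 a) :
      𝔼 (2 * n a) →L[ℝ] 𝔼 (2 * n a) →L[ℝ] ℝ) 0 v = 0 := fun a v =>
    DFunLike.congr_fun (map_zero (S.ΩB a (S.projB z.2 a) :
      𝔼 (2 * n a) →L[ℝ] 𝔼 (2 * n a) →L[ℝ] ℝ)) v
  simp only [h4, h2, h3, S.dprod_genP, S.con_genP]
  simp only [Pi.zero_apply, zero_mul, zero_sub, Finset.sum_neg_distrib]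
  rw [add_right_comm, add_neg_cancel, zero_add]
  exact Finset.sum_eq_zero fun a _ => mul_eq_zero_of_right _ (h5 a _)

/-- The form on `X × P` is invariant; with `formZ_vert` this makes it basic. -/
theorem formZ_dR (t : LieT r) (z : X × P) (h h' : 𝔼 (2 * m) × 𝔼 (2 * (∑ a, n a) + r)) :
    S.formZ c Ω μ (S.actZ t z) (S.dR t z h) (S.dR t z h') = S.formZ c Ω μ z h h' := by
  have h1 : (Ω (S.actX (-t) z.1) : 𝔼 (2 * m) →L[ℝ] 𝔼 (2 * m) →L[ℝ] ℝ)
      (dmap (S.actX (-t)) z.1 h.1) (dmap (S.actX (-t)) z.1 h'.1) = Ω z.1 h.1 h'.1 :=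
    hΩ.act_form (-t) z.1 h.1 h'.1
  have h2 : ∀ i u, dfun (fun x => μ x i) (S.actX (-t) z.1) (dmap (S.actX (-t)) z.1 u) =
      dfun (fun x => μ x i) z.1 u := fun i u =>
    S.torus_X.dfun_dmap (hΩ.contMDiff_mu i) (fun t x => by rw [hΩ.mom_inv]) _ _ _
  have h3 : ∀ (b b' : ∀ a, B a), b = b' → ∀ a (v w : 𝔼 (2 * n a)),
      (S.ΩB a (b a) : 𝔼 (2 * n a) →L[ℝ] 𝔼 (2 * n a) →L[ℝ] ℝ) v w = S.ΩB a (b' a) v w := by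
    rintro b _ rfl a v w; rfl
  simp only [formZ_apply, actZ, dR, S.dprod_dmap, S.con_dmap, hΩ.mom_inv, h1, h2,
    h3 _ _ (S.projB_act t z.2)]

/-- `formZ` is basic: it is the pull-back of `formY`. -/
theorem formY_dY (z : X × P) (h h' : 𝔼 (2 * m) × 𝔼 (2 * (∑ a, n a) + r)) :
    (S.formY c Ω μ (S.projY z) : 𝔼 (2 * (m + ∑ a, n a)) →L[ℝ] 𝔼 (2 * (m + ∑ a, n a)) →L[ℝ] ℝ)
      (S.dY z h) (S.dY z h') = S.formZ c Ω μ z h h' := by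
  obtain ⟨t, ht⟩ := S.lift_projY z
  have h1 : (S.formY c Ω μ (S.projY z) :
      𝔼 (2 * (m + ∑ a, n a)) →L[ℝ] 𝔼 (2 * (m + ∑ a, n a)) →L[ℝ] ℝ) (S.dY z h) (S.dY z h') =
      S.formZ c Ω μ (S.lift (S.projY z)) (S.hlift (S.lift (S.projY z)) (S.dY z h))
        (S.hlift (S.lift (S.projY z)) (S.dY z h')) := rfl
  have halt : ∀ h, S.formZ c Ω μ z h h = 0 := S.formZ_self hΩ.kahler.alternating z
  rw [h1, ht, ← S.dY_hor z h, ← S.dY_hor z h', S.hlift_dR t z (S.con_hor z h),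
    S.hlift_dR t z (S.con_hor z h'), S.formZ_dR hΩ]
  conv_lhs => rw [hor, hor]
  simp only [map_sub, sub_apply, S.formZ_vert hΩ]
  rw [antisymm_of_alternating halt h (-S.genX _ z.1, _), S.formZ_vert hΩ]
  simp

end Form

/-! ### Local sections of the principal bundle -/

/-- The coordinates of the base point of `q` in the product of the charts of the factors `B_a`. -/
def base (q : P) : ∀ a, 𝔼 (2 * n a) := fun a => chart (2 * n a) (S.projB q a) (S.projB q a)

/-- `σ` is a section of `projB` near the base point of `q`, through `q`, in the product of the
charts of the factors `B_a`. -/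
structure IsSection (q : P) (σ : (∀ a, 𝔼 (2 * n a)) → P) : Prop where
  smAt : SmAt (2 * (∑ a, n a) + r) σ (S.base q)
  apply_base : σ (S.base q) = q
  proj : ∀ᶠ y in 𝓝 (S.base q), ∀ a, S.projB (σ y) a = (chart (2 * n a) (S.projB q a)).symm (y a)

/-- The pull-back of the connection form by a section. -/
def pot (σ : (∀ a, 𝔼 (2 * n a)) → P) : (∀ a, 𝔼 (2 * n a)) → (∀ a, 𝔼 (2 * n a)) →L[ℝ] LieT r :=
  pb1 σ S.θ

theorem base_mem (q : P) (a : Fin k) : S.base q a ∈ (chart (2 * n a) (S.projB q a)).target :=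
  (chart (2 * n a) (S.projB q a)).map_source (mem_chart_self _)

theorem contDiffAt_pot {σ : (∀ a, 𝔼 (2 * n a)) → P} {y : ∀ a, 𝔼 (2 * n a)}
    (h : SmAt (2 * (∑ a, n a) + r) σ y) : ContDiffAt ℝ ∞ (S.pot σ) y := S.θ_smooth.pb1 h

/-- Local sections of the submersion `P → ∏ B_a`, by inverting it on a complement of the vertical
space. -/
theorem exists_isSection (q : P) : ∃ σ, S.IsSection q σ := by
  obtain ⟨C, z₀, hCz, hC, hCb⟩ := exists_param (d := 2 * (∑ a, n a) + r) q
  have hq : ∀ a, S.projB (C z₀) a ∈ (chart (2 * n a) (S.projB q a)).source := by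
    intro a; rw [hCz]; exact mem_chart_self _
  have hpC : ∀ a, SmAt (2 * n a) ((fun q => S.projB q a) ∘ C) z₀ := fun a =>
    hC.comp (S.projB_smooth a)
  let H : 𝔼 (2 * (∑ a, n a) + r) → ∀ a, 𝔼 (2 * n a) := fun z a => chart (2 * n a) (S.projB q a) (S.projB (C z) a)
  have hHa : ∀ᶠ z in 𝓝 z₀, ∀ a, SmAt (2 * n a) ((fun q => S.projB q a) ∘ C) z ∧
      S.projB (C z) a ∈ (chart (2 * n a) (S.projB q a)).source :=
    Filter.eventually_all.2 fun a => (hpC a).eventually.and ((hpC a).mem_source (hq a))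
  have hH : ∀ᶠ z in 𝓝 z₀, ContDiffAt ℝ ∞ H z := by
    filter_upwards [hHa] with z hz
    exact contDiffAt_pi.2 fun a => (hz a).1.contDiffAt_chart (hz a).2
  have hH0 : H z₀ = S.base q := by
    ext1 a; simp only [H, base, hCz]
  have hHd : DifferentiableAt ℝ H z₀ := hH.self_of_nhds.differentiableAt (by simp)
  have hHs : Function.Surjective (fderiv ℝ H z₀) := by
    intro w
    have hs : ∀ a, ∃ v : 𝔼 (2 * n a), (coframe (S.projB q a) (S.projB (C z₀) a) :
        𝔼 (2 * n a) →L[ℝ] 𝔼 (2 * n a)) v = w a := by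
      intro a
      have := coframe_frame (d := 2 * n a) ((chart (2 * n a) (S.projB q a)).map_source (hq a)) (w a)
      rw [(chart (2 * n a) (S.projB q a)).left_inv (hq a)] at this
      exact ⟨_, this⟩
    choose v hv using hs
    obtain ⟨h, hh⟩ := S.projB_subm (C z₀) v
    obtain ⟨x, rfl⟩ := hCb.2 h
    refine ⟨x, ?_⟩
    ext1 a
    have h1 := (hpC a).coframe_md (hq a) x
    have h2 := S.dprod_md hC a x
    have h3 : fderiv ℝ H z₀ x a = fderiv ℝ (fun z => H z a) z₀ x := by
      rw [fderiv_apply hHd a]; rfl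
    rw [h3, ← hv a, ← congrFun hh a]
    exact h1.symm.trans (congrArg _ h2.symm)
  -- restrict `H` to the affine complement `z₀ + L w` of the kernel, where it is a local diffeomorphism
  obtain ⟨L₀, hL₀⟩ := (fderiv ℝ H z₀).toLinearMap.exists_rightInverse_of_surjective
    (LinearMap.range_eq_top.2 hHs)
  let L : (∀ a, 𝔼 (2 * n a)) →L[ℝ] 𝔼 (2 * (∑ a, n a) + r) := LinearMap.toContinuousLinearMap L₀
  have hL : ∀ w, fderiv ℝ H z₀ (L w) = w := fun w => LinearMap.congr_fun hL₀ w
  let ℓ : (∀ a, 𝔼 (2 * n a)) → 𝔼 (2 * (∑ a, n a) + r) := fun y => z₀ + L (y - S.base q)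
  have hℓ0 : ℓ (S.base q) = z₀ := by simp [ℓ]
  have hℓs : ContDiff ℝ ∞ ℓ := contDiff_const.add (L.contDiff.comp (contDiff_id.sub contDiff_const))
  have hψ : ∀ᶠ y in 𝓝 (S.base q), ContDiffAt ℝ ∞ (H ∘ ℓ) y := by
    have := hℓs.continuous.continuousAt.eventually (hℓ0.symm ▸ hH : ∀ᶠ z in 𝓝 (ℓ (S.base q)), _)
    filter_upwards [this] with y hy using hy.comp y hℓs.contDiffAt
  have hψd : fderiv ℝ (H ∘ ℓ) (S.base q) = ContinuousLinearMap.id ℝ _ := by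
    have h1 : HasFDerivAt ℓ L (S.base q) :=
      ((L.hasFDerivAt.comp (S.base q) ((hasFDerivAt_id _).sub_const _)).const_add z₀)
    have h2 : HasFDerivAt H (fderiv ℝ H z₀) (ℓ (S.base q)) := by
      rw [hℓ0]; exact hHd.hasFDerivAt
    rw [(h2.comp _ h1).fderiv]
    ext1 w
    exact hL w
  obtain ⟨ρ, h1, h2, h3, -⟩ := exists_local_inverse_eventually hψ
    (by rw [hψd]; exact Function.bijective_id)
  have h0 : (H ∘ ℓ) (S.base q) = S.base q := by
    rw [Function.comp_apply, hℓ0, hH0]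
  rw [h0] at h1 h2 h3
  have hsm : SmAt (2 * (∑ a, n a) + r) (C ∘ (ℓ ∘ ρ)) (S.base q) := by
    refine SmAt.comp_left (φ := ℓ ∘ ρ) ?_ ?_
    · rw [Function.comp_apply, h1, hℓ0]; exact hC
    · filter_upwards [h2] with y hy using hℓs.contDiffAt.comp y hy
  refine ⟨C ∘ (ℓ ∘ ρ), hsm, by simp only [Function.comp_apply, h1, hℓ0, hCz], ?_⟩
  have hc : ContinuousAt (ℓ ∘ ρ) (S.base q) :=
    hℓs.continuous.continuousAt.comp h2.self_of_nhds.continuousAt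
  have h4 : (ℓ ∘ ρ) (S.base q) = z₀ := by rw [Function.comp_apply, h1, hℓ0]
  filter_upwards [h3, hc.eventually (h4.symm ▸ hHa)] with y hy hz a
  have h5 := congrFun hy a
  rw [← h5]
  exact ((chart (2 * n a) (S.projB q a)).left_inv (hz a).2).symm

/-- The differential of a section covers the identity. -/
theorem IsSection.dB_md {q : P} {σ : (∀ a, 𝔼 (2 * n a)) → P} (h : S.IsSection q σ) :
    ∀ᶠ y in 𝓝 (S.base q), ∀ b a, S.dB (σ y) (md (d := 2 * (∑ a, n a) + r) σ y b) a =
      md (d := 2 * n a) (chart (2 * n a) (S.projB q a)).symm (y a) (b a) := by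
  have ht : ∀ᶠ y in 𝓝 (S.base q), ∀ a, y a ∈ (chart (2 * n a) (S.projB q a)).target :=
    Filter.eventually_all.2 fun a => (continuous_apply a).continuousAt.eventually
      (target_mem_nhds (S.base_mem q a))
  filter_upwards [h.smAt.eventually, h.proj.eventually_nhds, ht] with y h1 h2 h3 b a
  refine (S.dprod_md h1 a b).trans ?_
  have e : (fun z => S.projB (σ z) a) =ᶠ[𝓝 y] (chart (2 * n a) (S.projB q a)).symm ∘ fun z => z a :=
    h2.mono fun z hz => hz a
  rw [md, e.mfderiv_eq]
  have h4 := SmAt.md_comp_left (φ := fun z : (∀ a, 𝔼 (2 * n a)) => z a) (w := y)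
    (smAt_chart_symm (S.projB q a) (h3 a)) (by fun_prop) b
  have h5 : fderiv ℝ (fun z : (∀ a, 𝔼 (2 * n a)) => z a) y b = b a := by
    have := (ContinuousLinearMap.proj (R := ℝ) (φ := fun a => 𝔼 (2 * n a)) a).hasFDerivAt (x := y)
    exact congrArg (fun T => T b) this.fderiv
  rw [h5] at h4
  exact h4

/-- The curvature of the connection in a section. -/
theorem IsSection.curl_pot {q : P} {σ : (∀ a, 𝔼 (2 * n a)) → P} (h : S.IsSection q σ) (b b' : ∀ a, 𝔼 (2 * n a)) :
    curl (S.pot σ) (S.base q) b b' = ∑ a, coord2 (S.ΩB a) (S.projB q a) (S.base q a) (b a) (b' a) •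
      fun i => (S.p a i : ℝ) := by
  have h1 := DFunLike.congr_fun (DFunLike.congr_fun (pb2_extd S.θ_smooth h.smAt) b) b'
  rw [pot, ← h1, pb2_apply]
  refine (S.θ_curv _ _ _).trans ?_
  refine Finset.sum_congr rfl fun a _ => ?_
  have h2 := h.dB_md.self_of_nhds
  have h3 : ∀ a b, dprod (r := r) (n := n) S.projB (σ (S.base q)) (md σ (S.base q) b) a = _ := fun a b => h2 b a
  have h4 := h.proj.self_of_nhds a
  congr 1
  have h5 : ∀ (x x' : B a) (v w : 𝔼 (2 * n a)), x = x' →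
      (S.ΩB a x : 𝔼 (2 * n a) →L[ℝ] 𝔼 (2 * n a) →L[ℝ] ℝ) v w = S.ΩB a x' v w := by
    rintro x _ v w rfl; rfl
  rw [h5 _ _ _ _ h4, h3, h3]
  rfl

/-- A change of gauge: the section `y ↦ t(y) · σ(y)`. -/
theorem IsSection.act {q : P} {σ : (∀ a, 𝔼 (2 * n a)) → P} (h : S.IsSection q σ)
    {t : (∀ a, 𝔼 (2 * n a)) → LieT r} (ht : ContDiff ℝ ∞ t) (h0 : t (S.base q) = 0) :
    S.IsSection q (fun y => S.actP (t y) (σ y)) ∧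
      S.pot (fun y => S.actP (t y) (σ y)) =ᶠ[𝓝 (S.base q)] fun y => S.pot σ y + fderiv ℝ t y := by
  refine ⟨⟨S.torus_P.smAt_act (Filter.Eventually.of_forall fun y => ht.contDiffAt) h.smAt, ?_, ?_⟩, ?_⟩
  · rw [h0, h.apply_base, S.torus_P.zero_act]
  · filter_upwards [h.proj] with y hy a
    rw [S.projB_act, hy]
  · filter_upwards [h.smAt.eventually] with y hy
    ext1 b
    have h1 := S.torus_P.md_act (ht.differentiable (by simp) y) hy b
    have h2 : S.pot (fun y => S.actP (t y) (σ y)) y b =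
      S.con (S.actP (t y) (σ y)) (md (d := 2 * (∑ a, n a) + r) (fun y => S.actP (t y) (σ y)) y b) := rfl
    rw [h2, h1, map_add, S.con_dmap]
    have h3 := S.con_genP (fderiv ℝ t y b) (S.actP (t y) (σ y))
    rw [genP] at h3
    rw [h3, add_comm]
    rfl

/-- There is a section in which the connection form vanishes at the base point, and its derivative
there is antisymmetric, i.e. one half of the curvature. -/
theorem exists_isSection_gauge (q : P) : ∃ σ, S.IsSection q σ ∧ S.pot σ (S.base q) = 0 ∧
    ∀ b b', fderiv ℝ (S.pot σ) (S.base q) b b' = (1 / 2 : ℝ) •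
      ∑ a, coord2 (S.ΩB a) (S.projB q a) (S.base q a) (b a) (b' a) • fun i => (S.p a i : ℝ) := by
  obtain ⟨σ, hσ⟩ := S.exists_isSection q
  set y₀ := S.base q with hy₀
  set A₀ := S.pot σ y₀
  set D := fderiv ℝ (S.pot σ) y₀
  -- translating by `t` adds `dt` to the potential: this kills its value and the symmetric part of its
  -- derivative at the base point
  let t : (∀ a, 𝔼 (2 * n a)) → LieT r := fun y =>
    -A₀ (y - y₀) - (1 / 2 : ℝ) • D (y - y₀) (y - y₀)
  have hD : ∀ y, HasFDerivAt (fun y => D (y - y₀) (y - y₀)) (D (y - y₀) + D.flip (y - y₀)) y := by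
    intro y
    have h1 : HasFDerivAt (fun y => D (y - y₀)) D y :=
      D.hasFDerivAt.comp y ((hasFDerivAt_id y).sub_const y₀)
    have h2 := h1.clm_apply ((hasFDerivAt_id y).sub_const y₀)
    exact h2
  have ht : ContDiff ℝ ∞ t := by
    have h1 : ContDiff ℝ ∞ fun y => D (y - y₀) := D.contDiff.comp (contDiff_id.sub contDiff_const)
    have h2 : ContDiff ℝ ∞ fun y => D (y - y₀) (y - y₀) := h1.clm_apply (contDiff_id.sub contDiff_const)
    exact ((A₀.contDiff.comp (contDiff_id.sub contDiff_const)).neg).sub (h2.const_smul (1 / 2 : ℝ))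
  have htd : ∀ y, fderiv ℝ t y = -A₀ - (1 / 2 : ℝ) • (D (y - y₀) + D.flip (y - y₀)) := by
    intro y
    have h1 : HasFDerivAt (fun y => A₀ (y - y₀)) A₀ y :=
      A₀.hasFDerivAt.comp y ((hasFDerivAt_id y).sub_const y₀)
    exact (h1.neg.sub ((hD y).const_smul (1 / 2 : ℝ))).fderiv
  obtain ⟨h1, h2⟩ := hσ.act S ht (by simp [t, hy₀])
  refine ⟨_, h1, ?_, fun b b' => ?_⟩
  · rw [h2.self_of_nhds]
    change S.pot σ y₀ + fderiv ℝ t y₀ = 0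
    rw [htd]
    simp [A₀]
  · have h3 : HasFDerivAt (fun y => S.pot σ y + fderiv ℝ t y)
        (D - (1 / 2 : ℝ) • (D + D.flip)) y₀ := by
      have e : (fun y => S.pot σ y + fderiv ℝ t y) = fun y =>
          (S.pot σ y - A₀) - (1 / 2 : ℝ) • ((D + D.flip) (y - y₀)) := by
        ext1 y
        rw [htd]
        simp only [add_apply]
        abel
      rw [e]
      have h4 : HasFDerivAt (fun y => (D + D.flip) (y - y₀)) (D + D.flip) y₀ :=
        (D + D.flip).hasFDerivAt.comp y₀ ((hasFDerivAt_id y₀).sub_const y₀)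
      exact HasFDerivAt.sub (((S.contDiffAt_pot hσ.smAt).differentiableAt
        (by simp)).hasFDerivAt.sub_const A₀) (h4.const_smul (1 / 2 : ℝ))
    rw [h2.fderiv_eq, h3.fderiv, ← hσ.curl_pot S b b']
    simp only [curl_apply, sub_apply, smul_apply, add_apply, ContinuousLinearMap.flip_apply]
    ext i
    simp only [Pi.sub_apply, Pi.smul_apply, Pi.add_apply, smul_eq_mul, D, y₀]
    ring

/-! ### Adapted parametrizations of the fibration -/

/-- The parametrization of `Y` given by a chart of `X` and a local section of `P`. -/
def par (x₀ : X) (σ : (∀ a, 𝔼 (2 * n a)) → P) (z : 𝔼 (2 * m) × ∀ a, 𝔼 (2 * n a)) : Y :=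
  S.projY ((chart (2 * m) x₀).symm z.1, σ z.2)

/-- The conditions on `z` under which the parametrization `par x₀ σ` behaves well at `z`; they hold
near the base point. -/
structure Adapted (x₀ : X) (q : P) (σ : (∀ a, 𝔼 (2 * n a)) → P)
    (z : 𝔼 (2 * m) × ∀ a, 𝔼 (2 * n a)) : Prop where
  mem : z.1 ∈ (chart (2 * m) x₀).target
  smAt : SmAt (2 * (∑ a, n a) + r) σ z.2
  memB : ∀ a, z.2 a ∈ (chart (2 * n a) (S.projB q a)).target
  proj : ∀ a, S.projB (σ z.2) a = (chart (2 * n a) (S.projB q a)).symm (z.2 a)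
  dB : ∀ b a, S.dB (σ z.2) (md (d := 2 * (∑ a, n a) + r) σ z.2 b) a =
    md (d := 2 * n a) (chart (2 * n a) (S.projB q a)).symm (z.2 a) (b a)

theorem IsSection.adapted {q : P} {σ : (∀ a, 𝔼 (2 * n a)) → P} (h : S.IsSection q σ) (x₀ : X) :
    ∀ᶠ z in 𝓝 (chart (2 * m) x₀ x₀, S.base q), S.Adapted x₀ q σ z := by
  have ht : ∀ᶠ y in 𝓝 (S.base q), ∀ a, y a ∈ (chart (2 * n a) (S.projB q a)).target :=
    Filter.eventually_all.2 fun a => (continuous_apply a).continuousAt.eventually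
      (target_mem_nhds (S.base_mem q a))
  have hX : ∀ᶠ u in 𝓝 (chart (2 * m) x₀ x₀), u ∈ (chart (2 * m) x₀).target :=
    target_mem_nhds ((chart (2 * m) x₀).map_source (mem_chart_self x₀))
  rw [nhds_prod_eq]
  filter_upwards [hX.prod_mk (((h.smAt.eventually.and h.proj).and h.dB_md).and ht)] with z hz
  exact ⟨hz.1, hz.2.1.1.1, hz.2.2, hz.2.1.1.2, hz.2.1.2⟩

/-- The vertical direction can be moved from `P` to `X`. -/
theorem dY_eq_of_hor {x : X} {q : P} (v : 𝔼 (2 * m)) (w : 𝔼 (2 * (∑ a, n a) + r)) (ξ : LieT r) :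
    S.dY (x, q) (v, w) = S.dY (x, q) (v + S.genX ξ x, w - S.genP ξ q) := by
  have h := S.dY_vert ξ (x, q)
  have e : ((v, w) : 𝔼 (2 * m) × 𝔼 (2 * (∑ a, n a) + r)) =
      (v + S.genX ξ x, w - S.genP ξ q) + (-S.genX ξ x, S.genP ξ q) := by simp
  rw [e, map_add, h, add_zero]

theorem JD_genP (ξ : LieT r) (q : P) : S.JD q (S.genP ξ q) = 0 := by
  refine S.ext_P (q := q) ?_ ?_
  · rw [S.dprod_JD, S.dprod_genP, map_zero, map_zero]
  · rw [S.con_JD, map_zero]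

section Par

variable {x₀ : X} {q : P} {σ : (∀ a, 𝔼 (2 * n a)) → P} {z : 𝔼 (2 * m) × ∀ a, 𝔼 (2 * n a)}
  (hz : S.Adapted x₀ q σ z)
include hz

theorem Adapted.smAt_fst :
    SmAt (2 * m) (fun z : 𝔼 (2 * m) × ∀ a, 𝔼 (2 * n a) => (chart (2 * m) x₀).symm z.1) z :=
  (smAt_chart_symm x₀ hz.mem).comp_left (φ := Prod.fst)
    (Filter.Eventually.of_forall fun _ => contDiffAt_fst)

theorem Adapted.smAt_snd :
    SmAt (2 * (∑ a, n a) + r) (fun z : 𝔼 (2 * m) × ∀ a, 𝔼 (2 * n a) => σ z.2) z :=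
  hz.smAt.comp_left (φ := Prod.snd) (Filter.Eventually.of_forall fun _ => contDiffAt_snd)

theorem Adapted.smAt_par : SmAt (2 * (m + ∑ a, n a)) (S.par x₀ σ) z :=
  S.smAt_projY hz.smAt_fst hz.smAt_snd

theorem Adapted.md_par (w : 𝔼 (2 * m) × ∀ a, 𝔼 (2 * n a)) :
    md (d := 2 * (m + ∑ a, n a)) (S.par x₀ σ) z w = S.dY ((chart (2 * m) x₀).symm z.1, σ z.2)
      (md (chart (2 * m) x₀).symm z.1 w.1, md σ z.2 w.2) := by
  refine (S.md_projY hz.smAt_fst hz.smAt_snd w).trans ?_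
  have h1 := SmAt.md_comp_left (φ := Prod.fst) (w := z) (smAt_chart_symm x₀ hz.mem)
    differentiableAt_fst w
  have h2 := SmAt.md_comp_left (φ := Prod.snd) (w := z) hz.smAt differentiableAt_snd w
  rw [fderiv_fst] at h1
  rw [fderiv_snd] at h2
  exact congrArg _ (Prod.ext h1 h2)

theorem Adapted.con_md (b : ∀ a, 𝔼 (2 * n a)) :
    S.con (σ z.2) (md σ z.2 b) = S.pot σ z.2 b := rfl

/-- An adapted parametrization is a local diffeomorphism. -/
theorem Adapted.bijective_md :
    Function.Bijective (md (d := 2 * (m + ∑ a, n a)) (S.par x₀ σ) z) := by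
  have hinj : Function.Injective (md (d := 2 * (m + ∑ a, n a)) (S.par x₀ σ) z) := by
    rw [injective_iff_map_eq_zero]
    rintro ⟨a, b⟩ h
    rw [hz.md_par, S.dY_eq_of_hor _ _ (S.pot σ z.2 b)] at h
    have h1 : ((md (chart (2 * m) x₀).symm z.1 a + S.genX (S.pot σ z.2 b) ((chart (2 * m) x₀).symm z.1),
        md σ z.2 b - S.genP (S.pot σ z.2 b) (σ z.2)) : 𝔼 (2 * m) × 𝔼 (2 * (∑ a, n a) + r)) = 0 := by
      refine S.ext_Z (z := ((chart (2 * m) x₀).symm z.1, σ z.2)) (h.trans (map_zero _).symm) ?_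
      simp only [map_sub, S.con_genP, hz.con_md, sub_self, Prod.snd_zero, map_zero]
    have h2 : md σ z.2 b - S.genP (S.pot σ z.2 b) (σ z.2) = 0 := congrArg Prod.snd h1
    have hb : b = 0 := by
      ext1 a
      have h3 := congrFun (congrArg (S.dB (σ z.2)) h2) a
      rw [map_sub, S.dprod_genP, sub_zero, hz.dB, map_zero] at h3
      exact (bijective_frame (hz.memB a)).1 (h3.trans (map_zero _).symm)
    subst hb
    have h4 : md (chart (2 * m) x₀).symm z.1 a +
        S.genX (S.pot σ z.2 0) ((chart (2 * m) x₀).symm z.1) = 0 := congrArg Prod.fst h1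
    have h5 : S.genX (0 : LieT r) ((chart (2 * m) x₀).symm z.1) = 0 := by
      rw [genX, S.torus_X.gen_eq, map_zero]
    rw [map_zero, h5, add_zero] at h4
    rw [(bijective_frame hz.mem).1 (h4.trans (map_zero _).symm)]
    rfl
  refine ⟨hinj, ?_⟩
  refine (LinearMap.injective_iff_surjective_of_finrank_eq_finrank
    (f := (md (d := 2 * (m + ∑ a, n a)) (S.par x₀ σ) z).toLinearMap) ?_).1 hinj
  rw [Module.finrank_prod, Module.finrank_pi_fintype]
  simp [mul_add, Finset.mul_sum]

variable {l : 𝔼 (2 * m) → LieT r →L[ℝ] 𝔼 (2 * m)}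

theorem Adapted.md_chart_J (v : 𝔼 (2 * m)) :
    md (chart (2 * m) x₀).symm z.1 (coordEnd S.JX x₀ z.1 v) =
      (S.JX ((chart (2 * m) x₀).symm z.1) : 𝔼 (2 * m) →L[ℝ] 𝔼 (2 * m))
        (md (chart (2 * m) x₀).symm z.1 v) :=
  (represents_coordEnd S.JX x₀ hz.mem).self_of_nhds v

/-- `J_B` on the differential of the section. -/
theorem Adapted.JD_md (b : ∀ a, 𝔼 (2 * n a)) :
    S.JD (σ z.2) (md σ z.2 b) = md σ z.2 (prodEnd (fun a => coordEnd (S.JB a) (S.projB q a)) z.2 b) -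
      S.genP (S.pot σ z.2 (prodEnd (fun a => coordEnd (S.JB a) (S.projB q a)) z.2 b)) (σ z.2) := by
  refine S.ext_P (q := σ z.2) ?_ ?_
  · rw [S.dprod_JD, map_sub, S.dprod_genP, sub_zero]
    ext1 a
    rw [hz.dB, prodEnd_apply]
    refine Eq.trans ?_ ((represents_coordEnd (S.JB a) (S.projB q a) (hz.memB a)).self_of_nhds (b a)).symm
    have h1 : ∀ (x x' : B a) (v : 𝔼 (2 * n a)), x = x' →
        (S.JB a x : 𝔼 (2 * n a) →L[ℝ] 𝔼 (2 * n a)) v = S.JB a x' v := by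
      rintro x _ v rfl; rfl
    have h2 : S.JBv (S.projB (σ z.2)) (S.dB (σ z.2) (md σ z.2 b)) a =
      (S.JB a (S.projB (σ z.2) a) : 𝔼 (2 * n a) →L[ℝ] 𝔼 (2 * n a)) (S.dB (σ z.2) (md σ z.2 b) a) := rfl
    rw [h2, hz.dB]
    exact h1 _ _ _ (hz.proj a)
  · rw [S.con_JD, map_sub, S.con_genP, hz.con_md, sub_self]

variable (hl : ∀ ξ, md (chart (2 * m) x₀).symm z.1 (l z.1 ξ) =
  S.genX ξ ((chart (2 * m) x₀).symm z.1))
include hl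

/-- The horizontal form of the differential of an adapted parametrization. -/
theorem Adapted.md_par_hor (w : 𝔼 (2 * m) × ∀ a, 𝔼 (2 * n a)) :
    md (d := 2 * (m + ∑ a, n a)) (S.par x₀ σ) z w = S.dY ((chart (2 * m) x₀).symm z.1, σ z.2)
      (md (chart (2 * m) x₀).symm z.1 (w.1 + l z.1 (S.pot σ z.2 w.2)),
        md σ z.2 w.2 - S.genP (S.pot σ z.2 w.2) (σ z.2)) := by
  rw [hz.md_par, S.dY_eq_of_hor _ _ (S.pot σ z.2 w.2), map_add, hl]

theorem Adapted.JY_md (w : 𝔼 (2 * m) × ∀ a, 𝔼 (2 * n a)) :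
    (S.JY (S.par x₀ σ z) : 𝔼 (2 * (m + ∑ a, n a)) →L[ℝ] 𝔼 (2 * (m + ∑ a, n a)))
      (md (d := 2 * (m + ∑ a, n a)) (S.par x₀ σ) z w) =
      S.dY ((chart (2 * m) x₀).symm z.1, σ z.2)
        (md (chart (2 * m) x₀).symm z.1 (coordEnd S.JX x₀ z.1 (w.1 + l z.1 (S.pot σ z.2 w.2))),
          S.JD (σ z.2) (md σ z.2 w.2)) := by
  rw [hz.md_par_hor S hl]
  refine (S.JY_dY _ _ ?_).trans (congrArg _ (Prod.ext ?_ ?_))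
  · simp only [map_sub, S.con_genP, hz.con_md, sub_self]
  · exact (hz.md_chart_J S _).symm
  · refine (map_sub (S.JD (σ z.2)) _ _).trans ?_
    rw [S.JD_genP, sub_zero]

/-- In an adapted parametrization the complex structure of `Y` is `modelJ`. -/
theorem Adapted.md_modelJ (w : 𝔼 (2 * m) × ∀ a, 𝔼 (2 * n a)) :
    md (d := 2 * (m + ∑ a, n a)) (S.par x₀ σ) z (modelJ (coordEnd S.JX x₀) l (S.pot σ)
      (fun a => coordEnd (S.JB a) (S.projB q a)) z w) =
    (S.JY (S.par x₀ σ z) : 𝔼 (2 * (m + ∑ a, n a)) →L[ℝ] 𝔼 (2 * (m + ∑ a, n a)))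
      (md (d := 2 * (m + ∑ a, n a)) (S.par x₀ σ) z w) := by
  rw [hz.JY_md S hl, hz.md_par_hor S hl, modelJ_apply, hz.JD_md]
  simp only [sub_add_cancel]

section Form

variable {c : Fin k → ℝ} {Ω : BilForm (2 * m) X ℝ} {μ : X → LieT r}
  (hΩ : IsHamKahler S.JX Ω S.actX μ)
include hΩ

/-- In an adapted parametrization the metric of `Y` is `modelG`. -/
theorem Adapted.pb2_metric : pb2 (S.par x₀ σ) (metric S.JY (S.formY c Ω μ)) z =
    modelG (coord2 (metric S.JX Ω) x₀) l (S.pot σ) (fun a u => S.aff c a (μ ((chart (2 * m) x₀).symm u)))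
      (fun a => coord2 (metric (S.JB a) (S.ΩB a)) (S.projB q a)) z := by
  refine ContinuousLinearMap.ext fun v => ContinuousLinearMap.ext fun w => ?_
  have h1 : pb2 (S.par x₀ σ) (metric S.JY (S.formY c Ω μ)) z v w = S.formY c Ω μ (S.par x₀ σ z)
      (md (d := 2 * (m + ∑ a, n a)) (S.par x₀ σ) z v)
      ((S.JY (S.par x₀ σ z) : 𝔼 (2 * (m + ∑ a, n a)) →L[ℝ] 𝔼 (2 * (m + ∑ a, n a)))
        (md (d := 2 * (m + ∑ a, n a)) (S.par x₀ σ) z w)) := rfl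
  rw [h1, hz.JY_md S hl, hz.md_par_hor S hl]
  refine (S.formY_dY hΩ _ _ _).trans ?_
  rw [formZ_apply, modelG_apply]
  simp only [map_sub, S.con_genP, hz.con_md, sub_self, S.con_JD, S.dprod_JD, S.dprod_genP, sub_zero,
    Pi.zero_apply, mul_zero, zero_mul, Finset.sum_const_zero, add_zero]
  congr 1
  · exact congrArg ((Ω ((chart (2 * m) x₀).symm z.1) : 𝔼 (2 * m) →L[ℝ] 𝔼 (2 * m) →L[ℝ] ℝ) _)
      (hz.md_chart_J S _)
  · refine Finset.sum_congr rfl fun a _ => congrArg _ ?_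
    have h2 : ∀ (x x' : B a) (v v' : 𝔼 (2 * n a)), x = x' →
        (S.ΩB a x : 𝔼 (2 * n a) →L[ℝ] 𝔼 (2 * n a) →L[ℝ] ℝ) v (S.JB a x v') =
          S.ΩB a x' v (S.JB a x' v') := by
      rintro x _ v v' rfl; rfl
    refine (h2 _ _ _ _ (hz.proj a)).trans ?_
    exact congrArg₂ (fun v v' => (S.ΩB a ((chart (2 * n a) (S.projB q a)).symm (z.2 a)) :
      𝔼 (2 * n a) →L[ℝ] 𝔼 (2 * n a) →L[ℝ] ℝ) v (S.JB a _ v')) (hz.dB v.2 a) (hz.dB w.2 a)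

/-- In an adapted parametrization the form of `Y` is `modelForm`. -/
theorem Adapted.pb2_form : pb2 (S.par x₀ σ) (S.formY c Ω μ) z =
    modelForm (coord2 Ω x₀) (fun u => μ ((chart (2 * m) x₀).symm u)) (S.pot σ)
      (fun a u => S.aff c a (μ ((chart (2 * m) x₀).symm u)))
      (fun a => coord2 (S.ΩB a) (S.projB q a)) z := by
  refine ContinuousLinearMap.ext fun v => ContinuousLinearMap.ext fun w => ?_
  rw [pb2_apply, hz.md_par, hz.md_par]
  refine (S.formY_dY hΩ _ _ _).trans ?_
  rw [formZ_apply, modelForm_apply]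
  congr 1
  · congr 1
    refine Finset.sum_congr rfl fun a _ => congrArg _ ?_
    have h2 : ∀ (x x' : B a) (v v' : 𝔼 (2 * n a)), x = x' →
        (S.ΩB a x : 𝔼 (2 * n a) →L[ℝ] 𝔼 (2 * n a) →L[ℝ] ℝ) v v' = S.ΩB a x' v v' := by
      rintro x _ v v' rfl; rfl
    refine (h2 _ _ _ _ (hz.proj a)).trans ?_
    rw [hz.dB, hz.dB]
    rfl
  · refine Finset.sum_congr rfl fun i _ => ?_
    have h3 : ∀ a, fderiv ℝ (fun u => μ ((chart (2 * m) x₀).symm u) i) z.1 a =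
        dfun (fun x => μ x i) ((chart (2 * m) x₀).symm z.1) (md (chart (2 * m) x₀).symm z.1 a) :=
      fun a => (smAt_chart_symm x₀ hz.mem).fderiv_fun (f := fun x => μ x i)
        ((hΩ.contMDiff_mu i).mdifferentiableAt (by simp)) a
    rw [h3, h3]
    rfl

end Form
end Par

/-! ### The Kähler structure of the fibration -/

/-- A section `σ` in a gauge adapted to the point `q`, together with the coordinate expression `l` of
the generators of the action on `X` in the chart around `x₀`. -/
structure IsGauge (x₀ : X) (q : P) (σ : (∀ a, 𝔼 (2 * n a)) → P)
    (l : 𝔼 (2 * m) → LieT r →L[ℝ] 𝔼 (2 * m)) : Prop where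
  isSection : S.IsSection q σ
  pot_base : S.pot σ (S.base q) = 0
  fderiv_pot : ∀ b b', fderiv ℝ (S.pot σ) (S.base q) b b' = (1 / 2 : ℝ) •
    ∑ a, coord2 (S.ΩB a) (S.projB q a) (S.base q a) (b a) (b' a) • fun i => (S.p a i : ℝ)
  smooth_l : ∀ u ∈ (chart (2 * m) x₀).target, ContDiffAt ℝ ∞ l u
  md_l : ∀ u ∈ (chart (2 * m) x₀).target, ∀ ξ,
    md (chart (2 * m) x₀).symm u (l u ξ) = S.genX ξ ((chart (2 * m) x₀).symm u)

/-- The base point of an adapted parametrization. -/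
def pt (x₀ : X) (q : P) : 𝔼 (2 * m) × ∀ a, 𝔼 (2 * n a) := (chart (2 * m) x₀ x₀, S.base q)

theorem exists_isGauge (x₀ : X) (q : P) : ∃ σ l, S.IsGauge x₀ q σ l := by
  obtain ⟨σ, h1, h2, h3⟩ := S.exists_isSection_gauge q
  obtain ⟨l, hl⟩ := S.torus_X.exists_gen_param x₀
  exact ⟨σ, l, h1, h2, h3, fun u hu => (hl u hu).1, fun u hu => (hl u hu).2⟩

theorem chart_mem (x₀ : X) : chart (2 * m) x₀ x₀ ∈ (chart (2 * m) x₀).target :=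
  (chart (2 * m) x₀).map_source (mem_chart_self x₀)

theorem chart_symm_self (x₀ : X) : (chart (2 * m) x₀).symm (chart (2 * m) x₀ x₀) = x₀ :=
  (chart (2 * m) x₀).left_inv (mem_chart_self x₀)

theorem IsSection.par_pt {q : P} {σ : (∀ a, 𝔼 (2 * n a)) → P} (h : S.IsSection q σ) (x₀ : X) :
    S.par x₀ σ (S.pt x₀ q) = S.projY (x₀, q) := by
  rw [par, pt, chart_symm_self, h.apply_base]

/-- Local sections of `X × P → Y`. -/
theorem exists_local_lift (y₀ : Y) : ∃ (sX : Y → X) (sP : Y → P),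
    ContMDiffAt 𝓘(ℝ, 𝔼 (2 * (m + ∑ a, n a))) 𝓘(ℝ, 𝔼 (2 * m)) ∞ sX y₀ ∧
    ContMDiffAt 𝓘(ℝ, 𝔼 (2 * (m + ∑ a, n a))) 𝓘(ℝ, 𝔼 (2 * (∑ a, n a) + r)) ∞ sP y₀ ∧
    ∀ᶠ y in 𝓝 y₀, S.projY (sX y, sP y) = y := by
  obtain ⟨x₀, q, hy⟩ : ∃ x q, S.projY (x, q) = y₀ := ⟨_, _, S.projY_lift y₀⟩
  obtain ⟨σ, hσ⟩ := S.exists_isSection q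
  have hpt := hσ.par_pt S x₀
  rw [hy] at hpt
  have had : S.Adapted x₀ q σ (S.pt x₀ q) := (hσ.adapted S x₀).self_of_nhds
  have hmem : S.par x₀ σ (S.pt x₀ q) ∈ (chart (2 * (m + ∑ a, n a)) y₀).source := by
    rw [hpt]; exact mem_chart_self _
  obtain ⟨ρ, h1, h2⟩ := (had.smAt_par S).exists_inverse (had.bijective_md S) hmem
  rw [hpt] at h1 h2
  have hch : ContMDiffAt 𝓘(ℝ, 𝔼 (2 * (m + ∑ a, n a))) 𝓘(ℝ, 𝔼 (2 * (m + ∑ a, n a))) ∞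
    (chart (2 * (m + ∑ a, n a)) y₀) y₀ := contMDiffAt_extChartAt
  have hρ : ContMDiffAt 𝓘(ℝ, 𝔼 (2 * (m + ∑ a, n a)))
      𝓘(ℝ, 𝔼 (2 * m) × ∀ a, 𝔼 (2 * n a)) ∞ (ρ ∘ chart (2 * (m + ∑ a, n a)) y₀) y₀ :=
    h2.self_of_nhds.1.contMDiffAt.comp y₀ hch
  have e0 : (ρ ∘ chart (2 * (m + ∑ a, n a)) y₀) y₀ = S.pt x₀ q := h1
  refine ⟨fun y => (chart (2 * m) x₀).symm (ρ (chart (2 * (m + ∑ a, n a)) y₀ y)).1,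
    fun y => σ (ρ (chart (2 * (m + ∑ a, n a)) y₀ y)).2, ?_, ?_, ?_⟩
  · have h3 := (had.smAt_fst S).contMDiffAt
    rw [← e0] at h3
    exact ContMDiffAt.comp (f := ρ ∘ chart (2 * (m + ∑ a, n a)) y₀)
      (g := fun z => (chart (2 * m) x₀).symm z.1) y₀ h3 hρ
  · have h3 := (had.smAt_snd S).contMDiffAt
    rw [← e0] at h3
    exact ContMDiffAt.comp (f := ρ ∘ chart (2 * (m + ∑ a, n a)) y₀)
      (g := fun z => σ z.2) y₀ h3 hρ
  · filter_upwards [hch.continuousAt.eventually h2,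
      chart_source_mem_nhds (mem_chart_self (d := 2 * (m + ∑ a, n a)) y₀)] with y hy1 hy2
    exact hy1.2.2.2.1.trans ((chart (2 * (m + ∑ a, n a)) y₀).left_inv hy2)

theorem contMDiff_down {V : Type*} [NormedAddCommGroup V] [NormedSpace ℝ V] {f : X → V}
    (hf : ContMDiff 𝓘(ℝ, 𝔼 (2 * m)) 𝓘(ℝ, V) ∞ f) (hi : ∀ t x, f (S.actX t x) = f x) :
    ContMDiff 𝓘(ℝ, 𝔼 (2 * (m + ∑ a, n a))) 𝓘(ℝ, V) ∞ (S.down f) := by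
  intro y₀
  obtain ⟨sX, sP, h1, -, h2⟩ := S.exists_local_lift y₀
  refine (hf.contMDiffAt.comp y₀ h1).congr_of_eventuallyEq ?_
  filter_upwards [h2] with y hy
  rw [Function.comp_apply, ← S.down_projY hi (sX y) (sP y), hy]

theorem torus_Y : IsTorusAction (2 * (m + ∑ a, n a)) S.actY := by
  have hz : ∀ y, ∃ x q, S.projY (x, q) = y := fun y => ⟨_, _, S.projY_lift y⟩
  refine ⟨fun y => ?_, fun s t y => ?_, fun l y => ?_, ?_⟩
  · obtain ⟨x, q, rfl⟩ := hz y
    rw [S.actY_projY, S.torus_X.zero_act]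
  · obtain ⟨x, q, rfl⟩ := hz y
    rw [S.actY_projY, S.actY_projY, S.actY_projY, S.torus_X.add_act]
  · obtain ⟨x, q, rfl⟩ := hz y
    rw [S.actY_projY, S.torus_X.periodic]
  · rintro ⟨t₀, y₀⟩
    obtain ⟨sX, sP, h1, h2, h3⟩ := S.exists_local_lift y₀
    have h4 : ContMDiffAt (𝓘(ℝ, LieT r).prod 𝓘(ℝ, 𝔼 (2 * (m + ∑ a, n a)))) 𝓘(ℝ, 𝔼 (2 * m)) ∞
        (fun z : LieT r × Y => S.actX z.1 (sX z.2)) (t₀, y₀) :=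
      ContMDiffAt.comp (t₀, y₀) (g := fun z : LieT r × X => S.actX z.1 z.2)
        (f := fun z : LieT r × Y => (z.1, sX z.2)) S.torus_X.smooth.contMDiffAt
        (contMDiffAt_fst.prodMk (ContMDiffAt.comp (t₀, y₀) h1 contMDiffAt_snd))
    have h5 : ContMDiffAt (𝓘(ℝ, LieT r).prod 𝓘(ℝ, 𝔼 (2 * (m + ∑ a, n a))))
        𝓘(ℝ, 𝔼 (2 * (∑ a, n a) + r)) ∞ (fun z : LieT r × Y => sP z.2) (t₀, y₀) :=
      ContMDiffAt.comp (t₀, y₀) h2 contMDiffAt_snd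
    refine (S.projY_smooth.contMDiffAt.comp (t₀, y₀) (h4.prodMk h5)).congr_of_eventuallyEq ?_
    have h6 : ∀ᶠ z : LieT r × Y in 𝓝 (t₀, y₀), S.projY (sX z.2, sP z.2) = z.2 :=
      (continuousAt_snd (p := (t₀, y₀))).eventually h3
    filter_upwards [h6] with z hz
    rw [Function.comp_apply, ← S.actY_projY, hz]

theorem dfun_down {V : Type*} [NormedAddCommGroup V] [NormedSpace ℝ V] {f : X → V}
    (hf : ContMDiff 𝓘(ℝ, 𝔼 (2 * m)) 𝓘(ℝ, V) ∞ f) (hi : ∀ t x, f (S.actX t x) = f x) (z : X × P)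
    (h : 𝔼 (2 * m) × 𝔼 (2 * (∑ a, n a) + r)) :
    dfun (S.down f) (S.projY z) (S.dY z h) = dfun f z.1 h.1 := by
  obtain ⟨cX, cP, u, w, hX, hP, rfl, rfl⟩ := exists_velocity z h
  have h1 := (S.smAt_projY hX hP).fderiv_fun (f := S.down f)
    ((S.contMDiff_down hf hi).mdifferentiableAt (by simp)) w
  have h2 := hX.fderiv_fun (f := f) (hf.mdifferentiableAt (by simp)) w
  have e : S.down f ∘ (fun z => S.projY (cX z, cP z)) = f ∘ cX := by
    ext z; exact S.down_projY hi _ _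
  rw [e, S.md_projY hX hP] at h1
  exact h1.symm.trans h2

theorem dmap_actY (t : LieT r) (x : X) (q : P) (h : 𝔼 (2 * m) × 𝔼 (2 * (∑ a, n a) + r)) :
    dmap (S.actY t) (S.projY (x, q)) (S.dY (x, q) h) =
      S.dY (S.actX t x, q) (dmap (S.actX t) x h.1, h.2) := by
  obtain ⟨cX, cP, u, w, hX, hP, hz, rfl⟩ := exists_velocity (x, q) h
  obtain ⟨rfl, rfl⟩ := Prod.mk.inj hz
  have h1 := (S.smAt_projY hX hP).md_comp (f := S.actY t) (S.torus_Y.mdiff t _) w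
  have e : S.actY t ∘ (fun z => S.projY (cX z, cP z)) = fun z => S.projY ((S.actX t ∘ cX) z, cP z) := by
    ext z; exact S.actY_projY t _ _
  rw [e, S.md_projY (hX.comp (S.torus_X.contMDiff t)) hP, S.md_projY hX hP,
    hX.md_comp (S.torus_X.mdiff t _)] at h1
  exact h1.symm

theorem gen_actY (ξ : LieT r) (x : X) (q : P) :
    genV (2 * (m + ∑ a, n a)) S.actY ξ (S.projY (x, q)) = S.dY (x, q) (S.genX ξ x, 0) := by
  rw [S.torus_Y.gen_eq]
  have e : (fun t => S.actY t (S.projY (x, q))) = fun t => S.projY (S.actX t x, q) := by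
    ext t; exact S.actY_projY t _ _
  have hq : SmAt (2 * (∑ a, n a) + r) (fun _ : LieT r => q) 0 :=
    Filter.Eventually.of_forall fun _ => contMDiffAt_const
  have h1 := S.md_projY (S.torus_X.smAt_orbit x 0) hq ξ
  have h2 : md (d := 2 * (∑ a, n a) + r) (fun _ : LieT r => q) 0 ξ = 0 := by
    rw [md, mfderiv_const]; rfl
  rw [← S.torus_X.gen_eq, h2] at h1
  rw [e, h1]
  have h3 : ∀ x', x' = x → S.dY (x', q) (genV (2 * m) S.actX ξ x, 0) = S.dY (x, q) (S.genX ξ x, 0) := by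
    rintro _ rfl; rfl
  exact h3 _ (S.torus_X.zero_act x)

/-- Every tangent vector of `Y` is the image of a horizontal vector. -/
theorem exists_hor (y : Y) (u : 𝔼 (2 * (m + ∑ a, n a))) : ∃ (z : X × P)
    (h : 𝔼 (2 * m) × 𝔼 (2 * (∑ a, n a) + r)), S.projY z = y ∧ S.dY z h = u ∧ S.con z.2 h.2 = 0 :=
  ⟨S.lift y, S.hlift (S.lift y) u, S.projY_lift y, S.dY_hlift _ _, S.con_hlift _ _⟩

theorem exists_dY (z : X × P) (u : 𝔼 (2 * (m + ∑ a, n a))) : ∃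
    h : 𝔼 (2 * m) × 𝔼 (2 * (∑ a, n a) + r), S.dY z h = u ∧ S.con z.2 h.2 = 0 :=
  ⟨S.hlift z u, S.dY_hlift _ _, S.con_hlift _ _⟩

theorem JBv_JBv (b : ∀ a, B a) (v : ∀ a, 𝔼 (2 * n a)) : S.JBv b (S.JBv b v) = -v := by
  ext1 a
  exact (S.kahler_B a).sq_J (b a) (v a)

theorem JZ_JZ (z : X × P) {h : 𝔼 (2 * m) × 𝔼 (2 * (∑ a, n a) + r)} (hh : S.con z.2 h.2 = 0) :
    S.JZ z (S.JZ z h) = -h := by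
  refine Prod.ext (S.sq_JX z.1 h.1) (S.ext_P (q := z.2) ?_ ?_)
  · change S.dB z.2 (S.JD z.2 (S.JD z.2 h.2)) = S.dB z.2 (-h.2)
    rw [S.dprod_JD, S.dprod_JD, S.JBv_JBv, map_neg]
  · change S.con z.2 (S.JD z.2 (S.JD z.2 h.2)) = S.con z.2 (-h.2)
    rw [S.con_JD, map_neg, hh, neg_zero]

theorem JY_JY (y : Y) (u : 𝔼 (2 * (m + ∑ a, n a))) :
    (S.JY y : 𝔼 (2 * (m + ∑ a, n a)) →L[ℝ] 𝔼 (2 * (m + ∑ a, n a))) (S.JY y u) = -u := by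
  obtain ⟨z, h, rfl, rfl, hh⟩ := S.exists_hor y u
  have h1 := S.JY_dY z h hh
  refine (congrArg _ h1).trans ?_
  rw [S.JY_dY z (S.JZ z h) (S.con_JD z.2 h.2), S.JZ_JZ z hh, map_neg]

namespace IsGauge

variable {x₀ : X} {q : P} {σ : (∀ a, 𝔼 (2 * n a)) → P} {l : 𝔼 (2 * m) → LieT r →L[ℝ] 𝔼 (2 * m)}
  (hg : S.IsGauge x₀ q σ l)
include hg

theorem adapted : ∀ᶠ z in 𝓝 (S.pt x₀ q), S.Adapted x₀ q σ z := hg.isSection.adapted S x₀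

theorem adapted_pt : S.Adapted x₀ q σ (S.pt x₀ q) := (hg.adapted S).self_of_nhds

theorem smAt_par : SmAt (2 * (m + ∑ a, n a)) (S.par x₀ σ) (S.pt x₀ q) := (hg.adapted_pt S).smAt_par S

theorem represents : Represents (S.par x₀ σ) S.JY (modelJ (coordEnd S.JX x₀) l (S.pot σ)
    (fun a => coordEnd (S.JB a) (S.projB q a))) (S.pt x₀ q) := by
  filter_upwards [hg.adapted S] with z hz w
  exact hz.md_modelJ S (hg.md_l _ hz.mem) w

theorem contDiffAt_modelJ : ContDiffAt ℝ ∞ (modelJ (coordEnd S.JX x₀) l (S.pot σ)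
    (fun a => coordEnd (S.JB a) (S.projB q a))) (S.pt x₀ q) :=
  WKahler.contDiffAt_modelJ (S.smooth_JX.contDiffAt (mem_chart_self x₀)) (hg.smooth_l _ (chart_mem x₀))
    (S.contDiffAt_pot hg.isSection.smAt) fun a => (S.kahler_B a).smooth_J.contDiffAt (mem_chart_self _)

theorem fderiv_pot_antisymm (b b' : ∀ a, 𝔼 (2 * n a)) :
    fderiv ℝ (S.pot σ) (S.base q) b b' = -fderiv ℝ (S.pot σ) (S.base q) b' b := by
  rw [hg.fderiv_pot, hg.fderiv_pot, ← smul_neg, ← Finset.sum_neg_distrib]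
  congr 1
  refine Finset.sum_congr rfl fun a _ => ?_
  rw [← neg_smul]
  congr 1
  exact coord2_alt (S.kahler_B a).alternating _ _ _ _

/-- The curvature of the connection is of type `(1, 1)`, since the `ω_a` are. -/
theorem fderiv_pot_J (b b' : ∀ a, 𝔼 (2 * n a)) :
    fderiv ℝ (S.pot σ) (S.base q) (prodEnd (fun a => coordEnd (S.JB a) (S.projB q a)) (S.base q) b)
      (prodEnd (fun a => coordEnd (S.JB a) (S.projB q a)) (S.base q) b') =
    fderiv ℝ (S.pot σ) (S.base q) b b' := by
  rw [hg.fderiv_pot, hg.fderiv_pot]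
  congr 1
  refine Finset.sum_congr rfl fun a _ => ?_
  congr 1
  have hr := (represents_coordEnd (S.JB a) (S.projB q a) (S.base_mem q a)).self_of_nhds
  rw [coord2_apply, coord2_apply, prodEnd_apply, prodEnd_apply, hr, hr]
  exact (S.kahler_B a).invariant _ _ _

theorem nij_eq_zero (v w : 𝔼 (2 * m) × ∀ a, 𝔼 (2 * n a)) :
    nij (modelJ (coordEnd S.JX x₀) l (S.pot σ)
      (fun a => coordEnd (S.JB a) (S.projB q a))) (S.pt x₀ q) v w = 0 := by
  have hJ := S.smooth_JX.contDiffAt (mem_chart_self x₀)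
  have hK : ∀ a, ContDiffAt ℝ ∞ (coordEnd (S.JB a) (S.projB q a)) (S.base q a) := fun a =>
    (S.kahler_B a).smooth_J.contDiffAt (mem_chart_self _)
  have hrX := represents_coordEnd S.JX x₀ (chart_mem x₀)
  have hrB := fun a => represents_coordEnd (S.JB a) (S.projB q a) (S.base_mem q a)
  refine nij_modelJ hJ (hg.smooth_l _ (chart_mem x₀)) (S.contDiffAt_pot hg.isSection.smAt) hK
    hg.pot_base ?_ ?_ ?_ ?_ (hg.fderiv_pot_antisymm S) (hg.fderiv_pot_J S) v w
  · intro v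
    refine (bijective_frame (chart_mem x₀)).1 ?_
    rw [hrX.self_of_nhds, hrX.self_of_nhds, map_neg]
    exact S.sq_JX _ _
  · intro a v
    refine (bijective_frame (S.base_mem q a)).1 ?_
    rw [(hrB a).self_of_nhds, (hrB a).self_of_nhds, map_neg]
    exact (S.kahler_B a).sq_J _ _
  · exact fun v w => S.integrable_JX.nij_eq_zero S.smooth_JX (smAt_chart_symm x₀ (chart_mem x₀))
      (bijective_frame (chart_mem x₀)) hrX (hJ.differentiableAt (by simp)) v w
  · exact fun a v w => (S.kahler_B a).integrable.nij_eq_zero (S.kahler_B a).smooth_J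
      (smAt_chart_symm (S.projB q a) (S.base_mem q a)) (bijective_frame (S.base_mem q a)) (hrB a)
      ((hK a).differentiableAt (by simp)) v w

end IsGauge

theorem smooth_JY : SmoothEnd S.JY := by
  refine smoothEnd_of_param (E := 𝔼 (2 * m) × ∀ a, 𝔼 (2 * n a)) fun y => ?_
  obtain ⟨x₀, q, rfl⟩ : ∃ x q, S.projY (x, q) = y := ⟨_, _, S.projY_lift y⟩
  obtain ⟨σ, l, hg⟩ := S.exists_isGauge x₀ q
  exact ⟨_, _, _, hg.isSection.par_pt S x₀, hg.smAt_par S, (hg.adapted_pt S).bijective_md S,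
    hg.represents S, hg.contDiffAt_modelJ S⟩

theorem integrable_JY : IsIntegrable S.JY := by
  refine isIntegrable_of_param (E := 𝔼 (2 * m) × ∀ a, 𝔼 (2 * n a)) S.smooth_JY fun y => ?_
  obtain ⟨x₀, q, rfl⟩ : ∃ x q, S.projY (x, q) = y := ⟨_, _, S.projY_lift y⟩
  obtain ⟨σ, l, hg⟩ := S.exists_isGauge x₀ q
  exact ⟨_, _, _, hg.isSection.par_pt S x₀, hg.smAt_par S, (hg.adapted_pt S).bijective_md S,
    hg.represents S, (hg.contDiffAt_modelJ S).differentiableAt (by simp), hg.nij_eq_zero S⟩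

section Form

variable {c : Fin k → ℝ} {Ω : BilForm (2 * m) X ℝ} {μ : X → LieT r}
  (hΩ : IsHamKahler S.JX Ω S.actX μ)
include hΩ

theorem contMDiff_aff (a : Fin k) :
    ContMDiff 𝓘(ℝ, 𝔼 (2 * m)) 𝓘(ℝ, ℝ) ∞ fun x => S.aff c a (μ x) :=
  (hΩ.contMDiff_pair _).add contMDiff_const

theorem dfun_aff (a : Fin k) (x : X) (u : 𝔼 (2 * m)) :
    dfun (fun x => S.aff c a (μ x)) x u = ∑ i, (S.p a i : ℝ) * dfun (fun x => μ x i) x u := by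
  rw [← hΩ.dfun_pair]
  have h1 : (fun x => S.aff c a (μ x)) = (fun x => pair (fun i => (S.p a i : ℝ)) (μ x)) +
    fun _ => c a := rfl
  have h2 : dfun (d := 2 * m) (fun x => S.aff c a (μ x)) x =
      dfun (d := 2 * m) (fun x => pair (fun i => (S.p a i : ℝ)) (μ x)) x +
        dfun (d := 2 * m) (fun _ : X => c a) x := by
    rw [h1]
    exact mfderiv_add ((hΩ.contMDiff_pair _).mdifferentiableAt (by simp)) mdifferentiableAt_const
  have h3 : dfun (d := 2 * m) (fun _ : X => c a) x = 0 := mfderiv_const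
  rw [h2, h3, add_zero]

theorem smooth_formY : Smooth2 (S.formY c Ω μ) := by
  refine smooth2_of_param (E := 𝔼 (2 * m) × ∀ a, 𝔼 (2 * n a)) fun y => ?_
  obtain ⟨x₀, q, rfl⟩ : ∃ x q, S.projY (x, q) = y := ⟨_, _, S.projY_lift y⟩
  obtain ⟨σ, l, hg⟩ := S.exists_isGauge x₀ q
  refine ⟨_, _, hg.isSection.par_pt S x₀, hg.smAt_par S, (hg.adapted_pt S).bijective_md S, ?_⟩
  have hs := smAt_chart_symm (d := 2 * m) x₀ (chart_mem x₀)
  refine (contDiffAt_modelForm (hΩ.kahler.smooth_form.contDiffAt (mem_chart_self x₀))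
    (hs.contDiffAt_fun hΩ.smooth_mom) (S.contDiffAt_pot hg.isSection.smAt)
    (fun a => hs.contDiffAt_fun (S.contMDiff_aff (c := c) hΩ a))
    (fun a => (S.kahler_B a).smooth_form.contDiffAt (mem_chart_self _))).congr_of_eventuallyEq ?_
  exact (hg.adapted S).mono fun z hz => hz.pb2_form S (hg.md_l _ hz.mem) hΩ

theorem formY_self (y : Y) (u : 𝔼 (2 * (m + ∑ a, n a))) :
    (S.formY c Ω μ y : 𝔼 (2 * (m + ∑ a, n a)) →L[ℝ] 𝔼 (2 * (m + ∑ a, n a)) →L[ℝ] ℝ) u u = 0 := by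
  obtain ⟨z, h, rfl, rfl, -⟩ := S.exists_hor y u
  rw [S.formY_dY hΩ, S.formZ_self hΩ.kahler.alternating]

theorem closed_formY : IsClosed2 (S.formY c Ω μ) := by
  refine isClosed2_of_param (E := 𝔼 (2 * m) × ∀ a, 𝔼 (2 * n a)) (S.smooth_formY hΩ)
    (S.formY_self hΩ) fun y => ?_
  obtain ⟨x₀, q, rfl⟩ : ∃ x q, S.projY (x, q) = y := ⟨_, _, S.projY_lift y⟩
  obtain ⟨σ, l, hg⟩ := S.exists_isGauge x₀ q
  refine ⟨_, _, hg.isSection.par_pt S x₀, hg.smAt_par S, (hg.adapted_pt S).bijective_md S,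
    fun v₁ v₂ v₃ => ?_⟩
  have hs := smAt_chart_symm (d := 2 * m) x₀ (chart_mem x₀)
  have e : pb2 (S.par x₀ σ) (S.formY c Ω μ) =ᶠ[𝓝 (S.pt x₀ q)] _ :=
    (hg.adapted S).mono fun z hz => hz.pb2_form S (hg.md_l _ hz.mem) hΩ
  rw [cyc, e.fderiv_eq, ← cyc]
  refine cyc_modelForm (p := fun a i => (S.p a i : ℝ))
    (hΩ.kahler.smooth_form.contDiffAt (mem_chart_self x₀))
    (hs.contDiffAt_fun hΩ.smooth_mom) (S.contDiffAt_pot hg.isSection.smAt)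
    (fun a => hs.contDiffAt_fun (S.contMDiff_aff (c := c) hΩ a))
    (fun a => (S.kahler_B a).smooth_form.contDiffAt (mem_chart_self _)) hg.pot_base
    (hΩ.kahler.closed.cyc_pb2 hΩ.kahler.smooth_form hΩ.kahler.alternating hs)
    (fun a => (S.kahler_B a).closed.cyc_pb2 (S.kahler_B a).smooth_form (S.kahler_B a).alternating
      (smAt_chart_symm _ (S.base_mem q a)))
    (fun a v w => coord2_alt (S.kahler_B a).alternating _ _ _ _) ?_ ?_ v₁ v₂ v₃
  · intro a v
    have h1 := hs.fderiv_fun (f := fun x => S.aff c a (μ x))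
      ((S.contMDiff_aff hΩ a).mdifferentiableAt (by simp)) v
    refine h1.trans ((S.dfun_aff hΩ a _ _).trans (Finset.sum_congr rfl fun i _ => ?_))
    congr 1
    exact (hs.fderiv_fun (f := fun x => μ x i)
      ((hΩ.contMDiff_mu i).mdifferentiableAt (by simp)) v).symm
  · intro b b' i
    rw [hg.fderiv_pot]
    simp only [Pi.smul_apply, Finset.sum_apply, smul_eq_mul]

theorem formZ_hor (z : X × P) {h h' : 𝔼 (2 * m) × 𝔼 (2 * (∑ a, n a) + r)} (hh : S.con z.2 h.2 = 0)
    (hh' : S.con z.2 h'.2 = 0) : S.formZ c Ω μ z h h' =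
      (Ω z.1 : 𝔼 (2 * m) →L[ℝ] 𝔼 (2 * m) →L[ℝ] ℝ) h.1 h'.1 + ∑ a, S.aff c a (μ z.1) *
        (S.ΩB a (S.projB z.2 a) : 𝔼 (2 * n a) →L[ℝ] 𝔼 (2 * n a) →L[ℝ] ℝ)
          (S.dB z.2 h.2 a) (S.dB z.2 h'.2 a) := by
  rw [formZ_apply, hh, hh']
  simp

theorem formY_JY (y : Y) (u w : 𝔼 (2 * (m + ∑ a, n a))) :
    (S.formY c Ω μ y : 𝔼 (2 * (m + ∑ a, n a)) →L[ℝ] 𝔼 (2 * (m + ∑ a, n a)) →L[ℝ] ℝ)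
      (S.JY y u) (S.JY y w) = S.formY c Ω μ y u w := by
  obtain ⟨z, h, rfl, rfl, hh⟩ := S.exists_hor y u
  obtain ⟨h', rfl, hh'⟩ := S.exists_dY z w
  have h1 := S.JY_dY z h hh
  have h2 := S.JY_dY z h' hh'
  refine (congrArg₂ (fun a b => (S.formY c Ω μ (S.projY z) :
    𝔼 (2 * (m + ∑ a, n a)) →L[ℝ] 𝔼 (2 * (m + ∑ a, n a)) →L[ℝ] ℝ) a b) h1 h2).trans ?_
  refine (S.formY_dY hΩ z _ _).trans (Eq.trans ?_ (S.formY_dY hΩ z _ _).symm)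
  have e1 : (S.JZ z h).2 = S.JD z.2 h.2 := rfl
  have e2 : (S.JZ z h').2 = S.JD z.2 h'.2 := rfl
  rw [S.formZ_hor hΩ z hh hh', S.formZ_hor hΩ z (S.con_JD z.2 h.2) (S.con_JD z.2 h'.2), e1, e2,
    S.dprod_JD, S.dprod_JD]
  congr 1
  · exact hΩ.kahler.invariant z.1 h.1 h'.1
  · exact Finset.sum_congr rfl fun a _ => congrArg _ ((S.kahler_B a).invariant _ _ _)

theorem formY_pos (hc : ∀ a x, 0 < S.aff c a (μ x)) (y : Y) {u : 𝔼 (2 * (m + ∑ a, n a))} (hu : u ≠ 0) :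
    0 < (S.formY c Ω μ y : 𝔼 (2 * (m + ∑ a, n a)) →L[ℝ] 𝔼 (2 * (m + ∑ a, n a)) →L[ℝ] ℝ)
      u (S.JY y u) := by
  obtain ⟨z, h, rfl, rfl, hh⟩ := S.exists_hor y u
  have h1 := S.JY_dY z h hh
  refine lt_of_lt_of_eq ?_ (congrArg ((S.formY c Ω μ (S.projY z) :
    𝔼 (2 * (m + ∑ a, n a)) →L[ℝ] 𝔼 (2 * (m + ∑ a, n a)) →L[ℝ] ℝ) (S.dY z h)) h1).symm
  refine lt_of_lt_of_eq ?_ (S.formY_dY hΩ z _ _).symm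
  have e1 : (S.JZ z h).2 = S.JD z.2 h.2 := rfl
  rw [S.formZ_hor hΩ z hh (S.con_JD z.2 h.2), e1, S.dprod_JD]
  have hX : ∀ v : 𝔼 (2 * m), 0 ≤ (Ω z.1 : 𝔼 (2 * m) →L[ℝ] 𝔼 (2 * m) →L[ℝ] ℝ) v (S.JX z.1 v) := by
    intro v
    by_cases hv : v = 0
    · subst hv
      exact le_of_eq (DFunLike.congr_fun
        (map_zero (Ω z.1 : 𝔼 (2 * m) →L[ℝ] 𝔼 (2 * m) →L[ℝ] ℝ)) (S.JX z.1 0)).symm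
    · exact (hΩ.kahler.positive z.1 v hv).le
  have hB : ∀ a (v : 𝔼 (2 * n a)), 0 ≤ (S.ΩB a (S.projB z.2 a) :
      𝔼 (2 * n a) →L[ℝ] 𝔼 (2 * n a) →L[ℝ] ℝ) v (S.JB a (S.projB z.2 a) v) := by
    intro a v
    by_cases hv : v = 0
    · subst hv
      exact le_of_eq (DFunLike.congr_fun (map_zero (S.ΩB a (S.projB z.2 a) :
        𝔼 (2 * n a) →L[ℝ] 𝔼 (2 * n a) →L[ℝ] ℝ)) (S.JB a (S.projB z.2 a) 0)).symm
    · exact ((S.kahler_B a).positive _ v hv).le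
  have hsum : 0 ≤ ∑ a, S.aff c a (μ z.1) *
      (S.ΩB a (S.projB z.2 a) : 𝔼 (2 * n a) →L[ℝ] 𝔼 (2 * n a) →L[ℝ] ℝ)
        (S.dB z.2 h.2 a) (S.JBv (S.projB z.2) (S.dB z.2 h.2) a) :=
    Finset.sum_nonneg fun a _ => mul_nonneg (hc a _).le (hB a _)
  by_cases h1 : h.1 = 0
  · have h2 : S.dB z.2 h.2 ≠ 0 := by
      intro h2
      refine hu ?_
      have h3 : h = 0 := Prod.ext h1 (S.ext_P (q := z.2) (h2.trans (map_zero _).symm)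
        (hh.trans (map_zero _).symm))
      rw [h3, map_zero]
    obtain ⟨a, ha⟩ := Function.ne_iff.1 h2
    refine add_pos_of_nonneg_of_pos (hX _) (Finset.sum_pos' (fun a _ => mul_nonneg (hc a _).le (hB a _))
      ⟨a, Finset.mem_univ a, mul_pos (hc a _) ((S.kahler_B a).positive _ _ ha)⟩)
  · exact add_pos_of_pos_of_nonneg (hΩ.kahler.positive z.1 h.1 h1) hsum

/-- The bundle-compatible form is a Hamiltonian Kähler form. -/
theorem isHamKahler_formY (hc : ∀ a x, 0 < S.aff c a (μ x)) :
    IsHamKahler S.JY (S.formY c Ω μ) S.actY (S.down μ) := by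
  refine ⟨⟨S.smooth_JY, S.JY_JY, S.integrable_JY, S.smooth_formY hΩ, S.formY_self hΩ,
    S.closed_formY hΩ, S.formY_JY hΩ, fun y u hu => S.formY_pos hΩ hc y hu⟩, S.torus_Y, ?_, ?_,
    S.contMDiff_down hΩ.smooth_mom hΩ.mom_inv, ?_, ?_⟩
  · intro t y u
    obtain ⟨⟨x, q⟩, h, rfl, rfl, hh⟩ := S.exists_hor y u
    have h1 := S.JY_dY (x, q) h hh
    have h2 := S.dmap_actY t x q (S.JZ (x, q) h)
    have h3 := S.dmap_actY t x q h
    have h4 := S.JY_dY (S.actX t x, q) (dmap (S.actX t) x h.1, h.2) hh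
    have h5 : S.JZ (S.actX t x, q) (dmap (S.actX t) x h.1, h.2) =
        (dmap (S.actX t) x (S.JZ (x, q) h).1, (S.JZ (x, q) h).2) :=
      Prod.ext (S.act_JX t x h.1).symm rfl
    rw [h5] at h4
    have h6 : ∀ (y y' : Y) (v : 𝔼 (2 * (m + ∑ a, n a))), y = y' →
        (S.JY y : 𝔼 (2 * (m + ∑ a, n a)) →L[ℝ] 𝔼 (2 * (m + ∑ a, n a))) v = S.JY y' v := by
      rintro y _ v rfl; rfl
    refine (congrArg (dmap (S.actY t) (S.projY (x, q))) h1).trans (h2.trans (h4.symm.trans ?_))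
    refine (h6 _ _ _ (S.actY_projY t x q).symm).trans ?_
    exact congrArg (S.JY (S.actY t (S.projY (x, q))) :
      𝔼 (2 * (m + ∑ a, n a)) →L[ℝ] 𝔼 (2 * (m + ∑ a, n a))) h3.symm
  · intro t y u w
    obtain ⟨⟨x, q⟩, h, rfl, rfl, hh⟩ := S.exists_hor y u
    obtain ⟨h', rfl, hh'⟩ := S.exists_dY (x, q) w
    have h3 := S.dmap_actY t x q h
    have h3' := S.dmap_actY t x q h'
    have h6 : ∀ (y y' : Y) (v w : 𝔼 (2 * (m + ∑ a, n a))), y = y' →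
        (S.formY c Ω μ y : 𝔼 (2 * (m + ∑ a, n a)) →L[ℝ] 𝔼 (2 * (m + ∑ a, n a)) →L[ℝ] ℝ) v w =
          S.formY c Ω μ y' v w := by
      rintro y _ v w rfl; rfl
    refine (congrArg₂ (fun a b => (S.formY c Ω μ (S.actY t (S.projY (x, q))) :
      𝔼 (2 * (m + ∑ a, n a)) →L[ℝ] 𝔼 (2 * (m + ∑ a, n a)) →L[ℝ] ℝ) a b) h3 h3').trans ?_
    refine (h6 _ _ _ _ (S.actY_projY t x q)).trans ?_
    refine (S.formY_dY hΩ _ _ _).trans (Eq.trans ?_ (S.formY_dY hΩ _ _ _).symm)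
    have h7 := S.formZ_hor hΩ (c := c) (S.actX t x, q) (h := (dmap (S.actX t) x h.1, h.2))
      (h' := (dmap (S.actX t) x h'.1, h'.2)) hh hh'
    refine h7.trans (Eq.trans ?_ (S.formZ_hor hΩ (x, q) hh hh').symm)
    dsimp only
    rw [hΩ.mom_inv]
    exact congrArg₂ (· + ·) (hΩ.act_form t x h.1 h'.1) rfl
  · intro t y
    obtain ⟨x, q, rfl⟩ : ∃ x q, S.projY (x, q) = y := ⟨_, _, S.projY_lift y⟩
    rw [S.actY_projY, S.down_projY hΩ.mom_inv, S.down_projY hΩ.mom_inv, hΩ.mom_inv]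
  · intro ξ y u
    obtain ⟨⟨x, q⟩, h, rfl, rfl, hh⟩ := S.exists_hor y u
    have h1 := S.gen_actY ξ x q
    refine (congrArg (fun a => (S.formY c Ω μ (S.projY (x, q)) :
      𝔼 (2 * (m + ∑ a, n a)) →L[ℝ] 𝔼 (2 * (m + ∑ a, n a)) →L[ℝ] ℝ) a (S.dY (x, q) h)) h1).trans ?_
    refine (S.formY_dY hΩ _ _ _).trans ?_
    have h2 := S.dfun_down (hΩ.contMDiff_pair ξ) (fun t x => by rw [hΩ.mom_inv]) (x, q) h
    rw [S.formZ_hor hΩ _ (map_zero _) hh]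
    have h3 : ∀ a (v : 𝔼 (2 * n a)), (S.ΩB a (S.projB q a) :
        𝔼 (2 * n a) →L[ℝ] 𝔼 (2 * n a) →L[ℝ] ℝ) (S.dB q 0 a) v = 0 := by
      intro a v
      have h4 : S.dB q 0 a = 0 := by rw [map_zero]; rfl
      rw [h4]
      exact DFunLike.congr_fun (map_zero (S.ΩB a (S.projB q a) :
        𝔼 (2 * n a) →L[ℝ] 𝔼 (2 * n a) →L[ℝ] ℝ)) v
    have h5 : ∑ a, S.aff c a (μ x) * (S.ΩB a (S.projB q a) :
        𝔼 (2 * n a) →L[ℝ] 𝔼 (2 * n a) →L[ℝ] ℝ) (S.dB q 0 a) (S.dB q h.2 a) = 0 :=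
      Finset.sum_eq_zero fun a _ => mul_eq_zero_of_right _ (h3 a _)
    refine (congrArg₂ (· + ·) (hΩ.mom ξ x h.1) h5).trans ((add_zero _).trans ?_)
    exact congrArg Neg.neg h2.symm

end Form

/-! ### Relative Kähler potentials on the fibration -/

section Potential

variable {φ : X → ℝ}

section Pot

variable {x₀ : X} {q : P} {σ : (∀ a, 𝔼 (2 * n a)) → P} {l : 𝔼 (2 * m) → LieT r →L[ℝ] 𝔼 (2 * m)}

theorem Adapted.pb1_dc_down {z : 𝔼 (2 * m) × ∀ a, 𝔼 (2 * n a)} (hz : S.Adapted x₀ q σ z)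
    (hl : ∀ ξ, md (chart (2 * m) x₀).symm z.1 (l z.1 ξ) = S.genX ξ ((chart (2 * m) x₀).symm z.1))
    (hφ : φ ∈ SmoothInv (2 * m) S.actX) :
    pb1 (S.par x₀ σ) (dc S.JY (S.down φ)) z =
      (coord1 (dc S.JX φ) x₀ z.1).comp (shear l (S.pot σ) z) := by
  refine ContinuousLinearMap.ext fun v => ?_
  have h1 : pb1 (S.par x₀ σ) (dc S.JY (S.down φ)) z v =
      -dfun (S.down φ) (S.par x₀ σ z) ((S.JY (S.par x₀ σ z) :
        𝔼 (2 * (m + ∑ a, n a)) →L[ℝ] 𝔼 (2 * (m + ∑ a, n a)))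
          (md (d := 2 * (m + ∑ a, n a)) (S.par x₀ σ) z v)) := rfl
  rw [h1, hz.JY_md S hl]
  have h2 := S.dfun_down hφ.1 hφ.2 ((chart (2 * m) x₀).symm z.1, σ z.2)
    (md (chart (2 * m) x₀).symm z.1 (coordEnd S.JX x₀ z.1 (v.1 + l z.1 (S.pot σ z.2 v.2))),
          S.JD (σ z.2) (md σ z.2 v.2))
  refine (congrArg Neg.neg h2).trans ?_
  exact congrArg (fun t => -dfun φ ((chart (2 * m) x₀).symm z.1) t) (hz.md_chart_J S _)

variable (hg : S.IsGauge x₀ q σ l)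
include hg

/-- `dd^c φ` on `Y`: the curvature pairs with `d^c φ`, which produces the shift of the momentum
map. -/
theorem IsGauge.pb2_ddc_down (hφ : φ ∈ SmoothInv (2 * m) S.actX) (v w : 𝔼 (2 * m) × ∀ a, 𝔼 (2 * n a)) :
    pb2 (S.par x₀ σ) (ddc S.JY (S.down φ)) (S.pt x₀ q) v w =
      coord2 (ddc S.JX φ) x₀ (chart (2 * m) x₀ x₀) v.1 w.1 +
        ∑ a, dcGen S.JX S.actX φ (fun i => (S.p a i : ℝ)) x₀ *
          coord2 (S.ΩB a) (S.projB q a) (S.base q a) (v.2 a) (w.2 a) := by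
  have hsX := smooth1_dc hφ.1 S.smooth_JX
  have hsY := smooth1_dc (S.contMDiff_down hφ.1 hφ.2) S.smooth_JY
  have hs := smAt_chart_symm (d := 2 * m) x₀ (chart_mem x₀)
  have e : pb1 (S.par x₀ σ) (dc S.JY (S.down φ)) =ᶠ[𝓝 (S.pt x₀ q)]
      fun z => (coord1 (dc S.JX φ) x₀ z.1).comp (shear l (S.pot σ) z) :=
    (hg.adapted S).mono fun z hz => hz.pb1_dc_down S (hg.md_l _ hz.mem) hφ
  have h1 : pb2 (S.par x₀ σ) (ddc S.JY (S.down φ)) (S.pt x₀ q) =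
    curl (pb1 (S.par x₀ σ) (dc S.JY (S.down φ))) (S.pt x₀ q) := pb2_extd hsY (hg.smAt_par S)
  have h2 : coord2 (ddc S.JX φ) x₀ (chart (2 * m) x₀ x₀) =
    curl (coord1 (dc S.JX φ) x₀) (chart (2 * m) x₀ x₀) := pb2_extd hsX hs
  have h3 : curl (pb1 (S.par x₀ σ) (dc S.JY (S.down φ))) (S.pt x₀ q) =
      curl (fun z : 𝔼 (2 * m) × ∀ a, 𝔼 (2 * n a) =>
        (coord1 (dc S.JX φ) x₀ z.1).comp (shear l (S.pot σ) z)) (S.pt x₀ q) := by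
    rw [curl, curl, e.fderiv_eq]
  rw [h1, h2, h3]
  refine (curl_comp_shear (hsX.contDiffAt (mem_chart_self x₀)) (hg.smooth_l _ (chart_mem x₀))
    (S.contDiffAt_pot hg.isSection.smAt) hg.pot_base v w).trans ?_
  congr 1
  have h4 : fderiv ℝ (S.pot σ) (S.base q) v.2 w.2 - fderiv ℝ (S.pot σ) (S.base q) w.2 v.2 =
      ∑ a, coord2 (S.ΩB a) (S.projB q a) (S.base q a) (v.2 a) (w.2 a) • fun i => (S.p a i : ℝ) := by
    rw [hg.fderiv_pot_antisymm S w.2 v.2, sub_neg_eq_add, hg.fderiv_pot, ← add_smul]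
    norm_num
  rw [h4, map_sum, map_sum]
  refine Finset.sum_congr rfl fun a _ => ?_
  rw [map_smul, map_smul, smul_eq_mul, mul_comm]
  congr 1
  have h5 : ∀ x, x = x₀ → dcGen S.JX S.actX φ (fun i => (S.p a i : ℝ)) x =
    dcGen S.JX S.actX φ (fun i => (S.p a i : ℝ)) x₀ := by rintro _ rfl; rfl
  refine Eq.trans ?_ (h5 _ (chart_symm_self (m := m) x₀))
  exact congrArg (dc S.JX φ ((chart (2 * m) x₀).symm (chart (2 * m) x₀ x₀)) : 𝔼 (2 * m) →L[ℝ] ℝ)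
    (hg.md_l _ (chart_mem x₀) _)

end Pot

section Form

variable {c : Fin k → ℝ} {Ω : BilForm (2 * m) X ℝ} {μ : X → LieT r}
  (hΩ : IsHamKahler S.JX Ω S.actX μ)
include hΩ

theorem aff_momOf (a : Fin k) (x : X) :
    S.aff c a (momOf S.JX S.actX μ φ x) =
      S.aff c a (μ x) + dcGen S.JX S.actX φ (fun i => (S.p a i : ℝ)) x := by
  rw [aff, pair_momOf hΩ, aff]
  ring

/-- The positivity of the weights `⟨p_a, μ⟩ + c_a` persists in the Kähler class. -/
theorem aff_momOf_pos [CompactSpace X] (hc : ∀ a x, 0 < S.aff c a (μ x))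
    (hφ : φ ∈ potentials S.JX Ω S.actX) (a : Fin k) (x : X) :
    0 < S.aff c a (momOf S.JX S.actX μ φ x) := by
  obtain ⟨y, hy⟩ := exists_pair_le_momOf hΩ hφ (fun i => (S.p a i : ℝ)) x
  have h1 := hc a y
  rw [aff] at h1 ⊢
  linarith

/-- The form `ω̃ + dd^c φ` on `Y` is the one induced by `ω_φ` and `μ_φ`. -/
theorem formOf_down (hφ : φ ∈ potentials S.JX Ω S.actX) :
    formOf S.JY (S.formY c Ω μ) (S.down φ) =
      S.formY c (formOf S.JX Ω φ) (momOf S.JX S.actX μ φ) := by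
  funext y
  obtain ⟨x₀, q, rfl⟩ : ∃ x q, S.projY (x, q) = y := ⟨_, _, S.projY_lift y⟩
  obtain ⟨σ, l, hg⟩ := S.exists_isGauge x₀ q
  have had := hg.adapted_pt S
  have hl := hg.md_l _ had.mem
  have key : pb2 (S.par x₀ σ) (formOf S.JY (S.formY c Ω μ) (S.down φ)) (S.pt x₀ q) =
      pb2 (S.par x₀ σ) (S.formY c (formOf S.JX Ω φ) (momOf S.JX S.actX μ φ)) (S.pt x₀ q) := by
    refine ContinuousLinearMap.ext fun v => ContinuousLinearMap.ext fun w => ?_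
    have e1 : pb2 (S.par x₀ σ) (formOf S.JY (S.formY c Ω μ) (S.down φ)) (S.pt x₀ q) v w =
      pb2 (S.par x₀ σ) (S.formY c Ω μ) (S.pt x₀ q) v w +
        pb2 (S.par x₀ σ) (ddc S.JY (S.down φ)) (S.pt x₀ q) v w := rfl
    have e2 : coord2 (formOf S.JX Ω φ) x₀ (chart (2 * m) x₀ x₀) v.1 w.1 =
      coord2 Ω x₀ (chart (2 * m) x₀ x₀) v.1 w.1 +
        coord2 (ddc S.JX φ) x₀ (chart (2 * m) x₀ x₀) v.1 w.1 := rfl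
    have hA : S.pot σ (S.pt x₀ q).2 = 0 := hg.pot_base
    have ex : (chart (2 * m) x₀).symm (S.pt x₀ q).1 = x₀ := chart_symm_self x₀
    rw [e1, had.pb2_form S hl hΩ, had.pb2_form S hl (hΩ.formOf hφ), hg.pb2_ddc_down S hφ.1,
      modelForm_apply, modelForm_apply, hA, ex]
    have e3 : (S.pt x₀ q).1 = chart (2 * m) x₀ x₀ := rfl
    have e4 : (S.pt x₀ q).2 = S.base q := rfl
    rw [e3, e4, e2]
    simp only [S.aff_momOf hΩ, zero_apply, Pi.zero_apply, mul_zero, zero_mul, sub_self,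
      Finset.sum_const_zero, add_zero, add_mul, Finset.sum_add_distrib]
    ring
  have hb := had.bijective_md S
  have h2 : ∀ y', y' = S.projY (x₀, q) →
      (∀ u w : 𝔼 (2 * (m + ∑ a, n a)), (formOf S.JY (S.formY c Ω μ) (S.down φ) y' :
        𝔼 (2 * (m + ∑ a, n a)) →L[ℝ] 𝔼 (2 * (m + ∑ a, n a)) →L[ℝ] ℝ) u w =
        S.formY c (formOf S.JX Ω φ) (momOf S.JX S.actX μ φ) y' u w) →
      formOf S.JY (S.formY c Ω μ) (S.down φ) (S.projY (x₀, q)) =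
        S.formY c (formOf S.JX Ω φ) (momOf S.JX S.actX μ φ) (S.projY (x₀, q)) := by
    rintro _ rfl h
    exact ContinuousLinearMap.ext fun u => ContinuousLinearMap.ext fun w => h u w
  refine h2 _ (hg.isSection.par_pt S x₀) fun u w => ?_
  obtain ⟨v, rfl⟩ := hb.2 u
  obtain ⟨v', rfl⟩ := hb.2 w
  exact DFunLike.congr_fun (DFunLike.congr_fun key v) v'

theorem momOf_down (hφ : φ ∈ SmoothInv (2 * m) S.actX) (x : X) (q : P) :
    momOf S.JY S.actY (S.down μ) (S.down φ) (S.projY (x, q)) = momOf S.JX S.actX μ φ x := by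
  ext i
  refine congrArg₂ (· + ·) (congrFun (S.down_projY hΩ.mom_inv x q) i) ?_
  have h1 := S.gen_actY (bas i) x q
  have h2 := S.JY_dY (x, q) (S.genX (bas i) x, 0) (map_zero _)
  refine (dc_apply S.JY (S.down φ) (S.projY (x, q)) (genV _ S.actY (bas i) (S.projY (x, q)))).trans ?_
  refine (congrArg (fun t => -dfun (S.down φ) (S.projY (x, q)) ((S.JY (S.projY (x, q)) :
    𝔼 (2 * (m + ∑ a, n a)) →L[ℝ] 𝔼 (2 * (m + ∑ a, n a))) t)) h1).trans ?_
  refine (congrArg (fun t => -dfun (S.down φ) (S.projY (x, q)) t) h2).trans ?_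
  exact congrArg Neg.neg (S.dfun_down hφ.1 hφ.2 (x, q) _)

theorem momOf_down_eq (hφ : φ ∈ potentials S.JX Ω S.actX) :
    momOf S.JY S.actY (S.down μ) (S.down φ) = S.down (momOf S.JX S.actX μ φ) := by
  funext y
  obtain ⟨x, q, rfl⟩ : ∃ x q, S.projY (x, q) = y := ⟨_, _, S.projY_lift y⟩
  rw [S.momOf_down hΩ hφ.1, S.down_projY (hΩ.formOf hφ).mom_inv]

theorem down_mem_smoothInv (hφ : φ ∈ SmoothInv (2 * m) S.actX) :
    S.down φ ∈ SmoothInv (2 * (m + ∑ a, n a)) S.actY := by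
  refine ⟨S.contMDiff_down hφ.1 hφ.2, fun t y => ?_⟩
  obtain ⟨x, q, rfl⟩ : ∃ x q, S.projY (x, q) = y := ⟨_, _, S.projY_lift y⟩
  rw [S.actY_projY, S.down_projY hφ.2, S.down_projY hφ.2, hφ.2]

theorem down_mem_potentials [CompactSpace X] (hc : ∀ a x, 0 < S.aff c a (μ x))
    (hφ : φ ∈ potentials S.JX Ω S.actX) :
    S.down φ ∈ potentials S.JY (S.formY c Ω μ) S.actY := by
  refine ⟨S.down_mem_smoothInv hΩ hφ.1, ?_⟩
  rw [S.formOf_down hΩ hφ]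
  exact (S.isHamKahler_formY (hΩ.formOf hφ) (S.aff_momOf_pos hΩ hc hφ)).kahler.positive

end Form

end Potential

/-! ### Scalar curvature and Laplacian of the fibration -/

/-- The logarithmic derivative `p_{,j} / p` of the weight `p`. -/
def psi (c : Fin k → ℝ) (j : Fin r) (y : LieT r) : ℝ := ∑ a, n a / S.aff c a y * S.p a j

/-- The derivative `-∂_i (p_{,j} / p)`. -/
def chi (c : Fin k → ℝ) (i j : Fin r) (y : LieT r) : ℝ :=
  ∑ a, n a / S.aff c a y ^ 2 * (S.p a i * S.p a j)

theorem hasFDerivAt_aff (c : Fin k → ℝ) (a : Fin k) (y : LieT r) : HasFDerivAt (S.aff c a)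
    (∑ i, (S.p a i : ℝ) • ContinuousLinearMap.proj (R := ℝ) (φ := fun _ : Fin r => ℝ) i) y :=
  (HasFDerivAt.fun_sum fun i _ => (hasFDerivAt_apply i y).const_mul (S.p a i : ℝ)).add_const (c a)

theorem fderiv_aff (c : Fin k → ℝ) (a : Fin k) (y : LieT r) (i : Fin r) :
    fderiv ℝ (S.aff c a) y (bas i) = S.p a i := by
  rw [(S.hasFDerivAt_aff c a y).fderiv, sum_apply]
  simp [bas, Pi.single_apply]

theorem contDiff_aff (c : Fin k → ℝ) (a : Fin k) : ContDiff ℝ ∞ (S.aff c a) :=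
  (ContDiff.sum fun i _ => contDiff_const.mul (contDiff_apply ℝ ℝ i)).add contDiff_const

theorem hess_aff (c : Fin k → ℝ) (a : Fin k) (y : LieT r) (i j : Fin r) :
    hess (S.aff c a) i j y = 0 := by
  simp only [hess, S.fderiv_aff, fderiv_fun_const, Pi.zero_apply, zero_apply]

section Curvature

variable {c : Fin k → ℝ} {Ω : BilForm (2 * m) X ℝ} {μ : X → LieT r}
  (hΩ : IsHamKahler S.JX Ω S.actX μ)
include hΩ

theorem laplacian_aff (a : Fin k) (x : X) : laplacian (metric S.JX Ω) (fun x => S.aff c a (μ x)) x =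
    ∑ i, (S.p a i : ℝ) * laplacian (metric S.JX Ω) (fun x => μ x i) x := by
  rw [hΩ.laplacian_comp (S.contDiff_aff c a)]
  simp only [S.fderiv_aff, S.hess_aff, zero_mul, Finset.sum_const_zero, sub_zero]

/-- The generators of the action on `Y` are induced by those on `X`, whence the same Gram matrix. -/
theorem genGram_formY (i j : Fin r) (x : X) (q : P) :
    genGram S.JY (S.formY c Ω μ) S.actY i j (S.projY (x, q)) = genGram S.JX Ω S.actX i j x := by
  have h0 : S.con (x, q).2 ((S.genX (bas j) x, 0) : 𝔼 (2 * m) × 𝔼 (2 * (∑ a, n a) + r)).2 = 0 :=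
    map_zero _
  have h1 : genGram S.JY (S.formY c Ω μ) S.actY i j (S.projY (x, q)) =
      S.formY c Ω μ (S.projY (x, q)) (genV (2 * (m + ∑ a, n a)) S.actY (bas i) (S.projY (x, q)))
      ((S.JY (S.projY (x, q)) : 𝔼 (2 * (m + ∑ a, n a)) →L[ℝ] 𝔼 (2 * (m + ∑ a, n a)))
        (genV (2 * (m + ∑ a, n a)) S.actY (bas j) (S.projY (x, q)))) := rfl
  rw [h1, S.gen_actY, S.gen_actY]
  refine (congrArg _ (S.JY_dY (x, q) (S.genX (bas j) x, 0) h0)).trans ?_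
  refine (S.formY_dY hΩ _ _ _).trans ((S.formZ_hor hΩ _ (map_zero _) (S.con_JD _ _)).trans ?_)
  have h2 : ∀ a, S.aff c a (μ x) * (S.ΩB a (S.projB q a) :
      𝔼 (2 * n a) →L[ℝ] 𝔼 (2 * n a) →L[ℝ] ℝ) (S.dB q 0 a)
        (S.dB q (S.JZ (x, q) (S.genX (bas j) x, 0)).2 a) = 0 := by
    intro a
    have h3 : ∀ (A : 𝔼 (2 * n a) →L[ℝ] 𝔼 (2 * n a) →L[ℝ] ℝ) w, A (S.dB q 0 a) w = 0 := by
      intro A w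
      rw [map_zero, Pi.zero_apply, map_zero, zero_apply]
    exact (congrArg _ (h3 _ _)).trans (mul_zero _)
  refine (congrArg _ (Finset.sum_eq_zero fun a _ => h2 a)).trans (add_zero _)

section Gauge

variable {x₀ : X} {q : P} {σ : (∀ a, 𝔼 (2 * n a)) → P} {l : 𝔼 (2 * m) → LieT r →L[ℝ] 𝔼 (2 * m)}
  (hg : S.IsGauge x₀ q σ l)
include hg

theorem IsGauge.pb2_metric_eventuallyEq : pb2 (S.par x₀ σ) (metric S.JY (S.formY c Ω μ)) =ᶠ[𝓝 (S.pt x₀ q)]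
    modelG (coord2 (metric S.JX Ω) x₀) l (S.pot σ) (fun a u => S.aff c a (μ ((chart (2 * m) x₀).symm u)))
      (fun a => coord2 (metric (S.JB a) (S.ΩB a)) (S.projB q a)) :=
  (hg.adapted S).mono fun _ hz => hz.pb2_metric S (hg.md_l _ hz.mem) hΩ

theorem IsGauge.isModel : IsModel (coord2 (metric S.JX Ω) x₀) l (S.pot σ)
    (fun a u => S.aff c a (μ ((chart (2 * m) x₀).symm u)))
    (fun a => coord2 (metric (S.JB a) (S.ΩB a)) (S.projB q a)) (chart (2 * m) x₀ x₀) (S.base q) where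
  smooth_g := hΩ.kahler.isRiem.smooth.contDiffAt (mem_chart_self x₀)
  smooth_l := hg.smooth_l _ (chart_mem x₀)
  smooth_A := S.contDiffAt_pot hg.isSection.smAt
  smooth_f a := (smAt_chart_symm (d := 2 * m) x₀ (chart_mem x₀)).contDiffAt_fun
    (S.contMDiff_aff (c := c) hΩ a)
  smooth_h a := (S.kahler_B a).isRiem.smooth.contDiffAt (mem_chart_self _)
  symm_g := hΩ.kahler.isRiem.coord2_symm x₀
  symm_h a := (S.kahler_B a).isRiem.coord2_symm _
  A_zero := hg.pot_base
  antisymm := hg.fderiv_pot_antisymm S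

/-- The length of the generator of `p_a` is the length of the gradient of `⟨p_a, μ⟩ + c_a`. -/
theorem IsGauge.norm_gen_eq {ι : Type*} [Fintype ι] [DecidableEq ι] {e : ι → 𝔼 (2 * m)}
    (he : IsFrame (coord2 (metric S.JX Ω) x₀ (chart (2 * m) x₀ x₀)) e) (a : Fin k) :
    coord2 (metric S.JX Ω) x₀ (chart (2 * m) x₀ x₀)
      (l (chart (2 * m) x₀ x₀) fun i => (S.p a i : ℝ)) (l (chart (2 * m) x₀ x₀) fun i => (S.p a i : ℝ)) =
    ∑ i, fderiv ℝ (fun u => S.aff c a (μ ((chart (2 * m) x₀).symm u))) (chart (2 * m) x₀ x₀) (e i) ^ 2 := by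
  have hs := smAt_chart_symm (d := 2 * m) x₀ (chart_mem x₀)
  refine (hΩ.kahler.sum_form_sq (c := (chart (2 * m) x₀).symm) (bijective_frame (chart_mem x₀)).2
    he _).symm.trans (Finset.sum_congr rfl fun i _ => ?_)
  have h1 := hs.fderiv_fun (f := fun x => S.aff c a (μ x))
    ((S.contMDiff_aff (c := c) hΩ a).mdifferentiableAt (by simp)) (e i)
  have h2 := hΩ.mom (fun i => (S.p a i : ℝ)) ((chart (2 * m) x₀).symm (chart (2 * m) x₀ x₀))
    (md (chart (2 * m) x₀).symm (chart (2 * m) x₀ x₀) (e i))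
  have h3 := hΩ.dfun_pair (fun i => (S.p a i : ℝ)) ((chart (2 * m) x₀).symm (chart (2 * m) x₀ x₀))
    (md (chart (2 * m) x₀).symm (chart (2 * m) x₀ x₀) (e i))
  have h4 : fderiv ℝ (fun u => S.aff c a (μ ((chart (2 * m) x₀).symm u))) (chart (2 * m) x₀ x₀) (e i) =
      dfun (fun x => pair (fun i => (S.p a i : ℝ)) (μ x))
        ((chart (2 * m) x₀).symm (chart (2 * m) x₀ x₀))
        (md (chart (2 * m) x₀).symm (chart (2 * m) x₀ x₀) (e i)) :=
    h1.trans ((S.dfun_aff hΩ a _ _).trans h3.symm)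
  have h5 : pb2 (d := 2 * m) (chart (2 * m) x₀).symm Ω (chart (2 * m) x₀ x₀)
      (l (chart (2 * m) x₀ x₀) fun i => (S.p a i : ℝ)) (e i) =
      -dfun (d := 2 * m) (fun x => pair (fun i => (S.p a i : ℝ)) (μ x))
        ((chart (2 * m) x₀).symm (chart (2 * m) x₀ x₀))
        (md (d := 2 * m) (chart (2 * m) x₀).symm (chart (2 * m) x₀ x₀) (e i)) := by
    rw [pb2_apply, hg.md_l _ (chart_mem (m := m) x₀)]
    exact h2
  rw [h4, h5, neg_sq]

end Gauge

variable (hc : ∀ a x, 0 < S.aff c a (μ x))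
include hc

/-- The scalar curvature of `Y`, and the Laplacians of the components of the momentum map. -/
theorem curvature_formY (x : X) (q : P) :
    scal (metric S.JY (S.formY c Ω μ)) (S.projY (x, q)) = scal (metric S.JX Ω) x + S.qWeight c (μ x) +
      2 * ∑ j, S.psi c j (μ x) * laplacian (metric S.JX Ω) (fun x => μ x j) x +
      ∑ i, ∑ j, (S.chi c i j (μ x) - S.psi c i (μ x) * S.psi c j (μ x)) *
        genGram S.JX Ω S.actX i j x ∧
    ∀ j, laplacian (metric S.JY (S.formY c Ω μ)) (fun y => S.down μ y j) (S.projY (x, q)) =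
      laplacian (metric S.JX Ω) (fun x => μ x j) x -
        ∑ i, S.psi c i (μ x) * genGram S.JX Ω S.actX i j x := by
  obtain ⟨σ, l, hg⟩ := S.exists_isGauge x q
  have hm := hg.isModel S hΩ (c := c)
  have hs := smAt_chart_symm (d := 2 * m) x (chart_mem x)
  have hbX := bijective_frame (d := 2 * m) (x₀ := x) (chart_mem (m := m) x)
  have hY := (S.isHamKahler_formY hΩ hc)
  have hpt := hg.isSection.par_pt S x
  have hx : (chart (2 * m) x).symm (chart (2 * m) x x) = x :=
    chart_symm_self (m := m) x
  have hxb : ∀ a, (chart (2 * n a) (S.projB q a)).symm (S.base q a) = S.projB q a := fun a =>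
    (chart (2 * n a) (S.projB q a)).left_inv (mem_chart_self (d := 2 * n a) _)
  obtain ⟨e, he⟩ := hΩ.kahler.isRiem.exists_frame (c := (chart (2 * m) x).symm) hbX.1
  choose ε hε using fun a => (S.kahler_B a).isRiem.exists_frame
    (c := (chart (2 * n a) (S.projB q a)).symm) (bijective_frame (S.base_mem q a)).1
  have hf : ∀ a, (Real.sqrt (S.aff c a (μ ((chart (2 * m) x).symm (chart (2 * m) x x)))))⁻¹ ^ 2 *
      S.aff c a (μ ((chart (2 * m) x).symm (chart (2 * m) x x))) = 1 := by
    intro a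
    rw [inv_pow, Real.sq_sqrt (hc a _).le, inv_mul_cancel₀ (hc a _).ne']
  have hframe := hm.isFrame he hε hf
  have hcong := hg.pb2_metric_eventuallyEq S hΩ (c := c)
  have hframeY := hframe
  rw [show modelG _ _ _ _ _ (chart (2 * m) x x, S.base q) = _ from hcong.self_of_nhds.symm] at hframeY
  have hsY := hg.smAt_par S
  have hbY := ((hg.adapted_pt S).bijective_md S).2
  have hcard : ∀ a, (Fintype.card (Fin (Module.finrank ℝ (𝔼 (2 * n a)))) : ℝ) = 2 * n a := by
    intro a; simp
  -- the square norm of `ω_a` is the real dimension of `B_a`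
  have hβ : ∀ a, ∑ i, ∑ j, coord2 (S.ΩB a) (S.projB q a) (S.base q a) (ε a i) (ε a j) ^ 2 =
      Fintype.card (Fin (Module.finrank ℝ (𝔼 (2 * n a)))) := by
    intro a
    have h1 : ∀ i, ∑ j, coord2 (S.ΩB a) (S.projB q a) (S.base q a) (ε a i) (ε a j) ^ 2 = 1 := by
      intro i
      refine ((S.kahler_B a).sum_form_sq (c := (chart (2 * n a) (S.projB q a)).symm)
        (bijective_frame (S.base_mem q a)).2 (hε a) (ε a i)).trans ?_
      rw [(hε a).orth, if_pos rfl]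
    simp only [h1, Finset.sum_const, Finset.card_univ, nsmul_eq_mul, mul_one]
  -- the derivatives of the momentum map in the frame
  let D : Fin r → Fin (Module.finrank ℝ (𝔼 (2 * m))) → ℝ := fun j i =>
    fderiv ℝ (fun u => μ ((chart (2 * m) x).symm u) j) (chart (2 * m) x x) (e i)
  have hD : ∀ i j, ∑ κ, D i κ * D j κ = genGram S.JX Ω S.actX i j x := by
    intro i j
    refine (hΩ.sum_dmu_mul_dmu hs hbX.2 he i j).trans ?_
    rw [hx]
  have hDf : ∀ a i, fderiv ℝ (fun u => S.aff c a (μ ((chart (2 * m) x).symm u)))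
      (chart (2 * m) x x) (e i) = ∑ j, (S.p a j : ℝ) * D j i := by
    intro a i
    refine (hs.fderiv_fun (f := fun x => S.aff c a (μ x))
      ((S.contMDiff_aff (c := c) hΩ a).mdifferentiableAt (by simp)) (e i)).trans ?_
    refine (S.dfun_aff hΩ a _ _).trans (Finset.sum_congr rfl fun j _ => congrArg _ ?_)
    exact (hs.fderiv_fun (f := fun x => μ x j) ((hΩ.contMDiff_mu j).mdifferentiableAt (by simp))
      (e i)).symm
  have hψ : ∀ i, ∑ a, 2 * (n a : ℝ) / S.aff c a (μ x) * ∑ j, (S.p a j : ℝ) * D j i =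
      2 * ∑ j, S.psi c j (μ x) * D j i := by
    intro i
    simp only [psi, Finset.mul_sum, Finset.sum_mul]
    rw [Finset.sum_comm]
    exact Finset.sum_congr rfl fun j _ => Finset.sum_congr rfl fun a _ => by ring
  constructor
  · have h1 := scal_eq_scalJet hY.kahler.isRiem hsY hbY hframeY
    rw [hpt, scalJet_congr hcong] at h1
    have h2 := hm.scalJet_modelG he hε hf hg.fderiv_pot hβ (hg.norm_gen_eq S hΩ he)
    have h3 := scal_eq_scalJet hΩ.kahler.isRiem hs hbX.2 he
    have h4 : ∀ a, S.s a = scalJet (coord2 (metric (S.JB a) (S.ΩB a)) (S.projB q a)) (S.base q a)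
        (ε a) := fun a => by
      rw [← S.scal_B a (S.projB q a)]
      have := scal_eq_scalJet (S.kahler_B a).isRiem (smAt_chart_symm (S.projB q a) (S.base_mem q a))
        (bijective_frame (S.base_mem q a)).2 (hε a)
      rwa [hxb] at this
    have h5 : ∀ a, laplacian (metric S.JX Ω) (fun x => S.aff c a (μ x)) x =
        lapJet (coord2 (metric S.JX Ω) x) (fun u => S.aff c a (μ ((chart (2 * m) x).symm u)))
          (chart (2 * m) x x) e := fun a => by
      have := laplacian_eq_lapJet hΩ.kahler.isRiem hs hbX.2 he (S.contMDiff_aff (c := c) hΩ a)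
      rwa [hx] at this
    rw [hx] at h3
    rw [pb2_chart_symm] at h3
    rw [h1]
    refine h2.trans ?_
    simp only [← h3, ← h4, ← h5, hx, hDf, hcard, S.laplacian_aff hΩ, hψ]
    have t1 : ∑ i, ∑ a, 2 * (n a : ℝ) / S.aff c a (μ x) ^ 2 * (∑ j, (S.p a j : ℝ) * D j i) ^ 2 =
        2 * ∑ i, ∑ j, S.chi c i j (μ x) * genGram S.JX Ω S.actX i j x := by
      rw [Finset.sum_comm]
      simp only [sq (∑ j, _ * D j _), ← Finset.mul_sum, sum_mul_sum_lin, hD]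
      simp only [chi, Finset.mul_sum, Finset.sum_mul]
      rw [Finset.sum_comm]
      refine Finset.sum_congr rfl fun i _ => ?_
      rw [Finset.sum_comm]
      exact Finset.sum_congr rfl fun j _ => Finset.sum_congr rfl fun a _ => by ring
    have t2 : ∑ i, (2 * ∑ j, S.psi c j (μ x) * D j i) ^ 2 =
        4 * ∑ i, ∑ j, S.psi c i (μ x) * S.psi c j (μ x) * genGram S.JX Ω S.actX i j x := by
      simp only [mul_pow, sq (∑ j, _ * D j _), ← Finset.mul_sum, sum_mul_sum_lin, hD]
      norm_num
    have t3 : ∑ a, 2 * (n a : ℝ) / S.aff c a (μ x) *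
        ∑ i, (S.p a i : ℝ) * laplacian (metric S.JX Ω) (fun x => μ x i) x =
        2 * ∑ j, S.psi c j (μ x) * laplacian (metric S.JX Ω) (fun x => μ x j) x := by
      simp only [psi, Finset.mul_sum, Finset.sum_mul]
      rw [Finset.sum_comm]
      exact Finset.sum_congr rfl fun j _ => Finset.sum_congr rfl fun a _ => by ring
    rw [t1, t2, t3]
    simp only [qWeight, sub_mul, Finset.sum_sub_distrib]
    ring
  · intro j
    have h1 := laplacian_eq_lapJet hY.kahler.isRiem hsY hbY hframeY (hY.contMDiff_mu j)
    have h2 : ContDiffAt ℝ 2 (fun u => μ ((chart (2 * m) x).symm u) j) (chart (2 * m) x x) :=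
      (hs.contDiffAt_fun (hΩ.contMDiff_mu j)).of_le two_le_infty
    have h3 := laplacian_eq_lapJet hΩ.kahler.isRiem hs hbX.2 he (hΩ.contMDiff_mu j)
    have h4 : (fun y => S.down μ y j) ∘ S.par x σ = fun z => μ ((chart (2 * m) x).symm z.1) j :=
      funext fun z => congrFun (S.down_projY hΩ.mom_inv _ _) j
    rw [hpt, h4, lapJet_congr hcong Filter.EventuallyEq.rfl] at h1
    rw [hx] at h3
    rw [pb2_chart_symm] at h3
    rw [h1]
    refine (hm.lapJet_modelG he hε hf h2).trans ?_
    rw [h3]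
    refine congrArg₂ _ rfl ?_
    simp only [hx, hDf, hcard, hψ]
    have t1 : ∀ i, (2 * ∑ l, S.psi c l (μ x) * D l i) * D j i =
        2 * ((∑ l, S.psi c l (μ x) * D l i) * D j i) := fun i => by ring
    refine (congrArg _ (Finset.sum_congr rfl fun i _ => t1 i)).trans ?_
    rw [← Finset.mul_sum]
    simp only [Finset.sum_mul]
    rw [Finset.sum_comm]
    simp only [← hD, Finset.mul_sum]
    exact Finset.sum_congr rfl fun l _ => Finset.sum_congr rfl fun i _ => by ring

end Curvature

/-! ### The weighted scalar curvature of the fibration -/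

section Weight

variable {c : Fin k → ℝ} {v : LieT r → ℝ} {y : LieT r}

theorem contDiff_pWeight (c : Fin k → ℝ) : ContDiff ℝ ∞ (S.pWeight c) :=
  contDiff_prod fun a _ => (S.contDiff_aff c a).pow (n a)

theorem pWeight_pos (hy : ∀ a, 0 < S.aff c a y) : 0 < S.pWeight c y :=
  Finset.prod_pos fun a _ => pow_pos (hy a) _

theorem eventually_aff_pos (hy : ∀ a, 0 < S.aff c a y) : ∀ᶠ z in 𝓝 y, ∀ a, 0 < S.aff c a z :=
  Filter.eventually_all.2 fun a =>
    ((S.contDiff_aff c a).continuous.continuousAt (x := y)).eventually_const_lt (hy a)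

/-- The logarithmic derivative of `p` is `ψ`. -/
theorem fderiv_pWeight (hy : ∀ a, 0 < S.aff c a y) (j : Fin r) :
    fderiv ℝ (S.pWeight c) y (bas j) = S.pWeight c y * S.psi c j y := by
  have h1 : ∀ a, HasFDerivAt (fun z => S.aff c a z ^ n a) _ y := fun a =>
    ((S.contDiff_aff c a).differentiable (by simp) y).hasFDerivAt.pow (n a)
  have h2 := HasFDerivAt.finsetProd (u := Finset.univ) fun a _ => h1 a
  refine (DFunLike.congr_fun h2.fderiv (bas j)).trans ?_
  rw [sum_apply, psi, Finset.mul_sum]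
  refine Finset.sum_congr rfl fun a _ => ?_
  have ha := (hy a).ne'
  have h3 : S.pWeight c y = S.aff c a y ^ n a * ∏ b ∈ Finset.univ.erase a, S.aff c b y ^ n b :=
    (Finset.mul_prod_erase _ _ (Finset.mem_univ a)).symm
  have h4 : (n a : ℝ) * S.aff c a y ^ (n a - 1) = S.aff c a y ^ n a * (n a / S.aff c a y) := by
    rcases Nat.eq_zero_or_pos (n a) with h0 | h0
    · simp [h0]
    · rw [← Nat.sub_add_cancel h0, pow_succ, Nat.add_sub_cancel]
      field_simp
  rw [h3]
  simp only [smul_apply, smul_eq_mul, nsmul_eq_mul, S.fderiv_aff]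
  linear_combination (∏ b ∈ Finset.univ.erase a, S.aff c b y ^ n b) * S.p a j * h4

theorem hasFDerivAt_psi (hy : ∀ a, 0 < S.aff c a y) (j : Fin r) :
    HasFDerivAt (S.psi c j) (∑ a, (-(n a / S.aff c a y ^ 2 * S.p a j : ℝ)) • fderiv ℝ (S.aff c a) y) y := by
  refine HasFDerivAt.fun_sum fun a _ => ?_
  have ha := (hy a).ne'
  have h1 := (((hasDerivAt_inv ha).comp_hasFDerivAt y
    ((S.contDiff_aff c a).differentiable (by simp) y).hasFDerivAt).const_mul (n a : ℝ)).mul_const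
      (S.p a j : ℝ)
  refine h1.congr_fderiv ?_
  ext z
  simp only [smul_apply, smul_eq_mul]
  ring

theorem fderiv_psi (hy : ∀ a, 0 < S.aff c a y) (i j : Fin r) :
    fderiv ℝ (S.psi c j) y (bas i) = -S.chi c i j y := by
  rw [(S.hasFDerivAt_psi hy j).fderiv, sum_apply, chi, ← Finset.sum_neg_distrib]
  refine Finset.sum_congr rfl fun a _ => ?_
  rw [smul_apply, S.fderiv_aff, smul_eq_mul]
  ring

theorem fderiv_pWeight_mul (hv : ContDiff ℝ ∞ v) (hy : ∀ a, 0 < S.aff c a y) (j : Fin r) :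
    fderiv ℝ (fun y => S.pWeight c y * v y) y (bas j) =
      S.pWeight c y * (S.psi c j y * v y + fderiv ℝ v y (bas j)) := by
  have h := ((S.contDiff_pWeight c).differentiable (by simp) y).hasFDerivAt.mul
    (hv.differentiable (by simp) y).hasFDerivAt
  refine (DFunLike.congr_fun h.fderiv (bas j)).trans ?_
  simp only [add_apply, smul_apply, smul_eq_mul, S.fderiv_pWeight hy]
  ring

/-- The second derivatives of `p v`, divided by `p`. -/
theorem hess_pWeight_mul (hv : ContDiff ℝ ∞ v) (hy : ∀ a, 0 < S.aff c a y) (i j : Fin r) :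
    hess (fun y => S.pWeight c y * v y) i j y = S.pWeight c y *
      (S.psi c i y * (S.psi c j y * v y + fderiv ℝ v y (bas j)) - S.chi c i j y * v y +
        S.psi c j y * fderiv ℝ v y (bas i) + hess v i j y) := by
  have hvj : Differentiable ℝ fun z => fderiv ℝ v z (bas j) :=
    ((hv.fderiv_right (m := ∞) (by simp)).clm_apply contDiff_const).differentiable (by simp)
  have e : (fun z => fderiv ℝ (fun y => S.pWeight c y * v y) z (bas j)) =ᶠ[𝓝 y]
      fun z => S.pWeight c z * (S.psi c j z * v z + fderiv ℝ v z (bas j)) :=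
    (S.eventually_aff_pos hy).mono fun z hz => S.fderiv_pWeight_mul hv hz j
  have h := ((S.contDiff_pWeight c).differentiable (by simp) y).hasFDerivAt.mul
    (((S.hasFDerivAt_psi hy j).differentiableAt.hasFDerivAt.mul
      (hv.differentiable (by simp) y).hasFDerivAt).add (hvj y).hasFDerivAt)
  rw [hess, e.fderiv_eq]
  refine (DFunLike.congr_fun h.fderiv (bas i)).trans ?_
  simp only [add_apply, smul_apply, smul_eq_mul, S.fderiv_pWeight hy, S.fderiv_psi hy, hess,
    Pi.add_apply, Pi.mul_apply]
  ring

variable {Ω : BilForm (2 * m) X ℝ} {μ : X → LieT r}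
  (hΩ : IsHamKahler S.JX Ω S.actX μ) (hc : ∀ a x, 0 < S.aff c a (μ x))
  {w : LieT r → ℝ} (hv : ContDiff ℝ ∞ v)
include hΩ hc hv

/-- The relation between the weighted scalar curvatures of `Y` and `X`. -/
theorem wScal_formY (x : X) (q : P) :
    wScal v S.JY (S.formY c Ω μ) S.actY (S.down μ) (S.projY (x, q)) =
      wScal (fun y => S.pWeight c y * v y) S.JX Ω S.actX μ x / S.pWeight c (μ x) +
        v (μ x) * S.qWeight c (μ x) := by
  have hy : ∀ a, 0 < S.aff c a (μ x) := fun a => hc a x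
  obtain ⟨h1, h2⟩ := S.curvature_formY hΩ hc x q
  rw [(S.isHamKahler_formY hΩ hc).wScal_eq hv, hΩ.wScal_eq ((S.contDiff_pWeight c).mul hv),
    S.down_projY hΩ.mom_inv]
  simp only [h1, h2, S.genGram_formY hΩ, S.fderiv_pWeight_mul hv hy, S.hess_pWeight_mul hv hy]
  have hp := (S.pWeight_pos hy).ne'
  have t1 : ∑ i, S.pWeight c (μ x) * (S.psi c i (μ x) * v (μ x) + fderiv ℝ v (μ x) (bas i)) *
      laplacian (metric S.JX Ω) (fun y => μ y i) x = S.pWeight c (μ x) *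
        (v (μ x) * ∑ i, S.psi c i (μ x) * laplacian (metric S.JX Ω) (fun y => μ y i) x +
          ∑ i, fderiv ℝ v (μ x) (bas i) * laplacian (metric S.JX Ω) (fun y => μ y i) x) := by
    rw [Finset.mul_sum, ← Finset.sum_add_distrib, Finset.mul_sum]
    exact Finset.sum_congr rfl fun i _ => by ring
  have t2 : ∑ i, ∑ j, S.psi c i (μ x) * fderiv ℝ v (μ x) (bas j) * genGram S.JX Ω S.actX i j x =
      ∑ j, fderiv ℝ v (μ x) (bas j) * ∑ i, S.psi c i (μ x) * genGram S.JX Ω S.actX i j x := by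
    rw [Finset.sum_comm]
    simp only [Finset.mul_sum]
    exact Finset.sum_congr rfl fun i _ => Finset.sum_congr rfl fun j _ => by ring
  have t3 : ∑ i, ∑ j, S.psi c j (μ x) * fderiv ℝ v (μ x) (bas i) * genGram S.JX Ω S.actX i j x =
      ∑ j, fderiv ℝ v (μ x) (bas j) * ∑ i, S.psi c i (μ x) * genGram S.JX Ω S.actX i j x := by
    simp only [Finset.mul_sum]
    exact Finset.sum_congr rfl fun i _ => Finset.sum_congr rfl fun j _ => by
      rw [hΩ.genGram_symm i j]; ring
  have t4 : ∑ i, ∑ j, S.pWeight c (μ x) * (S.psi c i (μ x) * (S.psi c j (μ x) * v (μ x) +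
      fderiv ℝ v (μ x) (bas j)) - S.chi c i j (μ x) * v (μ x) + S.psi c j (μ x) *
      fderiv ℝ v (μ x) (bas i) + hess v i j (μ x)) * genGram S.JX Ω S.actX i j x =
      S.pWeight c (μ x) * (-(v (μ x) * ∑ i, ∑ j, (S.chi c i j (μ x) - S.psi c i (μ x) *
        S.psi c j (μ x)) * genGram S.JX Ω S.actX i j x) +
      ∑ i, ∑ j, S.psi c i (μ x) * fderiv ℝ v (μ x) (bas j) * genGram S.JX Ω S.actX i j x +
      ∑ i, ∑ j, S.psi c j (μ x) * fderiv ℝ v (μ x) (bas i) * genGram S.JX Ω S.actX i j x +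
      ∑ i, ∑ j, hess v i j (μ x) * genGram S.JX Ω S.actX i j x) := by
    simp only [Finset.mul_sum, ← Finset.sum_neg_distrib, ← Finset.sum_add_distrib]
    exact Finset.sum_congr rfl fun i _ => Finset.sum_congr rfl fun j _ => by ring
  rw [t1, t4, t2, t3]
  simp only [mul_sub, Finset.sum_sub_distrib]
  field_simp
  ring

/-- The two equations differ by the factor `p(μ) > 0`, and every point of `X` lies under one of
`Y`. -/
theorem isWCscK_iff [∀ a, Nonempty (B a)] :
    IsWCscK (fun y => S.pWeight c y * v y) (fun y => S.pWeight c y * (w y - v y * S.qWeight c y))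
        S.JX Ω S.actX μ ↔
      IsWCscK v w S.JY (S.formY c Ω μ) S.actY (S.down μ) := by
  have key : ∀ x q, wScal v S.JY (S.formY c Ω μ) S.actY (S.down μ) (S.projY (x, q)) =
      w (S.down μ (S.projY (x, q))) ↔ wScal (fun y => S.pWeight c y * v y) S.JX Ω S.actX μ x =
        S.pWeight c (μ x) * (w (μ x) - v (μ x) * S.qWeight c (μ x)) := by
    intro x q
    have hp := S.pWeight_pos fun a => hc a x
    rw [S.wScal_formY hΩ hc hv, S.down_projY hΩ.mom_inv, ← eq_sub_iff_add_eq, div_eq_iff hp.ne',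
      mul_comm (_ - _)]
  refine ⟨fun h => ⟨S.isHamKahler_formY hΩ hc, fun y => ?_⟩, fun h => ⟨hΩ, fun x => ?_⟩⟩
  · obtain ⟨⟨x, q⟩, rfl⟩ := S.projY_surj y
    exact (key x q).2 (h.2 x)
  · obtain ⟨q, -⟩ := S.projB_surj fun a => Classical.arbitrary (B a)
    exact (key x q).1 (h.2 _)

end Weight

/-! ### The volume of the fibration -/

/-- Local sections with an open set of base points over which parametrizations are adapted. -/
theorem exists_adapted_nhds (q : P) : ∃ (σ : (∀ a, 𝔼 (2 * n a)) → P) (O : Set (∀ a, 𝔼 (2 * n a))),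
    IsOpen O ∧ S.base q ∈ O ∧
      ∀ (x₀ : X) (u y), u ∈ (chart (2 * m) x₀).target → y ∈ O → S.Adapted x₀ q σ (u, y) := by
  obtain ⟨σ, h⟩ := S.exists_isSection q
  have ht : ∀ᶠ y in 𝓝 (S.base q), ∀ a, y a ∈ (chart (2 * n a) (S.projB q a)).target :=
    Filter.eventually_all.2 fun a => (continuous_apply a).continuousAt.eventually
      (target_mem_nhds (S.base_mem q a))
  obtain ⟨O, hO, hO', hq⟩ := eventually_nhds_iff.1
    (((h.smAt.eventually.and h.proj).and h.dB_md).and ht)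
  exact ⟨σ, O, hO', hq, fun x₀ u y hu hy =>
    ⟨hu, (hO y hy).1.1.1, (hO y hy).2, (hO y hy).1.1.2, (hO y hy).1.2⟩⟩

/-- The chart of `∏ B_a` around the base point of `q`. -/
def baseChart (q : P) (b : ∀ a, B a) : ∀ a, 𝔼 (2 * n a) := fun a => chart (2 * n a) (S.projB q a) (b a)

/-- Two points of `X × P` with the same image in `Y` and the same second component have the same
first component. -/
theorem fst_eq_of_projY_eq {x x' : X} {q : P} (h : S.projY (x, q) = S.projY (x', q)) : x = x' := by
  obtain ⟨t, h1, h2⟩ := (S.projY_fibre _ _ _ _).1 h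
  obtain ⟨l, rfl⟩ := S.free_P t q h2.symm
  have h3 := S.torus_X.periodic (-l) x
  rw [h1]
  refine h3.symm.trans (congrArg (fun t => S.actX t x) ?_)
  ext i
  simp

theorem projB_eq_of_projY_eq {x x' : X} {q q' : P} (h : S.projY (x, q) = S.projY (x', q')) :
    S.projB q = S.projB q' := by
  obtain ⟨t, -, h2⟩ := (S.projY_fibre _ _ _ _).1 h
  rw [h2, S.projB_act]

section Volume

variable [T2Space X] [CompactSpace X] [Nonempty X] [MeasurableSpace X] [BorelSpace X]
  [∀ a, T2Space (B a)] [∀ a, CompactSpace (B a)]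
  [∀ a, Nonempty (B a)] [∀ a, MeasurableSpace (B a)] [∀ a, BorelSpace (B a)]
  [T2Space Y] [CompactSpace Y] [Nonempty Y] [MeasurableSpace Y] [BorelSpace Y]

/-- Countably many local sections whose domains cover the base. -/
theorem exists_section_cover : ∃ (q : ℕ → P) (σ : ℕ → (∀ a, 𝔼 (2 * n a)) → P)
    (V : ℕ → Set (∀ a, B a)), (∀ j, IsOpen (V j)) ∧ ⋃ j, V j = Set.univ ∧
      (∀ j, ContinuousOn (fun b => σ j (S.baseChart (q j) b)) (V j)) ∧
      (∀ j, ∀ b ∈ V j, S.projB (σ j (S.baseChart (q j) b)) = b) ∧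
      ∀ j, ∃ O : Set (∀ a, 𝔼 (2 * n a)),
        (∀ b ∈ V j, (∀ a, b a ∈ (chart (2 * n a) (S.projB (q j) a)).source) ∧
          S.baseChart (q j) b ∈ O) ∧
        ∀ (x₀ : X) u y, u ∈ (chart (2 * m) x₀).target → y ∈ O → S.Adapted x₀ (q j) (σ j) (u, y) := by
  choose q hq using S.projB_surj
  choose σ O hO hbase had using S.exists_adapted_nhds
  let U : (∀ a, B a) → Set (∀ a, B a) := fun b =>
    (Set.univ.pi fun a => (chart (2 * n a) (S.projB (q b) a)).source) ∩ S.baseChart (q b) ⁻¹' O (q b)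
  have hsrc : ∀ b, IsOpen (Set.univ.pi fun a => (chart (2 * n a) (S.projB (q b) a)).source) := fun b =>
    isOpen_set_pi Set.finite_univ fun a _ => isOpen_extChartAt_source _
  have hcont : ∀ b, ContinuousOn (S.baseChart (q b))
      (Set.univ.pi fun a => (chart (2 * n a) (S.projB (q b) a)).source) := fun b =>
    continuousOn_pi.2 fun a => (continuousOn_extChartAt _).comp (continuous_apply a).continuousOn
      fun y hy => hy a trivial
  have hU : ∀ b, IsOpen (U b) := fun b => (hcont b).isOpen_inter_preimage (hsrc b) (hO _)
  have hself : ∀ b, b ∈ U b := fun b => by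
    have h : ∀ b', S.projB (q b) = b' → b' ∈ U b := by
      rintro _ rfl
      exact ⟨fun a _ => mem_chart_self _, hbase (q b)⟩
    exact h b (hq b)
  obtain ⟨s, hs, hcov⟩ := countable_cover_nhds fun b => (hU b).mem_nhds (hself b)
  have hne : s.Nonempty := by
    by_contra h
    rw [Set.not_nonempty_iff_eq_empty] at h
    subst h
    simp only [Set.mem_empty_iff_false, Set.iUnion_of_empty, Set.iUnion_empty] at hcov
    exact Set.empty_ne_univ hcov
  obtain ⟨t, rfl⟩ := hs.exists_eq_range hne
  obtain ⟨x₀⟩ := ‹Nonempty X›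
  have hA : ∀ j, ∀ b ∈ U (t j), S.Adapted x₀ (q (t j)) (σ (q (t j)))
      (chart (2 * m) x₀ x₀, S.baseChart (q (t j)) b) := fun j b hb =>
    had _ x₀ _ _ ((chart (2 * m) x₀).map_source (mem_chart_self x₀)) hb.2
  refine ⟨fun j => q (t j), fun j => σ (q (t j)), fun j => U (t j), fun j => hU _,
    by simpa using hcov, fun j => ?_, fun j b hb => ?_, fun j => ⟨O (q (t j)), fun b hb =>
      ⟨fun a => hb.1 a trivial, hb.2⟩, had _⟩⟩
  · intro b hb
    have h1 : ContinuousAt (σ (q (t j))) (S.baseChart (q (t j)) b) := (hA j b hb).smAt.continuousAt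
    exact h1.comp_continuousWithinAt (((hcont (t j)).mono Set.inter_subset_left) b hb)
  · ext1 a
    rw [(hA j b hb).proj]
    exact (chart (2 * n a) _).left_inv (hb.1 a trivial)

variable {c : Fin k → ℝ} {Ω : BilForm (2 * m) X ℝ} {μ : X → LieT r}
  (hΩ : IsHamKahler S.JX Ω S.actX μ) (hc : ∀ a x, 0 < S.aff c a (μ x))
include hΩ hc

/-- The volume density of `Y` in an adapted parametrization. -/
theorem Adapted.density {x₀ : X} {q : P} {σ : (∀ a, 𝔼 (2 * n a)) → P}
    {z : 𝔼 (2 * m) × ∀ a, 𝔼 (2 * n a)} (hz : S.Adapted x₀ q σ z) :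
    ENNReal.ofReal (Real.sqrt (Matrix.of fun i j => pb2 (S.par x₀ σ) (metric S.JY (S.formY c Ω μ)) z
      ((EuclideanSpace.basisFun (Fin (2 * m)) ℝ).toBasis.prod
        (Pi.basis fun a => (EuclideanSpace.basisFun (Fin (2 * n a)) ℝ).toBasis) i)
      ((EuclideanSpace.basisFun (Fin (2 * m)) ℝ).toBasis.prod
        (Pi.basis fun a => (EuclideanSpace.basisFun (Fin (2 * n a)) ℝ).toBasis) j)).det) =
    prodDens (metric S.JX Ω) (fun a => metric (S.JB a) (S.ΩB a)) x₀ (S.projB q) z *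
      ENNReal.ofReal (S.pWeight c (μ (prodChart x₀ (S.projB q) z).1)) := by
  obtain ⟨l, hl⟩ := S.torus_X.exists_gen_param x₀
  rw [hz.pb2_metric S (fun ξ => (hl _ hz.mem).2 ξ) hΩ, det_modelG]
  have hX : Matrix.of (fun i j => coord2 (metric S.JX Ω) x₀ z.1
      ((EuclideanSpace.basisFun (Fin (2 * m)) ℝ).toBasis i)
      ((EuclideanSpace.basisFun (Fin (2 * m)) ℝ).toBasis j)) = gramF (coord2 (metric S.JX Ω) x₀) z.1 := by
    ext i j; simp [gramF]
  have hB : ∀ a, Matrix.of (fun i j => coord2 (metric (S.JB a) (S.ΩB a)) (S.projB q a) (z.2 a)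
      ((EuclideanSpace.basisFun (Fin (2 * n a)) ℝ).toBasis i)
      ((EuclideanSpace.basisFun (Fin (2 * n a)) ℝ).toBasis j)) =
        gramF (coord2 (metric (S.JB a) (S.ΩB a)) (S.projB q a)) (z.2 a) := by
    intro a; ext i j; simp [gramF]
  simp only [hX, hB, Fintype.card_fin]
  have hX0 := det_coord2_nonneg hΩ.kahler.isRiem hz.mem
  have hB0 := fun a => det_coord2_nonneg (S.kahler_B a).isRiem (hz.memB a)
  rw [Real.sqrt_mul hX0, Finset.prod_mul_distrib, Real.sqrt_mul
    (Finset.prod_nonneg fun a _ => pow_nonneg (hc a _).le _)]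
  have h1 : √(∏ a, S.aff c a (μ ((chart (2 * m) x₀).symm z.1)) ^ (2 * n a)) =
      S.pWeight c (μ ((chart (2 * m) x₀).symm z.1)) := by
    have : ∏ a, S.aff c a (μ ((chart (2 * m) x₀).symm z.1)) ^ (2 * n a) =
        S.pWeight c (μ ((chart (2 * m) x₀).symm z.1)) ^ 2 := by
      rw [pWeight, ← Finset.prod_pow]
      exact Finset.prod_congr rfl fun a _ => by
        rw [← pow_mul, mul_comm (n a) 2]
    rw [this, Real.sqrt_sq (S.pWeight_pos fun a => hc a _).le]
  rw [h1, Real.sqrt_prod _ fun a _ => hB0 a, prodDens, prodChart, vdens_apply _ hz.mem,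
    vchart_apply hz.mem]
  simp only [vdens_apply _ (hz.memB _), dens]
  rw [ENNReal.ofReal_mul (Real.sqrt_nonneg _), ENNReal.ofReal_mul (S.pWeight_pos fun a => hc a _).le,
    ENNReal.ofReal_prod_of_nonneg fun a _ => Real.sqrt_nonneg _]
  ring

theorem measurable_weight : Measurable fun z : X × (∀ a, B a) =>
    ENNReal.ofReal (S.pWeight c (μ z.1)) :=
  (((S.contDiff_pWeight c).continuous.measurable.comp hΩ.smooth_mom.continuous.measurable).comp
    measurable_fst).ennreal_ofReal

/-- The volume of a part of `Y` lying over a chart of `X` and the domain of a section of `P`. -/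
theorem vol_patch {x₀ : X} {q : P} {σ : (∀ a, 𝔼 (2 * n a)) → P} {O : Set (∀ a, 𝔼 (2 * n a))}
    (had : ∀ u y, u ∈ (chart (2 * m) x₀).target → y ∈ O → S.Adapted x₀ q σ (u, y))
    {Q : Set (X × ∀ a, B a)} (hQ : MeasurableSet Q)
    (hQs : ∀ z ∈ Q, z.1 ∈ (chart (2 * m) x₀).source ∧
      (∀ a, z.2 a ∈ (chart (2 * n a) (S.projB q a)).source) ∧ S.baseChart q z.2 ∈ O) :
    vol (metric S.JY (S.formY c Ω μ)) ((fun z => S.projY (z.1, σ (S.baseChart q z.2))) '' Q) =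
      ∫⁻ z in Q, ENNReal.ofReal (S.pWeight c (μ z.1)) ∂((vol (metric S.JX Ω)).prod
        (Measure.pi fun a => vol (metric (S.JB a) (S.ΩB a)))) := by
  have hm := measurable_prodChart (e := 2 * m) (n := fun a => 2 * n a) x₀ (S.projB q)
  rw [setLIntegral_prod_vol hΩ.kahler.isRiem.smooth (fun a => (S.kahler_B a).isRiem.smooth) x₀
    (S.projB q) hQ (fun z hz => ⟨(hQs z hz).1, fun a _ => (hQs z hz).2.1 a⟩)
    (S.measurable_weight hΩ hc)]
  set R := ((chart (2 * m) x₀).target ×ˢ Set.univ.pi fun a => (chart (2 * n a) (S.projB q a)).target) ∩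
        prodChart x₀ (S.projB q) ⁻¹' Q with hR
  have hRm : MeasurableSet R :=
    ((isOpen_extChartAt_target x₀).measurableSet.prod (MeasurableSet.univ_pi fun a =>
      (isOpen_extChartAt_target (S.projB q a)).measurableSet)).inter (hm hQ)
  have hch : ∀ z ∈ R, prodChart x₀ (S.projB q) z =
      ((chart (2 * m) x₀).symm z.1, fun a => (chart (2 * n a) (S.projB q a)).symm (z.2 a)) :=
    fun z hz => Prod.ext (vchart_apply hz.1.1) (funext fun a => vchart_apply (hz.1.2 a trivial))
  have hbase : ∀ z ∈ R, S.baseChart q (prodChart x₀ (S.projB q) z).2 = z.2 := fun z hz => by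
    rw [hch z hz]
    exact funext fun a => (chart (2 * n a) (S.projB q a)).right_inv (hz.1.2 a trivial)
  have hA : ∀ z ∈ R, S.Adapted x₀ q σ z := fun z hz =>
    had z.1 z.2 hz.1.1 (hbase z hz ▸ (hQs _ hz.2).2.2)
  -- in the charts, the set is the image of `R` under the adapted parametrization
  have himg : (fun z => S.projY (z.1, σ (S.baseChart q z.2))) '' Q = S.par x₀ σ '' R := by
    ext y
    constructor
    · rintro ⟨z, hz, rfl⟩
      obtain ⟨h1, h2, h3⟩ := hQs z hz
      have e1 : vchart x₀ (chart (2 * m) x₀ z.1) = z.1 := by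
        rw [vchart_apply ((chart (2 * m) x₀).map_source h1), (chart (2 * m) x₀).left_inv h1]
      have e2 : ∀ a, vchart (S.projB q a) (S.baseChart q z.2 a) = z.2 a := fun a => by
        rw [baseChart, vchart_apply ((chart (2 * n a) _).map_source (h2 a)), (chart (2 * n a) _).left_inv (h2 a)]
      refine ⟨(chart (2 * m) x₀ z.1, S.baseChart q z.2), ⟨⟨(chart (2 * m) x₀).map_source h1,
        fun a _ => (chart (2 * n a) _).map_source (h2 a)⟩, ?_⟩, ?_⟩
      · have : prodChart x₀ (S.projB q) (chart (2 * m) x₀ z.1, S.baseChart q z.2) = z :=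
          Prod.ext e1 (funext e2)
        rw [Set.mem_preimage, this]
        exact hz
      · exact congrArg (fun x => S.projY (x, σ (S.baseChart q z.2)))
          ((chart (2 * m) x₀).left_inv h1)
    · rintro ⟨z, hz, rfl⟩
      refine ⟨_, hz.2, ?_⟩
      simp only [hbase z hz]
      rw [hch z hz]
      rfl
  have hinj : Set.InjOn (S.par x₀ σ) R := by
    intro z hz z' hz' h
    have h1 := S.projB_eq_of_projY_eq h
    have h2 : z.2 = z'.2 := funext fun a => (chart (2 * n a) (S.projB q a)).symm.injOn
      (hz.1.2 a trivial) (hz'.1.2 a trivial) (by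
        rw [← (hA z hz).proj, ← (hA z' hz').proj]
        exact congrFun h1 a)
    refine Prod.ext ((chart (2 * m) x₀).symm.injOn hz.1.1 hz'.1.1 ?_) h2
    rw [par, par, ← h2] at h
    exact S.fst_eq_of_projY_eq h
  have hcard : Fintype.card (Fin (2 * m) ⊕ (Σ a, Fin (2 * n a))) = 2 * (m + ∑ a, n a) := by
    simp [mul_add, Finset.mul_sum]
  rw [himg, vol_image_basis _ ((EuclideanSpace.basisFun (Fin (2 * m)) ℝ).toBasis.prod
    (Pi.basis fun a => (EuclideanSpace.basisFun (Fin (2 * n a)) ℝ).toBasis)) (ν := volume) (by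
      rw [Module.Basis.prod_addHaar, addHaar_piBasis, OrthonormalBasis.addHaar_eq_volume]; rfl)
    hcard (fun z hz => (hA z hz).smAt_par S) hinj hRm]
  exact setLIntegral_congr_fun hRm fun z hz => (hA z hz).density S hΩ hc

/-- Over a measurable trivialization of the bundle, the volume of `Y` is the product of the volumes
of `X` and `B` with density `p(μ)`. -/
theorem exists_vol_formY_eq_map : ∃ T : X × (∀ a, B a) → Y, MeasurableEmbedding T ∧
    (∀ z, ∃ q, T z = S.projY (z.1, q)) ∧
    vol (metric S.JY (S.formY c Ω μ)) = Measure.map T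
      (((vol (metric S.JX Ω)).prod (Measure.pi fun a => vol (metric (S.JB a) (S.ΩB a)))).withDensity
        fun z => ENNReal.ofReal (S.pWeight c (μ z.1))) := by
  have hX2 := ChartedSpace.secondCountable_of_sigmaCompact (𝔼 (2 * m)) X
  have hB2 := fun a => ChartedSpace.secondCountable_of_sigmaCompact (𝔼 (2 * n a)) (B a)
  have hY2 := ChartedSpace.secondCountable_of_sigmaCompact (𝔼 (2 * (m + ∑ a, n a))) Y
  -- needed for the Lusin-Souslin theorem, by which an injective measurable map is an embedding
  have hZ : PolishSpace (X × ∀ a, B a) := by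
    let _ := TopologicalSpace.metrizableSpaceMetric (X × ∀ a, B a)
    infer_instance
  obtain ⟨q, σ, V, hV, hcov, hcont, hproj, hO⟩ := S.exists_section_cover
  -- glue the local sections along a measurable partition of the base to a section `sec`
  let E : ℕ → Set (∀ a, B a) := disjointed V
  have hE : ∀ j, MeasurableSet (E j) := fun j =>
    MeasurableSet.disjointed (fun j => (hV j).measurableSet) j
  have hEV : ∀ j, E j ⊆ V j := fun j => disjointed_subset V j
  have hEu : ⋃ j, E j = Set.univ := (iUnion_disjointed (f := V)).trans hcov
  have hEd : Pairwise (Function.onFun Disjoint E) := disjoint_disjointed V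
  let D : ℕ → Set X := disjointed fun l => (chartAt (𝔼 (2 * m)) (chartCentre (2 * m) X l)).source
  have hD : ∀ j, MeasurableSet (D j) := fun j =>
    MeasurableSet.disjointed (fun l => (chartAt (𝔼 (2 * m)) _).open_source.measurableSet) j
  have hDs : ∀ j, D j ⊆ (chart (2 * m) (chartCentre (2 * m) X j)).source := fun j => by
    rw [extChartAt_source]; exact disjointed_subset _ j
  have hDu : ⋃ j, D j = Set.univ :=
    iUnion_disjointed.trans (exists_chart_cover (2 * m) X).choose_spec
  have hDd : Pairwise (Function.onFun Disjoint D) := disjoint_disjointed _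
  have hidx : ∀ b, ∃ j, b ∈ E j := fun b => by
    have : b ∈ ⋃ j, E j := hEu ▸ trivial
    simpa using this
  choose idx hidx using hidx
  have hidx' : ∀ b j, b ∈ E j → idx b = j := fun b j hb => by
    by_contra h
    exact Set.disjoint_left.1 (hEd h) (hidx b) hb
  let sec : (∀ a, B a) → P := fun b => σ (idx b) (S.baseChart (q (idx b)) b)
  have hsec : ∀ b, S.projB (sec b) = b := fun b => hproj _ b (hEV _ (hidx b))
  have hsec' : ∀ j, ∀ b ∈ E j, sec b = σ j (S.baseChart (q j) b) := fun j b hb => by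
    simp only [sec, hidx' b j hb]
  let T : X × (∀ a, B a) → Y := fun z => S.projY (z.1, sec z.2)
  have hTm : Measurable T := by
    refine ContinuousOn.measurable_of_cover (s := fun j => Set.univ ×ˢ E j)
      (fun j => MeasurableSet.univ.prod (hE j)) ?_ fun j => ?_
    · rw [← Set.prod_iUnion, hEu, Set.univ_prod_univ]
    · refine S.projY_smooth.continuous.comp_continuousOn (continuousOn_fst.prodMk ?_)
      have h1 : ContinuousOn sec (E j) := ((hcont j).mono (hEV j)).congr (hsec' j)
      exact h1.comp continuousOn_snd fun z hz => hz.2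
  have hTi : Function.Injective T := fun z z' h => by
    have h2 : z.2 = z'.2 := by
      have := S.projB_eq_of_projY_eq h
      rwa [hsec, hsec] at this
    refine Prod.ext (S.fst_eq_of_projY_eq (q := sec z.2) ?_) h2
    exact h.trans (congrArg (fun b => S.projY (z'.1, sec b)) h2.symm)
  have hTs : Function.Surjective T := fun y => by
    obtain ⟨⟨x, q'⟩, rfl⟩ := S.projY_surj y
    obtain ⟨t, ht⟩ := (S.projB_fibre q' (sec (S.projB q'))).1 (hsec _).symm
    exact ⟨(S.actX (-t) x, S.projB q'), ((S.projY_fibre _ _ _ _).2 ⟨t, rfl, ht⟩).symm⟩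
  have hTe : MeasurableEmbedding T := hTm.measurableEmbedding hTi
  refine ⟨T, hTe, fun z => ⟨_, rfl⟩, ?_⟩
  refine eq_map_of_partition hTe hTs (D := fun i : ℕ × ℕ => D i.1 ×ˢ E i.2)
    (fun i => (hD i.1).prod (hE i.2)) ?_ ?_ ?_
  · rintro ⟨i, j⟩ ⟨i', j'⟩ hij
    refine Set.disjoint_left.2 fun z hz hz' => hij (Prod.ext ?_ ?_)
    · by_contra h
      exact Set.disjoint_left.1 (hDd h) hz.1 hz'.1
    · by_contra h
      exact Set.disjoint_left.1 (hEd h) hz.2 hz'.2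
  · refine Set.eq_univ_of_forall fun z => Set.mem_iUnion.2 ?_
    have : z.1 ∈ ⋃ j, D j := hDu ▸ trivial
    obtain ⟨i, hi⟩ := Set.mem_iUnion.1 this
    exact ⟨(i, idx z.2), hi, hidx z.2⟩
  · rintro ⟨i, j⟩ Q hQ hQs
    obtain ⟨O, hO1, hO2⟩ := hO j
    rw [withDensity_apply _ hQ, ← S.vol_patch hΩ hc (x₀ := chartCentre (2 * m) X i) (q := q j)
      (σ := σ j) (O := O) (hO2 _) hQ fun z hz =>
        ⟨hDs i (hQs hz).1, hO1 z.2 (hEV j (hQs hz).2)⟩]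
    congr 1
    exact Set.image_congr fun z hz => congrArg (fun p => S.projY (z.1, p)) (hsec' j z.2 (hQs hz).2)

/-- Fibre integration of functions induced from `X`. -/
theorem integral_formY {F : Y → ℝ} {f : X → ℝ} (hF : ∀ x q, F (S.projY (x, q)) = f x) :
    ∫ y, F y ∂(vol (metric S.JY (S.formY c Ω μ))) =
      S.volB * ∫ x, S.pWeight c (μ x) * f x ∂(vol (metric S.JX Ω)) := by
  have := isFiniteMeasure_vol hΩ.kahler.isRiem.smooth
  have := fun a => isFiniteMeasure_vol (S.kahler_B a).isRiem.smooth
  obtain ⟨T, hT, hT', hvol⟩ := S.exists_vol_formY_eq_map hΩ hc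
  have hFT : ∀ z, F (T z) = f z.1 := fun z => by
    obtain ⟨q, hq⟩ := hT' z
    rw [hq, hF]
  rw [hvol, hT.integral_map]
  simp only [hFT]
  rw [integral_withDensity_eq_integral_toReal_smul (S.measurable_weight hΩ hc)
    (Filter.Eventually.of_forall fun _ => ENNReal.ofReal_lt_top)]
  have h1 : ∀ z : X × (∀ a, B a), (ENNReal.ofReal (S.pWeight c (μ z.1))).toReal • f z.1 =
      (S.pWeight c (μ z.1) * f z.1) * (1 : ℝ) := fun z => by
    rw [ENNReal.toReal_ofReal (S.pWeight_pos fun a => hc a _).le, smul_eq_mul, mul_one]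
  simp only [h1]
  rw [integral_prod_mul (fun x => S.pWeight c (μ x) * f x) fun _ => (1 : ℝ), mul_comm]
  congr 1
  rw [integral_const, smul_eq_mul, mul_one, measureReal_def, Measure.pi_univ, ENNReal.toReal_prod]
  rfl

/-! ### The weighted Mabuchi energy of the fibration -/

variable {v w : LieT r → ℝ} (hv : ContDiff ℝ ∞ v)
include hv

/-- The equality of the differentials: `wScal_formY` for `ω_φ`, integrated over `Y`. -/
theorem mabuchiDiff_down {φ ψ : X → ℝ} (hφ : φ ∈ potentials S.JX Ω S.actX)
    (hψ : ψ ∈ SmoothInv (2 * m) S.actX) :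
    mabuchiDiff v w S.JY (S.formY c Ω μ) S.actY (S.down μ) (S.down φ) (S.down ψ) =
      S.volB * mabuchiDiff (fun y => S.pWeight c y * v y)
        (fun y => S.pWeight c y * (w y - v y * S.qWeight c y)) S.JX Ω S.actX μ φ ψ := by
  have hΩφ := hΩ.formOf hφ
  have hcφ := S.aff_momOf_pos hΩ hc hφ
  rw [mabuchiDiff, mabuchiDiff, S.formOf_down hΩ hφ, S.momOf_down_eq hΩ hφ,
    S.integral_formY hΩφ hcφ (fun x q => by
      rw [S.wScal_formY hΩφ hcφ hv, S.down_projY hΩφ.mom_inv, S.down_projY hψ.2]), mul_neg]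
  congr 2
  refine integral_congr_ae (Filter.Eventually.of_forall fun x => ?_)
  have hp := (S.pWeight_pos fun a => hcφ a x).ne'
  change _ * ((_ / _ + _ - _) * _) = _
  field_simp
  ring

/-- Both energies vanish at `0` and have proportional derivatives along the ray `s φ`. -/
theorem mabuchi_down {EX : (X → ℝ) → ℝ} {EY : (Y → ℝ) → ℝ}
    (hEX : IsMabuchi (fun y => S.pWeight c y * v y)
      (fun y => S.pWeight c y * (w y - v y * S.qWeight c y)) S.JX Ω S.actX μ EX)
    (hEY : IsMabuchi v w S.JY (S.formY c Ω μ) S.actY (S.down μ) EY)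
    {φ : X → ℝ} (hφ : φ ∈ potentials S.JX Ω S.actX) : EY (S.down φ) = S.volB * EX φ := by
  have hY := S.isHamKahler_formY hΩ hc
  have hφY := S.down_mem_potentials hΩ hc hφ
  -- the difference of the two energies is constant along the ray
  have hD : ∀ s ∈ Set.Icc (0 : ℝ) 1,
      HasDerivAt (fun s : ℝ => EY (s • S.down φ) - S.volB * EX (s • φ)) 0 s := fun s hs => by
    have h1 := (hEY.hasDerivAt_ray hY hφY hs).sub ((hEX.hasDerivAt_ray hΩ hφ hs).const_mul S.volB)
    have h2 : s • S.down φ = S.down (s • φ) := rfl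
    rwa [h2, S.mabuchiDiff_down hΩ hc hv (hΩ.smul_mem_potentials hφ hs) hφ.1, sub_self] at h1
  have h := constant_of_has_deriv_right_zero
    (fun s hs => (hD s hs).continuousAt.continuousWithinAt)
    (fun s hs => (hD s (Set.Ico_subset_Icc_self hs)).hasDerivWithinAt) 1 (by simp)
  simp only [one_smul, zero_smul] at h
  rw [hEX.1, hEY.1, mul_zero, sub_zero] at h
  exact sub_eq_zero.1 h

end Volume
end Fibration

end WKahler

end

theorem mainTheorem8 {r m k : ℕ} {n : Fin k → ℕ}
    {X : Type*} [TopologicalSpace X] [ChartedSpace (𝔼 (2 * m)) X]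
    [IsManifold 𝓘(ℝ, 𝔼 (2 * m)) ∞ X] [T2Space X] [CompactSpace X] [ConnectedSpace X]
    [MeasurableSpace X] [BorelSpace X]
    {B : Fin k → Type*} [∀ a, TopologicalSpace (B a)] [∀ a, ChartedSpace (𝔼 (2 * n a)) (B a)]
    [∀ a, IsManifold 𝓘(ℝ, 𝔼 (2 * n a)) ∞ (B a)] [∀ a, T2Space (B a)] [∀ a, CompactSpace (B a)]
    [∀ a, ConnectedSpace (B a)] [∀ a, MeasurableSpace (B a)] [∀ a, BorelSpace (B a)]
    {P : Type*} [TopologicalSpace P] [ChartedSpace (𝔼 (2 * (∑ a, n a) + r)) P]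
    [IsManifold 𝓘(ℝ, 𝔼 (2 * (∑ a, n a) + r)) ∞ P] [T2Space P]
    {Y : Type*} [TopologicalSpace Y] [ChartedSpace (𝔼 (2 * (m + ∑ a, n a))) Y]
    [IsManifold 𝓘(ℝ, 𝔼 (2 * (m + ∑ a, n a))) ∞ Y] [T2Space Y] [CompactSpace Y] [Nonempty Y]
    [MeasurableSpace Y] [BorelSpace Y]
    (S : Fibration r m n X B P Y)
    (c : Fin k → ℝ) (Ω : BilForm (2 * m) X ℝ) (μ : X → LieT r)
    (hΩ : IsHamKahler S.JX Ω S.actX μ)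
    (hc : ∀ a x, 0 < S.aff c a (μ x))
    (v w : LieT r → ℝ) (hv : ContDiff ℝ ∞ v) (hv_pos : ∀ x, 0 < v (μ x)) (hw : ContDiff ℝ ∞ w) :
    -- the objects on `Y` are induced by those on `Z = X × P`
    ((∀ t x q, S.actY t (S.projY (x, q)) = S.projY (S.actX t x, q)) ∧
      (∀ x q, S.down μ (S.projY (x, q)) = μ x) ∧
      (∀ z h, S.con z.2 h.2 = 0 → S.JY (S.projY z) (S.dY z h) = S.dY z (S.JZ z h)) ∧
      (∀ z h h', S.formY c Ω μ (S.projY z) (S.dY z h) (S.dY z h') = S.formZ c Ω μ z h h')) ∧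
    -- the bundle-compatible form is a `𝕋`-invariant Kähler form with momentum map `μ`
    IsHamKahler S.JY (S.formY c Ω μ) S.actY (S.down μ) ∧
    -- the weighted scalar curvature
    (∀ x q, wScal v S.JY (S.formY c Ω μ) S.actY (S.down μ) (S.projY (x, q)) =
      wScal (fun y => S.pWeight c y * v y) S.JX Ω S.actX μ x / S.pWeight c (μ x) +
        v (μ x) * S.qWeight c (μ x)) ∧
    -- weighted cscK metrics
    (IsWCscK (fun y => S.pWeight c y * v y)
        (fun y => S.pWeight c y * (w y - v y * S.qWeight c y)) S.JX Ω S.actX μ ↔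
      IsWCscK v w S.JY (S.formY c Ω μ) S.actY (S.down μ)) ∧
    -- `𝒦_𝕋(X, ω) ⊂ 𝒦_𝕋(Y, ω̃)`, and the metrics `ω̃ + dd^c φ` are the bundle-compatible ones
    (∀ φ ∈ potentials S.JX Ω S.actX,
      S.down φ ∈ potentials S.JY (S.formY c Ω μ) S.actY ∧
      formOf S.JY (S.formY c Ω μ) (S.down φ) =
        S.formY c (formOf S.JX Ω φ) (momOf S.JX S.actX μ φ)) ∧
    -- the differential of the weighted Mabuchi energy of `Y` restricts to that of `X`
    (∀ φ ∈ potentials S.JX Ω S.actX, ∀ ψ ∈ SmoothInv (2 * m) S.actX,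
      mabuchiDiff v w S.JY (S.formY c Ω μ) S.actY (S.down μ) (S.down φ) (S.down ψ) =
        S.volB * mabuchiDiff (fun y => S.pWeight c y * v y)
          (fun y => S.pWeight c y * (w y - v y * S.qWeight c y)) S.JX Ω S.actX μ φ ψ) ∧
    -- the weighted Mabuchi energy of `Y` restricts to that of `X`
    (∀ (EX : (X → ℝ) → ℝ) (EY : (Y → ℝ) → ℝ),
      IsMabuchi (fun y => S.pWeight c y * v y)
        (fun y => S.pWeight c y * (w y - v y * S.qWeight c y)) S.JX Ω S.actX μ EX →
      IsMabuchi v w S.JY (S.formY c Ω μ) S.actY (S.down μ) EY →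
      ∀ φ ∈ potentials S.JX Ω S.actX, EY (S.down φ) = S.volB * EX φ) := by
  refine ⟨⟨S.actY_projY, S.down_projY hΩ.mom_inv, S.JY_dY, S.formY_dY hΩ⟩,
    S.isHamKahler_formY hΩ hc, S.wScal_formY hΩ hc hv, S.isWCscK_iff hΩ hc hv,
    fun φ hφ => ⟨S.down_mem_potentials hΩ hc hφ, S.formOf_down hΩ hφ⟩,
    fun φ hφ ψ hψ => S.mabuchiDiff_down hΩ hc hv hφ hψ,
    fun EX EY hEX hEY φ hφ => S.mabuchi_down hΩ hc hv hEX hEY hφ⟩
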